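/- **Setting.** Let $d\ge 1$, $p\in[2,\infty)$, $T\in(0,\infty)$, $\alpha\in(0,2)$, $\beta<\alpha+\frac12$ and $\Lambda:=\max(\lceil\alpha\rceil,\lceil\beta\rceil)$. Let $(\Omega,\mathscr F,P)$ be a complete probability space with a filtration $(\mathscr F_t)_{t\ge0}$ each of whose members contains all null sets, let $w^1,w^2,\dots$ be independent one-dimensional Wiener processes relative to $(\mathscr F_t)$, and let $\mathcal P$ be the predictable $\sigma$-field. For $\gamma\in\mathbb R$, $H^\gamma_p$ is the space of (real) tempered distributions $u$ on $\mathbb R^d$ with $\|u\|_{H^\gamma_p}:=\|(1-\Delta)^{\gamma/2}u\|_{L_p}<\infty$, and $H^\gamma_p(l_2)$ is the space of $l_2$-valued tempered distributions with $\|v\|_{H^\gamma_p(l_2)}:=\|\,|(1-\Delta)^{\gamma/2}v|_{l_2}\|_{L_p}<\infty$. Put $\mathbb H^\gamma_p(t):=L_p(\Omega\times[0,t],\mathcal P;H^\gamma_p)$ and $\mathbb H^\gamma_p(t,l_2):=L_p(\Omega\times[0,t],\mathcal P;H^\gamma_p(l_2))$. A norm is $+\infty$ on elements outside the space. $U^{\alpha,\gamma}_p$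 is the space of $\mathscr F_0$-measurable random variables in $L_p(\Omega;H_p^{\gamma+(2-2/(\alpha p))_+})$. For $a>0$, $I^a_t\varphi=\frac1{\Gamma(a)}\int_0^t(t-s)^{a-1}\varphi(s)\,ds$, and $I^0_t\varphi=\varphi(t)$. $\mathcal H^{\gamma+2}_p(T)$ is the space of all $u\in\mathbb H^{\gamma+2}_p(T)$ such that $I^{\Lambda-\alpha}u$ has a version $\mathbb I^{\Lambda-\alpha}u\in L_p(\Omega;C([0,T];H^\gamma_p))$, with the norm $$\|u\|_{\mathcal H^{\gamma+2}_p(T)}:=\|u\|_{\mathbb H^{\gamma+2}_p(T)}+\Big(\mathbb E\sup_{t\le T}\|\mathbb I^{\Lambda-\alpha}_tu\|^p_{H^\gamma_p}\Big)^{1/p}.$$ Let $u\in\mathcal H^{\gamma_1+2}_p(T)$, $f\in\mathbb H^{\gamma_2}_p(T)$, $g\in\mathbb H^{\gamma_3}_p(T,l_2)$, $u_0\in U^{\alpha,\gamma_4}_p$ and, if $\alpha>1$, $v_0\in U^{\alpha-1,\gamma_4}_p$, for some $\gamma_i\in\mathbb R$. We say that $u$ satisfies $$\partial^\alpha_tu=f+\partial^\beta_t\int_0^tg^k\,dw^k_s,\qquad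 u(0)=u_0,\quad \partial_tu(0)=v_0\ (\text{if }\alpha>1)\qquad(*)$$ if for every Schwartz function $\phi$, almost surely, for all $t\in[0,T]$, $$\big(\mathbb I^{\Lambda-\alpha}_tu-I^{\Lambda-\alpha}_t(u_0+tv_01_{\alpha>1}),\phi\big)=I^\Lambda_t(f,\phi)+\sum_{k=1}^\infty I^{\Lambda-\beta}_t\int_0^\cdot(g^k(s),\phi)\,dw^k_s,$$ where the series converges in probability. **Theorem 2.6.** (i) For all $\gamma,\nu\in\mathbb R$ the operator $(1-\Delta)^{\nu/2}$ (applied for each $(\omega,t)$) is a linear isometry of $\mathcal H^{\gamma+2}_p(T)$ onto $\mathcal H^{\gamma-\nu+2}_p(T)$. (ii) There is a constant $N=N(d,p,T)$ such that for every $\gamma\in\mathbb R$ and every $u\in\mathcal H^{\gamma+2}_p(T)$ satisfying $(*)$, $$\mathbb E\sup_{t\le T}\|\mathbb I^{\Lambda-\alpha}_tu\|^p_{H^\gamma_p}\le N\Big(\mathbb E\|u_0\|^p_{H^\gamma_p}+1_{\alpha>1}\mathbb E\|v_0\|^p_{H^\gamma_p}+\|f\|^p_{\mathbb H^\gamma_p(T)}+\|g\|^p_{\mathbb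 H^\gamma_p(T,l_2)}\Big).$$ (iii) For every $\gamma\in\mathbb R$, $\mathcal H^{\gamma+2}_p(T)$ is a Banach space. (iv) Let $\theta:=\min\{1,\alpha,2(\alpha-\beta)+1\}$. There is a constant $N=N(d,\alpha,\beta,p,T)$ such that for every $\gamma\in\mathbb R$, every $u\in\mathcal H^{\gamma+2}_p(T)$ satisfying $(*)$ with $u_0=v_0=0$, and every $t\le T$, $$\|u\|^p_{\mathbb H^\gamma_p(t)}\le N\int_0^t(t-s)^{\theta-1}\Big(\|f\|^p_{\mathbb H^\gamma_p(s)}+\|g\|^p_{\mathbb H^\gamma_p(s,l_2)}\Big)ds.$$ -/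

import Mathlib

open MeasureTheory ProbabilityTheory Filter Topology
open scoped NNReal ENNReal SchwartzMap FourierTransform

namespace FracSPDE
noncomputable section

/-- The Euclidean space `ℝ^d`. -/
abbrev Space (d : ℕ) : Type := EuclideanSpace ℝ (Fin d)
/-- The real sequence space `ℓ₂`. -/
abbrev ell2 : Type := lp (fun _ : ℕ => ℝ) 2

/-- The symbol of `(1 - Δ)^{s/2}`. Mathlib's Fourier transform has the kernel `e^{-2πi x·ξ}`, so that
`-Δ` has the symbol `|2πξ|²`. -/
def besselSymbol (d : ℕ) (s : ℝ) (ξ : Space d) : ℝ :=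
  (1 + ‖(2 * Real.pi) • ξ‖ ^ 2) ^ (s / 2)

lemma hasTemperateGrowth_besselSymbol (d : ℕ) (s : ℝ) :
    (besselSymbol d s).HasTemperateGrowth := by
  have h := (Function.hasTemperateGrowth_one_add_norm_sq_rpow (Space d) (s / 2)).comp
    (((2 * Real.pi) • ContinuousLinearMap.id ℝ (Space d)).hasTemperateGrowth)
  exact h

/-- `(1 - Δ)^{s/2}` on complex-valued Schwartz functions, as a Fourier multiplier. -/
def schwartzBesselC (d : ℕ) (s : ℝ) : 𝓢(Space d, ℂ) →L[ℝ] 𝓢(Space d, ℂ) :=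
  SchwartzMap.fourierMultiplierCLM ℂ (besselSymbol d s)

/-- `(1 - Δ)^{s/2}` on real-valued Schwartz functions. The multiplier maps real functions to real
functions (`schwartzBessel_ofReal`), so that taking the real part only changes the codomain. -/
def schwartzBessel (d : ℕ) (s : ℝ) : 𝓢(Space d, ℝ) →L[ℝ] 𝓢(Space d, ℝ) :=
  (SchwartzMap.postcompCLM Complex.reCLM) ∘L (schwartzBesselC d s) ∘L
    (SchwartzMap.postcompCLM Complex.ofRealCLM)

lemma fourier_conj (d : ℕ) (φ : Space d → ℂ) (ξ : Space d) :
    𝓕 (fun x => (starRingEnd ℂ) (φ x)) ξ = (starRingEnd ℂ) (𝓕⁻ φ ξ) := by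
  rw [Real.fourier_eq, Real.fourierInv_eq, ← integral_conj]
  congr 1; ext v
  simp [Circle.smul_def, AddChar.map_neg_eq_inv]

lemma besselSymbol_neg (d : ℕ) (s : ℝ) (ξ : Space d) :
    besselSymbol d s (-ξ) = besselSymbol d s ξ := by
  simp [besselSymbol]

lemma schwartzBesselC_apply (d : ℕ) (s : ℝ) (φ : 𝓢(Space d, ℂ)) (x : Space d) :
    schwartzBesselC d s φ x = 𝓕⁻ (fun ξ => besselSymbol d s ξ • 𝓕 (φ : Space d → ℂ) ξ) x := by
  rw [schwartzBesselC, SchwartzMap.fourierMultiplierCLM_apply, SchwartzMap.fourierInv_coe]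
  refine congrArg (fun f : Space d → ℂ => 𝓕⁻ f x) (funext fun ξ => ?_)
  rw [SchwartzMap.smulLeftCLM_apply_apply (hasTemperateGrowth_besselSymbol d s),
    SchwartzMap.fourier_coe]

lemma conj_schwartzBesselC (d : ℕ) (s : ℝ) (φ : 𝓢(Space d, ℂ))
    (hφ : ∀ x, (starRingEnd ℂ) (φ x) = φ x) (x : Space d) :
    (starRingEnd ℂ) (schwartzBesselC d s φ x) = schwartzBesselC d s φ x := by
  have h1 : ∀ ξ, 𝓕 (φ : Space d → ℂ) (-ξ) = (starRingEnd ℂ) (𝓕 (φ : Space d → ℂ) ξ) := by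
    intro ξ
    have := fourier_conj d φ (-ξ)
    rw [Real.fourierInv_eq_fourier_neg, neg_neg] at this
    rw [← this]; simp only [hφ]
  rw [schwartzBesselC_apply, ← fourier_conj, Real.fourierInv_eq_fourier_comp_neg]
  refine congrArg (fun f : Space d → ℂ => 𝓕 f x) (funext fun ξ => ?_)
  simp only [besselSymbol_neg, h1]
  simp

lemma schwartzBessel_ofReal (d : ℕ) (s : ℝ) (φ : 𝓢(Space d, ℝ)) :
    SchwartzMap.postcompCLM Complex.ofRealCLM (schwartzBessel d s φ) =
      schwartzBesselC d s (SchwartzMap.postcompCLM Complex.ofRealCLM φ) := by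
  ext x
  have := conj_schwartzBesselC d s (SchwartzMap.postcompCLM Complex.ofRealCLM φ) (by simp) x
  simpa [schwartzBessel] using Complex.conj_eq_iff_re.mp this

lemma schwartzBessel_comp (d : ℕ) (s r : ℝ) (φ : 𝓢(Space d, ℝ)) :
    schwartzBessel d s (schwartzBessel d r φ) = schwartzBessel d (s + r) φ := by
  have h : schwartzBesselC d s (schwartzBesselC d r
      (SchwartzMap.postcompCLM Complex.ofRealCLM φ)) =
      schwartzBesselC d (s + r) (SchwartzMap.postcompCLM Complex.ofRealCLM φ) := by
    unfold schwartzBesselC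
    rw [SchwartzMap.fourierMultiplierCLM_fourierMultiplierCLM_apply
      (hasTemperateGrowth_besselSymbol d s) (hasTemperateGrowth_besselSymbol d r)]
    congr 2
    ext ξ
    simp only [besselSymbol, Pi.mul_apply]
    rw [← Real.rpow_add (by positivity)]
    congr 1; ring
  rw [← schwartzBessel_ofReal, ← schwartzBessel_ofReal, ← schwartzBessel_ofReal] at h
  ext x
  have := congrArg (fun f : 𝓢(Space d, ℂ) => (f x).re) h
  simpa using this

lemma schwartzBessel_zero (d : ℕ) (φ : 𝓢(Space d, ℝ)) : schwartzBessel d 0 φ = φ := by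
  have h : besselSymbol d 0 = fun _ => 1 := by ext ξ; simp [besselSymbol]
  ext x
  simp [schwartzBessel, schwartzBesselC, h]

/-- Tempered distributions on `ℝ^d` with values in the real Banach space `F` (`F = ℝ` or `F = ℓ₂`):
continuous linear maps on the real Schwartz space. -/
abbrev TDist (d : ℕ) (F : Type*) [NormedAddCommGroup F] [NormedSpace ℝ F] : Type _ :=
  𝓢(Space d, ℝ) →L[ℝ] F

section Bessel
variable {d : ℕ} {F : Type*} [NormedAddCommGroup F] [NormedSpace ℝ F]

/-- `(1 - Δ)^{s/2}` on tempered distributions, by duality (the symbol is even). -/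
def bessel (s : ℝ) (u : TDist d F) : TDist d F := u ∘L schwartzBessel d s

lemma bessel_add (s : ℝ) (u v : TDist d F) : bessel s (u + v) = bessel s u + bessel s v := rfl

lemma bessel_smul (s c : ℝ) (u : TDist d F) : bessel s (c • u) = c • bessel s u := rfl

lemma bessel_zero_right (s : ℝ) : bessel s (0 : TDist d F) = 0 := rfl

lemma bessel_bessel (s r : ℝ) (u : TDist d F) : bessel s (bessel r u) = bessel (s + r) u := by
  ext φ
  simp [bessel, schwartzBessel_comp, add_comm]

lemma bessel_zero (u : TDist d F) : bessel 0 u = u := by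
  ext φ; simp [bessel, schwartzBessel_zero]

/-- The distribution `u` is given by the `L_p` function `f`. -/
def Represents {p : ℝ≥0∞} (f : Lp F p (volume : Measure (Space d))) (u : TDist d F) : Prop :=
  ∀ φ : 𝓢(Space d, ℝ), u φ = ∫ x, φ x • f x

set_option linter.unusedSectionVars false

variable {p : ℝ≥0∞} [hp : Fact (1 ≤ p)]

lemma integrable_smul (f : Lp F p (volume : Measure (Space d))) (φ : 𝓢(Space d, ℝ)) :
    Integrable (fun x => φ x • f x) := by
  have := (ENNReal.HolderConjugate.inv_one_sub_inv' hp.out).symm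
  exact memLp_one_iff_integrable.mp ((Lp.memLp f).smul (φ.memLp (1 - p⁻¹)⁻¹ volume))

lemma Represents.add {f g : Lp F p (volume : Measure (Space d))} {u v : TDist d F}
    (hf : Represents f u) (hg : Represents g v) : Represents (f + g) (u + v) := by
  intro φ
  rw [_root_.add_apply, hf, hg, ← integral_add (integrable_smul f φ) (integrable_smul g φ)]
  apply integral_congr_ae
  filter_upwards [Lp.coeFn_add f g] with x hx
  rw [hx, Pi.add_apply, smul_add]

lemma Represents.smul {f : Lp F p (volume : Measure (Space d))} {u : TDist d F} (c : ℝ)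
    (hf : Represents f u) : Represents (c • f) (c • u) := by
  intro φ
  rw [_root_.smul_apply, hf, ← integral_smul]
  apply integral_congr_ae
  filter_upwards [Lp.coeFn_smul c f] with x hx
  rw [hx, Pi.smul_apply, smul_comm]

lemma Represents.zero : Represents (0 : Lp F p (volume : Measure (Space d))) (0 : TDist d F) := by
  intro φ
  rw [integral_congr_ae (g := fun _ => (0 : F))]
  · simp
  · filter_upwards [Lp.coeFn_zero F p (volume : Measure (Space d))] with x hx
    rw [hx, Pi.zero_apply, smul_zero]

lemma Represents.eq_zero [CompleteSpace F] {f : Lp F p (volume : Measure (Space d))}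
    (hf : Represents f (0 : TDist d F)) : f = 0 := by
  rw [Lp.eq_zero_iff_ae_eq_zero]
  apply ae_eq_zero_of_integral_contDiff_smul_eq_zero
  · exact (Lp.memLp f).locallyIntegrable hp.elim
  · intro g hg hg'
    have := hf (hg'.toSchwartzMap hg)
    simpa using this.symm

lemma Represents.unique [CompleteSpace F] {f g : Lp F p (volume : Measure (Space d))}
    {u : TDist d F} (hf : Represents f u) (hg : Represents g u) : f = g := by
  have := hf.add (hg.smul (-1))
  rw [neg_one_smul, neg_one_smul, add_neg_cancel] at this
  exact add_neg_eq_zero.mp this.eq_zero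

end Bessel

section HSpace

variable (d : ℕ) (F : Type*) [NormedAddCommGroup F] [NormedSpace ℝ F]
  (p : ℝ≥0∞) [hp : Fact (1 ≤ p)] (γ : ℝ)

/-- Tempered distributions `u` such that `(1 - Δ)^{γ/2} u` belongs to `L_p(ℝ^d; F)`. -/
def hSubmodule : Submodule ℝ (TDist d F) where
  carrier := {u | ∃ f : Lp F p (volume : Measure (Space d)), Represents f (bessel γ u)}
  add_mem' := by
    rintro u v ⟨f, hf⟩ ⟨g, hg⟩
    exact ⟨f + g, bessel_add γ u v ▸ hf.add hg⟩
  zero_mem' := ⟨0, (bessel_zero_right γ : bessel γ (0 : TDist d F) = 0) ▸ Represents.zero⟩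
  smul_mem' := by
    rintro c u ⟨f, hf⟩
    exact ⟨c • f, bessel_smul γ c u ▸ hf.smul c⟩

/-- The Bessel potential space `H_p^γ(ℝ^d; F)`: `H_p^γ` for `F = ℝ` and `H_p^γ(ℓ₂)` for `F = ℓ₂`.
Its norm, given below, is `‖(1 - Δ)^{γ/2} u‖_{L_p}`. -/
def HSpace : Type _ := ↥(hSubmodule d F p γ)

instance : AddCommGroup (HSpace d F p γ) := inferInstanceAs (AddCommGroup ↥(hSubmodule d F p γ))
instance : Module ℝ (HSpace d F p γ) := inferInstanceAs (Module ℝ ↥(hSubmodule d F p γ))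

variable {d F p γ}
/-- The underlying tempered distribution; `u.toDist φ` is the pairing `(u, φ)`. -/
def HSpace.toDist (u : HSpace d F p γ) : TDist d F := u.1

/-- The `L_p` function `(1 - Δ)^{γ/2} u`. -/
def HSpace.density (u : HSpace d F p γ) : Lp F p (volume : Measure (Space d)) := u.2.choose

lemma HSpace.density_spec (u : HSpace d F p γ) : Represents u.density (bessel γ u.toDist) :=
  u.2.choose_spec

variable (d F p γ)

/-- `u ↦ (1 - Δ)^{γ/2} u` as an injective linear map into `L_p`; it induces the norm. -/
def HSpace.densityL [CompleteSpace F] :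
    HSpace d F p γ →ₗ[ℝ] Lp F p (volume : Measure (Space d)) where
  toFun u := u.density
  map_add' u v := (u + v).density_spec.unique (u.density_spec.add v.density_spec)
  map_smul' c u := (c • u).density_spec.unique (u.density_spec.smul c)

lemma HSpace.densityL_injective [CompleteSpace F] :
    Function.Injective (HSpace.densityL d F p γ) := by
  rw [injective_iff_map_eq_zero]
  intro u hu
  have h := u.density_spec
  have h2 : u.density = 0 := hu
  rw [h2] at h
  have h0 : bessel γ u.toDist = 0 := by
    ext φ
    rw [h φ, (Represents.zero (d := d) (F := F) (p := p)) φ]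
  have h1 : bessel (-γ) (bessel γ u.toDist) = 0 := by rw [h0, bessel_zero_right]
  rw [bessel_bessel, neg_add_cancel, bessel_zero] at h1
  exact Subtype.ext h1

instance [CompleteSpace F] : NormedAddCommGroup (HSpace d F p γ) :=
  NormedAddCommGroup.induced _ _ (HSpace.densityL d F p γ) (HSpace.densityL_injective d F p γ)

instance [CompleteSpace F] : NormedSpace ℝ (HSpace d F p γ) :=
  NormedSpace.induced ℝ _ _ (HSpace.densityL d F p γ)

variable {d F p γ} in
lemma HSpace.toDist_add [CompleteSpace F] (u v : HSpace d F p γ) :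
    (u + v).toDist = u.toDist + v.toDist := rfl

variable {d F p γ} in
lemma HSpace.toDist_smul [CompleteSpace F] (c : ℝ) (u : HSpace d F p γ) :
    (c • u).toDist = c • u.toDist := rfl

lemma HSpace.toDist_zero [CompleteSpace F] : (0 : HSpace d F p γ).toDist = 0 := rfl

lemma HSpace.densityL_surjective [CompleteSpace F] :
    Function.Surjective (HSpace.densityL d F p γ) := by
  intro f
  have h1 := ENNReal.HolderConjugate.inv_one_sub_inv' hp.out
  have h2 : Fact (1 ≤ (1 - p⁻¹)⁻¹) := by simp [fact_iff]
  let v : TDist d F :=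
    (ContinuousLinearMap.lsmul ℝ ℝ (E := F)).flip.lpPairing volume p (1 - p⁻¹)⁻¹ f ∘L
      SchwartzMap.toLpCLM ℝ ℝ (1 - p⁻¹)⁻¹ volume
  have hv : Represents f v := by
    intro φ
    have h3 : v φ = (ContinuousLinearMap.lsmul ℝ ℝ (E := F)).flip.lpPairing volume p
      (1 - p⁻¹)⁻¹ f (φ.toLp (1 - p⁻¹)⁻¹ volume) := rfl
    rw [h3, ContinuousLinearMap.lpPairing_eq_integral]
    apply integral_congr_ae
    filter_upwards [φ.coeFn_toLp (1 - p⁻¹)⁻¹ volume] with x hx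
    rw [hx]
    simp
  have hu : Represents f (bessel γ (bessel (-γ) v)) := by
    rw [bessel_bessel, add_neg_cancel, bessel_zero]
    exact hv
  exact ⟨⟨bessel (-γ) v, f, hu⟩, (HSpace.density_spec _).unique hu⟩

instance [CompleteSpace F] : CompleteSpace (HSpace d F p γ) := by
  have hi : Isometry (HSpace.densityL d F p γ) :=
    AddMonoidHomClass.isometry_of_norm _ fun _ => rfl
  exact ((IsometryEquiv.mk (Equiv.ofBijective _ ⟨HSpace.densityL_injective d F p γ,
    HSpace.densityL_surjective d F p γ⟩) hi).completeSpace_iff).2 inferInstance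

lemma HSpace.norm_def [CompleteSpace F] (u : HSpace d F p γ) : ‖u‖ = ‖u.density‖ := rfl
end HSpace

/-- Lebesgue measure on the time axis `[0, ∞)`. -/
def timeVol : Measure ℝ≥0 := ((volume : Measure ℝ).restrict (Set.Ici 0)).map Real.toNNReal

instance : SFinite timeVol := by unfold timeVol; infer_instance

instance : timeVol.IsOpenPosMeasure where
  open_pos U hU hne := by
    obtain ⟨x, hx⟩ := hne
    have hV : IsOpen (Real.toNNReal ⁻¹' U) := hU.preimage continuous_real_toNNReal
    have hxV : (x : ℝ) ∈ closure (Set.Ioi (0 : ℝ)) := by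
      rw [closure_Ioi]; exact x.2
    obtain ⟨y, hy1, hy2⟩ := mem_closure_iff.1 hxV _ hV (by simpa using hx)
    rw [timeVol, Measure.map_apply measurable_real_toNNReal hU.measurableSet,
      Measure.restrict_apply (hU.measurableSet.preimage measurable_real_toNNReal)]
    have h0 : volume (Real.toNNReal ⁻¹' U ∩ Set.Ioi 0) ≠ 0 :=
      ((hV.inter isOpen_Ioi).measure_pos volume ⟨y, hy1, hy2⟩).ne'
    exact fun h => h0 (measure_mono_null (Set.inter_subset_inter_right _
      Set.Ioi_subset_Ici_self) h)

section FracInt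
variable {E : Type*} [NormedAddCommGroup E] [NormedSpace ℝ E]

/-- The kernel `(t - s)^{a-1} / Γ(a)` of the Riemann–Liouville integral. -/
def fracKernel (a : ℝ) (t s : ℝ≥0) : ℝ := ((t : ℝ) - s) ^ (a - 1) / Real.Gamma a

/-- The Riemann–Liouville integral `I^a_t φ = Γ(a)⁻¹ ∫_0^t (t-s)^{a-1} φ(s) ds` of order `a ≥ 0`, with
`I^0_t φ = φ(t)`. -/
def fracInt (a : ℝ) (φ : ℝ≥0 → E) (t : ℝ≥0) : E :=
  if a = 0 then φ t else ∫ s in Set.Iic t, fracKernel a t s • φ s ∂timeVol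

/-- `I^a_t φ` is well defined at the time `t`: its integral converges absolutely. -/
def FracIntegrable (a : ℝ) (φ : ℝ≥0 → E) (t : ℝ≥0) : Prop :=
  a = 0 ∨ IntegrableOn (fun s => fracKernel a t s • φ s) (Set.Iic t) timeVol

lemma fracInt_congr {a : ℝ} {φ ψ : ℝ≥0 → E} {t T : ℝ≥0} (ht : t ≤ T) (h0 : φ t = ψ t)
    (h : ∀ᵐ s ∂timeVol.restrict (Set.Iic T), φ s = ψ s) :
    (FracIntegrable a φ t ↔ FracIntegrable a ψ t) ∧ fracInt a φ t = fracInt a ψ t := by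
  have h' : (fun s => fracKernel a t s • φ s) =ᵐ[timeVol.restrict (Set.Iic t)]
      fun s => fracKernel a t s • ψ s := by
    filter_upwards [ae_restrict_of_ae_restrict_of_subset (Set.Iic_subset_Iic.2 ht) h] with s hs
    rw [hs]
  refine ⟨or_congr Iff.rfl (integrable_congr h'), ?_⟩
  unfold fracInt
  rw [h0, integral_congr_ae h']

lemma fracInt_add {a : ℝ} {φ ψ : ℝ≥0 → E} {t : ℝ≥0} (hφ : FracIntegrable a φ t)
    (hψ : FracIntegrable a ψ t) : FracIntegrable a (φ + ψ) t ∧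
      fracInt a (φ + ψ) t = fracInt a φ t + fracInt a ψ t := by
  by_cases ha : a = 0
  · simp [FracIntegrable, fracInt, ha]
  · have h1 := hφ.resolve_left ha
    have h2 := hψ.resolve_left ha
    constructor
    · right
      have h3 := Integrable.add h1 h2
      refine h3.congr (Eventually.of_forall fun s => ?_)
      simp only [Pi.add_apply, smul_add]
    · simp only [fracInt, ha, if_false, Pi.add_apply, smul_add]
      exact integral_add h1 h2

lemma fracInt_smul {a : ℝ} (c : ℝ) {φ : ℝ≥0 → E} {t : ℝ≥0} (hφ : FracIntegrable a φ t) :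
    FracIntegrable a (c • φ) t ∧ fracInt a (c • φ) t = c • fracInt a φ t := by
  by_cases ha : a = 0
  · simp [FracIntegrable, fracInt, ha]
  · have h1 := hφ.resolve_left ha
    have h2 : (fun s => fracKernel a t s • (c • φ) s) =
        c • fun s => fracKernel a t s • φ s := by
      ext s; exact smul_comm _ _ _
    constructor
    · right
      rw [h2]
      exact h1.smul c
    · simp only [fracInt, ha, if_false]
      rw [h2]
      exact integral_smul c _

lemma fracInt_zero (a : ℝ) (t : ℝ≥0) : FracIntegrable a (0 : ℝ≥0 → E) t ∧
    fracInt a (0 : ℝ≥0 → E) t = 0 := by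
  refine ⟨Or.inr ?_, ?_⟩ <;> simp [fracInt]

end FracInt

section Basis
variable {Ω : Type*} {mΩ : MeasurableSpace Ω}

/-- The stochastic basis: a complete probability space, a filtration each of whose `σ`-fields contains
all null sets, and an independent family of one-dimensional Wiener processes relative to it. -/
structure IsWienerBasis (P : Measure Ω) (ℱ : Filtration ℝ≥0 mΩ) (w : ℕ → ℝ≥0 → Ω → ℝ) :
    Prop where
  complete : P.IsComplete
  null_mem : ∀ (t : ℝ≥0) (A : Set Ω), P A = 0 → MeasurableSet[ℱ t] A
  brownian : ∀ k, IsBrownianReal (w k) P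
  adapted : ∀ k, StronglyAdapted ℱ (w k)
  indep_increments : ∀ (k : ℕ) (s t : ℝ≥0), s ≤ t →
    Indep (MeasurableSpace.comap (fun ω => w k t ω - w k s ω) inferInstance) (ℱ s) P
  indep : iIndepFun (fun (k : ℕ) (ω : Ω) (t : ℝ≥0) => w k t ω) P

lemma predictable_le (ℱ : Filtration ℝ≥0 mΩ) :
    ℱ.predictable ≤ (inferInstance : MeasurableSpace (ℝ≥0 × Ω)) :=
  measurableSpace_le_predictable_of_measurableSet
    (fun _ hA => (measurableSet_singleton _).prod (ℱ.le _ _ hA))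
    (fun _ _ hA => measurableSet_Ioi.prod (ℱ.le _ _ hA))

/-- The measure `dt × dP` on `[0, T] × Ω`. -/
def rectMeasure (P : Measure Ω) (T : ℝ≥0) : Measure (ℝ≥0 × Ω) :=
  (timeVol.restrict (Set.Iic T)).prod P

/-- The measure `dt × dP` on `[0, T] × Ω`, on the predictable `σ`-field. -/
def predMeasure (ℱ : Filtration ℝ≥0 mΩ) (P : Measure Ω) (T : ℝ≥0) :
    @Measure (ℝ≥0 × Ω) ℱ.predictable :=
  (rectMeasure P T).trim (predictable_le ℱ)

/-- `L_p(Ω × [0,T], 𝒫; H_p^γ(ℝ^d; F))` for the predictable `σ`-field `𝒫`. Its elements are classes of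
functions that are a.e. equal to `𝒫`-measurable ones, i.e. measurable for the completion of `𝒫`. -/
abbrev StochH (d : ℕ) (F : Type*) [NormedAddCommGroup F] [NormedSpace ℝ F] [CompleteSpace F]
    (p : ℝ≥0∞) [Fact (1 ≤ p)] (γ : ℝ) (ℱ : Filtration ℝ≥0 mΩ) (P : Measure Ω) (T : ℝ≥0) :=
  Lp (HSpace d F p γ) p (predMeasure ℱ P T)

/-- The space `U_p^{α,γ}` of `ℱ₀`-measurable random variables in `L_p(Ω; H_p^{γ + (2 - 2/(αp))₊})`. -/
abbrev InitSpace (d : ℕ) (p : ℝ≥0∞) [Fact (1 ≤ p)] (α γ : ℝ) (ℱ : Filtration ℝ≥0 mΩ)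
    (P : Measure Ω) :=
  Lp (HSpace d ℝ p (γ + max (2 - 2 / (α * p.toReal)) 0)) p (P.trim (ℱ.le 0))

/-- Simple predictable processes `∑_i ξ_i 1_{(t_i, t_{i+1}]}`, with `ξ_i` bounded and
`ℱ_{t_i}`-measurable. -/
structure SimpleProcess (ℱ : Filtration ℝ≥0 mΩ) where
  n : ℕ
  time : ℕ → ℝ≥0
  coeff : ℕ → Ω → ℝ
  mono : Monotone time
  meas : ∀ i, StronglyMeasurable[ℱ (time i)] (coeff i)
  bdd : ∃ C : ℝ, ∀ i ω, |coeff i ω| ≤ C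

/-- The value of a simple process at `z = (t, ω)`. -/
def SimpleProcess.val {ℱ : Filtration ℝ≥0 mΩ} (H : SimpleProcess ℱ) (z : ℝ≥0 × Ω) : ℝ :=
  ∑ i ∈ Finset.range H.n,
    (Set.Ioc (H.time i) (H.time (i + 1))).indicator (fun _ => H.coeff i z.2) z.1

/-- The elementary integral `∑_i ξ_i (B_{t_{i+1} ∧ t} - B_{t_i ∧ t})`. -/
def SimpleProcess.integral {ℱ : Filtration ℝ≥0 mΩ} (H : SimpleProcess ℱ) (B : ℝ≥0 → Ω → ℝ)
    (t : ℝ≥0) (ω : Ω) : ℝ :=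
  ∑ i ∈ Finset.range H.n,
    H.coeff i ω * (B (min (H.time (i + 1)) t) ω - B (min (H.time i) t) ω)

/-- `M` is (a continuous adapted version on `[0, T]` of) the Itô integral `∫_0^t h dB`: the `L_2(Ω)`-limit
of the elementary integrals of simple processes that converge to `h` in `L_2(Ω × [0, T])`. -/
structure IsItoIntegral (ℱ : Filtration ℝ≥0 mΩ) (P : Measure Ω) (T : ℝ≥0) (B : ℝ≥0 → Ω → ℝ)
    (h : ℝ≥0 × Ω → ℝ) (M : ℝ≥0 → Ω → ℝ) : Prop where
  adapted : ∀ t ≤ T, StronglyMeasurable[ℱ t] (M t)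
  continuous : ∀ᵐ ω ∂P, ContinuousOn (fun t => M t ω) (Set.Icc 0 T)
  approx : ∃ H : ℕ → SimpleProcess ℱ,
    Tendsto (fun n => eLpNorm (fun z => (H n).val z - h z) 2 (rectMeasure P T)) atTop (𝓝 0) ∧
    ∀ t ≤ T, Tendsto (fun n => eLpNorm (fun ω => (H n).integral B t ω - M t ω) 2 P) atTop (𝓝 0)

end Basis

/-- `Λ = max(⌈α⌉, ⌈β⌉)`. -/
def bigLambda (α β : ℝ) : ℝ := ((max ⌈α⌉ ⌈β⌉ : ℤ) : ℝ)

section Sol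
variable {Ω : Type*} {mΩ : MeasurableSpace Ω}
variable (d : ℕ) (p : ℝ≥0∞) [Fact (1 ≤ p)] (α β γ : ℝ) (ℱ : Filtration ℝ≥0 mΩ) (P : Measure Ω)
  (T : ℝ≥0)

/-- `L_p(Ω; C([0,T]; H_p^γ))`, with the norm `(𝔼 sup_{t ≤ T} ‖U(t)‖^p_{H_p^γ})^{1/p}`. -/
abbrev PathH := Lp C(Set.Icc (0 : ℝ≥0) T, HSpace d ℝ p γ) p P

variable {d p γ ℱ P T} in
/-- `U` is a continuous `H_p^γ`-valued version of `I^{Λ-α} u`: they agree for almost all `(ω, t)`. -/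
def IsVersion (u : StochH d ℝ p (γ + 2) ℱ P T) (U : PathH d p γ P T) : Prop :=
  ∀ᵐ ω ∂P, ∀ᵐ t ∂timeVol.restrict (Set.Iic T),
    FracIntegrable (bigLambda α β - α) (fun s => u (s, ω)) t ∧
    ∀ ht : t ∈ Set.Icc 0 T,
      (U ω ⟨t, ht⟩).toDist = (fracInt (bigLambda α β - α) (fun s => u (s, ω)) t).toDist

lemma ae_ae_of_ae_predMeasure [IsProbabilityMeasure P] {q : ℝ≥0 × Ω → Prop}
    (h : ∀ᵐ z ∂predMeasure ℱ P T, q z) :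
    ∀ᵐ ω ∂P, ∀ᵐ t ∂timeVol.restrict (Set.Iic T), q (t, ω) := by
  have h1 : ∀ᵐ z ∂rectMeasure P T, q z := ae_of_ae_trim (predictable_le ℱ) h
  have h2 : ∀ᵐ z ∂P.prod (timeVol.restrict (Set.Iic T)), q z.swap := by
    rw [rectMeasure, ← Measure.prod_swap] at h1
    exact ae_of_ae_map measurable_swap.aemeasurable h1
  exact Measure.ae_ae_of_ae_prod h2

/-- The space `𝓗_p^{γ+2}(T)` (note the shift in the parameter `γ`) of all `u ∈ ℍ_p^{γ+2}(T)` such that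
`I^{Λ-α} u` has a version `U` in `L_p(Ω; C([0,T]; H_p^γ))`, with the norm
`‖u‖_{ℍ_p^{γ+2}(T)} + (𝔼 sup_{t ≤ T} ‖U(t)‖^p_{H_p^γ})^{1/p}`. An element `u` is recorded as the pair
`(u, U)`; for `T > 0` the version `U` is unique (`SolSpace.ext_fst`). -/
def SolSpace [IsProbabilityMeasure P] : Submodule ℝ
    (WithLp 1 (StochH d ℝ p (γ + 2) ℱ P T × PathH d p γ P T)) where
  carrier := {x | IsVersion α β x.fst x.snd}
  add_mem' := by
    intro x y hx hy
    have h1 := ae_ae_of_ae_predMeasure ℱ P T (Lp.coeFn_add x.fst y.fst)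
    have h2 := Lp.coeFn_add x.snd y.snd
    simp only [Set.mem_ofPred_eq] at hx hy ⊢
    filter_upwards [hx, hy, h1, h2] with ω hx hy h1 h2
    filter_upwards [hx, hy, h1, ae_restrict_mem measurableSet_Iic] with t hx hy h3 htT
    obtain ⟨e1, e2⟩ := fracInt_congr (a := bigLambda α β - α) (E := HSpace d ℝ p (γ + 2)) htT
      h3 h1
    obtain ⟨e3, e4⟩ := fracInt_add hx.1 hy.1
    refine ⟨e1.2 e3, fun ht => ?_⟩
    have e5 : (fun s => x.fst (s, ω)) + (fun s => y.fst (s, ω)) =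
        fun s => (⇑x.fst + ⇑y.fst) (s, ω) := rfl
    rw [e5] at e4
    rw [WithLp.add_fst, e2, e4, WithLp.add_snd, h2, Pi.add_apply, ContinuousMap.add_apply,
      HSpace.toDist_add, HSpace.toDist_add, hx.2 ht, hy.2 ht]
  zero_mem' := by
    have h1 := ae_ae_of_ae_predMeasure ℱ P T
      (Lp.coeFn_zero (HSpace d ℝ p (γ + 2)) p (predMeasure ℱ P T))
    have h2 := Lp.coeFn_zero C(Set.Icc (0 : ℝ≥0) T, HSpace d ℝ p γ) p P
    simp only [Set.mem_ofPred_eq]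
    filter_upwards [h1, h2] with ω h1 h2
    filter_upwards [h1, ae_restrict_mem measurableSet_Iic] with t h3 htT
    obtain ⟨e1, e2⟩ := fracInt_congr (a := bigLambda α β - α) (E := HSpace d ℝ p (γ + 2)) htT
      h3 h1
    obtain ⟨e3, e4⟩ := fracInt_zero (E := HSpace d ℝ p (γ + 2)) (bigLambda α β - α) t
    refine ⟨e1.2 e3, fun ht => ?_⟩
    have e5 : (0 : ℝ≥0 → HSpace d ℝ p (γ + 2)) =
        fun s => (0 : ℝ≥0 × Ω → HSpace d ℝ p (γ + 2)) (s, ω) := rfl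
    rw [e5] at e4
    rw [WithLp.zero_fst, e2, e4, WithLp.zero_snd, h2, Pi.zero_apply, ContinuousMap.zero_apply,
      HSpace.toDist_zero, HSpace.toDist_zero]
  smul_mem' := by
    intro c x hx
    have h1 := ae_ae_of_ae_predMeasure ℱ P T (Lp.coeFn_smul c x.fst)
    have h2 := Lp.coeFn_smul c x.snd
    simp only [Set.mem_ofPred_eq] at hx ⊢
    filter_upwards [hx, h1, h2] with ω hx h1 h2
    filter_upwards [hx, h1, ae_restrict_mem measurableSet_Iic] with t hx h3 htT
    obtain ⟨e1, e2⟩ := fracInt_congr (a := bigLambda α β - α) (E := HSpace d ℝ p (γ + 2)) htT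
      h3 h1
    obtain ⟨e3, e4⟩ := fracInt_smul c hx.1
    refine ⟨e1.2 e3, fun ht => ?_⟩
    have e5 : (c • fun s => x.fst (s, ω)) = fun s => (c • ⇑x.fst) (s, ω) := rfl
    rw [e5] at e4
    rw [WithLp.smul_fst, e2, e4, WithLp.smul_snd, h2, Pi.smul_apply, ContinuousMap.smul_apply,
      HSpace.toDist_smul, HSpace.toDist_smul, hx.2 ht]


lemma SolSpace.norm_eq [IsProbabilityMeasure P] (x : SolSpace d p α β γ ℱ P T) :
    ‖x‖ = ‖x.1.fst‖ + ‖x.1.snd‖ :=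
  WithLp.prod_norm_eq_of_L1 x.1

lemma SolSpace.ext_fst [IsProbabilityMeasure P] (hT : 0 < T) (x y : SolSpace d p α β γ ℱ P T)
    (h : x.1.fst = y.1.fst) : x = y := by
  have hx : IsVersion α β x.1.fst x.1.snd := x.2
  have hy : IsVersion α β y.1.fst y.1.snd := y.2
  rw [← h] at hy
  have hs : x.1.snd = y.1.snd := by
    apply Lp.ext
    filter_upwards [hx, hy] with ω hx hy
    have h1 : Set.IccExtend (zero_le : (0 : ℝ≥0) ≤ T) (x.1.snd ω) =ᵐ[timeVol.restrict (Set.Iic T)]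
        Set.IccExtend (zero_le : (0 : ℝ≥0) ≤ T) (y.1.snd ω) := by
      filter_upwards [hx, hy, ae_restrict_mem measurableSet_Iic] with t hx hy htT
      have ht : t ∈ Set.Icc 0 T := ⟨zero_le, htT⟩
      rw [Set.IccExtend_of_mem _ _ ht, Set.IccExtend_of_mem _ _ ht]
      exact Subtype.ext ((hx.2 ht).trans (hy.2 ht).symm)
    have h2 := Measure.eqOn_of_ae_eq h1 (x.1.snd ω).continuous.Icc_extend'.continuousOn
      (y.1.snd ω).continuous.Icc_extend'.continuousOn (by
        rw [interior_Iic, closure_Iio' (a := T) ⟨0, hT⟩])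
    ext1 t
    have h3 := h2 (show (t : ℝ≥0) ∈ Set.Iic T from t.2.2)
    rwa [Set.IccExtend_val, Set.IccExtend_val] at h3
  exact Subtype.ext (WithLp.ofLp_injective 1 (Prod.ext h hs))

end Sol

section Eqn
variable {d : ℕ} {F : Type*} [NormedAddCommGroup F] [NormedSpace ℝ F] [CompleteSpace F]
  (p : ℝ≥0∞) [Fact (1 ≤ p)] (γ : ℝ)

/-- The `H_p^γ`-norm of an arbitrary tempered distribution, equal to `∞` outside `H_p^γ`. -/
def hNorm (u : TDist d F) : ℝ≥0∞ :=
  ⨅ (f : Lp F p (volume : Measure (Space d))) (_ : Represents f (bessel γ u)), ‖f‖ₑ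

lemma hNorm_toDist (u : HSpace d F p γ) : hNorm p γ u.toDist = ‖u‖ₑ := by
  refine le_antisymm (iInf₂_le u.density u.density_spec) (le_iInf₂ fun f hf => ?_)
  rw [hf.unique u.density_spec]
  exact le_rfl

variable {Ω : Type*} {mΩ : MeasurableSpace Ω} {p} {ℱ : Filtration ℝ≥0 mΩ} {P : Measure Ω} {T : ℝ≥0}

/-- `‖f‖^p_{ℍ_p^γ(t)} = 𝔼 ∫_0^t ‖f(s)‖^p_{H_p^γ} ds`, possibly infinite, for `f ∈ ℍ_p^{γ'}(T)` and `t ≤ T`. -/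
def stochNormPow {γ' : ℝ} (f : StochH d F p γ' ℱ P T) (t : ℝ≥0) : ℝ≥0∞ :=
  ∫⁻ z, hNorm p γ (f z).toDist ^ p.toReal ∂rectMeasure P t

/-- `𝔼 ‖u₀‖^p_{H_p^γ}`, possibly infinite, for an `H_p^{γ'}`-valued random variable `u₀`. -/
def initNormPow {γ' : ℝ} {m : MeasurableSpace Ω} {μ : @Measure Ω m}
    (P : @Measure Ω mΩ) (u₀ : Lp (HSpace d ℝ p γ') p μ) : ℝ≥0∞ :=
  ∫⁻ ω, hNorm p γ (u₀ ω).toDist ^ p.toReal ∂P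

/-- `u ∈ 𝓗_p^{γ₁+2}(T)` satisfies `∂_t^α u = f + ∂_t^β ∑_k ∫_0^t g^k dw^k`, `u(0) = u₀` and
`∂_t u(0) = v₀` (if `α > 1`): for every test function `φ`, almost surely for all `t ∈ [0, T]`,
`(I^{Λ-α} u - I^{Λ-α}(u₀ + t v₀ 1_{α>1}), φ) = I^Λ (f, φ) + ∑_k I^{Λ-β} ∫_0^t (g^k, φ) dw^k`,
where `M k` is the Itô integral of `(g^k, φ)` and the series converges in probability to `S`.
For `α ≤ 1` the datum `v₀` plays no role. -/
def IsSolution [IsProbabilityMeasure P] {α β γ₁ γ₂ γ₃ γ₄ : ℝ} (w : ℕ → ℝ≥0 → Ω → ℝ)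
    (u : SolSpace d p α β γ₁ ℱ P T) (f : StochH d ℝ p γ₂ ℱ P T) (g : StochH d ell2 p γ₃ ℱ P T)
    (u₀ : InitSpace d p α γ₄ ℱ P) (v₀ : InitSpace d p (α - 1) γ₄ ℱ P) : Prop :=
  ∀ φ : 𝓢(Space d, ℝ), ∃ (M : ℕ → ℝ≥0 → Ω → ℝ) (S : ℝ≥0 → Ω → ℝ),
    (∀ k, IsItoIntegral ℱ P T (w k) (fun z => (g z).toDist φ k) (M k)) ∧
    (∀ t ≤ T, TendstoInMeasure P
      (fun (K : ℕ) ω => ∑ k ∈ Finset.range K,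
        fracInt (bigLambda α β - β) (fun s => M k s ω) t) atTop (S t)) ∧
    ∀ᵐ ω ∂P, ∀ (t : ℝ≥0) (ht : t ∈ Set.Icc 0 T),
      (u.1.snd ω ⟨t, ht⟩).toDist φ -
        fracInt (bigLambda α β - α)
          (fun s => (u₀ ω).toDist φ + if 1 < α then (s : ℝ) * (v₀ ω).toDist φ else 0) t =
      fracInt (bigLambda α β) (fun s => (f (s, ω)).toDist φ) t + S t ω

end Eqn
end
end FracSPDE

open FracSPDE

namespace FracSPDE
noncomputable section
set_option linter.unusedSectionVars false

/-! ### Elementary power inequalities -/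

/-! Testing the equation with a Schwartz function reduces everything to real processes. Let `X` be
the continuous sum of the Itô integrals of the coordinates of `(g, φ)`, and let `I^a` be the
Riemann–Liouville integral.

Stochastic input. Two bounds on `X` are needed: a maximal inequality, and a moment bound for `∑ c_j
(X_{σ_{j+1}} - X_{σ_j})` with deterministic weights, whose right-hand side is `∫ c(s)² 𝔼|(g, φ)|^p
ds` with a constant that depends on the weights only through a bound of `∫ c²`. The second comes
from the Taylor bound of `|x|^p` along elementary sums (`abs_add_rpow_le`,
`integral_abs_elemSum_rpow_le`), in which the higher order remainder disappears under refinement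
(`lintegral_sum_stepInt_le`). It extends to Itô integrals by approximation in `L_p`, and Doob's
inequality turns it into the maximal inequality. `exists_isItoSum` passes to infinitely many Wiener
processes.

Assertion (ii), scalar form. The tested equation expresses `(I^{Λ-α} u, φ)` through
Riemann–Liouville integrals of the data and of `X`. Their operator norms are controlled by `T^a /
Γ(a + 1)`, which is bounded uniformly in `a ≥ 0` (`rlK_add_one_le`); hence the constant is free of
`α` and `β`.

Assertion (iv), scalar form. With zero initial data, applying `I^α` to the equation and cancelling
the common `I^{Λ-1}` gives `I^1 V = I^{1+α-β} X` for `V = (u, φ) - I^α (f, φ)`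
(`rl_one_eq_of_rlI_eq`). By Lebesgue differentiation `V` is the limit of difference quotients of
`I^{1+α-β} X`. Abel summation writes such a quotient as a limit of weighted sums of increments of
`X`, with squared weights bounded by a multiple of `(t - s)^ρ`, `ρ = min(2(α-β), 0)`, uniformly in
the step; `β < α + 1/2` means that this is integrable. The moment bound, Fatou's lemma and Tonelli's
theorem then give the Volterra estimate (`lintegral_le_of_fracInt_eq`), with no need for a
stochastic Fubini theorem.

Back to `H_p^γ`. The test functions are `(1 - Δ)^{γ/2}` of a mollifier translated by `x`, for which
the pairing is a mollification of `(1 - Δ)^{γ/2} u` at `x`. The scalar bounds are integrated over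
`x`; Young's inequality controls the data and Fatou's lemma recovers the norm of the solution as the
mollifier concentrates. In (iv) this uses that `H_p^{γ+2}` embeds into `H_p^γ`, which holds because
`(1 - Δ)⁻¹` is convolution with a probability measure.

Assertions (i) and (iii) concern only the space. The Bessel potential acts isometrically on values
and commutes with `I^{Λ-α}`; and being a version survives limits along rapidly convergent sequences,
so that the space is closed in a product of Banach spaces. -/

lemma rpow_sub_rpow_le {a b r : ℝ} (hb : 0 ≤ b) (hba : b ≤ a) (hr : 1 ≤ r) :
    a ^ r - b ^ r ≤ r * a ^ (r - 1) * (a - b) := by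
  rcases (hb.trans hba).eq_or_lt with h0 | ha
  · obtain rfl : b = 0 := le_antisymm (h0 ▸ hba) hb
    simp [← h0]
  -- Bernoulli's inequality at `b / a`, rescaled by `a ^ r`.
  · have h1 := one_add_mul_self_le_rpow_one_add (s := b / a - 1)
      (by have := div_nonneg hb ha.le; linarith) hr
    rw [add_sub_cancel, Real.div_rpow hb ha.le, le_div_iff₀ (Real.rpow_pos_of_pos ha r)] at h1
    have h2 : a ^ r = a ^ (r - 1) * a := by
      rw [← Real.rpow_add_one ha.ne', sub_add_cancel]
    have h3 : (1 + r * (b / a - 1)) * a ^ r = a ^ r + r * a ^ (r - 1) * (b - a) := by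
      rw [h2]; field_simp
    rw [h3] at h1
    linarith

lemma abs_rpow_sub_two_mul_self {q : ℝ} (hq : 2 ≤ q) (x : ℝ) :
    |x| ^ (q - 2) * x * x = |x| ^ q := by
  rcases eq_or_ne x 0 with rfl | hx
  · simp [Real.zero_rpow (by linarith : q ≠ 0)]
  · rw [mul_assoc, ← abs_mul_abs_self x, ← mul_assoc, ← Real.rpow_add_one (abs_ne_zero.2 hx),
      ← Real.rpow_add_one (abs_ne_zero.2 hx)]
    congr 1; ring

lemma abs_rpow_sub_two_mul_abs {q : ℝ} (hq : 2 ≤ q) (x : ℝ) :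
    |x| ^ (q - 2) * |x| = |x| ^ (q - 1) := by
  rcases eq_or_ne x 0 with rfl | hx
  · simp [Real.zero_rpow (by linarith : q - 1 ≠ 0)]
  · rw [← Real.rpow_add_one (abs_ne_zero.2 hx)]
    congr 1; ring

/-- Convexity of `|x|^q`, obtained from Young's inequality with the exponents `q / (q - 1)` and `q`
instead of by differentiation. -/
lemma abs_rpow_tangent_le {q : ℝ} (hq : 2 ≤ q) (a b : ℝ) :
    |a| ^ q + q * (|a| ^ (q - 2) * a) * (b - a) ≤ |b| ^ q := by
  have hq0 : (0 : ℝ) < q := by linarith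
  have h1 := Real.young_inequality_of_nonneg (a := |a| ^ (q - 1)) (b := |b|) (p := q / (q - 1))
    (q := q) (by positivity) (by positivity) (by
      refine Real.HolderConjugate.symm ?_
      exact Real.HolderConjugate.conjExponent (by linarith))
  rw [← Real.rpow_mul (abs_nonneg a), mul_div_cancel₀ _ (by linarith : q - 1 ≠ 0)] at h1
  have h2 : |a| ^ (q - 2) * a * b ≤ |a| ^ (q - 1) * |b| := by
    calc |a| ^ (q - 2) * a * b ≤ |(|a| ^ (q - 2) * a * b)| := le_abs_self _
      _ = |a| ^ (q - 1) * |b| := by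
        rw [abs_mul, abs_mul, abs_of_nonneg (by positivity : 0 ≤ |a| ^ (q - 2)),
          abs_rpow_sub_two_mul_abs hq]
  have h3 := abs_rpow_sub_two_mul_self hq a
  have h4 : q * (|a| ^ (q - 1) * |b|) ≤ (q - 1) * |a| ^ q + |b| ^ q := by
    calc q * (|a| ^ (q - 1) * |b|) ≤ q * (|a| ^ q / (q / (q - 1)) + |b| ^ q / q) := by gcongr
      _ = (q - 1) * |a| ^ q + |b| ^ q := by
        field_simp
  nlinarith

/-- For equal signs `rpow_sub_rpow_le` with exponent `q - 1` replaces the mean value theorem. For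
opposite signs each of the two powers is bounded separately by the maximum, and `1 ≤ q - 1` does the
rest. -/
lemma sub_mul_abs_rpow_le {q : ℝ} (hq : 2 ≤ q) (a b : ℝ) :
    (|a| ^ (q - 2) * a - |b| ^ (q - 2) * b) * (a - b) ≤
      (q - 1) * max |a| |b| ^ (q - 2) * (a - b) ^ 2 := by
  have key : ∀ {x y : ℝ}, 0 ≤ y → y ≤ x → (x ^ (q - 2) * x - y ^ (q - 2) * y) * (x - y) ≤
      (q - 1) * max |x| |y| ^ (q - 2) * (x - y) ^ 2 := by
    intro x y hy hyx
    have hx := hy.trans hyx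
    have h1 := rpow_sub_rpow_le (r := q - 1) hy hyx (by linarith)
    have e1 := abs_rpow_sub_two_mul_abs hq x
    have e2 := abs_rpow_sub_two_mul_abs hq y
    rw [abs_of_nonneg hx] at e1
    rw [abs_of_nonneg hy] at e2
    rw [e1, e2, abs_of_nonneg hx, abs_of_nonneg hy, max_eq_left hyx]
    calc _ ≤ (q - 1) * x ^ (q - 1 - 1) * (x - y) * (x - y) := by
          gcongr
      _ = _ := by rw [show q - 1 - 1 = q - 2 by ring]; ring
  have key2 : ∀ {x y : ℝ}, 0 ≤ x → y ≤ 0 → (|x| ^ (q - 2) * x - |y| ^ (q - 2) * y) * (x - y) ≤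
      (q - 1) * max |x| |y| ^ (q - 2) * (x - y) ^ 2 := by
    intro x y hx hy
    have h1 : |x| ^ (q - 2) ≤ max |x| |y| ^ (q - 2) := by
      gcongr
      exact le_max_left _ _
    have h2 : |y| ^ (q - 2) ≤ max |x| |y| ^ (q - 2) := by
      gcongr
      exact le_max_right _ _
    have h3 : |x| ^ (q - 2) * x - |y| ^ (q - 2) * y ≤ max |x| |y| ^ (q - 2) * (x - y) := by
      nlinarith
    have h4 : 0 ≤ max |x| |y| ^ (q - 2) := by positivity
    calc _ ≤ max |x| |y| ^ (q - 2) * (x - y) * (x - y) := by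
          gcongr; linarith
      _ ≤ _ := by
        rw [sq, ← mul_assoc]
        have : 0 ≤ x - y := by linarith
        gcongr
        nlinarith
  rcases le_total 0 a with ha | ha <;> rcases le_total 0 b with hb | hb
  · rcases le_total a b with h | h
    · have := key ha h
      rw [abs_of_nonneg ha, abs_of_nonneg hb] at this ⊢
      rw [max_comm]
      nlinarith
    · have := key hb h
      rwa [abs_of_nonneg ha, abs_of_nonneg hb] at this ⊢
  · exact key2 ha hb
  · have := key2 hb ha
    rw [max_comm]; nlinarith
  · rcases le_total a b with h | h
    · have := key (x := -a) (y := -b) (by linarith) (by linarith)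
      rw [abs_neg, abs_neg, abs_of_nonpos ha, abs_of_nonpos hb] at this
      rw [abs_of_nonpos ha, abs_of_nonpos hb]
      nlinarith
    · have := key (x := -b) (y := -a) (by linarith) (by linarith)
      rw [abs_neg, abs_neg, abs_of_nonpos ha, abs_of_nonpos hb] at this
      rw [max_comm, abs_of_nonpos ha, abs_of_nonpos hb]
      nlinarith

/-- The constant in the second order Taylor bound of `|x|^q`. -/
def taylorConst (q : ℝ) : ℝ := q * (q - 1) * 2 ^ (q - 2)

lemma taylorConst_pos {q : ℝ} (hq : 2 ≤ q) : 0 < taylorConst q := by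
  have h1 : 0 < q := by linarith
  have h2 : 0 < q - 1 := by linarith
  unfold taylorConst; positivity

/-- The tangent inequality at `x + y`, evaluated at `x`, bounds the increment of `|·|^q` by `q`
times the derivative term at `x + y`; moving that term back to `x` costs `sub_mul_abs_rpow_le`. The
linear term in `y` is kept exact because it averages to zero along a martingale. -/
lemma abs_add_rpow_le {q : ℝ} (hq : 2 ≤ q) (x y : ℝ) :
    |x + y| ^ q ≤ |x| ^ q + q * (|x| ^ (q - 2) * x * y) +
      taylorConst q * (|x| ^ (q - 2) * y ^ 2 + |y| ^ q) := by
  have h1 := abs_rpow_tangent_le hq (x + y) x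
  have h2 := sub_mul_abs_rpow_le hq (x + y) x
  rw [add_sub_cancel_left] at h2
  have h3 : max |x + y| |x| ^ (q - 2) ≤ 2 ^ (q - 2) * (|x| ^ (q - 2) + |y| ^ (q - 2)) := by
    have e1 : max |x + y| |x| ≤ 2 * max |x| |y| := by
      refine max_le ((abs_add_le x y).trans ?_) ?_
      · linarith [le_max_left |x| |y|, le_max_right |x| |y|]
      · linarith [le_max_left |x| |y|, abs_nonneg x]
    calc max |x + y| |x| ^ (q - 2) ≤ (2 * max |x| |y|) ^ (q - 2) := by
          gcongr
      _ = 2 ^ (q - 2) * max |x| |y| ^ (q - 2) := Real.mul_rpow (by norm_num) (by positivity)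
      _ ≤ _ := by
        gcongr
        rcases max_choice |x| |y| with h | h <;> rw [h]
        · linarith [Real.rpow_nonneg (abs_nonneg y) (q - 2)]
        · linarith [Real.rpow_nonneg (abs_nonneg x) (q - 2)]
  have h4 : |y| ^ (q - 2) * y ^ 2 = |y| ^ q := by
    rw [← abs_rpow_sub_two_mul_self hq y]; ring
  have h5 : (q - 1) * max |x + y| |x| ^ (q - 2) * y ^ 2 ≤
      (q - 1) * (2 ^ (q - 2) * (|x| ^ (q - 2) + |y| ^ (q - 2))) * y ^ 2 := by
    gcongr
    linarith
  have h6 : q * ((q - 1) * (2 ^ (q - 2) * (|x| ^ (q - 2) + |y| ^ (q - 2))) * y ^ 2) =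
      taylorConst q * (|x| ^ (q - 2) * y ^ 2 + |y| ^ q) := by
    rw [← h4, taylorConst]; ring
  have hq0 : 0 ≤ q := by linarith
  have h7 := mul_le_mul_of_nonneg_left (h2.trans h5) hq0
  rw [h6] at h7
  linarith

/-- Whichever of `b²` and `l a²` is larger bounds the product. The weight `l` is free so that the
first term can later be made small enough to be absorbed. -/
lemma rpow_mul_rpow_le_weighted {q : ℝ} (hq : 2 ≤ q) {a b l : ℝ} (ha : 0 ≤ a) (hb : 0 ≤ b)
    (hl : 0 < l) : a ^ (q - 2) * b ^ 2 ≤ l * a ^ q + (l⁻¹) ^ ((q - 2) / 2) * b ^ q := by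
  have e : ∀ {c : ℝ}, 0 ≤ c → c ^ (q - 2) * c ^ 2 = c ^ q := by
    intro c hc
    have := abs_rpow_sub_two_mul_self hq c
    rw [abs_of_nonneg hc] at this
    rw [← this]; ring
  rcases le_total (b ^ 2) (l * a ^ 2) with h | h
  · calc a ^ (q - 2) * b ^ 2 ≤ a ^ (q - 2) * (l * a ^ 2) := by gcongr
      _ = l * a ^ q := by rw [← e ha]; ring
      _ ≤ _ := by
        have : 0 ≤ (l⁻¹) ^ ((q - 2) / 2) * b ^ q := by positivity
        linarith
  · have h1 : a ^ 2 ≤ l⁻¹ * b ^ 2 := by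
      rw [inv_mul_eq_div, le_div_iff₀ hl]; linarith
    have h2 : a ^ (q - 2) ≤ (l⁻¹) ^ ((q - 2) / 2) * b ^ (q - 2) := by
      have e2 : ∀ {c : ℝ}, 0 ≤ c → (c ^ 2) ^ ((q - 2) / 2) = c ^ (q - 2) := by
        intro c hc
        rw [← Real.rpow_natCast, ← Real.rpow_mul hc]
        congr 1; push_cast; ring
      rw [← e2 ha, ← e2 hb, ← Real.mul_rpow (by positivity) (by positivity)]
      gcongr
    calc a ^ (q - 2) * b ^ 2 ≤ (l⁻¹) ^ ((q - 2) / 2) * b ^ (q - 2) * b ^ 2 := by gcongr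
      _ = (l⁻¹) ^ ((q - 2) / 2) * b ^ q := by rw [mul_assoc, e hb]
      _ ≤ _ := by
        have : 0 ≤ l * a ^ q := by positivity
        linarith

/-! ### Functions all of whose moments are finite -/

section Moments
variable {Ω : Type*} {mΩ : MeasurableSpace Ω} {P : Measure Ω}

/-- All moments of `f` are finite. -/
def HasMoments (f : Ω → ℝ) (P : Measure Ω) : Prop := ∀ r : ℝ≥0∞, r ≠ ∞ → MemLp f r P

lemma HasMoments.mul {f g : Ω → ℝ} (hf : HasMoments f P) (hg : HasMoments g P) :
    HasMoments (fun ω => f ω * g ω) P := fun r hr => by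
  have h2 : 2 * r ≠ ∞ := ENNReal.mul_ne_top (by simp) hr
  have : ENNReal.HolderTriple (2 * r) (2 * r) r := ⟨by
    rw [ENNReal.mul_inv (by simp) (by simp), ← add_mul, ENNReal.inv_two_add_inv_two, one_mul]⟩
  exact (hg _ h2).mul' (hf _ h2)

lemma HasMoments.abs_rpow [IsFiniteMeasure P] {f : Ω → ℝ} (hf : HasMoments f P) {s : ℝ}
    (hs : 0 ≤ s) : HasMoments (fun ω => |f ω| ^ s) P := fun r hr => by
  rcases hs.eq_or_lt with rfl | hs
  · simpa using memLp_const (1 : ℝ)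
  · have h := (hf (r * ENNReal.ofReal s) (ENNReal.mul_ne_top hr (by simp))).norm_rpow_div
      (ENNReal.ofReal s)
    have e : r * ENNReal.ofReal s / ENNReal.ofReal s = r :=
      ENNReal.mul_div_cancel_right (by simpa using hs) (by simp)
    rw [e, ENNReal.toReal_ofReal hs.le] at h
    exact h

lemma HasMoments.const_mul {f : Ω → ℝ} (hf : HasMoments f P) (c : ℝ) :
    HasMoments (fun ω => c * f ω) P := fun r hr => (hf r hr).const_mul c

lemma HasMoments.sum {ι : Type*} {s : Finset ι} {f : ι → Ω → ℝ}
    (hf : ∀ i ∈ s, HasMoments (f i) P) : HasMoments (fun ω => ∑ i ∈ s, f i ω) P := fun r hr =>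
  memLp_finsetSum s fun i hi => hf i hi r hr

lemma HasMoments.integrable {f : Ω → ℝ} (hf : HasMoments f P) : Integrable f P :=
  memLp_one_iff_integrable.1 (hf 1 (by simp))

lemma HasMoments.of_bound [IsFiniteMeasure P] {f : Ω → ℝ} (hf : AEStronglyMeasurable f P) {C : ℝ}
    (h : ∀ ω, |f ω| ≤ C) : HasMoments f P := fun _ _ =>
  MemLp.of_bound hf C (Eventually.of_forall h)

end Moments

/-! ### Moments of the increments of a Wiener basis -/

section Increments
variable {Ω : Type*} {mΩ : MeasurableSpace Ω} {P : Measure Ω} [IsProbabilityMeasure P]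
  {ℱ : Filtration ℝ≥0 mΩ} {w : ℕ → ℝ≥0 → Ω → ℝ}

lemma IsWienerBasis.hasLaw_incr (hW : IsWienerBasis P ℱ w) (k : ℕ) {s t : ℝ≥0} (hst : s ≤ t) :
    HasLaw (fun ω => w k t ω - w k s ω) (gaussianReal 0 (t - s)) P := by
  have h := (hW.brownian k).toIsPreBrownianReal.hasLaw_sub t s
  have e : nndist t.1 s.1 = t - s := by
    rw [← NNReal.coe_inj, coe_nndist, Real.dist_eq, NNReal.coe_sub hst]
    exact abs_of_nonneg (sub_nonneg.2 (NNReal.coe_le_coe.2 hst))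
  rw [e] at h
  exact h

lemma IsWienerBasis.stronglyMeasurable_incr (hW : IsWienerBasis P ℱ w) (k : ℕ) {s t u : ℝ≥0}
    (hs : s ≤ u) (ht : t ≤ u) : StronglyMeasurable[ℱ u] (fun ω => w k t ω - w k s ω) :=
  ((hW.adapted k t).mono (ℱ.mono ht)).sub ((hW.adapted k s).mono (ℱ.mono hs))

lemma IsWienerBasis.hasMoments_incr (hW : IsWienerBasis P ℱ w) (k : ℕ) {s t : ℝ≥0}
    (hst : s ≤ t) : HasMoments (fun ω => w k t ω - w k s ω) P := fun r hr => by
  have h := hW.hasLaw_incr k hst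
  have h2 := memLp_id_gaussianReal' (μ := 0) (v := t - s) r hr
  rw [← h.map_eq, memLp_map_measure_iff aestronglyMeasurable_id h.aemeasurable] at h2
  exact h2

/-- The absolute moment of order `q` of the standard normal law. -/
def gaussMoment (q : ℝ) : ℝ := ∫ x, |x| ^ q ∂gaussianReal 0 1

lemma gaussMoment_nonneg (q : ℝ) : 0 ≤ gaussMoment q :=
  integral_nonneg fun x => by positivity

lemma IsWienerBasis.integral_abs_incr_rpow (hW : IsWienerBasis P ℱ w) (k : ℕ) {s t : ℝ≥0}
    (hst : s ≤ t) (q : ℝ) :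
    ∫ ω, |w k t ω - w k s ω| ^ q ∂P = gaussMoment q * ((t : ℝ) - s) ^ (q / 2) := by
  have h := hW.hasLaw_incr k hst
  have hm : AEStronglyMeasurable (fun x : ℝ => |x| ^ q) (P.map fun ω => w k t ω - w k s ω) :=
    (Measurable.pow_const measurable_norm q).aestronglyMeasurable
  have h1 : ∫ ω, |w k t ω - w k s ω| ^ q ∂P = ∫ x, |x| ^ q ∂gaussianReal 0 (t - s) := by
    rw [← h.map_eq, integral_map h.aemeasurable hm]
  have h2 : gaussianReal 0 (t - s) = (gaussianReal 0 1).map ((NNReal.sqrt (t - s) : ℝ) * ·) := by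
    rw [gaussianReal_map_const_mul]
    congr 1
    · simp
    · rw [← NNReal.coe_inj]; simp
  have h3 : (0 : ℝ) ≤ t - s := sub_nonneg.2 (NNReal.coe_le_coe.2 hst)
  have hm2 : AEStronglyMeasurable (fun x : ℝ => |x| ^ q)
      ((gaussianReal 0 1).map ((NNReal.sqrt (t - s) : ℝ) * ·)) :=
    (Measurable.pow_const measurable_norm q).aestronglyMeasurable
  rw [h1, h2, integral_map (by fun_prop) hm2, gaussMoment, mul_comm,
    ← integral_const_mul]
  refine integral_congr_ae (Eventually.of_forall fun x => ?_)
  simp only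
  rw [abs_mul, Real.mul_rpow (abs_nonneg _) (abs_nonneg _)]
  congr 1
  rw [Real.coe_sqrt, NNReal.coe_sub hst, abs_of_nonneg (Real.sqrt_nonneg _), Real.sqrt_eq_rpow,
    ← Real.rpow_mul h3]
  congr 1; ring

lemma IsWienerBasis.indepFun_incr (hW : IsWienerBasis P ℱ w) (k : ℕ) {s t : ℝ≥0}
    (hst : s ≤ t) {Z : Ω → ℝ} (hZ : StronglyMeasurable[ℱ s] Z) :
    IndepFun Z (fun ω => w k t ω - w k s ω) P := by
  rw [IndepFun_iff_Indep]
  exact indep_of_indep_of_le_left (hW.indep_increments k s t hst).symm hZ.measurable.comap_le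

lemma IsWienerBasis.integral_incr (hW : IsWienerBasis P ℱ w) (k : ℕ) {s t : ℝ≥0}
    (hst : s ≤ t) : ∫ ω, (w k t ω - w k s ω) ∂P = 0 := by
  rw [(hW.hasLaw_incr k hst).integral_eq, integral_id_gaussianReal]

lemma IsWienerBasis.integral_incr_sq (hW : IsWienerBasis P ℱ w) (k : ℕ) {s t : ℝ≥0}
    (hst : s ≤ t) : ∫ ω, (w k t ω - w k s ω) ^ 2 ∂P = (t : ℝ) - s := by
  have h := hW.hasLaw_incr k hst
  have h1 := h.variance_eq
  rw [variance_eq_integral h.aemeasurable, hW.integral_incr k hst] at h1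
  simp only [sub_zero] at h1
  rw [h1]
  have := variance_id_gaussianReal (μ := 0) (v := t - s)
  rw [this, NNReal.coe_sub hst]

lemma IsWienerBasis.integral_mul_incr (hW : IsWienerBasis P ℱ w) (k : ℕ) {s t : ℝ≥0}
    (hst : s ≤ t) {Z : Ω → ℝ} (hZ : StronglyMeasurable[ℱ s] Z) :
    ∫ ω, Z ω * (w k t ω - w k s ω) ∂P = 0 := by
  rw [(hW.indepFun_incr k hst hZ).integral_fun_mul_eq_mul_integral
    (hZ.mono (ℱ.le s)).aestronglyMeasurable
    ((hW.stronglyMeasurable_incr k hst le_rfl).mono (ℱ.le t)).aestronglyMeasurable,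
    hW.integral_incr k hst, mul_zero]

lemma IsWienerBasis.integral_mul_incr_sq (hW : IsWienerBasis P ℱ w) (k : ℕ) {s t : ℝ≥0}
    (hst : s ≤ t) {Z : Ω → ℝ} (hZ : StronglyMeasurable[ℱ s] Z) :
    ∫ ω, Z ω * (w k t ω - w k s ω) ^ 2 ∂P = ((t : ℝ) - s) * ∫ ω, Z ω ∂P := by
  have h := (hW.indepFun_incr k hst hZ).comp measurable_id (measurable_id.pow_const 2)
  have h2 := h.integral_fun_mul_eq_mul_integral
    (hZ.mono (ℱ.le s)).aestronglyMeasurable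
    (((hW.stronglyMeasurable_incr k hst le_rfl).mono (ℱ.le t)).pow 2).aestronglyMeasurable
  have h3 := hW.integral_incr_sq k hst
  simp only [Function.comp_def, id] at h2
  rw [h2, h3, mul_comm]

/-- Independence of two whole paths, with no reference to the filtration; it is used for the second
moment of a discrete covariation. -/
lemma IsWienerBasis.integral_incr_mul_incr_of_ne (hW : IsWienerBasis P ℱ w) {k l : ℕ}
    (hkl : k ≠ l) (a b c e : ℝ≥0) :
    ∫ ω, ((w k b ω - w k a ω) * (w k e ω - w k c ω)) *
      ((w l b ω - w l a ω) * (w l e ω - w l c ω)) ∂P =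
    (∫ ω, (w k b ω - w k a ω) * (w k e ω - w k c ω) ∂P) *
      ∫ ω, (w l b ω - w l a ω) * (w l e ω - w l c ω) ∂P := by
  have hm : Measurable fun x : ℝ≥0 → ℝ => (x b - x a) * (x e - x c) := by fun_prop
  have h := (hW.indep.indepFun hkl).comp hm hm
  have hs : ∀ m, StronglyMeasurable fun ω => (w m b ω - w m a ω) * (w m e ω - w m c ω) :=
    fun m => (((hW.adapted m b).mono (ℱ.le b)).sub ((hW.adapted m a).mono (ℱ.le a))).mul
      (((hW.adapted m e).mono (ℱ.le e)).sub ((hW.adapted m c).mono (ℱ.le c)))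
  exact h.integral_fun_mul_eq_mul_integral (hs k).aestronglyMeasurable (hs l).aestronglyMeasurable

/-- Each `w k` has increments independent of `ℱ s` and the processes are independent of one another,
but joint independence of the pair of increments from `ℱ s` is not assumed. The product is therefore
replaced by the discrete covariation over a fine subdivision: the off-diagonal products have mean
zero against `Z`, and the covariation tends to zero in `L_2`. -/
lemma IsWienerBasis.integral_mul_incr_mul_incr_of_ne (hW : IsWienerBasis P ℱ w) {k l : ℕ}
    (hkl : k ≠ l) {s t : ℝ≥0} (hst : s ≤ t) {Z : Ω → ℝ} (hZ : StronglyMeasurable[ℱ s] Z)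
    (hZm : HasMoments Z P) :
    ∫ ω, Z ω * ((w k t ω - w k s ω) * (w l t ω - w l s ω)) ∂P = 0 := by
  have main : ∀ {Z : Ω → ℝ}, StronglyMeasurable[ℱ s] Z → HasMoments Z P →
      ∫ ω, Z ω * ((w k t ω - w k s ω) * (w l t ω - w l s ω)) ∂P ≤ 0 := by
    intro Z hZ hZm
    have bound : ∀ (ε : ℝ), 0 < ε → ∀ n : ℕ,
        2 * ∫ ω, Z ω * ((w k t ω - w k s ω) * (w l t ω - w l s ω)) ∂P ≤
          ε * (∫ ω, Z ω ^ 2 ∂P) + ε⁻¹ * (((t : ℝ) - s) ^ 2 * (1 / ((n : ℝ) + 1))) := by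
      intro ε hε n
      let u : ℕ → ℝ≥0 := fun i => s + (i / (n + 1 : ℝ≥0)) * (t - s)
      have hu : Monotone u := fun i j hij => by
        simp only [u]; gcongr
      have hu0 : u 0 = s := by simp [u]
      have hun : u (n + 1) = t := by
        simp only [u]; push_cast
        rw [div_self (by positivity), one_mul, add_tsub_cancel_of_le hst]
      have hsu : ∀ i, s ≤ u i := fun i => hu0 ▸ hu (Nat.zero_le i)
      have hd : ∀ i, (u (i + 1) : ℝ) - u i = ((t : ℝ) - s) * (1 / ((n : ℝ) + 1)) := by
        intro i
        simp only [u]; push_cast [NNReal.coe_sub hst]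
        field_simp; ring
      let D : ℕ → ℕ → Ω → ℝ := fun m i ω => w m (u (i + 1)) ω - w m (u i) ω
      have hDm : ∀ m i, HasMoments (D m i) P := fun m i =>
        hW.hasMoments_incr m (hu (Nat.le_succ i))
      have hDs : ∀ m i j, i < j → StronglyMeasurable[ℱ (u j)] (D m i) := fun m i j hij =>
        hW.stronglyMeasurable_incr m (hu hij.le) (hu hij)
      have hsum : ∀ m ω, w m t ω - w m s ω = ∑ i ∈ Finset.range (n + 1), D m i ω := by
        intro m ω
        rw [Finset.sum_range_sub (fun i => w m (u i) ω), hu0, hun]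
      -- The later of the two increments is independent of `Z` and of the earlier increment,
      -- whatever the two processes are.
      have hoff : ∀ i j, i ≠ j → ∫ ω, Z ω * (D k i ω * D l j ω) ∂P = 0 := by
        intro i j hij
        rcases lt_or_gt_of_ne hij with h | h
        · have := hW.integral_mul_incr l (hu (Nat.le_succ j))
            ((hZ.mono (ℱ.mono (hsu j))).mul (hDs k i j h))
          rw [← this]
          refine integral_congr_ae (Eventually.of_forall fun ω => ?_)
          simp only [D, Pi.mul_apply]; ring
        · have := hW.integral_mul_incr k (hu (Nat.le_succ i))
            ((hZ.mono (ℱ.mono (hsu i))).mul (hDs l j i h))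
          rw [← this]
          refine integral_congr_ae (Eventually.of_forall fun ω => ?_)
          simp only [D, Pi.mul_apply]; ring
      have hD2 : ∀ m i j, ∫ ω, D m i ω * D m j ω ∂P =
          if i = j then ((t : ℝ) - s) * (1 / ((n : ℝ) + 1)) else 0 := by
        intro m i j
        split_ifs with h
        · subst h
          rw [← hd i, ← hW.integral_incr_sq m (hu (Nat.le_succ i))]
          refine integral_congr_ae (Eventually.of_forall fun ω => ?_)
          simp only [D]; ring
        · rcases lt_or_gt_of_ne h with h | h
          · exact hW.integral_mul_incr m (hu (Nat.le_succ j)) (hDs m i j h)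
          · rw [← hW.integral_mul_incr m (hu (Nat.le_succ i)) (hDs m j i h)]
            refine integral_congr_ae (Eventually.of_forall fun ω => ?_)
            simp only [D]; ring
      let Q : Ω → ℝ := fun ω => ∑ i ∈ Finset.range (n + 1), D k i ω * D l i ω
      have hQm : HasMoments Q P := HasMoments.sum fun i _ => (hDm k i).mul (hDm l i)
      have hZQ : ∫ ω, Z ω * ((w k t ω - w k s ω) * (w l t ω - w l s ω)) ∂P =
          ∫ ω, Z ω * Q ω ∂P := by
        have e1 : ∀ ω, Z ω * ((w k t ω - w k s ω) * (w l t ω - w l s ω)) =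
            ∑ i ∈ Finset.range (n + 1), ∑ j ∈ Finset.range (n + 1), Z ω * (D k i ω * D l j ω) := by
          intro ω
          rw [hsum, hsum, Finset.sum_mul_sum, Finset.mul_sum]
          simp only [Finset.mul_sum]
        have e2 : ∀ ω, Z ω * Q ω =
            ∑ i ∈ Finset.range (n + 1), Z ω * (D k i ω * D l i ω) := by
          intro ω; simp only [Q, Finset.mul_sum]
        have hi : ∀ i j, Integrable (fun ω => Z ω * (D k i ω * D l j ω)) P := fun i j =>
          (hZm.mul ((hDm k i).mul (hDm l j))).integrable
        simp only [e1, e2]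
        rw [integral_finsetSum _ fun i _ => integrable_finsetSum _ fun j _ => hi i j,
          integral_finsetSum _ fun i _ => hi i i]
        refine Finset.sum_congr rfl fun i hi' => ?_
        rw [integral_finsetSum _ fun j _ => hi i j]
        exact Finset.sum_eq_single i (fun j _ hj => hoff i j hj.symm) (fun h => absurd hi' h)
      -- Independence of the two processes factorises the expectation, so that only the `n + 1`
      -- diagonal terms survive, each equal to `((t - s) / (n + 1))²`.
      have hQ2 : ∫ ω, Q ω ^ 2 ∂P = ((t : ℝ) - s) ^ 2 * (1 / ((n : ℝ) + 1)) := by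
        have e1 : ∀ ω, Q ω ^ 2 = ∑ i ∈ Finset.range (n + 1), ∑ j ∈ Finset.range (n + 1),
            (D k i ω * D k j ω) * (D l i ω * D l j ω) := by
          intro ω
          rw [sq, Finset.sum_mul_sum]
          refine Finset.sum_congr rfl fun i _ => Finset.sum_congr rfl fun j _ => by ring
        have hi : ∀ i j, Integrable (fun ω => (D k i ω * D k j ω) * (D l i ω * D l j ω)) P :=
          fun i j => (((hDm k i).mul (hDm k j)).mul ((hDm l i).mul (hDm l j))).integrable
        have e2 : ∀ i j, ∫ ω, (D k i ω * D k j ω) * (D l i ω * D l j ω) ∂P =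
            if i = j then (((t : ℝ) - s) * (1 / ((n : ℝ) + 1))) ^ 2 else 0 := by
          intro i j
          rw [hW.integral_incr_mul_incr_of_ne hkl, hD2 k, hD2 l]
          split_ifs <;> ring
        simp only [e1]
        rw [integral_finsetSum _ fun i _ => integrable_finsetSum _ fun j _ => hi i j]
        simp only [integral_finsetSum _ fun j _ => hi _ j, e2]
        rw [Finset.sum_congr rfl fun i hi' => by
          rw [Finset.sum_ite_eq, if_pos hi']]
        rw [Finset.sum_const, Finset.card_range, nsmul_eq_mul]
        push_cast
        field_simp
      have hle : ∀ ω, 2 * (Z ω * Q ω) ≤ ε * Z ω ^ 2 + ε⁻¹ * Q ω ^ 2 := by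
        intro ω
        have h1 : 0 ≤ ε⁻¹ * (ε * Z ω - Q ω) ^ 2 := by positivity
        have h2 : ε⁻¹ * (ε * Z ω - Q ω) ^ 2 = ε * Z ω ^ 2 + ε⁻¹ * Q ω ^ 2 - 2 * (Z ω * Q ω) := by
          field_simp; ring
        linarith
      have hZ2 : Integrable (fun ω => Z ω ^ 2) P := (hZm 2 (by simp)).integrable_sq
      have hQ2' : Integrable (fun ω => Q ω ^ 2) P := (hQm 2 (by simp)).integrable_sq
      rw [hZQ, ← integral_const_mul, ← hQ2, ← integral_const_mul, ← integral_const_mul,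
        ← integral_add (hZ2.const_mul ε) (hQ2'.const_mul ε⁻¹)]
      exact integral_mono ((hZm.mul hQm).integrable.const_mul 2)
        ((hZ2.const_mul ε).add (hQ2'.const_mul ε⁻¹)) hle
    have bound2 : ∀ ε : ℝ, 0 < ε →
        2 * ∫ ω, Z ω * ((w k t ω - w k s ω) * (w l t ω - w l s ω)) ∂P ≤
          ε * (∫ ω, Z ω ^ 2 ∂P) := by
      intro ε hε
      have hlim : Tendsto (fun n : ℕ => ε * (∫ ω, Z ω ^ 2 ∂P) +
          ε⁻¹ * (((t : ℝ) - s) ^ 2 * (1 / ((n : ℝ) + 1)))) atTop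
          (𝓝 (ε * (∫ ω, Z ω ^ 2 ∂P) + ε⁻¹ * (((t : ℝ) - s) ^ 2 * 0))) :=
        ((tendsto_one_div_add_atTop_nhds_zero_nat.const_mul _).const_mul _).const_add _
      have := ge_of_tendsto' hlim (bound ε hε)
      simpa using this
    have hlim : Tendsto (fun n : ℕ => (1 / ((n : ℝ) + 1)) * (∫ ω, Z ω ^ 2 ∂P)) atTop
        (𝓝 (0 * (∫ ω, Z ω ^ 2 ∂P))) :=
      tendsto_one_div_add_atTop_nhds_zero_nat.mul_const _
    have := ge_of_tendsto' hlim fun n => bound2 _ (by positivity)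
    linarith
  -- Letting `n → ∞` and then `ε → 0` gave only the upper bound zero; the same bound for `-Z` gives
  -- equality.
  refine le_antisymm (main hZ hZm) ?_
  have h := main hZ.neg (Z := -Z) (by
    have e : -Z = fun ω => -1 * Z ω := by ext ω; simp
    rw [e]; exact hZm.const_mul (-1))
  simp only [Pi.neg_apply, neg_mul, integral_neg] at h
  linarith

end Increments

/-! ### Moment bounds for elementary stochastic sums -/

section ElementarySums
variable {Ω : Type*} {mΩ : MeasurableSpace Ω} {P : Measure Ω} [IsProbabilityMeasure P]
  {ℱ : Filtration ℝ≥0 mΩ} {w : ℕ → ℝ≥0 → Ω → ℝ}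

/-- The `j`-th step `c_j ∑_k ξ_{jk} (w^k_{τ_{j+1}} - w^k_{τ_j})` of an elementary stochastic sum. -/
def elemStep (w : ℕ → ℝ≥0 → Ω → ℝ) (τ : ℕ → ℝ≥0) (c : ℕ → ℝ) (I : Finset ℕ) (ξ : ℕ → ℕ → Ω → ℝ)
    (j : ℕ) (ω : Ω) : ℝ :=
  c j * ∑ k ∈ I, ξ j k ω * (w k (τ (j + 1)) ω - w k (τ j) ω)

variable {τ : ℕ → ℝ≥0} {c : ℕ → ℝ} {I : Finset ℕ} {ξ : ℕ → ℕ → Ω → ℝ}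

lemma stronglyMeasurable_elemStep (hW : IsWienerBasis P ℱ w) (hτ : Monotone τ)
    (hξ : ∀ j k, StronglyMeasurable[ℱ (τ j)] (ξ j k)) {i j : ℕ} (hij : i < j) :
    StronglyMeasurable[ℱ (τ j)] (elemStep w τ c I ξ i) := by
  unfold elemStep
  refine StronglyMeasurable.const_mul (Finset.stronglyMeasurable_fun_sum _ fun k _ => ?_) _
  exact ((hξ i k).mono (ℱ.mono (hτ hij.le))).mul
    (hW.stronglyMeasurable_incr k (hτ hij.le) (hτ hij))

lemma hasMoments_elemStep (hW : IsWienerBasis P ℱ w) (hτ : Monotone τ)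
    (hξm : ∀ j k, HasMoments (ξ j k) P) (j : ℕ) : HasMoments (elemStep w τ c I ξ j) P :=
  (HasMoments.sum fun k _ => (hξm j k).mul (hW.hasMoments_incr k (hτ (Nat.le_succ j)))).const_mul _

lemma integral_mul_elemStep (hW : IsWienerBasis P ℱ w) (hτ : Monotone τ)
    (hξ : ∀ j k, StronglyMeasurable[ℱ (τ j)] (ξ j k)) (hξm : ∀ j k, HasMoments (ξ j k) P)
    {j : ℕ} {Z : Ω → ℝ} (hZ : StronglyMeasurable[ℱ (τ j)] Z) (hZm : HasMoments Z P) :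
    ∫ ω, Z ω * elemStep w τ c I ξ j ω ∂P = 0 := by
  have e : ∀ ω, Z ω * elemStep w τ c I ξ j ω =
      c j * ∑ k ∈ I, (Z ω * ξ j k ω) * (w k (τ (j + 1)) ω - w k (τ j) ω) := by
    intro ω
    rw [elemStep, mul_left_comm, Finset.mul_sum]
    congr 1
    exact Finset.sum_congr rfl fun k _ => by ring
  simp only [e]
  rw [integral_const_mul, integral_finsetSum _ fun k _ => ((hZm.mul (hξm j k)).mul
    (hW.hasMoments_incr k (hτ (Nat.le_succ j)))).integrable]
  rw [Finset.sum_eq_zero, mul_zero]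
  exact fun k _ => hW.integral_mul_incr k (hτ (Nat.le_succ j)) (hZ.mul (hξ j k))

/-- A one-step Itô isometry with a weight known at the start of the step. The terms with two
different Wiener processes vanish by `integral_mul_incr_mul_incr_of_ne`. -/
lemma integral_mul_elemStep_sq (hW : IsWienerBasis P ℱ w) (hτ : Monotone τ)
    (hξ : ∀ j k, StronglyMeasurable[ℱ (τ j)] (ξ j k)) (hξm : ∀ j k, HasMoments (ξ j k) P)
    {j : ℕ} {Z : Ω → ℝ} (hZ : StronglyMeasurable[ℱ (τ j)] Z) (hZm : HasMoments Z P) :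
    ∫ ω, Z ω * elemStep w τ c I ξ j ω ^ 2 ∂P =
      c j ^ 2 * ((τ (j + 1) : ℝ) - τ j) * ∫ ω, Z ω * ∑ k ∈ I, ξ j k ω ^ 2 ∂P := by
  have hd := fun k => hW.hasMoments_incr k (hτ (Nat.le_succ j))
  have e : ∀ ω, Z ω * elemStep w τ c I ξ j ω ^ 2 =
      c j ^ 2 * ∑ k ∈ I, ∑ l ∈ I, (Z ω * (ξ j k ω * ξ j l ω)) *
        ((w k (τ (j + 1)) ω - w k (τ j) ω) * (w l (τ (j + 1)) ω - w l (τ j) ω)) := by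
    intro ω
    rw [elemStep, mul_pow, mul_left_comm, sq (∑ k ∈ I, _), Finset.sum_mul_sum, Finset.mul_sum]
    congr 1
    refine Finset.sum_congr rfl fun k _ => ?_
    rw [Finset.mul_sum]
    exact Finset.sum_congr rfl fun l _ => by ring
  have hi : ∀ k l, Integrable (fun ω => (Z ω * (ξ j k ω * ξ j l ω)) *
        ((w k (τ (j + 1)) ω - w k (τ j) ω) * (w l (τ (j + 1)) ω - w l (τ j) ω))) P := fun k l =>
    ((hZm.mul ((hξm j k).mul (hξm j l))).mul ((hd k).mul (hd l))).integrable
  have e2 : ∀ k l, ∫ ω, (Z ω * (ξ j k ω * ξ j l ω)) *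
        ((w k (τ (j + 1)) ω - w k (τ j) ω) * (w l (τ (j + 1)) ω - w l (τ j) ω)) ∂P =
      if k = l then ((τ (j + 1) : ℝ) - τ j) * ∫ ω, Z ω * ξ j k ω ^ 2 ∂P else 0 := by
    intro k l
    split_ifs with h
    · subst h
      have := hW.integral_mul_incr_sq k (hτ (Nat.le_succ j)) (hZ.mul ((hξ j k).mul (hξ j k)))
      simp only [Pi.mul_apply] at this
      simpa only [sq] using this
    · exact hW.integral_mul_incr_mul_incr_of_ne h (hτ (Nat.le_succ j))
        (hZ.mul ((hξ j k).mul (hξ j l))) (hZm.mul ((hξm j k).mul (hξm j l)))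
  simp only [e]
  rw [integral_const_mul, integral_finsetSum _ fun k _ => integrable_finsetSum _ fun l _ => hi k l]
  simp only [integral_finsetSum _ fun l _ => hi _ l, e2, Finset.mul_sum]
  have hi2 : ∀ k, Integrable (fun ω => Z ω * ξ j k ω ^ 2) P := fun k => by
    simpa only [sq] using (hZm.mul ((hξm j k).mul (hξm j k))).integrable
  rw [integral_finsetSum _ fun k _ => hi2 k, Finset.mul_sum]
  refine Finset.sum_congr rfl fun k hk => ?_
  rw [← Finset.mul_sum, Finset.sum_ite_eq, if_pos hk, mul_assoc]

/-- The elementary stochastic sum with the given steps. -/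
def elemSum (w : ℕ → ℝ≥0 → Ω → ℝ) (τ : ℕ → ℝ≥0) (c : ℕ → ℝ) (I : Finset ℕ) (ξ : ℕ → ℕ → Ω → ℝ)
    (n : ℕ) (ω : Ω) : ℝ :=
  ∑ j ∈ Finset.range n, elemStep w τ c I ξ j ω

lemma stronglyMeasurable_elemSum (hW : IsWienerBasis P ℱ w) (hτ : Monotone τ)
    (hξ : ∀ j k, StronglyMeasurable[ℱ (τ j)] (ξ j k)) (n : ℕ) :
    StronglyMeasurable[ℱ (τ n)] (elemSum w τ c I ξ n) :=
  Finset.stronglyMeasurable_fun_sum _ fun _ hj =>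
    stronglyMeasurable_elemStep hW hτ hξ (Finset.mem_range.1 hj)

lemma hasMoments_elemSum (hW : IsWienerBasis P ℱ w) (hτ : Monotone τ)
    (hξm : ∀ j k, HasMoments (ξ j k) P) (n : ℕ) : HasMoments (elemSum w τ c I ξ n) P :=
  HasMoments.sum fun j _ => hasMoments_elemStep hW hτ hξm j

lemma elemSum_succ (n : ℕ) (ω : Ω) :
    elemSum w τ c I ξ (n + 1) ω = elemSum w τ c I ξ n ω + elemStep w τ c I ξ n ω :=
  Finset.sum_range_succ _ _

lemma hasMoments_sum_sq (hξm : ∀ j k, HasMoments (ξ j k) P) (j : ℕ) :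
    HasMoments (fun ω => ∑ k ∈ I, ξ j k ω ^ 2) P :=
  HasMoments.sum fun k _ => by simpa only [sq] using (hξm j k).mul (hξm j k)

/-- The Itô isometry. It serves the exponent two, for which the remainder in the general bound does
not disappear under refinement. -/
lemma integral_elemSum_sq (hW : IsWienerBasis P ℱ w) (hτ : Monotone τ)
    (hξ : ∀ j k, StronglyMeasurable[ℱ (τ j)] (ξ j k)) (hξm : ∀ j k, HasMoments (ξ j k) P) (n : ℕ) :
    ∫ ω, elemSum w τ c I ξ n ω ^ 2 ∂P = ∑ j ∈ Finset.range n,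
      c j ^ 2 * ((τ (j + 1) : ℝ) - τ j) * ∫ ω, ∑ k ∈ I, ξ j k ω ^ 2 ∂P := by
  induction n with
  | zero => simp [elemSum]
  | succ n ih =>
    have hS := hasMoments_elemSum (c := c) (I := I) hW hτ hξm n
    have hD := hasMoments_elemStep (c := c) (I := I) hW hτ hξm n
    have h1 := integral_mul_elemStep (c := c) (I := I) hW hτ hξ hξm
      (stronglyMeasurable_elemSum (c := c) (I := I) hW hτ hξ n) hS
    have h2 := integral_mul_elemStep_sq (c := c) (I := I) hW hτ hξ hξm (j := n)
      (Z := fun _ => 1) stronglyMeasurable_const (fun r _ => memLp_const 1)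
    simp only [one_mul] at h2
    rw [Finset.sum_range_succ, ← ih, ← h2]
    have e : ∀ ω, elemSum w τ c I ξ (n + 1) ω ^ 2 = (elemSum w τ c I ξ n ω ^ 2 +
        2 * (elemSum w τ c I ξ n ω * elemStep w τ c I ξ n ω)) + elemStep w τ c I ξ n ω ^ 2 := by
      intro ω; rw [elemSum_succ]; ring
    have i1 : Integrable (fun ω => elemSum w τ c I ξ n ω ^ 2) P := (hS 2 (by simp)).integrable_sq
    have i2 : Integrable (fun ω => elemStep w τ c I ξ n ω ^ 2) P := (hD 2 (by simp)).integrable_sq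
    have i3 : Integrable (fun ω => 2 * (elemSum w τ c I ξ n ω * elemStep w τ c I ξ n ω)) P :=
      (hS.mul hD).integrable.const_mul 2
    have i4 : Integrable (fun ω => elemSum w τ c I ξ n ω ^ 2 +
        2 * (elemSum w τ c I ξ n ω * elemStep w τ c I ξ n ω)) P := i1.add i3
    simp only [e]
    rw [integral_add i4 i2, integral_add i1 i3, integral_const_mul, h1, mul_zero, add_zero]

/-- Expanding `|X_{m+1}|^q` around `X_m`, the linear term vanishes in mean and the quadratic one
involves only `∑ ξ²`. The weighted inequality leaves a multiple of `𝔼|X_m|^q ≤ 𝔼|X_n|^q`, which is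
absorbed on the left. The last sum is an error term of higher order in the mesh. -/
lemma integral_abs_elemSum_rpow_le (hW : IsWienerBasis P ℱ w) (hτ : Monotone τ)
    (hξ : ∀ j k, StronglyMeasurable[ℱ (τ j)] (ξ j k)) (hξm : ∀ j k, HasMoments (ξ j k) P)
    {q : ℝ} (hq : 2 ≤ q) {A : ℝ} (hA : 0 < A) (n : ℕ)
    (hcA : ∑ j ∈ Finset.range n, c j ^ 2 * ((τ (j + 1) : ℝ) - τ j) ≤ A) :
    ∫ ω, |elemSum w τ c I ξ n ω| ^ q ∂P ≤ 2 * taylorConst q *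
      ((2 * taylorConst q * A) ^ ((q - 2) / 2) * (∑ j ∈ Finset.range n,
        c j ^ 2 * ((τ (j + 1) : ℝ) - τ j) * ∫ ω, (∑ k ∈ I, ξ j k ω ^ 2) ^ (q / 2) ∂P) +
      ∑ j ∈ Finset.range n, ∫ ω, |elemStep w τ c I ξ j ω| ^ q ∂P) := by
  set C := taylorConst q with hC
  have hC0 : 0 < C := taylorConst_pos hq
  have hq0 : 0 ≤ q := by linarith
  set X := elemSum w τ c I ξ with hX
  set D := elemStep w τ c I ξ with hD
  have hXm : ∀ m, HasMoments (X m) P := hasMoments_elemSum hW hτ hξm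
  have hDm : ∀ m, HasMoments (D m) P := hasMoments_elemStep hW hτ hξm
  have hδ : ∀ j, 0 ≤ c j ^ 2 * ((τ (j + 1) : ℝ) - τ j) := fun j =>
    mul_nonneg (sq_nonneg _) (sub_nonneg.2 (NNReal.coe_le_coe.2 (hτ (Nat.le_succ j))))
  have hq2 : 0 ≤ q - 2 := by linarith
  have hGm : ∀ m, HasMoments (fun ω => |X m ω| ^ (q - 2) * X m ω) P := fun m =>
    ((hXm m).abs_rpow hq2).mul (hXm m)
  have hXs : ∀ m, StronglyMeasurable[ℱ (τ m)] (X m) := stronglyMeasurable_elemSum hW hτ hξ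
  have hAs : ∀ m, StronglyMeasurable[ℱ (τ m)] (fun ω => |X m ω| ^ (q - 2)) := fun m =>
    (Measurable.pow_const (hXs m).norm.measurable _).stronglyMeasurable
  have hG0 : ∀ m, ∫ ω, (|X m ω| ^ (q - 2) * X m ω) * D m ω ∂P = 0 := fun m =>
    integral_mul_elemStep hW hτ hξ hξm ((hAs m).mul (hXs m)) (hGm m)
  have hXq : ∀ m, Integrable (fun ω => |X m ω| ^ q) P := fun m =>
    ((hXm m).abs_rpow hq0).integrable
  have hGi : ∀ m, Integrable (fun ω => (|X m ω| ^ (q - 2) * X m ω) * D m ω) P := fun m =>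
    ((hGm m).mul (hDm m)).integrable
  -- The convex function `|·|^q` of a martingale is a submartingale; here the tangent inequality is
  -- integrated.
  have hmono : Monotone fun m => ∫ ω, |X m ω| ^ q ∂P := by
    refine monotone_nat_of_le_succ fun m => ?_
    have h1 : ∫ ω, (|X m ω| ^ q + q * ((|X m ω| ^ (q - 2) * X m ω) * D m ω)) ∂P =
        ∫ ω, |X m ω| ^ q ∂P := by
      rw [integral_add (hXq m) ((hGi m).const_mul q), integral_const_mul, hG0, mul_zero, add_zero]
    rw [← h1]
    refine integral_mono ((hXq m).add ((hGi m).const_mul q)) (hXq (m + 1)) fun ω => ?_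
    have := abs_rpow_tangent_le hq (X m ω) (X (m + 1) ω)
    rw [hX, elemSum_succ, add_sub_cancel_left, mul_assoc] at this
    simpa only [hX, elemSum_succ] using this
  set V : ℕ → Ω → ℝ := fun j ω => ∑ k ∈ I, ξ j k ω ^ 2 with hV
  have hV0 : ∀ j ω, 0 ≤ V j ω := fun j ω => Finset.sum_nonneg fun k _ => sq_nonneg _
  have hVm : ∀ j, HasMoments (V j) P := hasMoments_sum_sq hξm
  have hVq : ∀ j, Integrable (fun ω => V j ω ^ (q / 2)) P := fun j => by
    have := ((hVm j).abs_rpow (s := q / 2) (by linarith)).integrable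
    simpa only [abs_of_nonneg (hV0 j _)] using this
  have hDq : ∀ m, Integrable (fun ω => |D m ω| ^ q) P := fun m =>
    ((hDm m).abs_rpow hq0).integrable
  -- With this weight the terms that contain `𝔼|X_n|^q` add up to at most half of it, since the
  -- weights `c_j² Δ_j` sum to at most `A`.
  set l := (2 * C * A)⁻¹ with hl
  have hl0 : 0 < l := by positivity
  have hstep : ∀ m, m < n → ∫ ω, |X (m + 1) ω| ^ q ∂P ≤ ∫ ω, |X m ω| ^ q ∂P +
      C * (c m ^ 2 * ((τ (m + 1) : ℝ) - τ m) * (l * ∫ ω, |X n ω| ^ q ∂P +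
        (l⁻¹) ^ ((q - 2) / 2) * ∫ ω, V m ω ^ (q / 2) ∂P) + ∫ ω, |D m ω| ^ q ∂P) := by
    intro m hm
    have i1 : Integrable (fun ω => |X m ω| ^ (q - 2) * D m ω ^ 2) P := by
      simpa only [sq] using (((hXm m).abs_rpow hq2).mul ((hDm m).mul (hDm m))).integrable
    have h1 : ∫ ω, |X (m + 1) ω| ^ q ∂P ≤ ∫ ω, ((|X m ω| ^ q +
        q * ((|X m ω| ^ (q - 2) * X m ω) * D m ω)) +
        C * (|X m ω| ^ (q - 2) * D m ω ^ 2 + |D m ω| ^ q)) ∂P := by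
      refine integral_mono (hXq (m + 1)) (((hXq m).add ((hGi m).const_mul q)).add
        ((i1.add (hDq m)).const_mul C)) fun ω => ?_
      simp only [hX, elemSum_succ]
      exact abs_add_rpow_le hq _ _
    have i2 : Integrable (fun ω => |X m ω| ^ q + q * ((|X m ω| ^ (q - 2) * X m ω) * D m ω)) P :=
      (hXq m).add ((hGi m).const_mul q)
    have i3 : Integrable (fun ω => C * (|X m ω| ^ (q - 2) * D m ω ^ 2 + |D m ω| ^ q)) P :=
      (i1.add (hDq m)).const_mul C
    rw [integral_add i2 i3,
      integral_add (hXq m) ((hGi m).const_mul q), integral_const_mul, hG0, mul_zero, add_zero,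
      integral_const_mul, integral_add i1 (hDq m),
      integral_mul_elemStep_sq hW hτ hξ hξm (hAs m) ((hXm m).abs_rpow hq2)] at h1
    refine h1.trans ?_
    gcongr
    · exact hδ m
    · calc ∫ ω, |X m ω| ^ (q - 2) * V m ω ∂P
          ≤ ∫ ω, (l * |X m ω| ^ q + (l⁻¹) ^ ((q - 2) / 2) * V m ω ^ (q / 2)) ∂P := by
            refine integral_mono (((hXm m).abs_rpow hq2).mul (hVm m)).integrable
              (((hXq m).const_mul _).add ((hVq m).const_mul _)) fun ω => ?_
            have := rpow_mul_rpow_le_weighted hq (abs_nonneg (X m ω)) (Real.sqrt_nonneg (V m ω)) hl0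
            rw [Real.sq_sqrt (hV0 m ω), Real.sqrt_eq_rpow, ← Real.rpow_mul (hV0 m ω)] at this
            rwa [show (1 / 2 * q : ℝ) = q / 2 by ring] at this
        _ = l * ∫ ω, |X m ω| ^ q ∂P + (l⁻¹) ^ ((q - 2) / 2) * ∫ ω, V m ω ^ (q / 2) ∂P := by
            rw [integral_add ((hXq m).const_mul _) ((hVq m).const_mul _), integral_const_mul,
              integral_const_mul]
        _ ≤ _ := by
            have := hmono hm.le
            simp only at this
            gcongr
  have hsum : ∀ m, m ≤ n → ∫ ω, |X m ω| ^ q ∂P ≤ ∑ j ∈ Finset.range m,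
      C * (c j ^ 2 * ((τ (j + 1) : ℝ) - τ j) * (l * ∫ ω, |X n ω| ^ q ∂P +
        (l⁻¹) ^ ((q - 2) / 2) * ∫ ω, V j ω ^ (q / 2) ∂P) + ∫ ω, |D j ω| ^ q ∂P) := by
    intro m
    induction m with
    | zero => intro _; simp [hX, elemSum, Real.zero_rpow (by linarith : q ≠ 0)]
    | succ m ih =>
      intro hm
      rw [Finset.sum_range_succ]
      linarith [hstep m (by omega), ih (by omega)]
  have h := hsum n le_rfl
  have hE0 : 0 ≤ ∫ ω, |X n ω| ^ q ∂P := integral_nonneg fun ω => by positivity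
  rw [← Finset.mul_sum, Finset.sum_add_distrib] at h
  simp only [mul_add] at h
  rw [Finset.sum_add_distrib, ← Finset.sum_mul] at h
  have h2 : C * ((∑ j ∈ Finset.range n, c j ^ 2 * ((τ (j + 1) : ℝ) - τ j)) *
      (l * ∫ ω, |X n ω| ^ q ∂P)) ≤ (∫ ω, |X n ω| ^ q ∂P) / 2 := by
    calc _ ≤ C * (A * (l * ∫ ω, |X n ω| ^ q ∂P)) := by gcongr
      _ = _ := by rw [hl]; field_simp
  have h3 : ∑ j ∈ Finset.range n, c j ^ 2 * ((τ (j + 1) : ℝ) - τ j) *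
      ((l⁻¹) ^ ((q - 2) / 2) * ∫ ω, V j ω ^ (q / 2) ∂P) = (2 * C * A) ^ ((q - 2) / 2) *
      ∑ j ∈ Finset.range n, c j ^ 2 * ((τ (j + 1) : ℝ) - τ j) * ∫ ω, V j ω ^ (q / 2) ∂P := by
    rw [hl, inv_inv, Finset.mul_sum]
    exact Finset.sum_congr rfl fun j _ => by ring
  rw [h3] at h
  linarith

end ElementarySums

/-! ### The time axis -/

lemma measurePreserving_coe_timeVol :
    MeasurePreserving ((↑) : ℝ≥0 → ℝ) timeVol ((volume : Measure ℝ).restrict (Set.Ici 0)) := by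
  refine ⟨measurable_coe_nnreal_real, ?_⟩
  rw [timeVol, Measure.map_map measurable_coe_nnreal_real measurable_real_toNNReal]
  conv_rhs => rw [← Measure.map_id (μ := (volume : Measure ℝ).restrict (Set.Ici 0))]
  refine Measure.map_congr ?_
  filter_upwards [ae_restrict_mem measurableSet_Ici] with x hx
  simpa using hx

lemma measurableEmbedding_coe_nnreal : MeasurableEmbedding ((↑) : ℝ≥0 → ℝ) :=
  MeasurableEmbedding.subtype_coe measurableSet_Ici

lemma timeVol_Ioc (a b : ℝ≥0) : timeVol (Set.Ioc a b) = ENNReal.ofReal ((b : ℝ) - a) := by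
  have h : Set.Ioc a b = ((↑) : ℝ≥0 → ℝ) ⁻¹' Set.Ioc (a : ℝ) b := by ext x; simp
  rw [h, measurePreserving_coe_timeVol.measure_preimage measurableSet_Ioc.nullMeasurableSet,
    Measure.restrict_apply measurableSet_Ioc, Set.inter_eq_left.2, Real.volume_Ioc]
  exact fun x hx => a.2.trans hx.1.le

lemma timeVol_singleton (a : ℝ≥0) : timeVol {a} = 0 := by
  have h : ({a} : Set ℝ≥0) = ((↑) : ℝ≥0 → ℝ) ⁻¹' {(a : ℝ)} := by ext x; simp
  rw [h, measurePreserving_coe_timeVol.measure_preimage (measurableSet_singleton _).nullMeasurableSet]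
  simp

instance : NullSingletonClass timeVol := ⟨timeVol_singleton⟩

lemma timeVol_Iic (b : ℝ≥0) : timeVol (Set.Iic b) = b := by
  have h : Set.Iic b = {0} ∪ Set.Ioc 0 b := by
    ext x; simp only [Set.mem_Iic, Set.mem_union, Set.mem_singleton_iff, Set.mem_Ioc]
    constructor
    · intro hx; rcases eq_or_lt_of_le (zero_le (a := x)) with h | h
      · exact Or.inl h.symm
      · exact Or.inr ⟨h, hx⟩
    · rintro (rfl | h)
      · exact zero_le
      · exact h.2
  refine le_antisymm ?_ ?_
  · rw [h]
    refine (measure_union_le _ _).trans ?_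
    rw [timeVol_singleton, zero_add, timeVol_Ioc]
    simp
  · calc (b : ℝ≥0∞) = timeVol (Set.Ioc 0 b) := by rw [timeVol_Ioc]; simp
      _ ≤ _ := measure_mono fun x hx => hx.2

instance (T : ℝ≥0) : IsFiniteMeasure (timeVol.restrict (Set.Iic T)) :=
  ⟨by simp [timeVol_Iic]⟩

instance {Ω : Type*} {mΩ : MeasurableSpace Ω} (P : Measure Ω) [IsFiniteMeasure P] (T : ℝ≥0) :
    IsFiniteMeasure (rectMeasure P T) := by unfold rectMeasure; infer_instance

/-! ### Step functions and refinements of partitions -/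

/-- The step function `∑_{i<n} c_i 1_{(σ_i, σ_{i+1}]}`. -/
def stepFun (σ : ℕ → ℝ≥0) (c : ℕ → ℝ) (n : ℕ) (s : ℝ≥0) : ℝ :=
  ∑ i ∈ Finset.range n, (Set.Ioc (σ i) (σ (i + 1))).indicator (fun _ => c i) s

/-- The sum `∑_{i<n} c_i (x(σ_{i+1}) - x(σ_i))`. -/
def stepInt (σ : ℕ → ℝ≥0) (c : ℕ → ℝ) (n : ℕ) (x : ℝ≥0 → ℝ) : ℝ :=
  ∑ i ∈ Finset.range n, c i * (x (σ (i + 1)) - x (σ i))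

/-- The cells are disjoint because `σ` is monotone. The active cell does not depend on the
coefficients, so that nonlinear functions of a step function can be computed coefficientwise. -/
lemma stepFun_eq_or {σ : ℕ → ℝ≥0} (hσ : Monotone σ) (n : ℕ) (s : ℝ≥0) :
    (∀ c, stepFun σ c n s = 0) ∨
      ∃ i < n, s ∈ Set.Ioc (σ i) (σ (i + 1)) ∧ ∀ c, stepFun σ c n s = c i := by
  by_cases h : ∃ i < n, s ∈ Set.Ioc (σ i) (σ (i + 1))
  · obtain ⟨i, hi, hs⟩ := h
    refine Or.inr ⟨i, hi, hs, fun c => ?_⟩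
    rw [stepFun, Finset.sum_eq_single_of_mem i (Finset.mem_range.2 hi), Set.indicator_of_mem hs]
    intro j _ hj
    refine Set.indicator_of_notMem (fun hs' => ?_) _
    rcases lt_or_gt_of_ne hj with h | h
    · exact absurd (hs'.2.trans (hσ (Nat.succ_le_of_lt h))) (not_le.2 hs.1)
    · exact absurd (hs.2.trans (hσ (Nat.succ_le_of_lt h))) (not_le.2 hs'.1)
  · refine Or.inl fun c => Finset.sum_eq_zero fun i hi => Set.indicator_of_notMem (fun hs => ?_) _
    exact h ⟨i, Finset.mem_range.1 hi, hs⟩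

lemma comp_stepFun {σ : ℕ → ℝ≥0} (hσ : Monotone σ) (c : ℕ → ℝ) (n : ℕ) {f : ℝ → ℝ} (hf : f 0 = 0)
    (s : ℝ≥0) : f (stepFun σ c n s) = stepFun σ (fun i => f (c i)) n s := by
  rcases stepFun_eq_or hσ n s with h | ⟨i, _, _, h⟩
  · rw [h, h, hf]
  · rw [h, h]

lemma stepFun_eq_zero_of_lt {σ : ℕ → ℝ≥0} (hσ : Monotone σ) (c : ℕ → ℝ) {n : ℕ} {s : ℝ≥0}
    (hs : σ n < s) : stepFun σ c n s = 0 := by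
  rcases stepFun_eq_or hσ n s with h | ⟨i, hi, hs', _⟩
  · exact h c
  · exact absurd (hs'.2.trans (hσ hi)) (not_le.2 hs)

lemma abs_stepFun_le {σ : ℕ → ℝ≥0} (c : ℕ → ℝ) (n : ℕ) (s : ℝ≥0) :
    |stepFun σ c n s| ≤ ∑ i ∈ Finset.range n, |c i| := by
  refine (Finset.abs_sum_le_sum_abs _ _).trans (Finset.sum_le_sum fun i _ => ?_)
  by_cases h : s ∈ Set.Ioc (σ i) (σ (i + 1))
  · rw [Set.indicator_of_mem h]
  · rw [Set.indicator_of_notMem h, abs_zero]; exact abs_nonneg _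

lemma mem_Ioc_iff_of_refine {τ : ℕ → ℝ≥0} (hτ : Monotone τ) {l m j : ℕ} {s : ℝ≥0}
    (hs : s ∈ Set.Ioc (τ j) (τ (j + 1))) :
    s ∈ Set.Ioc (τ l) (τ m) ↔ τ (j + 1) ∈ Set.Ioc (τ l) (τ m) := by
  constructor
  · rintro ⟨h1, h2⟩
    refine ⟨h1.trans_le hs.2, hτ (Nat.succ_le_of_lt ?_)⟩
    by_contra h
    exact absurd (hs.1.trans_le h2) (not_lt.2 (hτ (not_lt.1 h)))
  · rintro ⟨h1, h2⟩
    refine ⟨lt_of_le_of_lt (hτ ?_) hs.1, hs.2.trans h2⟩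
    by_contra h
    exact absurd h1 (not_lt.2 (hτ (by omega)))

lemma stepFun_eq_of_refine {σ τ : ℕ → ℝ≥0} (hτ : Monotone τ) {c : ℕ → ℝ} {n : ℕ}
    (h : ∀ i ≤ n, ∃ j, τ j = σ i) {j : ℕ} {s : ℝ≥0} (hs : s ∈ Set.Ioc (τ j) (τ (j + 1))) :
    stepFun σ c n s = stepFun σ c n (τ (j + 1)) := by
  refine Finset.sum_congr rfl fun i hi => ?_
  have hi' := Finset.mem_range.1 hi
  obtain ⟨l, hl⟩ := h i hi'.le
  obtain ⟨m, hm⟩ := h (i + 1) hi'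
  have := mem_Ioc_iff_of_refine hτ (l := l) (m := m) hs
  rw [hl, hm] at this
  by_cases hs' : s ∈ Set.Ioc (σ i) (σ (i + 1))
  · rw [Set.indicator_of_mem hs', Set.indicator_of_mem (this.1 hs')]
  · rw [Set.indicator_of_notMem hs', Set.indicator_of_notMem (mt this.2 hs')]

lemma sum_indicator_Ioc_mul_sub {τ : ℕ → ℝ≥0} (hτ : Monotone τ) {l m N : ℕ}
    (hm : m ≤ N) (hlm : τ l ≤ τ m) (c : ℝ) (x : ℝ≥0 → ℝ) :
    ∑ j ∈ Finset.range N, (Set.Ioc (τ l) (τ m)).indicator (fun _ => c) (τ (j + 1)) *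
      (x (τ (j + 1)) - x (τ j)) = c * (x (τ m) - x (τ l)) := by
  -- Clamping the grid points to `[τ l, τ m]` makes the sum telescope.
  let y : ℕ → ℝ := fun j => c * x (max (τ l) (min (τ m) (τ j)))
  have e : ∀ j, (Set.Ioc (τ l) (τ m)).indicator (fun _ => c) (τ (j + 1)) *
      (x (τ (j + 1)) - x (τ j)) = y (j + 1) - y j := by
    intro j
    have hj := hτ (Nat.le_succ j)
    by_cases h : τ (j + 1) ∈ Set.Ioc (τ l) (τ m)
    · have h2 : τ l ≤ τ j := by
        refine hτ ?_
        by_contra h'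
        exact absurd h.1 (not_lt.2 (hτ (by omega)))
      rw [Set.indicator_of_mem h]
      simp only [y]
      rw [min_eq_right h.2, min_eq_right (hj.trans h.2), max_eq_right h.1.le, max_eq_right h2]
      ring
    · rw [Set.indicator_of_notMem h, zero_mul, eq_comm, sub_eq_zero]
      simp only [y]
      rcases le_or_gt (τ (j + 1)) (τ l) with h1 | h1
      · rw [max_eq_left ((min_le_right _ _).trans h1),
          max_eq_left ((min_le_right _ _).trans (hj.trans h1))]
      · have h2 : τ m < τ (j + 1) := by
          by_contra h'; exact h ⟨h1, not_lt.1 h'⟩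
        have h3 : τ m ≤ τ j := by
          refine hτ ?_
          by_contra h'
          exact absurd h2 (not_lt.2 (hτ (by omega)))
        rw [min_eq_left h2.le, min_eq_left h3]
  rw [Finset.sum_congr rfl fun j _ => e j, Finset.sum_range_sub]
  simp only [y]
  rw [min_eq_left (hτ hm), max_eq_right hlm,
    max_eq_left ((min_le_right _ _).trans (hτ (Nat.zero_le l))), mul_sub]

lemma stepInt_eq_sum_refine {σ τ : ℕ → ℝ≥0} (hσ : Monotone σ) (hτ : Monotone τ) (c : ℕ → ℝ)
    {n N : ℕ} (h : ∀ i ≤ n, ∃ j ≤ N, τ j = σ i) (x : ℝ≥0 → ℝ) :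
    stepInt σ c n x = ∑ j ∈ Finset.range N,
      stepFun σ c n (τ (j + 1)) * (x (τ (j + 1)) - x (τ j)) := by
  simp only [stepFun, Finset.sum_mul]
  rw [Finset.sum_comm, stepInt]
  refine Finset.sum_congr rfl fun i hi => ?_
  have hi' := Finset.mem_range.1 hi
  obtain ⟨l, _, hl⟩ := h i hi'.le
  obtain ⟨m, hmN, hm⟩ := h (i + 1) hi'
  rw [← hl, ← hm, sum_indicator_Ioc_mul_sub hτ hmN (by rw [hl, hm]; exact hσ (Nat.le_succ i))]

/-- There is a partition that contains a given finite set and has a small mesh. -/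
lemma exists_partition (F : Finset ℝ≥0) (S : ℝ≥0) (M : ℕ) : ∃ (τ : ℕ → ℝ≥0) (N : ℕ),
    Monotone τ ∧ (∀ f ∈ F, ∃ j ≤ N, τ j = f) ∧
      ∀ j, τ (j + 1) ≤ S → (τ (j + 1) : ℝ) - τ j ≤ 1 / ((M : ℝ) + 1) := by
  classical
  let g : ℕ → ℝ≥0 := fun i => (i : ℝ≥0) / (M + 1)
  obtain ⟨R, hR⟩ := exists_nat_ge ((S : ℝ≥0) * (M + 1))
  -- The prescribed points together with a grid of spacing `1 / (M + 1)` that reaches beyond `S`.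
  let F' : Finset ℝ≥0 := insert 0 (F ∪ (Finset.range (R + 2)).image g)
  have hF' : 0 < F'.card := Finset.card_pos.2 ⟨0, Finset.mem_insert_self _ _⟩
  -- The increasing enumeration of the points, constant after the last one so that it is defined on
  -- all of `ℕ`.
  let τ : ℕ → ℝ≥0 := fun j => F'.orderEmbOfFin rfl ⟨min j (F'.card - 1), by omega⟩
  have hτ : Monotone τ := fun i j hij => by
    refine (F'.orderEmbOfFin rfl).monotone ?_
    simp only [Fin.mk_le_mk]; omega
  have hmem : ∀ f ∈ F', ∃ j ≤ F'.card, τ j = f := by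
    intro f hf
    have : f ∈ Set.range (F'.orderEmbOfFin rfl) := by
      rw [Finset.range_orderEmbOfFin]; exact hf
    obtain ⟨⟨i, hi⟩, h⟩ := this
    refine ⟨i, hi.le, ?_⟩
    rw [← h]
    simp only [τ]
    congr 2
    omega
  refine ⟨τ, F'.card, hτ, fun f hf => hmem f (by simp [F', hf]), fun j hj => ?_⟩
  -- A longer gap below `S` would have a grid point strictly between two consecutive points of the
  -- partition; the first grid point after `τ j` is such a point.
  by_contra! hlt
  let i := ⌊(τ j : ℝ≥0) * (M + 1)⌋₊ + 1
  have h1 : τ j < g i := by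
    simp only [g, i]
    rw [lt_div_iff₀ (by positivity)]
    push_cast
    exact Nat.lt_floor_add_one _
  have h2 : g i < τ (j + 1) := by
    rw [← NNReal.coe_lt_coe]
    refine lt_of_le_of_lt ?_ (lt_sub_iff_add_lt.1 hlt)
    have h3 : ((⌊(τ j : ℝ≥0) * (M + 1)⌋₊ : ℝ≥0) : ℝ) ≤ (τ j : ℝ) * (M + 1) := by
      exact_mod_cast Nat.floor_le (zero_le (a := (τ j : ℝ≥0) * (M + 1)))
    simp only [g, i]
    push_cast at h3 ⊢
    rw [div_add' _ _ _ (by positivity), div_le_div_iff_of_pos_right (by positivity)]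
    linarith
  have h4 : i < R + 2 := by
    have : (i : ℝ≥0) ≤ R := by
      refine le_trans ?_ hR
      have := (h2.le.trans hj)
      simp only [g] at this
      rwa [div_le_iff₀ (by positivity)] at this
    have : i ≤ R := by exact_mod_cast this
    omega
  obtain ⟨m, _, hm⟩ := hmem (g i) (by
    simp only [F', Finset.mem_insert, Finset.mem_union, Finset.mem_image, Finset.mem_range]
    exact Or.inr (Or.inr ⟨i, h4, rfl⟩))
  rw [← hm] at h1 h2
  have h5 : j < m := by by_contra h; exact absurd h1 (not_lt.2 (hτ (not_lt.1 h)))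
  exact absurd h2 (not_lt.2 (hτ h5))

/-! ### Elementary integrands -/

section Elementary
variable {Ω : Type*} {mΩ : MeasurableSpace Ω} {ℱ : Filtration ℝ≥0 mΩ}

/-- `V` is a bounded predictable step process, and `J` is its integral with respect to `B`. -/
def IsElementary (ℱ : Filtration ℝ≥0 mΩ) (B : ℝ≥0 → Ω → ℝ) (V : ℝ≥0 × Ω → ℝ)
    (J : ℝ≥0 → Ω → ℝ) : Prop :=
  ∃ (F : Finset ℝ≥0) (C : ℝ), (∀ z, |V z| ≤ C) ∧ ∀ (τ : ℕ → ℝ≥0) (N : ℕ), Monotone τ →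
    (∀ f ∈ F, ∃ j ≤ N, τ j = f) →
    (∀ t ω, J t ω = ∑ j ∈ Finset.range N,
      V (τ (j + 1), ω) * (B (min (τ (j + 1)) t) ω - B (min (τ j) t) ω)) ∧
    (∀ j, StronglyMeasurable[ℱ (τ j)] fun ω => V (τ (j + 1), ω)) ∧
    ∀ j, ∀ s ∈ Set.Ioc (τ j) (τ (j + 1)), ∀ ω, V (s, ω) = V (τ (j + 1), ω)

lemma SimpleProcess.val_eq_stepFun (H : SimpleProcess ℱ) (z : ℝ≥0 × Ω) :
    H.val z = stepFun H.time (fun i => H.coeff i z.2) H.n z.1 := rfl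

lemma SimpleProcess.integral_eq_stepInt (H : SimpleProcess ℱ) (B : ℝ≥0 → Ω → ℝ) (t : ℝ≥0) (ω : Ω) :
    H.integral B t ω = stepInt H.time (fun i => H.coeff i ω) H.n fun s => B (min s t) ω := rfl

lemma SimpleProcess.isElementary (H : SimpleProcess ℱ) (B : ℝ≥0 → Ω → ℝ) :
    IsElementary ℱ B H.val (H.integral B) := by
  classical
  obtain ⟨C, hC⟩ := H.bdd
  refine ⟨(Finset.range (H.n + 1)).image H.time, max C 0, fun z => ?_, fun τ N hτ hF => ?_⟩
  · rw [H.val_eq_stepFun]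
    rcases stepFun_eq_or H.mono H.n z.1 with h | ⟨i, _, _, h⟩
    · rw [h, abs_zero]; exact le_max_right _ _
    · rw [h]; exact (hC i z.2).trans (le_max_left _ _)
  · have h : ∀ i ≤ H.n, ∃ j ≤ N, τ j = H.time i := fun i hi =>
      hF _ (Finset.mem_image_of_mem _ (Finset.mem_range.2 (by omega)))
    refine ⟨fun t ω => ?_, fun j => ?_, fun j s hs ω => ?_⟩
    · rw [H.integral_eq_stepInt, stepInt_eq_sum_refine H.mono hτ _ h]
      rfl
    · simp only [SimpleProcess.val]
      refine Finset.stronglyMeasurable_fun_sum _ fun i hi => ?_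
      by_cases hj : τ (j + 1) ∈ Set.Ioc (H.time i) (H.time (i + 1))
      · simp only [Set.indicator_of_mem hj]
        refine (H.meas i).mono (ℱ.mono ?_)
        obtain ⟨m, _, hm⟩ := h i (Finset.mem_range.1 hi).le
        rw [← hm] at hj ⊢
        refine hτ ?_
        by_contra h'
        exact absurd hj.1 (not_lt.2 (hτ (by omega)))
      · simp only [Set.indicator_of_notMem hj]
        exact stronglyMeasurable_const
    · rw [H.val_eq_stepFun, H.val_eq_stepFun]
      exact stepFun_eq_of_refine hτ (fun i hi => (h i hi).imp fun _ h => h.2) hs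

/-- Both representations are available on every partition that refines both, so the union of the two
sets of breakpoints suffices and no explicit common form is needed. -/
lemma IsElementary.sub {B : ℝ≥0 → Ω → ℝ} {V V' : ℝ≥0 × Ω → ℝ} {J J' : ℝ≥0 → Ω → ℝ}
    (h : IsElementary ℱ B V J) (h' : IsElementary ℱ B V' J') :
    IsElementary ℱ B (fun z => V z - V' z) (fun t ω => J t ω - J' t ω) := by
  classical
  obtain ⟨F, C, hC, hF⟩ := h
  obtain ⟨F', C', hC', hF'⟩ := h'
  refine ⟨F ∪ F', C + C', fun z => (abs_sub _ _).trans (add_le_add (hC z) (hC' z)),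
    fun τ N hτ hU => ?_⟩
  obtain ⟨a1, a2, a3⟩ := hF τ N hτ fun f hf => hU f (Finset.mem_union_left _ hf)
  obtain ⟨b1, b2, b3⟩ := hF' τ N hτ fun f hf => hU f (Finset.mem_union_right _ hf)
  refine ⟨fun t ω => ?_, fun j => (a2 j).sub (b2 j), fun j s hs ω => by
    simp only [a3 j s hs, b3 j s hs]⟩
  simp only [a1, b1]
  rw [← Finset.sum_sub_distrib]
  exact Finset.sum_congr rfl fun j _ => by ring

end Elementary

/-! ### Burkholder-type inequality for weighted increments of elementary integrals. -/

section ElementaryBound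
variable {Ω : Type*} {mΩ : MeasurableSpace Ω} {P : Measure Ω} [IsProbabilityMeasure P]
  {ℱ : Filtration ℝ≥0 mΩ} {w : ℕ → ℝ≥0 → Ω → ℝ}

/-- The constant of the Burkholder-type inequality of order `q`. -/
def bdgConst (q : ℝ) : ℝ := 2 * taylorConst q * (2 * taylorConst q) ^ ((q - 2) / 2)

lemma bdgConst_pos {q : ℝ} (hq : 2 ≤ q) : 0 < bdgConst q := by
  have := taylorConst_pos hq
  unfold bdgConst; positivity

/-- On a common refinement the deterministic weights and the random integrands are constant on the
same cells, so that the weighted sum of increments of the integrals is again one elementary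
stochastic sum. -/
lemma sum_stepInt_eq_elemSum {σ τ : ℕ → ℝ≥0} (hσ : Monotone σ) (hτ : Monotone τ) (c : ℕ → ℝ)
    {n N : ℕ} (h : ∀ i ≤ n, ∃ j ≤ N, τ j = σ i) (I : Finset ℕ) {V : ℕ → ℝ≥0 × Ω → ℝ}
    {J : ℕ → ℝ≥0 → Ω → ℝ} (hJ : ∀ k ∈ I, ∀ t ω, J k t ω = ∑ j ∈ Finset.range N,
      V k (τ (j + 1), ω) * (w k (min (τ (j + 1)) t) ω - w k (min (τ j) t) ω)) (ω : Ω) :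
    ∑ k ∈ I, stepInt σ c n (fun t => J k t ω) =
      elemSum w τ (fun j => stepFun σ c n (τ (j + 1))) I (fun j k ω => V k (τ (j + 1), ω)) N ω := by
  -- The increment of `w k` stopped to cell `j` varies only across that cell.
  have h1 : ∀ k j, j < N → stepInt σ c n
      (fun t => w k (min (τ (j + 1)) t) ω - w k (min (τ j) t) ω) =
      stepFun σ c n (τ (j + 1)) * (w k (τ (j + 1)) ω - w k (τ j) ω) := by
    intro k j hj
    rw [stepInt_eq_sum_refine hσ hτ c h, Finset.sum_eq_single_of_mem j (Finset.mem_range.2 hj)]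
    · have := hτ (Nat.le_succ j)
      rw [min_self, min_eq_right this, min_self, min_eq_left this, sub_self, sub_zero]
    · intro m _ hm
      rcases lt_or_gt_of_ne hm with h | h
      · have e1 : τ (m + 1) ≤ τ j := hτ h
        have e2 := hτ (Nat.le_succ j)
        have e3 := hτ (Nat.le_succ m)
        rw [min_eq_right e1, min_eq_right (e1.trans e2), min_eq_right (e3.trans e1),
          min_eq_right (e3.trans (e1.trans e2))]
        simp
      · have e1 : τ (j + 1) ≤ τ m := hτ h
        have e2 := hτ (Nat.le_succ j)
        have e3 := hτ (Nat.le_succ m)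
        rw [min_eq_left e1, min_eq_left (e1.trans e3), min_eq_left (e2.trans e1),
          min_eq_left (e2.trans (e1.trans e3))]
        simp
  have h2 : ∀ k ∈ I, stepInt σ c n (fun t => J k t ω) = ∑ j ∈ Finset.range N,
      V k (τ (j + 1), ω) * (stepFun σ c n (τ (j + 1)) * (w k (τ (j + 1)) ω - w k (τ j) ω)) := by
    intro k hk
    simp only [stepInt, hJ k hk]
    simp only [← Finset.sum_sub_distrib, Finset.mul_sum]
    rw [Finset.sum_comm]
    refine Finset.sum_congr rfl fun j hj => ?_
    rw [← h1 k j (Finset.mem_range.1 hj), stepInt, Finset.mul_sum]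
    exact Finset.sum_congr rfl fun i _ => by ring
  rw [Finset.sum_congr rfl h2, Finset.sum_comm]
  refine Finset.sum_congr rfl fun j _ => ?_
  rw [elemStep, Finset.mul_sum]
  exact Finset.sum_congr rfl fun k _ => by ring

/-- Only an inequality, because the region not covered by the cells is dropped. A cell that ends
after `S` contributes nothing by `hgS`. -/
lemma ofReal_sum_integral_le_lintegral_rect {τ : ℕ → ℝ≥0} (hτ : Monotone τ) {S : ℝ≥0} (N : ℕ)
    {g : ℝ≥0 × Ω → ℝ} (hg0 : ∀ z, 0 ≤ g z)
    (hgc : ∀ j, ∀ s ∈ Set.Ioc (τ j) (τ (j + 1)), ∀ ω, g (s, ω) = g (τ (j + 1), ω))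
    (hgi : ∀ j, Integrable (fun ω => g (τ (j + 1), ω)) P)
    (hgS : ∀ j, S < τ (j + 1) → ∀ ω, g (τ (j + 1), ω) = 0) :
    ENNReal.ofReal (∑ j ∈ Finset.range N, ((τ (j + 1) : ℝ) - τ j) * ∫ ω, g (τ (j + 1), ω) ∂P) ≤
      ∫⁻ z, ENNReal.ofReal (g z) ∂rectMeasure P S := by
  have hΔ : ∀ j, (0 : ℝ) ≤ (τ (j + 1) : ℝ) - τ j := fun j =>
    sub_nonneg.2 (NNReal.coe_le_coe.2 (hτ (Nat.le_succ j)))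
  have hI : ∀ j, 0 ≤ ∫ ω, g (τ (j + 1), ω) ∂P := fun j => integral_nonneg fun ω => hg0 _
  let E : ℕ → Set (ℝ≥0 × Ω) := fun j => Set.Ioc (τ j) (τ (j + 1)) ×ˢ Set.univ
  have hE : ∀ j, MeasurableSet (E j) := fun j => measurableSet_Ioc.prod MeasurableSet.univ
  have hdisj : Set.PairwiseDisjoint (↑(Finset.range N)) E := by
    intro i _ j _ hij
    refine Set.disjoint_left.2 fun z hz hz' => ?_
    rcases lt_or_gt_of_ne hij with h | h
    · exact absurd (hz.1.2.trans (hτ (Nat.succ_le_of_lt h))) (not_le.2 hz'.1.1)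
    · exact absurd (hz'.1.2.trans (hτ (Nat.succ_le_of_lt h))) (not_le.2 hz.1.1)
  have hterm : ∀ j, ENNReal.ofReal (((τ (j + 1) : ℝ) - τ j) * ∫ ω, g (τ (j + 1), ω) ∂P) ≤
      ∫⁻ z in E j, ENNReal.ofReal (g z) ∂rectMeasure P S := by
    intro j
    rcases lt_or_ge S (τ (j + 1)) with h | h
    · simp [hgS j h]
    · have e1 : (rectMeasure P S).restrict (E j) =
          (timeVol.restrict (Set.Ioc (τ j) (τ (j + 1)))).prod P := by
        rw [rectMeasure, ← Measure.restrict_univ (μ := P), Measure.prod_restrict,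
          Measure.restrict_restrict (hE j), Set.prod_inter_prod, Set.univ_inter,
          Set.inter_eq_left.2 (fun x hx => hx.2.trans h), ← Measure.prod_restrict,
          Measure.restrict_univ]
      have e2 : ∀ᵐ z ∂(timeVol.restrict (Set.Ioc (τ j) (τ (j + 1)))).prod P,
          ENNReal.ofReal (g z) = ENNReal.ofReal (g (τ (j + 1), z.2)) := by
        rw [← e1]
        filter_upwards [ae_restrict_mem (hE j)] with z hz
        rw [← hgc j z.1 hz.1]
      rw [e1, lintegral_congr_ae e2]
      have e3 : AEMeasurable (fun ω => ENNReal.ofReal (g (τ (j + 1), ω))) P :=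
        (hgi j).aestronglyMeasurable.aemeasurable.ennreal_ofReal
      have e4 := lintegral_prod_mul (μ := timeVol.restrict (Set.Ioc (τ j) (τ (j + 1)))) (ν := P)
        (f := fun _ => 1) (g := fun ω => ENNReal.ofReal (g (τ (j + 1), ω))) aemeasurable_const e3
      simp only [one_mul, lintegral_one, Measure.restrict_apply MeasurableSet.univ,
        Set.univ_inter, timeVol_Ioc] at e4
      rw [e4, ENNReal.ofReal_mul (hΔ j),
        ofReal_integral_eq_lintegral_ofReal (hgi j) (Eventually.of_forall fun ω => hg0 _)]
  calc _ = ∑ j ∈ Finset.range N,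
        ENNReal.ofReal (((τ (j + 1) : ℝ) - τ j) * ∫ ω, g (τ (j + 1), ω) ∂P) :=
        ENNReal.ofReal_sum_of_nonneg fun j _ => mul_nonneg (hΔ j) (hI j)
    _ ≤ ∑ j ∈ Finset.range N, ∫⁻ z in E j, ENNReal.ofReal (g z) ∂rectMeasure P S :=
        Finset.sum_le_sum fun j _ => hterm j
    _ = ∫⁻ z in ⋃ j ∈ Finset.range N, E j, ENNReal.ofReal (g z) ∂rectMeasure P S :=
        (lintegral_biUnion_finset hdisj (fun j _ => hE j) _).symm
    _ ≤ _ := setLIntegral_le_lintegral _ _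

lemma sum_mesh_le {τ : ℕ → ℝ≥0} (hτ : Monotone τ) (S : ℝ≥0) (N : ℕ) :
    ∑ j ∈ Finset.range N, (if τ (j + 1) ≤ S then (τ (j + 1) : ℝ) - τ j else 0) ≤ S := by
  have h : ∀ j ∈ Finset.range N, (if τ (j + 1) ≤ S then (τ (j + 1) : ℝ) - τ j else 0) ≤
      ((min (τ (j + 1)) S : ℝ≥0) : ℝ) - (min (τ j) S : ℝ≥0) := by
    intro j _
    have hj := hτ (Nat.le_succ j)
    split_ifs with h
    · rw [min_eq_left h, min_eq_left (hj.trans h)]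
    · exact sub_nonneg.2 (NNReal.coe_le_coe.2 (min_le_min_right _ hj))
  refine (Finset.sum_le_sum h).trans ?_
  rw [Finset.sum_range_sub (fun j => ((min (τ j) S : ℝ≥0) : ℝ))]
  have h1 : ((min (τ N) S : ℝ≥0) : ℝ) ≤ S := NNReal.coe_le_coe.2 (min_le_right _ _)
  have h2 : (0 : ℝ) ≤ (min (τ 0) S : ℝ≥0) := NNReal.coe_nonneg _
  linarith

/-- A crude bound whose constant depends on the number of processes and on the bound of the
integrands. It matters only that it is of order `q / 2` in the length of the step. -/
lemma integral_abs_elemStep_rpow_le (hW : IsWienerBasis P ℱ w) {τ : ℕ → ℝ≥0} (hτ : Monotone τ)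
    {c : ℕ → ℝ} {I : Finset ℕ} {ξ : ℕ → ℕ → Ω → ℝ} {j : ℕ}
    {a b : ℝ} (hc : |c j| ≤ a) (hξb : ∀ k ∈ I, ∀ ω, |ξ j k ω| ≤ b) (hb : 0 ≤ b) {q : ℝ}
    (hq : 2 ≤ q) :
    ∫ ω, |elemStep w τ c I ξ j ω| ^ q ∂P ≤
      (a * b) ^ q * ((I.card : ℝ) ^ (q - 1) * (I.card * gaussMoment q)) *
        ((τ (j + 1) : ℝ) - τ j) ^ (q / 2) := by
  have ha : 0 ≤ a := (abs_nonneg _).trans hc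
  have hq0 : 0 < q := by linarith
  have hi : ∀ k, Integrable (fun ω => |w k (τ (j + 1)) ω - w k (τ j) ω| ^ q) P := fun k =>
    ((hW.hasMoments_incr k (hτ (Nat.le_succ j))).abs_rpow hq0.le).integrable
  have hpt : ∀ ω, |elemStep w τ c I ξ j ω| ^ q ≤ (a * b) ^ q * ((I.card : ℝ) ^ (q - 1) *
      ∑ k ∈ I, |w k (τ (j + 1)) ω - w k (τ j) ω| ^ q) := by
    intro ω
    have h1 : |elemStep w τ c I ξ j ω| ≤
        a * b * ∑ k ∈ I, |w k (τ (j + 1)) ω - w k (τ j) ω| := by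
      rw [elemStep, abs_mul, mul_assoc]
      refine mul_le_mul hc ?_ (abs_nonneg _) ha
      rw [Finset.mul_sum]
      refine (Finset.abs_sum_le_sum_abs _ _).trans (Finset.sum_le_sum fun k hk => ?_)
      rw [abs_mul]
      exact mul_le_mul_of_nonneg_right (hξb k hk ω) (abs_nonneg _)
    calc _ ≤ (a * b * ∑ k ∈ I, |w k (τ (j + 1)) ω - w k (τ j) ω|) ^ q := by gcongr
      _ = (a * b) ^ q * (∑ k ∈ I, |w k (τ (j + 1)) ω - w k (τ j) ω|) ^ q :=
        Real.mul_rpow (by positivity) (Finset.sum_nonneg fun k _ => abs_nonneg _)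
      _ ≤ _ := by
        gcongr
        exact Real.rpow_sum_le_const_mul_sum_rpow I _ (by linarith)
  calc _ ≤ ∫ ω, (a * b) ^ q * ((I.card : ℝ) ^ (q - 1) *
      ∑ k ∈ I, |w k (τ (j + 1)) ω - w k (τ j) ω| ^ q) ∂P := by
        refine integral_mono_of_nonneg (Eventually.of_forall fun ω => by positivity)
          (((integrable_finsetSum _ fun k _ => hi k).const_mul _).const_mul _)
          (Eventually.of_forall hpt)
    _ = _ := by
      rw [integral_const_mul, integral_const_mul, integral_finsetSum _ fun k _ => hi k]
      rw [Finset.sum_congr rfl fun k _ => hW.integral_abs_incr_rpow k (hτ (Nat.le_succ j)) q,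
        Finset.sum_const, nsmul_eq_mul]
      ring

/-- The constant depends on neither the number of Wiener processes nor the sizes of the integrands,
which permits the later limits. Those quantities occur only in the remainder of
`integral_abs_elemSum_rpow_le`, which is removed by refining the partition while the left-hand side
stays the same. -/
theorem lintegral_sum_stepInt_le (hW : IsWienerBasis P ℱ w) {σ : ℕ → ℝ≥0} (hσ : Monotone σ)
    (c : ℕ → ℝ) {n : ℕ} {S : ℝ≥0} (hS : σ n ≤ S) (I : Finset ℕ) {V : ℕ → ℝ≥0 × Ω → ℝ}
    {J : ℕ → ℝ≥0 → Ω → ℝ} (hV : ∀ k ∈ I, IsElementary ℱ (w k) (V k) (J k)) {q : ℝ} (hq : 2 ≤ q)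
    {A : ℝ} (hA : 0 < A) (hcA : stepInt σ (fun i => c i ^ 2) n (↑) ≤ A) :
    ∫⁻ ω, ENNReal.ofReal (|∑ k ∈ I, stepInt σ c n (fun t => J k t ω)| ^ q) ∂P ≤
      ENNReal.ofReal (bdgConst q * A ^ ((q - 2) / 2)) *
        ∫⁻ z, ENNReal.ofReal (stepFun σ c n z.1 ^ 2 * (∑ k ∈ I, V k z ^ 2) ^ (q / 2))
          ∂rectMeasure P S := by
  classical
  set X : Ω → ℝ := fun ω => ∑ k ∈ I, stepInt σ c n (fun t => J k t ω) with hX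
  set g : ℝ≥0 × Ω → ℝ := fun z => stepFun σ c n z.1 ^ 2 * (∑ k ∈ I, V k z ^ 2) ^ (q / 2) with hg
  set R := ∫⁻ z, ENNReal.ofReal (g z) ∂rectMeasure P S with hR
  have hC := taylorConst_pos hq
  have hK : 0 < bdgConst q * A ^ ((q - 2) / 2) := mul_pos (bdgConst_pos hq) (by positivity)
  rcases eq_or_ne R ∞ with hRt | hRt
  · rw [hRt, ENNReal.mul_top (by simpa using hK)]; exact le_top
  choose! F C hVC hF using hV
  have hsq : ∀ z, 0 ≤ ∑ k ∈ I, V k z ^ 2 := fun z => Finset.sum_nonneg fun k _ => sq_nonneg _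
  have hC0 : ∀ k ∈ I, 0 ≤ C k := fun k hk =>
    (abs_nonneg _).trans (hVC k hk (0, (nonempty_of_isProbabilityMeasure P).some))
  let b := ∑ k ∈ I, C k
  have hb0 : 0 ≤ b := Finset.sum_nonneg hC0
  let a := ∑ i ∈ Finset.range n, |c i|
  -- Extended by zero outside `I`, since the bounds for elementary sums ask for measurability and
  -- moments for every index.
  let ξ : (ℕ → ℝ≥0) → ℕ → ℕ → Ω → ℝ := fun τ j k ω => if k ∈ I then V k (τ (j + 1), ω) else 0
  have hξb : ∀ τ j k ω, |ξ τ j k ω| ≤ b := by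
    intro τ j k ω
    simp only [ξ]
    split_ifs with hk
    · exact (hVC k hk _).trans (Finset.single_le_sum hC0 hk)
    · simpa using hb0
  have hξV : ∀ τ j ω, ∑ k ∈ I, ξ τ j k ω ^ 2 = ∑ k ∈ I, V k (τ (j + 1), ω) ^ 2 := fun τ j ω =>
    Finset.sum_congr rfl fun k hk => by simp only [ξ, if_pos hk]
  have hstep : ∀ M : ℕ, ∃ (τ : ℕ → ℝ≥0) (N : ℕ), Monotone τ ∧
      (∀ j, τ (j + 1) ≤ S → (τ (j + 1) : ℝ) - τ j ≤ 1 / ((M : ℝ) + 1)) ∧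
      (∀ j k, StronglyMeasurable[ℱ (τ j)] (ξ τ j k)) ∧
      (X = elemSum w τ (fun j => stepFun σ c n (τ (j + 1))) I (ξ τ) N) ∧
      (∑ j ∈ Finset.range N, stepFun σ c n (τ (j + 1)) ^ 2 * ((τ (j + 1) : ℝ) - τ j) ≤ A) ∧
      (∑ j ∈ Finset.range N, stepFun σ c n (τ (j + 1)) ^ 2 * ((τ (j + 1) : ℝ) - τ j) *
        ∫ ω, (∑ k ∈ I, ξ τ j k ω ^ 2) ^ (q / 2) ∂P) ≤ R.toReal := by
    intro M
    obtain ⟨τ, N, hτ, hFτ, hmesh⟩ := exists_partition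
      (I.biUnion F ∪ (Finset.range (n + 1)).image σ) S M
    have hσN : ∀ i ≤ n, ∃ j ≤ N, τ j = σ i := fun i hi => hFτ _ (Finset.mem_union_right _
      (Finset.mem_image_of_mem _ (Finset.mem_range.2 (by omega))))
    have hkF : ∀ k ∈ I, ∀ f ∈ F k, ∃ j ≤ N, τ j = f := fun k hk f hf => hFτ _
      (Finset.mem_union_left _ (Finset.mem_biUnion.2 ⟨k, hk, hf⟩))
    have hξm : ∀ j k, StronglyMeasurable[ℱ (τ j)] (ξ τ j k) := by
      intro j k
      by_cases hk : k ∈ I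
      · simp only [ξ, if_pos hk]
        exact (hF k hk τ N hτ (hkF k hk)).2.1 j
      · simp only [ξ, if_neg hk]
        exact stronglyMeasurable_const
    have hξM : ∀ j k, HasMoments (ξ τ j k) P := fun j k =>
      HasMoments.of_bound ((hξm j k).mono (ℱ.le _)).aestronglyMeasurable (hξb τ j k)
    refine ⟨τ, N, hτ, hmesh, hξm, ?_, ?_, ?_⟩
    · ext ω
      simp only [hX]
      rw [sum_stepInt_eq_elemSum hσ hτ c hσN I fun k hk => (hF k hk τ N hτ (hkF k hk)).1]
      refine Finset.sum_congr rfl fun j _ => ?_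
      simp only [elemStep]
      congr 1
      exact Finset.sum_congr rfl fun k hk => by simp only [ξ, if_pos hk]
    · refine le_trans (le_of_eq ?_) hcA
      rw [stepInt_eq_sum_refine hσ hτ _ hσN]
      refine Finset.sum_congr rfl fun j _ => ?_
      rw [comp_stepFun hσ c n (f := fun x => x ^ 2) (by simp)]
    · have h0 : ∀ j, Integrable (fun ω => (∑ k ∈ I, ξ τ j k ω ^ 2) ^ (q / 2)) P := fun j => by
        have := ((hasMoments_sum_sq (I := I) hξM j).abs_rpow (s := q / 2) (by linarith)).integrable
        have e : ∀ ω, |∑ k ∈ I, ξ τ j k ω ^ 2| = ∑ k ∈ I, ξ τ j k ω ^ 2 := fun ω =>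
          abs_of_nonneg (Finset.sum_nonneg fun k _ => sq_nonneg _)
        simpa only [e] using this
      have h1 := ofReal_sum_integral_le_lintegral_rect (P := P) (S := S) hτ N (g := g)
        (fun z => mul_nonneg (sq_nonneg _) (Real.rpow_nonneg (hsq z) _))
        (fun j s hs ω => by
          simp only [hg]
          rw [stepFun_eq_of_refine hτ (fun i hi => (hσN i hi).imp fun _ h => h.2) hs]
          congr 2
          exact Finset.sum_congr rfl fun k hk => by
            rw [(hF k hk τ N hτ (hkF k hk)).2.2 j s hs ω])
        (fun j => by
          simp only [hg, ← hξV]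
          exact (h0 j).const_mul _)
        (fun j hj ω => by
          simp only [hg]
          rw [stepFun_eq_zero_of_lt hσ c (hS.trans_lt hj)]; simp)
      have h2 := (ENNReal.ofReal_le_iff_le_toReal hRt).1 h1
      refine le_trans (le_of_eq (Finset.sum_congr rfl fun j _ => ?_)) h2
      simp only [hg, hξV]
      rw [integral_const_mul]
      ring
  have hXm : HasMoments X P := by
    obtain ⟨τ, N, hτ, _, hξm, hXe, _⟩ := hstep 0
    rw [hXe]
    exact hasMoments_elemSum hW hτ (fun j k => HasMoments.of_bound
      ((hξm j k).mono (ℱ.le _)).aestronglyMeasurable (hξb τ j k)) N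
  have hXi : Integrable (fun ω => |X ω| ^ q) P := (hXm.abs_rpow (by linarith)).integrable
  have key : ∫ ω, |X ω| ^ q ∂P ≤ bdgConst q * A ^ ((q - 2) / 2) * R.toReal := by
    -- For `q = 2` the factor `mesh ^ (q / 2 - 1)` of the remainder is constant, so the isometry is
    -- used instead; its constant one is below `bdgConst 2 = 4`.
    rcases hq.eq_or_lt with rfl | hq2
    · obtain ⟨τ, N, hτ, hmesh, hξm, hXe, hA', hR'⟩ := hstep 0
      have h1 := integral_elemSum_sq (c := fun j => stepFun σ c n (τ (j + 1))) (I := I) hW hτ hξm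
        (fun j k => HasMoments.of_bound ((hξm j k).mono (ℱ.le _)).aestronglyMeasurable
          (hξb τ j k)) N
      rw [← hXe] at h1
      have e : ∀ x : ℝ, |x| ^ (2 : ℝ) = x ^ 2 := fun x => by
        rw [Real.rpow_two, sq_abs]
      have e2 : ∀ x : ℝ, x ^ (2 / 2 : ℝ) = x := fun x => by norm_num
      simp only [e2] at hR'
      simp only [e]
      rw [h1]
      refine hR'.trans ?_
      have e3 : bdgConst 2 * A ^ ((2 - 2 : ℝ) / 2) = 4 := by
        norm_num [bdgConst, taylorConst]
      rw [e3]
      linarith [ENNReal.toReal_nonneg (a := R)]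
    · set D := (a * b) ^ q * ((I.card : ℝ) ^ (q - 1) * (I.card * gaussMoment q)) with hD
      have ha0 : 0 ≤ a := Finset.sum_nonneg fun i _ => abs_nonneg _
      have hD0 : 0 ≤ D := by
        have := gaussMoment_nonneg q
        positivity
      have hM : ∀ M : ℕ, ∫ ω, |X ω| ^ q ∂P ≤ 2 * taylorConst q *
          ((2 * taylorConst q * A) ^ ((q - 2) / 2) * R.toReal +
            D * (1 / ((M : ℝ) + 1)) ^ (q / 2 - 1) * S) := by
        intro M
        obtain ⟨τ, N, hτ, hmesh, hξm, hXe, hA', hR'⟩ := hstep M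
        have hξM : ∀ j k, HasMoments (ξ τ j k) P := fun j k =>
          HasMoments.of_bound ((hξm j k).mono (ℱ.le _)).aestronglyMeasurable (hξb τ j k)
        have h1 := integral_abs_elemSum_rpow_le (I := I) hW hτ hξm hξM hq hA N hA'
        rw [← hXe] at h1
        refine h1.trans ?_
        have h2 : ∀ j ∈ Finset.range N, ∫ ω, |elemStep w τ (fun j => stepFun σ c n (τ (j + 1))) I
            (ξ τ) j ω| ^ q ∂P ≤ D * (1 / ((M : ℝ) + 1)) ^ (q / 2 - 1) *
              (if τ (j + 1) ≤ S then (τ (j + 1) : ℝ) - τ j else 0) := by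
          intro j _
          split_ifs with hj
          · refine (integral_abs_elemStep_rpow_le hW hτ (abs_stepFun_le c n _)
              (fun k _ => hξb τ j k) hb0 hq).trans ?_
            have hΔ : (0 : ℝ) ≤ (τ (j + 1) : ℝ) - τ j :=
              sub_nonneg.2 (NNReal.coe_le_coe.2 (hτ (Nat.le_succ j)))
            have e : ((τ (j + 1) : ℝ) - τ j) ^ (q / 2) =
                ((τ (j + 1) : ℝ) - τ j) ^ (q / 2 - 1) * ((τ (j + 1) : ℝ) - τ j) := by
              rw [← Real.rpow_add_one' hΔ (by linarith), sub_add_cancel]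
            rw [e, mul_assoc D]
            have := hmesh j hj
            gcongr
            linarith
          · have e : ∀ ω, elemStep w τ (fun j => stepFun σ c n (τ (j + 1))) I (ξ τ) j ω = 0 := by
              intro ω
              simp only [elemStep]
              rw [stepFun_eq_zero_of_lt hσ c (hS.trans_lt (not_le.1 hj)), zero_mul]
            simp only [e, abs_zero, Real.zero_rpow (by linarith : q ≠ 0), integral_zero, mul_zero,
              le_refl]
        have h3 := Finset.sum_le_sum h2
        rw [← Finset.mul_sum] at h3
        have h4 := sum_mesh_le hτ S N
        gcongr
        exact h3.trans (mul_le_mul_of_nonneg_left h4 (by positivity))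
      -- Since `q / 2 - 1 > 0`, the remainder vanishes as the mesh tends to zero.
      have hlim : Tendsto (fun M : ℕ => 2 * taylorConst q *
          ((2 * taylorConst q * A) ^ ((q - 2) / 2) * R.toReal +
            D * (1 / ((M : ℝ) + 1)) ^ (q / 2 - 1) * S)) atTop (𝓝 (2 * taylorConst q *
          ((2 * taylorConst q * A) ^ ((q - 2) / 2) * R.toReal + D * 0 ^ (q / 2 - 1) * S))) := by
        refine ((Tendsto.mul_const _ (Tendsto.const_mul _ ?_)).const_add _).const_mul _
        exact tendsto_one_div_add_atTop_nhds_zero_nat.rpow_const (Or.inr (by linarith))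
      have h5 := ge_of_tendsto' hlim hM
      rw [Real.zero_rpow (by linarith : q / 2 - 1 ≠ 0), mul_zero, zero_mul, add_zero,
        Real.mul_rpow (by positivity) hA.le] at h5
      refine h5.trans (le_of_eq ?_)
      rw [bdgConst]; ring
  rw [← ofReal_integral_eq_lintegral_ofReal hXi (Eventually.of_forall fun ω => by positivity)]
  calc _ ≤ ENNReal.ofReal (bdgConst q * A ^ ((q - 2) / 2) * R.toReal) := ENNReal.ofReal_le_ofReal key
    _ = _ := by rw [ENNReal.ofReal_mul hK.le, ENNReal.ofReal_toReal hRt]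

end ElementaryBound

/-! ### Approximation of Itô integrands by simple processes in `L_q` -/

/-- Truncation of a real number at the level `R`. -/
def clip (R x : ℝ) : ℝ := max (-R) (min R x)

lemma clip_zero {R : ℝ} (hR : 0 ≤ R) : clip R 0 = 0 := by
  simp [clip, hR]

lemma abs_clip_le {R : ℝ} (hR : 0 ≤ R) (x : ℝ) : |clip R x| ≤ R :=
  abs_le.2 ⟨le_max_left _ _, max_le (by linarith) (min_le_left _ _)⟩

lemma clip_of_abs_le {R x : ℝ} (h : |x| ≤ R) : clip R x = x := by
  rw [clip, min_eq_right (abs_le.1 h).2, max_eq_right (abs_le.1 h).1]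

lemma abs_clip_sub_self_le {R : ℝ} (hR : 0 ≤ R) (x : ℝ) : |clip R x - x| ≤ |x| := by
  rcases le_or_gt |x| R with h | h
  · rw [clip_of_abs_le h]; simp
  · unfold clip
    rcases le_total 0 x with hx | hx
    · rw [abs_of_nonneg hx] at h
      rw [min_eq_left h.le, max_eq_right (by linarith), abs_of_nonneg hx, abs_le]
      constructor <;> linarith
    · rw [abs_of_nonpos hx] at h
      rw [min_eq_right (by linarith), max_eq_left (by linarith), abs_of_nonpos hx, abs_le]
      constructor <;> linarith

lemma abs_clip_sub_clip_le (R x y : ℝ) : |clip R x - clip R y| ≤ |x - y| := by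
  have h1 : |clip R x - clip R y| ≤ |min R x - min R y| := by
    unfold clip
    simpa using abs_max_sub_max_le_max (-R) (min R x) (-R) (min R y)
  have h2 : |min R x - min R y| ≤ |x - y| := by
    simpa using abs_min_sub_min_le_max R x R y
  exact h1.trans h2

lemma continuous_clip (R : ℝ) : Continuous (clip R) := by unfold clip; fun_prop

section Approx
variable {Ω : Type*} {mΩ : MeasurableSpace Ω} {P : Measure Ω} [IsProbabilityMeasure P]
  {ℱ : Filtration ℝ≥0 mΩ} {w : ℕ → ℝ≥0 → Ω → ℝ} {T : ℝ≥0}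

/-- The simple process with truncated coefficients. -/
def SimpleProcess.truncate (H : SimpleProcess ℱ) {R : ℝ} (hR : 0 ≤ R) : SimpleProcess ℱ where
  n := H.n
  time := H.time
  coeff i ω := clip R (H.coeff i ω)
  mono := H.mono
  meas i := (continuous_clip R).comp_stronglyMeasurable (H.meas i)
  bdd := ⟨R, fun _ _ => abs_clip_le hR _⟩

lemma SimpleProcess.truncate_val (H : SimpleProcess ℱ) {R : ℝ} (hR : 0 ≤ R) (z : ℝ≥0 × Ω) :
    (H.truncate hR).val z = clip R (H.val z) := by
  rw [val_eq_stepFun, val_eq_stepFun, comp_stepFun H.mono _ _ (clip_zero hR)]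
  rfl

lemma SimpleProcess.stronglyMeasurable_val (H : SimpleProcess ℱ) : StronglyMeasurable H.val := by
  refine Finset.stronglyMeasurable_fun_sum _ fun i _ => ?_
  have e : (fun z : ℝ≥0 × Ω => (Set.Ioc (H.time i) (H.time (i + 1))).indicator
      (fun _ => H.coeff i z.2) z.1) =
      (Prod.fst ⁻¹' Set.Ioc (H.time i) (H.time (i + 1))).indicator fun z => H.coeff i z.2 := by
    ext z
    by_cases h : z.1 ∈ Set.Ioc (H.time i) (H.time (i + 1))
    · rw [Set.indicator_of_mem h, Set.indicator_of_mem (by exact h)]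
    · rw [Set.indicator_of_notMem h, Set.indicator_of_notMem (by exact h)]
  rw [e]
  exact (((H.meas i).mono (ℱ.le _)).comp_measurable measurable_snd).indicator
    (measurable_fst measurableSet_Ioc)

lemma SimpleProcess.stronglyMeasurable_integral (H : SimpleProcess ℱ) {B : ℝ≥0 → Ω → ℝ}
    (hB : ∀ t, StronglyMeasurable (B t)) (t : ℝ≥0) : StronglyMeasurable (H.integral B t) := by
  unfold SimpleProcess.integral
  refine Finset.stronglyMeasurable_fun_sum _ fun i _ => ?_
  have h1 : StronglyMeasurable (H.coeff i) := (H.meas i).mono (ℱ.le _)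
  have h2 : StronglyMeasurable fun ω => B (min (H.time (i + 1)) t) ω - B (min (H.time i) t) ω :=
    (hB _).sub (hB _)
  exact h1.mul h2

lemma tendsto_eLpNorm_clip_sub {α : Type*} {m : MeasurableSpace α} {μ : Measure α} {q : ℝ}
    (hq : 0 < q) {G : α → ℝ} (hG : MemLp G (ENNReal.ofReal q) μ) :
    Tendsto (fun n : ℕ => eLpNorm (fun x => clip n (G x) - G x) (ENNReal.ofReal q) μ) atTop
      (𝓝 0) := by
  have hq0 : ENNReal.ofReal q ≠ 0 := by simpa using hq
  have hGf : ∫⁻ x, ‖G x‖ₑ ^ q ∂μ ≠ ∞ := by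
    have := hG.eLpNorm_lt_top
    rw [eLpNorm_lt_top_iff_lintegral_rpow_enorm_lt_top hq0 ENNReal.ofReal_ne_top,
      ENNReal.toReal_ofReal hq.le] at this
    exact this.ne
  have h : Tendsto (fun n : ℕ => ∫⁻ x, ‖clip n (G x) - G x‖ₑ ^ q ∂μ) atTop
      (𝓝 (∫⁻ _, 0 ∂μ)) := by
    refine tendsto_lintegral_of_dominated_convergence' (fun x => ‖G x‖ₑ ^ q) (fun n => ?_)
      (fun n => Eventually.of_forall fun x => ?_) hGf (Eventually.of_forall fun x => ?_)
    · exact ((((continuous_clip n).comp_aestronglyMeasurable hG.1).sub hG.1).enorm).pow_const q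
    · refine ENNReal.rpow_le_rpow (enorm_le_iff_norm_le.2 ?_) hq.le
      exact abs_clip_sub_self_le (Nat.cast_nonneg n) _
    · obtain ⟨m, hm⟩ := exists_nat_ge |G x|
      refine tendsto_const_nhds.congr' ?_
      filter_upwards [eventually_ge_atTop m] with n hn
      rw [clip_of_abs_le (hm.trans (Nat.cast_le.2 hn)), sub_self, enorm_zero,
        ENNReal.zero_rpow_of_pos hq]
  rw [lintegral_zero] at h
  have h2 := h.ennrpow_const (1 / q)
  rw [ENNReal.zero_rpow_of_pos (by positivity)] at h2
  refine h2.congr fun n => ?_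
  rw [eLpNorm_eq_lintegral_rpow_enorm_toReal hq0 ENNReal.ofReal_ne_top, ENNReal.toReal_ofReal hq.le]

/-- Truncated values differ by at most `2R`, so `|d|^q ≤ (2R)^{q-2} d²` interpolates `L_q` from
`L_2`. -/
lemma eLpNorm_clip_sub_clip_le {α : Type*} {m : MeasurableSpace α} {μ : Measure α} {q : ℝ}
    (hq : 2 ≤ q) {R : ℝ} (hR : 0 ≤ R) (F G : α → ℝ) :
    eLpNorm (fun x => clip R (F x) - clip R (G x)) (ENNReal.ofReal q) μ ≤
      (ENNReal.ofReal ((2 * R) ^ (q - 2)) * eLpNorm (fun x => F x - G x) 2 μ ^ (2 : ℝ)) ^ (1 / q) := by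
  have hq0 : 0 < q := by linarith
  rw [eLpNorm_eq_lintegral_rpow_enorm_toReal (by simpa using hq0) ENNReal.ofReal_ne_top,
    ENNReal.toReal_ofReal hq0.le, eLpNorm_eq_lintegral_rpow_enorm_toReal (by simp) (by simp),
    ← ENNReal.rpow_mul]
  simp only [ENNReal.toReal_ofNat, one_div, inv_mul_cancel₀ (two_ne_zero' ℝ), ENNReal.rpow_one]
  rw [← lintegral_const_mul' _ _ ENNReal.ofReal_ne_top]
  refine ENNReal.rpow_le_rpow (lintegral_mono fun x => ?_) (by positivity)
  have h1 : |clip R (F x) - clip R (G x)| ≤ 2 * R := by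
    have := abs_sub (clip R (F x)) (clip R (G x))
    linarith [abs_clip_le hR (F x), abs_clip_le hR (G x)]
  have h2 := abs_clip_sub_clip_le R (F x) (G x)
  have e : ∀ y : ℝ, ∀ r : ℝ, 0 ≤ r → ‖y‖ₑ ^ r = ENNReal.ofReal (|y| ^ r) := fun y r hr => by
    rw [Real.enorm_eq_ofReal_abs, ENNReal.ofReal_rpow_of_nonneg (abs_nonneg y) hr]
  rw [e _ _ hq0.le, e _ _ zero_le_two, ← ENNReal.ofReal_mul (by positivity)]
  refine ENNReal.ofReal_le_ofReal ?_
  rw [← abs_rpow_sub_two_mul_self hq, mul_assoc]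
  set d := clip R (F x) - clip R (G x)
  have h3 : d * d ≤ |F x - G x| ^ (2 : ℝ) := by
    rw [Real.rpow_two, ← abs_mul_abs_self, sq]
    exact mul_self_le_mul_self (abs_nonneg _) h2
  exact mul_le_mul (Real.rpow_le_rpow (abs_nonneg _) h1 (by linarith)) h3 (mul_self_nonneg _)
    (by positivity)

/-- The definition of the Itô integral provides approximation in `L_2` only, whereas the moment
bound needs it in `L_q`. First `R` is chosen for the truncation of `G`; then a simple process close
to `G` in `L_2` is truncated at the same level. -/
lemma exists_simpleProcess_eLpNorm_lt {q : ℝ} (hq : 2 ≤ q) {μ : Measure (ℝ≥0 × Ω)}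
    {G : ℝ≥0 × Ω → ℝ} (hG : MemLp G (ENNReal.ofReal q) μ) {H : ℕ → SimpleProcess ℱ}
    (hH : Tendsto (fun n => eLpNorm (fun z => (H n).val z - G z) 2 μ) atTop (𝓝 0))
    {ε : ℝ≥0∞} (hε : 0 < ε) :
    ∃ H' : SimpleProcess ℱ, eLpNorm (fun z => H'.val z - G z) (ENNReal.ofReal q) μ < ε := by
  have hε2 : 0 < ε / 2 := ENNReal.half_pos hε.ne'
  obtain ⟨R, hR⟩ := ((tendsto_eLpNorm_clip_sub (by linarith) hG).eventually_lt_const hε2).exists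
  have hR0 : (0 : ℝ) ≤ R := Nat.cast_nonneg R
  have h1 : Tendsto (fun n => (ENNReal.ofReal ((2 * (R : ℝ)) ^ (q - 2)) *
      eLpNorm (fun z => (H n).val z - G z) 2 μ ^ (2 : ℝ)) ^ (1 / q)) atTop (𝓝 0) := by
    have := (ENNReal.Tendsto.const_mul (hH.ennrpow_const (2 : ℝ))
      (Or.inr (ENNReal.ofReal_ne_top (r := (2 * (R : ℝ)) ^ (q - 2))))).ennrpow_const (1 / q)
    rwa [ENNReal.zero_rpow_of_pos (by norm_num), mul_zero,
      ENNReal.zero_rpow_of_pos (one_div_pos.2 (by linarith))] at this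
  obtain ⟨n, hn⟩ := (h1.eventually_lt_const hε2).exists
  refine ⟨(H n).truncate hR0, ?_⟩
  have h2 : (fun z => ((H n).truncate hR0).val z - G z) =
      (fun z => clip R ((H n).val z) - clip R (G z)) + fun z => clip R (G z) - G z := by
    ext z; simp [SimpleProcess.truncate_val]
  have m1 : AEStronglyMeasurable (fun z => clip R ((H n).val z) - clip R (G z)) μ :=
    ((continuous_clip R).comp_stronglyMeasurable
      (H n).stronglyMeasurable_val).aestronglyMeasurable.sub
      ((continuous_clip R).comp_aestronglyMeasurable hG.1)
  have m2 : AEStronglyMeasurable (fun z => clip R (G z) - G z) μ :=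
    ((continuous_clip R).comp_aestronglyMeasurable hG.1).sub hG.1
  rw [h2]
  calc _ ≤ _ + _ := eLpNorm_add_le m1 m2 (by
        rw [← ENNReal.ofReal_one]; exact ENNReal.ofReal_le_ofReal (by linarith))
    _ < ε / 2 + ε / 2 :=
      ENNReal.add_lt_add ((eLpNorm_clip_sub_clip_le hq hR0 _ _).trans_lt hn) hR
    _ = ε := ENNReal.add_halves ε

lemma SimpleProcess.integral_zero (H : SimpleProcess ℱ) (B : ℝ≥0 → Ω → ℝ) (ω : Ω) :
    H.integral B 0 ω = 0 := by
  simp [SimpleProcess.integral]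

lemma eLpNorm_integral_sub_le (hW : IsWienerBasis P ℱ w) (k : ℕ) (H H' : SimpleProcess ℱ)
    {t T : ℝ≥0} (ht : t ≤ T) :
    eLpNorm (fun ω => H.integral (w k) t ω - H'.integral (w k) t ω) 2 P ≤
      2 * eLpNorm (fun z => H.val z - H'.val z) 2 (rectMeasure P T) := by
  have hσ : Monotone fun i : ℕ => if i = 0 then 0 else t := by
    intro i j hij
    simp only
    split_ifs with h1 h2
    · exact le_rfl
    · exact zero_le
    · omega
    · exact le_rfl
  -- The single cell `(0, t]` with weight one. The bound `t + 1` is positive even for `t = 0`, and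
  -- for `q = 2` it enters with exponent zero.
  have h := lintegral_sum_stepInt_le hW hσ (fun _ => 1) (n := 1) (S := T) (by simpa using ht) {k}
    (V := fun _ z => H.val z - H'.val z)
    (J := fun _ t ω => H.integral (w k) t ω - H'.integral (w k) t ω)
    (fun l hl => by
      rw [Finset.mem_singleton.1 hl]
      exact (H.isElementary (w k)).sub (H'.isElementary (w k))) (q := 2) le_rfl
    (A := t + 1) (by positivity) (by simp [stepInt])
  simp only [Finset.sum_singleton, stepInt, Finset.range_one, one_mul,
    SimpleProcess.integral_zero, sub_zero, if_true] at h
  norm_num [bdgConst, taylorConst] at h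
  have h2 : ∫⁻ ω, ‖H.integral (w k) t ω - H'.integral (w k) t ω‖ₑ ^ (2 : ℝ) ∂P ≤
      4 * ∫⁻ z, ‖H.val z - H'.val z‖ₑ ^ (2 : ℝ) ∂rectMeasure P T := by
    have e : ∀ y : ℝ, ‖y‖ₑ ^ (2 : ℝ) = ENNReal.ofReal (y ^ 2) := fun y => by
      rw [Real.enorm_eq_ofReal_abs, ENNReal.ofReal_rpow_of_nonneg (abs_nonneg y) zero_le_two,
        Real.rpow_two, sq_abs]
    simp only [e]
    refine h.trans ?_
    gcongr with z
    have h3 : stepFun (fun i : ℕ => if i = 0 then 0 else t) (fun _ => (1 : ℝ)) 1 z.1 ^ 2 ≤ 1 := by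
      rcases stepFun_eq_or hσ 1 z.1 with h | ⟨i, _, _, h⟩ <;> rw [h] <;> norm_num
    exact mul_le_of_le_one_left (sq_nonneg _) h3
  rw [eLpNorm_eq_lintegral_rpow_enorm_toReal (by simp) (by simp),
    eLpNorm_eq_lintegral_rpow_enorm_toReal (by simp) (by simp)]
  simp only [ENNReal.toReal_ofNat]
  refine (ENNReal.rpow_le_rpow h2 (by norm_num)).trans (le_of_eq ?_)
  rw [ENNReal.mul_rpow_of_nonneg _ _ (by norm_num)]
  congr 1
  rw [show (4 : ℝ≥0∞) = 2 ^ (2 : ℝ) by norm_num, ← ENNReal.rpow_mul]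
  norm_num

/-- An Itô integral whose integrand is in `L_q` is a limit of integrals of simple processes that
converge to the integrand in `L_q`. -/
lemma IsItoIntegral.exists_approx (hW : IsWienerBasis P ℱ w) {k : ℕ} {G : ℝ≥0 × Ω → ℝ}
    {M : ℝ≥0 → Ω → ℝ} (hM : IsItoIntegral ℱ P T (w k) G M) {q : ℝ} (hq : 2 ≤ q)
    (hG : MemLp G (ENNReal.ofReal q) (rectMeasure P T)) :
    ∃ H : ℕ → SimpleProcess ℱ,
      Tendsto (fun n => eLpNorm (fun z => (H n).val z - G z) (ENNReal.ofReal q) (rectMeasure P T))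
        atTop (𝓝 0) ∧
      ∀ t ≤ T, Tendsto (fun n => eLpNorm (fun ω => (H n).integral (w k) t ω - M t ω) 2 P) atTop
        (𝓝 0) := by
  obtain ⟨K, hK1, hK2⟩ := hM.approx
  have hex : ∀ n : ℕ, ∃ H' : SimpleProcess ℱ, eLpNorm (fun z => H'.val z - G z) (ENNReal.ofReal q)
      (rectMeasure P T) < ((n : ℝ≥0∞) + 1)⁻¹ := fun n =>
    exists_simpleProcess_eLpNorm_lt hq hG hK1 (by simp)
  choose H hH using hex
  have hlim : Tendsto (fun n : ℕ => ((n : ℝ≥0∞) + 1)⁻¹) atTop (𝓝 0) := by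
    have := (tendsto_add_atTop_iff_nat (f := fun n : ℕ => ((n : ℝ≥0∞))⁻¹) 1).2
      ENNReal.tendsto_inv_nat_nhds_zero
    simpa using this
  have h1 : Tendsto (fun n => eLpNorm (fun z => (H n).val z - G z) (ENNReal.ofReal q)
      (rectMeasure P T)) atTop (𝓝 0) :=
    tendsto_of_tendsto_of_tendsto_of_le_of_le tendsto_const_nhds hlim (fun _ => zero_le)
      fun n => (hH n).le
  -- The new processes approximate `G` in `L_2` as well, so by `eLpNorm_integral_sub_le` their
  -- integrals have the same limit as those in the definition.
  refine ⟨H, h1, fun t ht => ?_⟩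
  have hm : ∀ n, AEStronglyMeasurable (fun z => (H n).val z - G z) (rectMeasure P T) := fun n =>
    (H n).stronglyMeasurable_val.aestronglyMeasurable.sub hG.1
  have hmK : ∀ n, AEStronglyMeasurable (fun z => (K n).val z - G z) (rectMeasure P T) := fun n =>
    (K n).stronglyMeasurable_val.aestronglyMeasurable.sub hG.1
  have hq2 : (2 : ℝ≥0∞) ≤ ENNReal.ofReal q := by
    rw [show (2 : ℝ≥0∞) = ENNReal.ofReal 2 by simp]; exact ENNReal.ofReal_le_ofReal hq
  set κ := rectMeasure P T Set.univ ^ (1 / (2 : ℝ≥0∞).toReal - 1 / (ENNReal.ofReal q).toReal)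
  have hκ : κ ≠ ∞ := by
    refine ENNReal.rpow_ne_top_of_nonneg ?_ (measure_ne_top _ _)
    rw [ENNReal.toReal_ofReal (by linarith), ENNReal.toReal_ofNat, sub_nonneg]
    exact one_div_le_one_div_of_le (by norm_num) hq
  have h2 : Tendsto (fun n => eLpNorm (fun z => (H n).val z - G z) 2 (rectMeasure P T)) atTop
      (𝓝 0) := by
    have h3 := ENNReal.Tendsto.mul_const h1 (Or.inr hκ)
    rw [zero_mul] at h3
    exact tendsto_of_tendsto_of_tendsto_of_le_of_le tendsto_const_nhds h3 (fun _ => zero_le)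
      fun n => eLpNorm_le_eLpNorm_mul_rpow_measure_univ hq2 (hm n)
  have h4 : Tendsto (fun n => 2 * (eLpNorm (fun z => (H n).val z - G z) 2 (rectMeasure P T) +
      eLpNorm (fun z => (K n).val z - G z) 2 (rectMeasure P T)) +
      eLpNorm (fun ω => (K n).integral (w k) t ω - M t ω) 2 P) atTop (𝓝 0) := by
    have := (ENNReal.Tendsto.const_mul (h2.add hK1) (Or.inr (by simp : (2 : ℝ≥0∞) ≠ ∞))).add
      (hK2 t ht)
    simpa using this
  refine tendsto_of_tendsto_of_tendsto_of_le_of_le tendsto_const_nhds h4 (fun _ => zero_le)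
    fun n => ?_
  have hMm : AEStronglyMeasurable (M t) P := ((hM.adapted t ht).mono (ℱ.le t)).aestronglyMeasurable
  have him : ∀ H : SimpleProcess ℱ, AEStronglyMeasurable (H.integral (w k) t) P := fun H =>
    (H.stronglyMeasurable_integral (fun s => ((hW.adapted k s).mono (ℱ.le s))) t).aestronglyMeasurable
  have e1 : (fun ω => (H n).integral (w k) t ω - M t ω) =
      (fun ω => (H n).integral (w k) t ω - (K n).integral (w k) t ω) +
        fun ω => (K n).integral (w k) t ω - M t ω := by ext ω; simp
  have e2 : (fun z => (H n).val z - (K n).val z) =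
      (fun z => (H n).val z - G z) - fun z => (K n).val z - G z := by ext z; simp
  rw [e1]
  refine (eLpNorm_add_le ((him _).sub (him _)) ((him _).sub hMm) one_le_two).trans ?_
  refine add_le_add ((eLpNorm_integral_sub_le hW k (H n) (K n) ht).trans ?_) le_rfl
  refine mul_le_mul_right ?_ _
  rw [e2]
  exact eLpNorm_sub_le (hm n) (hmK n) one_le_two

end Approx

/-! ### Doob's inequality in `L_q` -/

section Doob
variable {Ω : Type*} {mΩ : MeasurableSpace Ω} {P : Measure Ω} [IsProbabilityMeasure P]

/-- Equivalent to `2 a b^{q-1} ≤ a^q + b^q`, which follows from the tangent inequality at `b`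
together with `(q - 2)(a^q - b^q) ≥ 0`. -/
lemma rpow_sub_rpow_le_two_mul {q a b : ℝ} (hq : 2 ≤ q) (hb : 0 ≤ b) (hba : b ≤ a) :
    a ^ q - b ^ q ≤ 2 * (a * (a ^ (q - 1) - b ^ (q - 1))) := by
  have ha := hb.trans hba
  have h1 := abs_rpow_tangent_le hq b a
  have h2 : a * a ^ (q - 1) = a ^ q := by
    rcases ha.eq_or_lt with rfl | ha
    · rw [Real.zero_rpow (by linarith : q ≠ 0), zero_mul]
    · rw [mul_comm, ← Real.rpow_add_one ha.ne', sub_add_cancel]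
  have h3 : b ^ (q - 2) * b * b = b ^ q := by
    have := abs_rpow_sub_two_mul_self hq b
    rwa [abs_of_nonneg hb] at this
  have h4 : b ^ (q - 2) * b = b ^ (q - 1) := by
    have := abs_rpow_sub_two_mul_abs hq b
    rwa [abs_of_nonneg hb] at this
  rw [abs_of_nonneg hb, abs_of_nonneg ha, h4] at h1
  rw [h4] at h3
  have h5 : b ^ q ≤ a ^ q := Real.rpow_le_rpow hb hba (by linarith)
  have h6 : 0 ≤ q * (a ^ q + b ^ q - 2 * (a * b ^ (q - 1))) := by
    nlinarith [mul_nonneg (sub_nonneg.2 hq) (sub_nonneg.2 h5)]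
  have h7 := nonneg_of_mul_nonneg_right h6 (by linarith)
  nlinarith

/-- Separating `4x ≤ s` from `s ≤ 4x` avoids the sharp Young constants; this is the origin of the
factor `4 ^ q` in Doob's inequality. -/
lemma two_mul_mul_rpow_le {q x s : ℝ} (hq : 2 ≤ q) (hx : 0 ≤ x) (hs : 0 ≤ s) :
    2 * (x * s ^ (q - 1)) ≤ s ^ q / 2 + 4 ^ q / 2 * x ^ q := by
  have e : ∀ y : ℝ, 0 ≤ y → y * y ^ (q - 1) = y ^ q := fun y hy => by
    rcases hy.eq_or_lt with rfl | hy
    · rw [Real.zero_rpow (by linarith : q ≠ 0), zero_mul]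
    · rw [mul_comm, ← Real.rpow_add_one hy.ne', sub_add_cancel]
  rcases le_total (4 * x) s with h | h
  · have h1 : 4 * x * s ^ (q - 1) ≤ s ^ q := by
      rw [← e s hs]; gcongr
    have h2 : 0 ≤ 4 ^ q / 2 * x ^ q := by positivity
    nlinarith
  · have h1 : 4 * (x * s ^ (q - 1)) ≤ (4 * x) ^ q := by
      rw [← e (4 * x) (by positivity), ← mul_assoc]
      have := Real.rpow_le_rpow hs h (by linarith : 0 ≤ q - 1)
      gcongr
    rw [Real.mul_rpow (by norm_num) hx] at h1
    have h2 : 0 ≤ s ^ q := by positivity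
    nlinarith

/-- The running maximum of `|X_0|, …, |X_n|`. -/
def runMax (X : ℕ → Ω → ℝ) : ℕ → Ω → ℝ
  | 0, ω => |X 0 ω|
  | n + 1, ω => max (runMax X n ω) |X (n + 1) ω|

lemma abs_le_runMax (X : ℕ → Ω → ℝ) {i n : ℕ} (h : i ≤ n) (ω : Ω) : |X i ω| ≤ runMax X n ω := by
  induction n with
  | zero => obtain rfl : i = 0 := by omega
            exact le_rfl
  | succ n ih =>
    rcases Nat.lt_or_ge n i with h1 | h1
    · obtain rfl : i = n + 1 := by omega
      exact le_max_right _ _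
    · exact (ih h1).trans (le_max_left _ _)

lemma runMax_nonneg (X : ℕ → Ω → ℝ) (n : ℕ) (ω : Ω) : 0 ≤ runMax X n ω :=
  (abs_nonneg _).trans (abs_le_runMax X (Nat.zero_le n) ω)

lemma stronglyMeasurable_runMax {X : ℕ → Ω → ℝ} {𝒢 : Filtration ℕ mΩ}
    (hX : StronglyAdapted 𝒢 X) (n : ℕ) : StronglyMeasurable[𝒢 n] (runMax X n) := by
  induction n with
  | zero => exact (hX 0).norm
  | succ n ih =>
    have h1 : StronglyMeasurable[𝒢 (n + 1)] fun ω => |X (n + 1) ω| := (hX (n + 1)).norm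
    have h2 : StronglyMeasurable[𝒢 (n + 1)] (runMax X n) := ih.mono (𝒢.mono (Nat.le_succ n))
    exact continuous_max.comp_stronglyMeasurable (h2.prodMk h1)

lemma memLp_runMax {X : ℕ → Ω → ℝ} {r : ℝ≥0∞} {n : ℕ} (hX : ∀ i ≤ n, MemLp (X i) r P) :
    MemLp (runMax X n) r P := by
  induction n with
  | zero => exact (hX 0 le_rfl).norm
  | succ n ih => exact (ih fun i hi => hX i (hi.trans (Nat.le_succ n))).sup (hX _ le_rfl).norm

/-- **Doob's `L_q` inequality** for a finite martingale. -/
theorem integral_runMax_rpow_le {X : ℕ → Ω → ℝ} {𝒢 : Filtration ℕ mΩ} (hX : StronglyAdapted 𝒢 X)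
    {q : ℝ} (hq : 2 ≤ q) {n : ℕ} (hXq : ∀ i ≤ n, MemLp (X i) (ENNReal.ofReal q) P)
    (hmart : ∀ i ≤ n, ∀ A, MeasurableSet[𝒢 i] A → ∫ ω in A, X n ω ∂P = ∫ ω in A, X i ω ∂P) :
    Integrable (fun ω => runMax X n ω ^ q) P ∧
    ∫ ω, runMax X n ω ^ q ∂P ≤ 4 ^ q * ∫ ω, |X n ω| ^ q ∂P := by
  have hq0 : 0 < q := by linarith
  have hq1 : (1 : ℝ≥0∞) ≤ ENNReal.ofReal q := by
    rw [← ENNReal.ofReal_one]; exact ENNReal.ofReal_le_ofReal (by linarith)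
  have hqi : ∀ {f : Ω → ℝ}, MemLp f (ENNReal.ofReal q) P → Integrable (fun ω => |f ω| ^ q) P := by
    intro f hf
    have := hf.integrable_norm_rpow (by simpa using hq0) ENNReal.ofReal_ne_top
    simpa [ENNReal.toReal_ofReal hq0.le] using this
  have hSq : ∀ i ≤ n, Integrable (fun ω => runMax X i ω ^ q) P := fun i hi => by
    have := hqi (memLp_runMax (n := i) fun j hj => hXq j (hj.trans hi))
    simpa only [abs_of_nonneg (runMax_nonneg X i _)] using this
  have hint : ∀ i ≤ n, Integrable (X i) P := fun i hi => (hXq i hi).integrable hq1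
  have hce : ∀ i ≤ n, X i =ᵐ[P] P[X n | 𝒢 i] := fun i hi =>
    ae_eq_condExp_of_forall_setIntegral_eq (𝒢.le i) (hint n le_rfl)
      (fun A _ _ => (hint i hi).integrableOn) (fun A hA _ => (hmart i hi A hA).symm)
      (hX i).aestronglyMeasurable
  have e : ∀ y : ℝ, 0 ≤ y → y * y ^ (q - 1) = y ^ q := fun y hy => by
    rcases hy.eq_or_lt with rfl | hy
    · rw [Real.zero_rpow hq0.ne', zero_mul]
    · rw [mul_comm, ← Real.rpow_add_one hy.ne', sub_add_cancel]
  have hSmono : ∀ ω, Monotone fun i => runMax X i ω := fun ω =>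
    monotone_nat_of_le_succ fun i => le_max_left _ _
  have hSm : ∀ i, StronglyMeasurable[𝒢 i] fun ω => runMax X i ω ^ (q - 1) := fun i =>
    ((stronglyMeasurable_runMax hX i).measurable.pow_const (q - 1)).stronglyMeasurable
  have hprod : ∀ i ≤ n, ∀ j ≤ n, Integrable (fun ω => |X i ω| * runMax X j ω ^ (q - 1)) P := by
    intro i hi j hj
    refine (hSq n le_rfl).mono' ?_ (Eventually.of_forall fun ω => ?_)
    · exact (((hX i).norm.mono (𝒢.le i)).mul ((hSm j).mono (𝒢.le j))).aestronglyMeasurable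
    · have h1 := runMax_nonneg X j ω
      have h2 := runMax_nonneg X n ω
      rw [Real.norm_of_nonneg (by positivity), ← e _ h2]
      refine mul_le_mul (abs_le_runMax X hi ω) ?_ (by positivity) h2
      exact Real.rpow_le_rpow h1 (hSmono ω hj) (by linarith)
  -- The submartingale property of `|X|` against nonnegative weights known at time `i`: the sign of
  -- `X i` is a multiplier known at that time, and it turns `X i` into `|X i|`.
  have hsub : ∀ i ≤ n, ∀ D : Ω → ℝ, StronglyMeasurable[𝒢 i] D → (∀ ω, 0 ≤ D ω) →
      Integrable (fun ω => |X n ω| * D ω) P → Integrable (fun ω => |X i ω| * D ω) P →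
      ∫ ω, |X i ω| * D ω ∂P ≤ ∫ ω, |X n ω| * D ω ∂P := by
    intro i hi D hD hD0 hn hi'
    let Z : Ω → ℝ := fun ω => SignType.sign (X i ω) * D ω
    have hZ : StronglyMeasurable[𝒢 i] Z := by
      refine StronglyMeasurable.mul ?_ hD
      have h1 : Measurable fun x : ℝ => ((SignType.sign x : SignType) : ℝ) := by
        have : (fun x : ℝ => ((SignType.sign x : SignType) : ℝ)) =
            fun x => if 0 < x then 1 else if x < 0 then -1 else 0 := by
          ext x
          simp only [sign_apply]
          split_ifs <;> simp
        rw [this]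
        exact Measurable.ite measurableSet_Ioi measurable_const
          (Measurable.ite measurableSet_Iio measurable_const measurable_const)
      exact (h1.comp (hX i).measurable).stronglyMeasurable
    have hZn : ∀ ω, Z ω * X n ω ≤ |X n ω| * D ω := fun ω => by
      have h1 : |((SignType.sign (X i ω) : SignType) : ℝ)| ≤ 1 := by
        rcases lt_trichotomy (X i ω) 0 with h | h | h <;> simp [h]
      calc Z ω * X n ω ≤ |Z ω * X n ω| := le_abs_self _
        _ = |((SignType.sign (X i ω) : SignType) : ℝ)| * (|X n ω| * D ω) := by
          rw [abs_mul, abs_mul, abs_of_nonneg (hD0 ω)]; ring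
        _ ≤ 1 * (|X n ω| * D ω) := by
          have := hD0 ω
          gcongr
        _ = _ := one_mul _
    have hZi : ∀ ω, Z ω * X i ω = |X i ω| * D ω := fun ω => by
      rw [← sign_mul_self (X i ω)]; ring
    have hZint : Integrable (Z * X n) P := by
      refine hn.mono ((hZ.mono (𝒢.le i)).mul ((hX n).mono (𝒢.le n))).aestronglyMeasurable
        (Eventually.of_forall fun ω => ?_)
      have h1 : |((SignType.sign (X i ω) : SignType) : ℝ)| ≤ 1 := by
        rcases lt_trichotomy (X i ω) 0 with h | h | h <;> simp [h]
      simp only [Z, Pi.mul_apply, norm_mul, Real.norm_eq_abs, abs_abs]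
      calc |((SignType.sign (X i ω) : SignType) : ℝ)| * |D ω| * |X n ω| ≤ 1 * |D ω| * |X n ω| := by
            gcongr
        _ = |X n ω| * |D ω| := by ring
    calc ∫ ω, |X i ω| * D ω ∂P = ∫ ω, (Z * P[X n | 𝒢 i]) ω ∂P := by
          refine integral_congr_ae ?_
          filter_upwards [hce i hi] with ω hω
          rw [Pi.mul_apply, ← hω, hZi]
      _ = ∫ ω, (P[Z * X n | 𝒢 i]) ω ∂P :=
          integral_congr_ae (condExp_mul_of_stronglyMeasurable_left hZ hZint (hint n le_rfl)).symm
      _ = ∫ ω, (Z * X n) ω ∂P := integral_condExp (𝒢.le i)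
      _ ≤ _ := integral_mono hZint hn hZn
  -- telescoping
  have htel : ∀ m ≤ n, Integrable (fun ω => runMax X m ω ^ q) P →
      ∫ ω, runMax X m ω ^ q ∂P ≤ 2 * ∫ ω, |X n ω| * runMax X m ω ^ (q - 1) ∂P := by
    intro m
    induction m with
    | zero =>
      intro hm _
      have h1 : ∫ ω, runMax X 0 ω ^ q ∂P = ∫ ω, |X 0 ω| * runMax X 0 ω ^ (q - 1) ∂P := by
        refine integral_congr_ae (Eventually.of_forall fun ω => ?_)
        exact (e _ (abs_nonneg _)).symm
      have h2 := hsub 0 hm _ (hSm 0) (fun ω => by have := runMax_nonneg X 0 ω; positivity)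
        (hprod n le_rfl 0 hm) (hprod 0 hm 0 hm)
      have h3 : 0 ≤ ∫ ω, |X n ω| * runMax X 0 ω ^ (q - 1) ∂P :=
        integral_nonneg fun ω => by have := runMax_nonneg X 0 ω; positivity
      linarith
    | succ m ih =>
      intro hm hi
      have hm' : m ≤ n := by omega
      have h1 := ih hm' (hSq m hm')
      let D : Ω → ℝ := fun ω => runMax X (m + 1) ω ^ (q - 1) - runMax X m ω ^ (q - 1)
      have hD0 : ∀ ω, 0 ≤ D ω := fun ω => sub_nonneg.2
        (Real.rpow_le_rpow (runMax_nonneg X m ω) (hSmono ω (Nat.le_succ m)) (by linarith))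
      have hi1 : ∀ i ≤ n, Integrable (fun ω => |X i ω| * D ω) P := fun i hi' => by
        refine ((hprod i hi' (m + 1) hm).sub (hprod i hi' m hm')).congr
          (Eventually.of_forall fun ω => ?_)
        simp only [D, Pi.sub_apply]; ring
      have h2 := hsub (m + 1) hm D ((hSm (m + 1)).sub ((hSm m).mono (𝒢.mono (Nat.le_succ m)))) hD0
        (hi1 n le_rfl) (hi1 _ hm)
      -- The running maximum increases only when the new value attains it, so the factor `runMax X
      -- (m + 1)` may be replaced by `|X (m + 1)|`.
      have h3 : ∀ ω, runMax X (m + 1) ω ^ q - runMax X m ω ^ q ≤ 2 * (|X (m + 1) ω| * D ω) := by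
        intro ω
        have h4 := rpow_sub_rpow_le_two_mul hq (runMax_nonneg X m ω) (hSmono ω (Nat.le_succ m))
        rcases le_or_gt |X (m + 1) ω| (runMax X m ω) with h | h
        · have h5 : runMax X (m + 1) ω = runMax X m ω := max_eq_left h
          simp [D, h5]
        · have h5 : runMax X (m + 1) ω = |X (m + 1) ω| := max_eq_right h.le
          refine h4.trans (le_of_eq ?_)
          simp only [D, h5]
      have h4 : ∫ ω, runMax X (m + 1) ω ^ q ∂P - ∫ ω, runMax X m ω ^ q ∂P ≤
          2 * ∫ ω, |X (m + 1) ω| * D ω ∂P := by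
        rw [← integral_sub hi (hSq m hm'), ← integral_const_mul]
        exact integral_mono (hi.sub (hSq m hm')) ((hi1 _ hm).const_mul 2) h3
      have h5 : ∫ ω, |X n ω| * runMax X (m + 1) ω ^ (q - 1) ∂P =
          ∫ ω, |X n ω| * runMax X m ω ^ (q - 1) ∂P + ∫ ω, |X n ω| * D ω ∂P := by
        rw [← integral_add (hprod n le_rfl m hm') (hi1 n le_rfl)]
        refine integral_congr_ae (Eventually.of_forall fun ω => ?_)
        simp only [D]; ring
      rw [h5]
      linarith
  refine ⟨hSq n le_rfl, ?_⟩
  -- Half of the moment of the maximum is absorbed. This is legitimate because the moment is finite.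
  have h1 := htel n le_rfl (hSq n le_rfl)
  have h2 : 2 * ∫ ω, |X n ω| * runMax X n ω ^ (q - 1) ∂P ≤
      ∫ ω, (runMax X n ω ^ q / 2 + 4 ^ q / 2 * |X n ω| ^ q) ∂P := by
    rw [← integral_const_mul]
    exact integral_mono ((hprod n le_rfl n le_rfl).const_mul 2)
      (((hSq n le_rfl).div_const 2).add ((hqi (hXq n le_rfl)).const_mul _))
      fun ω => two_mul_mul_rpow_le hq (abs_nonneg _) (runMax_nonneg X n ω)
  rw [integral_add ((hSq n le_rfl).div_const 2) ((hqi (hXq n le_rfl)).const_mul _),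
    integral_div, integral_const_mul] at h2
  linarith

end Doob

/-! ### Elementary properties of Itô integrals -/

section Ito
variable {Ω : Type*} {mΩ : MeasurableSpace Ω} {P : Measure Ω} [IsProbabilityMeasure P]
  {ℱ : Filtration ℝ≥0 mΩ} {w : ℕ → ℝ≥0 → Ω → ℝ} {T : ℝ≥0}

lemma IsItoIntegral.aestronglyMeasurable {B : ℝ≥0 → Ω → ℝ} {G : ℝ≥0 × Ω → ℝ} {M : ℝ≥0 → Ω → ℝ}
    (hM : IsItoIntegral ℱ P T B G M) {t : ℝ≥0} (ht : t ≤ T) : StronglyMeasurable (M t) :=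
  (hM.adapted t ht).mono (ℱ.le t)

lemma IsItoIntegral.ae_zero {B : ℝ≥0 → Ω → ℝ} {G : ℝ≥0 × Ω → ℝ} {M : ℝ≥0 → Ω → ℝ}
    (hM : IsItoIntegral ℱ P T B G M) : M 0 =ᵐ[P] 0 := by
  obtain ⟨H, -, hH⟩ := hM.approx
  have h := hH 0 zero_le
  simp only [SimpleProcess.integral_zero, zero_sub] at h
  have h2 := tendsto_nhds_unique tendsto_const_nhds h
  have h3 := (eLpNorm_eq_zero_iff (hM.aestronglyMeasurable zero_le).aestronglyMeasurable.neg
    two_ne_zero).1 h2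
  filter_upwards [h3] with ω hω
  simpa using hω

lemma SimpleProcess.memLp_integral (hW : IsWienerBasis P ℱ w) (k : ℕ) (H : SimpleProcess ℱ)
    (t : ℝ≥0) : MemLp (H.integral (w k) t) 2 P := by
  obtain ⟨C, hC⟩ := H.bdd
  have h : HasMoments (H.integral (w k) t) P := by
    unfold SimpleProcess.integral
    refine HasMoments.sum fun i _ => ?_
    exact (HasMoments.of_bound ((H.meas i).mono (ℱ.le _)).aestronglyMeasurable (hC i)).mul
      (hW.hasMoments_incr k (min_le_min_right t (H.mono (Nat.le_succ i))))
  exact h 2 (by simp)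

lemma SimpleProcess.setIntegral_integral (hW : IsWienerBasis P ℱ w) (k : ℕ) (H : SimpleProcess ℱ)
    {s t : ℝ≥0} (hst : s ≤ t) {A : Set Ω} (hA : MeasurableSet[ℱ s] A) :
    ∫ ω in A, H.integral (w k) t ω ∂P = ∫ ω in A, H.integral (w k) s ω ∂P := by
  have hi : ∀ t, Integrable (H.integral (w k) t) P := fun t =>
    (H.memLp_integral hW k t).integrable one_le_two
  rw [← sub_eq_zero, ← integral_sub (hi t).integrableOn (hi s).integrableOn,
    ← integral_indicator (ℱ.le s A hA)]
  -- The end points of `(time i, time (i + 1)] ∩ (s, t]`, with `u i = v i` when the intersection is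
  -- empty.
  let u : ℕ → ℝ≥0 := fun i => max (H.time i) s
  let v : ℕ → ℝ≥0 := fun i => max (u i) (min (H.time (i + 1)) t)
  let Z : ℕ → Ω → ℝ := fun i => A.indicator (H.coeff i)
  have hZ : ∀ i, StronglyMeasurable[ℱ (u i)] (Z i) := fun i =>
    ((H.meas i).mono (ℱ.mono (le_max_left _ _))).indicator (ℱ.mono (le_max_right _ _) A hA)
  have huv : ∀ i, u i ≤ v i := fun i => le_max_left _ _
  have e : (A.indicator fun ω => H.integral (w k) t ω - H.integral (w k) s ω) =
      fun ω => ∑ i ∈ Finset.range H.n, Z i ω * (w k (v i) ω - w k (u i) ω) := by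
    ext ω
    by_cases hω : ω ∈ A
    · rw [Set.indicator_of_mem hω, SimpleProcess.integral, SimpleProcess.integral,
        ← Finset.sum_sub_distrib]
      refine Finset.sum_congr rfl fun i _ => ?_
      simp only [Z, Set.indicator_of_mem hω, u, v]
      have hm := H.mono (Nat.le_succ i)
      rw [← mul_sub]
      congr 1
      rcases le_total (H.time (i + 1)) s with h1 | h1
      · have h2 := hm.trans h1
        rw [min_eq_left (h1.trans hst), min_eq_left (h2.trans hst), min_eq_left h1, min_eq_left h2,
          max_eq_right h2, max_eq_left h1]; ring
      · rcases le_total t (H.time i) with h3 | h3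
        · have h4 := h3.trans hm
          rw [min_eq_right h3, min_eq_right h4, min_eq_right h1, min_eq_right (hst.trans h3),
            max_eq_left (hst.trans h3), max_eq_left h3]; ring
        · rw [min_eq_left h3, min_eq_right h1]
          rcases le_total (H.time i) s with h5 | h5
          · rw [min_eq_left h5, max_eq_right h5, max_eq_right (le_min h1 hst)]; ring
          · rw [min_eq_right h5, max_eq_left h5, max_eq_right (le_min hm h3)]; ring
    · rw [Set.indicator_of_notMem hω]
      simp [Z, Set.indicator_of_notMem hω]
  obtain ⟨C, hC⟩ := H.bdd
  rw [e, integral_finsetSum]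
  · exact Finset.sum_eq_zero fun i _ => hW.integral_mul_incr k (huv i) (hZ i)
  · intro i _
    have hb : ∀ ω, |Z i ω| ≤ max C 0 := fun ω => by
      by_cases hω : ω ∈ A
      · simp only [Z, Set.indicator_of_mem hω]; exact (hC i ω).trans (le_max_left _ _)
      · simp only [Z, Set.indicator_of_notMem hω, abs_zero]; exact le_max_right _ _
    exact ((HasMoments.of_bound ((hZ i).mono (ℱ.le _)).aestronglyMeasurable hb).mul
      (hW.hasMoments_incr k (huv i))).integrable

lemma IsItoIntegral.memLp_two (hW : IsWienerBasis P ℱ w) {k : ℕ} {G : ℝ≥0 × Ω → ℝ}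
    {M : ℝ≥0 → Ω → ℝ} (hM : IsItoIntegral ℱ P T (w k) G M) {t : ℝ≥0} (ht : t ≤ T) :
    MemLp (M t) 2 P := by
  obtain ⟨H, -, hH⟩ := hM.approx
  obtain ⟨n, hn⟩ := ((hH t ht).eventually_lt_const (by simp : (0 : ℝ≥0∞) < 1)).exists
  have h1 : MemLp (fun ω => (H n).integral (w k) t ω - M t ω) 2 P :=
    ⟨((H n).memLp_integral hW k t).1.sub (hM.aestronglyMeasurable ht).aestronglyMeasurable,
      hn.trans (by simp)⟩
  have h2 := ((H n).memLp_integral hW k t).sub h1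
  refine h2.ae_eq (Eventually.of_forall fun ω => ?_)
  simp

/-- The martingale property passes to limits in `L_1`, in particular to the `L_2` limits of the
definition. -/
lemma IsItoIntegral.setIntegral_eq (hW : IsWienerBasis P ℱ w) {k : ℕ} {G : ℝ≥0 × Ω → ℝ}
    {M : ℝ≥0 → Ω → ℝ} (hM : IsItoIntegral ℱ P T (w k) G M) {s t : ℝ≥0} (hst : s ≤ t) (ht : t ≤ T)
    {A : Set Ω} (hA : MeasurableSet[ℱ s] A) :
    ∫ ω in A, M t ω ∂P = ∫ ω in A, M s ω ∂P := by
  obtain ⟨H, -, hH⟩ := hM.approx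
  have h1 : ∀ u ≤ T, Tendsto (fun n => ∫ ω in A, (H n).integral (w k) u ω ∂P) atTop
      (𝓝 (∫ ω in A, M u ω ∂P)) := by
    intro u hu
    refine tendsto_setIntegral_of_L1' (M u)
      (hM.aestronglyMeasurable hu).aestronglyMeasurable
      (Eventually.of_forall fun n => ((H n).memLp_integral hW k u).integrable one_le_two) ?_ A
    refine tendsto_of_tendsto_of_tendsto_of_le_of_le tendsto_const_nhds (hH u hu)
      (fun _ => zero_le) fun n => ?_
    exact eLpNorm_le_eLpNorm_of_exponent_le one_le_two
      (((H n).memLp_integral hW k u).1.sub (hM.aestronglyMeasurable hu).aestronglyMeasurable)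
  have h2 := h1 t ht
  simp only [SimpleProcess.setIntegral_integral hW k _ hst hA] at h2
  exact tendsto_nhds_unique h2 (h1 s (hst.trans ht))

end Ito

/-! ### Moment bounds for finite sums of Itô integrals -/

lemma enorm_rpow_eq_ofReal (y : ℝ) {r : ℝ} (hr : 0 ≤ r) : ‖y‖ₑ ^ r = ENNReal.ofReal (|y| ^ r) := by
  rw [Real.enorm_eq_ofReal_abs, ENNReal.ofReal_rpow_of_nonneg (abs_nonneg y) hr]

/-- Fatou's lemma for an almost everywhere convergent sequence whose integrals are bounded by a
convergent sequence. -/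
lemma lintegral_le_of_tendsto_ae {α : Type*} {m : MeasurableSpace α} {μ : Measure α}
    {F : ℕ → α → ℝ≥0∞} {f : α → ℝ≥0∞} {b : ℕ → ℝ≥0∞} {B : ℝ≥0∞} (hF : ∀ n, AEMeasurable (F n) μ)
    (hlim : ∀ᵐ x ∂μ, Tendsto (fun n => F n x) atTop (𝓝 (f x))) (hb : ∀ n, ∫⁻ x, F n x ∂μ ≤ b n)
    (hB : Tendsto b atTop (𝓝 B)) : ∫⁻ x, f x ∂μ ≤ B := by
  calc ∫⁻ x, f x ∂μ = ∫⁻ x, liminf (fun n => F n x) atTop ∂μ :=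
        lintegral_congr_ae (hlim.mono fun x hx => hx.liminf_eq.symm)
    _ ≤ liminf (fun n => ∫⁻ x, F n x ∂μ) atTop := lintegral_liminf_le' hF
    _ ≤ liminf b atTop := liminf_le_liminf (Eventually.of_forall hb)
    _ = B := hB.liminf_eq

lemma tendsto_eLpNorm_sum {α ι : Type*} {m : MeasurableSpace α} {μ : Measure α} {r : ℝ≥0∞}
    (hr : 1 ≤ r) (s : Finset ι) {f : ι → ℕ → α → ℝ}
    (hf : ∀ i ∈ s, ∀ n, AEStronglyMeasurable (f i n) μ)
    (h : ∀ i ∈ s, Tendsto (fun n => eLpNorm (f i n) r μ) atTop (𝓝 0)) :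
    Tendsto (fun n => eLpNorm (fun x => ∑ i ∈ s, f i n x) r μ) atTop (𝓝 0) := by
  have h1 := tendsto_finsetSum s h
  simp only [Finset.sum_const_zero] at h1
  refine tendsto_of_tendsto_of_tendsto_of_le_of_le tendsto_const_nhds h1 (fun _ => zero_le)
    fun n => ?_
  have e : (fun x => ∑ i ∈ s, f i n x) = ∑ i ∈ s, f i n := by ext x; simp
  rw [e]
  exact eLpNorm_sum_le (fun i hi => hf i hi n) hr

/-- The triangle inequality in `ℓ₂`, with the error measured in the larger `ℓ₁` norm, which is
easier to sum over a finite set of indices. -/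
lemma sqrt_sum_sq_le {ι : Type*} (s : Finset ι) (V G : ι → ℝ) :
    √(∑ k ∈ s, V k ^ 2) ≤ √(∑ k ∈ s, G k ^ 2) + ∑ k ∈ s, |V k - G k| := by
  have hD : 0 ≤ ∑ k ∈ s, |V k - G k| := Finset.sum_nonneg fun _ _ => abs_nonneg _
  have h1 : √(∑ k ∈ s, (V k - G k) ^ 2) ≤ ∑ k ∈ s, |V k - G k| := by
    rw [Real.sqrt_le_left hD]
    have := Finset.sum_sq_le_sq_sum_of_nonneg (s := s) (f := fun k => |V k - G k|)
      fun _ _ => abs_nonneg _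
    simpa only [sq_abs] using this
  have h2 := Real.sum_mul_le_sqrt_mul_sqrt s G fun k => V k - G k
  rw [Real.sqrt_le_left (by positivity)]
  have h3 : ∑ k ∈ s, V k ^ 2 = ∑ k ∈ s, G k ^ 2 + 2 * ∑ k ∈ s, G k * (V k - G k) +
      ∑ k ∈ s, (V k - G k) ^ 2 := by
    rw [Finset.mul_sum, ← Finset.sum_add_distrib, ← Finset.sum_add_distrib]
    exact Finset.sum_congr rfl fun k _ => by ring
  have ha : 0 ≤ ∑ k ∈ s, G k ^ 2 := Finset.sum_nonneg fun _ _ => sq_nonneg _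
  have hb : 0 ≤ ∑ k ∈ s, (V k - G k) ^ 2 := Finset.sum_nonneg fun _ _ => sq_nonneg _
  have h4 := Real.sq_sqrt ha
  have h5 := Real.sq_sqrt hb
  have h6 := Real.sqrt_nonneg (∑ k ∈ s, G k ^ 2)
  have h7 := Real.sqrt_nonneg (∑ k ∈ s, (V k - G k) ^ 2)
  nlinarith [mul_le_mul_of_nonneg_left h1 h6, mul_le_mul h1 h1 h7 hD]

lemma sum_sq_rpow_le {ι : Type*} (s : Finset ι) (V G : ι → ℝ) {q : ℝ} (hq : 0 ≤ q) :
    (∑ k ∈ s, V k ^ 2) ^ (q / 2) ≤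
      2 ^ q * ((∑ k ∈ s, G k ^ 2) ^ (q / 2) + (∑ k ∈ s, |V k - G k|) ^ q) := by
  have e : ∀ U : ι → ℝ, (∑ k ∈ s, U k ^ 2) ^ (q / 2) = √(∑ k ∈ s, U k ^ 2) ^ q := fun U => by
    rw [Real.sqrt_eq_rpow, ← Real.rpow_mul (Finset.sum_nonneg fun _ _ => sq_nonneg _)]
    congr 1; ring
  rw [e, e]
  set a := √(∑ k ∈ s, G k ^ 2)
  set b := ∑ k ∈ s, |V k - G k|
  have ha : 0 ≤ a := Real.sqrt_nonneg _
  have hb : 0 ≤ b := Finset.sum_nonneg fun _ _ => abs_nonneg _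
  have h1 : √(∑ k ∈ s, V k ^ 2) ≤ 2 * max a b :=
    (sqrt_sum_sq_le s V G).trans (by linarith [le_max_left a b, le_max_right a b])
  have h2 : (max a b) ^ q ≤ a ^ q + b ^ q := by
    have h3 : 0 ≤ a ^ q := by positivity
    have h4 : 0 ≤ b ^ q := by positivity
    rcases max_choice a b with h | h <;> rw [h] <;> linarith
  calc _ ≤ (2 * max a b) ^ q := Real.rpow_le_rpow (Real.sqrt_nonneg _) h1 hq
    _ = 2 ^ q * (max a b) ^ q := Real.mul_rpow (by norm_num) (le_max_of_le_left ha)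
    _ ≤ _ := by gcongr

/-- The constant of the moment bounds for Itô integrals. -/
def itoConst (q : ℝ) : ℝ := bdgConst q * 2 ^ q

lemma itoConst_pos {q : ℝ} (hq : 2 ≤ q) : 0 < itoConst q := by
  have := bdgConst_pos hq
  unfold itoConst; positivity

section Ito
variable {Ω : Type*} {mΩ : MeasurableSpace Ω} {P : Measure Ω} [IsProbabilityMeasure P]
  {ℱ : Filtration ℝ≥0 mΩ} {w : ℕ → ℝ≥0 → Ω → ℝ} {T : ℝ≥0}

/-- The bound for simple processes passes to the limit by Fatou's lemma. The square function of the
approximants is compared with that of `G` through `sum_sq_rpow_le`: its factor `2 ^ q` goes into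
`itoConst`, and the error tends to zero in `L_q`. -/
theorem lintegral_sum_stepInt_ito_le (hW : IsWienerBasis P ℱ w) {σ : ℕ → ℝ≥0} (hσ : Monotone σ)
    (c : ℕ → ℝ) {n : ℕ} (hT : σ n ≤ T) (I : Finset ℕ) {G : ℕ → ℝ≥0 × Ω → ℝ}
    {M : ℕ → ℝ≥0 → Ω → ℝ} (hM : ∀ k ∈ I, IsItoIntegral ℱ P T (w k) (G k) (M k)) {q : ℝ}
    (hq : 2 ≤ q) (hG : ∀ k ∈ I, MemLp (G k) (ENNReal.ofReal q) (rectMeasure P T))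
    {A : ℝ} (hA : 0 < A) (hcA : stepInt σ (fun i => c i ^ 2) n (↑) ≤ A) :
    ∫⁻ ω, ‖∑ k ∈ I, stepInt σ c n (fun t => M k t ω)‖ₑ ^ q ∂P ≤
      ENNReal.ofReal (itoConst q * A ^ ((q - 2) / 2)) *
        ∫⁻ z, ENNReal.ofReal (stepFun σ c n z.1 ^ 2 * (∑ k ∈ I, G k z ^ 2) ^ (q / 2))
          ∂rectMeasure P T := by
  have hq0 : 0 < q := by linarith
  have hq1 : (1 : ℝ≥0∞) ≤ ENNReal.ofReal q := by
    rw [← ENNReal.ofReal_one]; exact ENNReal.ofReal_le_ofReal (by linarith)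
  have hbdg := bdgConst_pos hq
  have hex := fun k (hk : k ∈ I) => (hM k hk).exists_approx hW hq (hG k hk)
  have : Nonempty (SimpleProcess ℱ) :=
    ⟨⟨0, fun _ => 0, fun _ _ => 0, monotone_const, fun _ => stronglyMeasurable_const, 0, by simp⟩⟩
  choose! H hH1 hH2 using hex
  let X : Ω → ℝ := fun ω => ∑ k ∈ I, stepInt σ c n (fun t => M k t ω)
  let Y : ℕ → Ω → ℝ := fun m ω => ∑ k ∈ I, stepInt σ c n (fun t => (H k m).integral (w k) t ω)
  let D : ℕ → ℝ≥0 × Ω → ℝ := fun m z => ∑ k ∈ I, |(H k m).val z - G k z|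
  have hσT : ∀ i ≤ n, σ i ≤ T := fun i hi => (hσ hi).trans hT
  have hMm : ∀ k ∈ I, ∀ i ≤ n, AEStronglyMeasurable (M k (σ i)) P := fun k hk i hi =>
    ((hM k hk).aestronglyMeasurable (hσT i hi)).aestronglyMeasurable
  have hJm : ∀ k m t, AEStronglyMeasurable ((H k m).integral (w k) t) P := fun k m t =>
    ((H k m).memLp_integral hW k t).1
  have hXm : AEStronglyMeasurable X P := by
    refine Finset.aestronglyMeasurable_fun_sum _ fun k hk =>
      Finset.aestronglyMeasurable_fun_sum _ fun i hi => ?_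
    have := Finset.mem_range.1 hi
    exact ((hMm k hk (i + 1) this).sub (hMm k hk i this.le)).const_mul _
  have hYm : ∀ m, AEStronglyMeasurable (Y m) P := fun m =>
    Finset.aestronglyMeasurable_fun_sum _ fun k _ =>
      Finset.aestronglyMeasurable_fun_sum _ fun i _ => ((hJm k m _).sub (hJm k m _)).const_mul _
  have hDm : ∀ m, AEStronglyMeasurable (D m) (rectMeasure P T) := fun m =>
    Finset.aestronglyMeasurable_fun_sum _ fun k hk =>
      ((H k m).stronglyMeasurable_val.aestronglyMeasurable.sub (hG k hk).1).norm
  have hYX : Tendsto (fun m => eLpNorm (Y m - X) 2 P) atTop (𝓝 0) := by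
    have e : ∀ m, Y m - X = fun ω => ∑ k ∈ I, ∑ i ∈ Finset.range n, c i *
        (((H k m).integral (w k) (σ (i + 1)) ω - M k (σ (i + 1)) ω) -
          ((H k m).integral (w k) (σ i) ω - M k (σ i) ω)) := by
      intro m; ext ω
      simp only [Y, X, Pi.sub_apply, stepInt]
      rw [← Finset.sum_sub_distrib]
      refine Finset.sum_congr rfl fun k _ => ?_
      rw [← Finset.sum_sub_distrib]
      exact Finset.sum_congr rfl fun i _ => by ring
    simp only [e]
    have hm2 : ∀ k ∈ I, ∀ m, ∀ i ≤ n, AEStronglyMeasurable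
        (fun ω => (H k m).integral (w k) (σ i) ω - M k (σ i) ω) P := fun k hk m i hi =>
      (hJm k m _).sub (hMm k hk i hi)
    refine tendsto_eLpNorm_sum one_le_two I (fun k hk m => ?_) fun k hk => ?_
    · refine Finset.aestronglyMeasurable_fun_sum _ fun i hi => ?_
      have := Finset.mem_range.1 hi
      exact ((hm2 k hk m _ this).sub (hm2 k hk m _ this.le)).const_mul _
    refine tendsto_eLpNorm_sum one_le_two _ (fun i hi m => ?_) fun i hi => ?_
    · have := Finset.mem_range.1 hi
      exact ((hm2 k hk m _ this).sub (hm2 k hk m _ this.le)).const_mul _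
    have hi' := Finset.mem_range.1 hi
    have h1 := (hH2 k hk _ (hσT (i + 1) hi')).add (hH2 k hk _ (hσT i hi'.le))
    have h2 := ENNReal.Tendsto.const_mul (a := ‖c i‖ₑ) h1 (Or.inr (by simp))
    rw [add_zero, mul_zero] at h2
    refine tendsto_of_tendsto_of_tendsto_of_le_of_le tendsto_const_nhds h2 (fun _ => zero_le)
      fun m => ?_
    have e2 : (fun ω => c i * (((H k m).integral (w k) (σ (i + 1)) ω - M k (σ (i + 1)) ω) -
          ((H k m).integral (w k) (σ i) ω - M k (σ i) ω))) =
        c i • ((fun ω => (H k m).integral (w k) (σ (i + 1)) ω - M k (σ (i + 1)) ω) -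
          fun ω => (H k m).integral (w k) (σ i) ω - M k (σ i) ω) := by ext ω; simp
    rw [e2, eLpNorm_const_smul]
    exact mul_le_mul_right (eLpNorm_sub_le (hm2 k hk m _ hi') (hm2 k hk m _ hi'.le) one_le_two) _
  -- Finitely many times and indices are involved, so the sums converge in `L_2` and hence almost
  -- surely along a subsequence.
  obtain ⟨ns, hns, hae⟩ := (tendstoInMeasure_of_tendsto_eLpNorm two_ne_zero hYm hXm
    hYX).exists_seq_tendsto_ae
  have hDlim : Tendsto (fun m => ∫⁻ z, ‖D m z‖ₑ ^ q ∂rectMeasure P T) atTop (𝓝 0) := by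
    have h1 : Tendsto (fun m => eLpNorm (D m) (ENNReal.ofReal q) (rectMeasure P T)) atTop
        (𝓝 0) := by
      refine tendsto_eLpNorm_sum hq1 I (f := fun k m z => |(H k m).val z - G k z|)
        (fun k hk m => ((H k m).stronglyMeasurable_val.aestronglyMeasurable.sub (hG k hk).1).norm)
        fun k hk => ?_
      refine (hH1 k hk).congr fun m => ?_
      exact (eLpNorm_norm _).symm
    have h2 := h1.ennrpow_const q
    rw [ENNReal.zero_rpow_of_pos hq0] at h2
    refine h2.congr fun m => ?_
    rw [eLpNorm_eq_lintegral_rpow_enorm_toReal (by simpa using hq0) ENNReal.ofReal_ne_top,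
      ENNReal.toReal_ofReal hq0.le, ← ENNReal.rpow_mul, one_div_mul_cancel hq0.ne',
      ENNReal.rpow_one]
  set R := ∫⁻ z, ENNReal.ofReal (stepFun σ c n z.1 ^ 2 * (∑ k ∈ I, G k z ^ 2) ^ (q / 2))
    ∂rectMeasure P T
  let B : ℝ := ∑ i ∈ Finset.range n, |c i|
  let K : ℝ := bdgConst q * A ^ ((q - 2) / 2)
  have hK : 0 ≤ K := by positivity
  have hbound : ∀ m, ∫⁻ ω, ‖Y m ω‖ₑ ^ q ∂P ≤ ENNReal.ofReal K *
      (ENNReal.ofReal (2 ^ q) * R +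
        ENNReal.ofReal (2 ^ q * B ^ 2) * ∫⁻ z, ‖D m z‖ₑ ^ q ∂rectMeasure P T) := by
    intro m
    have h1 := lintegral_sum_stepInt_le hW hσ c hT I
      (fun k _ => (H k m).isElementary (w k)) hq hA hcA
    simp only [← enorm_rpow_eq_ofReal _ hq0.le] at h1
    refine h1.trans (mul_le_mul_right ?_ _)
    rw [← lintegral_const_mul' _ _ ENNReal.ofReal_ne_top,
      ← lintegral_const_mul' _ _ ENNReal.ofReal_ne_top]
    rw [← lintegral_add_right' _ (((hDm m).enorm.pow_const q).const_mul _)]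
    refine lintegral_mono fun z => ?_
    have hs : stepFun σ c n z.1 ^ 2 ≤ B ^ 2 := by
      rw [← sq_abs]
      exact pow_le_pow_left₀ (abs_nonneg _) (abs_stepFun_le c n z.1) 2
    have hD0 : 0 ≤ D m z := Finset.sum_nonneg fun _ _ => abs_nonneg _
    have hGs : 0 ≤ ∑ k ∈ I, G k z ^ 2 := Finset.sum_nonneg fun _ _ => sq_nonneg _
    rw [enorm_rpow_eq_ofReal _ hq0.le, abs_of_nonneg hD0, ← ENNReal.ofReal_mul (by positivity),
      ← ENNReal.ofReal_mul (by positivity), ← ENNReal.ofReal_add (by positivity) (by positivity)]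
    refine ENNReal.ofReal_le_ofReal ?_
    have h3 := sum_sq_rpow_le I (fun k => (H k m).val z) (fun k => G k z) hq0.le
    calc stepFun σ c n z.1 ^ 2 * (∑ k ∈ I, (H k m).val z ^ 2) ^ (q / 2) ≤
          stepFun σ c n z.1 ^ 2 * (2 ^ q * ((∑ k ∈ I, G k z ^ 2) ^ (q / 2) + D m z ^ q)) := by
          gcongr
      _ = 2 ^ q * (stepFun σ c n z.1 ^ 2 * (∑ k ∈ I, G k z ^ 2) ^ (q / 2)) +
          2 ^ q * stepFun σ c n z.1 ^ 2 * D m z ^ q := by ring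
      _ ≤ _ := by gcongr
  have hlim : Tendsto (fun m => ENNReal.ofReal K * (ENNReal.ofReal (2 ^ q) * R +
      ENNReal.ofReal (2 ^ q * B ^ 2) * ∫⁻ z, ‖D (ns m) z‖ₑ ^ q ∂rectMeasure P T)) atTop
      (𝓝 (ENNReal.ofReal K * (ENNReal.ofReal (2 ^ q) * R + ENNReal.ofReal (2 ^ q * B ^ 2) * 0))) :=
    ENNReal.Tendsto.const_mul (tendsto_const_nhds.add (ENNReal.Tendsto.const_mul
      (hDlim.comp hns.tendsto_atTop) (Or.inr ENNReal.ofReal_ne_top)))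
      (Or.inr ENNReal.ofReal_ne_top)
  have hfin := lintegral_le_of_tendsto_ae (f := fun ω => ‖X ω‖ₑ ^ q)
    (fun m => ((hYm (ns m)).enorm.pow_const q))
    (hae.mono fun ω hω => ((continuous_enorm.tendsto _).comp hω).ennrpow_const q)
    (fun m => hbound (ns m)) hlim
  refine hfin.trans (le_of_eq ?_)
  rw [mul_zero, add_zero, ← mul_assoc, ← ENNReal.ofReal_mul hK]
  congr 2
  simp only [K, itoConst]; ring

/-- The moments of `∑_k M^k_t`. -/
lemma lintegral_sum_ito_le (hW : IsWienerBasis P ℱ w) (hT : 0 < T) (I : Finset ℕ)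
    {G : ℕ → ℝ≥0 × Ω → ℝ} {M : ℕ → ℝ≥0 → Ω → ℝ}
    (hM : ∀ k ∈ I, IsItoIntegral ℱ P T (w k) (G k) (M k)) {q : ℝ} (hq : 2 ≤ q)
    (hG : ∀ k ∈ I, MemLp (G k) (ENNReal.ofReal q) (rectMeasure P T)) {t : ℝ≥0} (ht : t ≤ T) :
    ∫⁻ ω, ‖∑ k ∈ I, M k t ω‖ₑ ^ q ∂P ≤ ENNReal.ofReal (itoConst q * (T : ℝ) ^ ((q - 2) / 2)) *
      ∫⁻ z, ENNReal.ofReal ((∑ k ∈ I, G k z ^ 2) ^ (q / 2)) ∂rectMeasure P T := by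
  have hσ : Monotone fun i : ℕ => if i = 0 then 0 else t := by
    intro i j hij
    simp only
    split_ifs with h1 h2
    · exact le_rfl
    · exact zero_le
    · omega
    · exact le_rfl
  have h := lintegral_sum_stepInt_ito_le hW hσ (fun _ => 1) (n := 1) (by simpa using ht) I hM hq hG
    (A := T) hT (by simpa [stepInt] using ht)
  simp only [stepInt, Finset.range_one, Finset.sum_singleton, one_mul] at h
  have h0 : ∀ᵐ ω ∂P, ∀ k ∈ I, M k 0 ω = 0 :=
    (Finset.eventually_all I).2 fun k hk => (hM k hk).ae_zero
  have e : ∫⁻ ω, ‖∑ k ∈ I, M k t ω‖ₑ ^ q ∂P = ∫⁻ ω, ‖∑ k ∈ I, (M k (if 0 + 1 = 0 then 0 else t) ω -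
      M k (if 0 = 0 then 0 else t) ω)‖ₑ ^ q ∂P := by
    refine lintegral_congr_ae ?_
    filter_upwards [h0] with ω hω
    congr 2
    refine Finset.sum_congr rfl fun k hk => ?_
    simp [hω k hk]
  rw [e]
  refine h.trans (mul_le_mul_right (lintegral_mono fun z => ENNReal.ofReal_le_ofReal ?_) _)
  have h3 : stepFun (fun i : ℕ => if i = 0 then 0 else t) (fun _ => (1 : ℝ)) 1 z.1 ^ 2 ≤ 1 := by
    rcases stepFun_eq_or hσ 1 z.1 with h | ⟨i, _, _, h⟩ <;> rw [h] <;> norm_num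
  exact mul_le_of_le_one_left (Real.rpow_nonneg (Finset.sum_nonneg fun _ _ => sq_nonneg _) _) h3

lemma lintegral_sum_sq_rpow_ne_top {α : Type*} {m : MeasurableSpace α} {μ : Measure α}
    (I : Finset ℕ) {G : ℕ → α → ℝ} {q : ℝ} (hq : 2 ≤ q)
    (hG : ∀ k ∈ I, MemLp (G k) (ENNReal.ofReal q) μ) :
    ∫⁻ z, ENNReal.ofReal ((∑ k ∈ I, G k z ^ 2) ^ (q / 2)) ∂μ ≠ ∞ := by
  have hq0 : 0 < q := by linarith
  have h1 : MemLp (fun z => ∑ k ∈ I, |G k z|) (ENNReal.ofReal q) μ :=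
    memLp_finsetSum I fun k hk => (hG k hk).norm
  have h2 := h1.eLpNorm_lt_top
  rw [eLpNorm_lt_top_iff_lintegral_rpow_enorm_lt_top (by simpa using hq0) ENNReal.ofReal_ne_top,
    ENNReal.toReal_ofReal hq0.le] at h2
  refine (lt_of_le_of_lt (lintegral_mono fun z => ?_) h2).ne
  rw [enorm_rpow_eq_ofReal _ hq0.le]
  refine ENNReal.ofReal_le_ofReal ?_
  rw [show q / 2 = (1 / 2) * q by ring, Real.rpow_mul (Finset.sum_nonneg fun _ _ => sq_nonneg _),
    ← Real.sqrt_eq_rpow]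
  refine Real.rpow_le_rpow (Real.sqrt_nonneg _) ?_ hq0.le
  have := sqrt_sum_sq_le I (fun k => G k z) fun _ => 0
  simp only [sub_zero] at this
  rw [abs_of_nonneg (Finset.sum_nonneg fun _ _ => abs_nonneg _)]
  simpa using this

/-- The maximal inequality for finite sums of Itô integrals. -/
theorem exists_sup_sum_ito_le (hW : IsWienerBasis P ℱ w) (hT : 0 < T) (I : Finset ℕ)
    {G : ℕ → ℝ≥0 × Ω → ℝ} {M : ℕ → ℝ≥0 → Ω → ℝ}
    (hM : ∀ k ∈ I, IsItoIntegral ℱ P T (w k) (G k) (M k)) {q : ℝ} (hq : 2 ≤ q)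
    (hG : ∀ k ∈ I, MemLp (G k) (ENNReal.ofReal q) (rectMeasure P T)) :
    ∃ Z : Ω → ℝ≥0∞, Measurable Z ∧ (∀ᵐ ω ∂P, ∀ t ≤ T, ‖∑ k ∈ I, M k t ω‖ₑ ≤ Z ω) ∧
      ∫⁻ ω, Z ω ^ q ∂P ≤ ENNReal.ofReal (4 ^ q * (itoConst q * (T : ℝ) ^ ((q - 2) / 2))) *
        ∫⁻ z, ENNReal.ofReal ((∑ k ∈ I, G k z ^ 2) ^ (q / 2)) ∂rectMeasure P T := by
  have hq0 : 0 < q := by linarith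
  let X : ℝ≥0 → Ω → ℝ := fun t ω => ∑ k ∈ I, M k t ω
  have hXad : ∀ t ≤ T, StronglyMeasurable[ℱ t] (X t) := fun t ht =>
    Finset.stronglyMeasurable_fun_sum _ fun k hk => (hM k hk).adapted t ht
  have hXq : ∀ t ≤ T, MemLp (X t) (ENNReal.ofReal q) P := fun t ht => by
    refine ⟨((hXad t ht).mono (ℱ.le t)).aestronglyMeasurable, ?_⟩
    rw [eLpNorm_lt_top_iff_lintegral_rpow_enorm_lt_top (by simpa using hq0) ENNReal.ofReal_ne_top,
      ENNReal.toReal_ofReal hq0.le]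
    exact (lintegral_sum_ito_le hW hT I hM hq hG ht).trans_lt (ENNReal.mul_lt_top
      ENNReal.ofReal_lt_top (lintegral_sum_sq_rpow_ne_top I hq hG).lt_top)
  have hXi : ∀ s t, s ≤ t → t ≤ T → ∀ A, MeasurableSet[ℱ s] A →
      ∫ ω in A, X t ω ∂P = ∫ ω in A, X s ω ∂P := fun s t hst ht A hA => by
    have hi : ∀ k ∈ I, ∀ u ≤ T, IntegrableOn (M k u) A P := fun k hk u hu =>
      (((hM k hk).memLp_two hW hu).integrable one_le_two).integrableOn
    rw [integral_finsetSum _ fun k hk => hi k hk t ht,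
      integral_finsetSum _ fun k hk => hi k hk s (hst.trans ht)]
    exact Finset.sum_congr rfl fun k hk => (hM k hk).setIntegral_eq hW hst ht hA
  -- Uniform grids with the last point `T` repeated forever, which gives discrete filtrations on all
  -- of `ℕ`.
  let τ : ℕ → ℕ → ℝ≥0 := fun N i => T * (min i (N + 1) : ℕ) / (N + 1)
  have hτm : ∀ N, Monotone (τ N) := fun N i j hij => by
    simp only [τ]
    gcongr
  have hτT : ∀ N i, τ N i ≤ T := fun N i => by
    simp only [τ]
    rw [div_le_iff₀ (by positivity)]
    gcongr
    exact_mod_cast min_le_right _ _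
  have hτN : ∀ N, τ N (N + 1) = T := fun N => by
    simp only [τ, min_self, Nat.cast_add, Nat.cast_one]
    rw [mul_div_assoc, div_self (by positivity), mul_one]
  let 𝒢 : ℕ → Filtration ℕ mΩ := fun N =>
    ⟨fun i => ℱ (τ N i), fun i j hij => ℱ.mono (hτm N hij), fun i => ℱ.le _⟩
  let R : ℕ → Ω → ℝ := fun N => runMax (fun i => X (τ N i)) (N + 1)
  have hR : ∀ N, Integrable (fun ω => R N ω ^ q) P ∧
      ∫ ω, R N ω ^ q ∂P ≤ 4 ^ q * ∫ ω, |X (τ N (N + 1)) ω| ^ q ∂P := fun N =>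
    integral_runMax_rpow_le (𝒢 := 𝒢 N) (fun i => hXad _ (hτT N i)) hq
      (fun i _ => hXq _ (hτT N i)) fun i hi A hA => hXi _ _ (hτm N hi) (hτT N _) A hA
  have hR0 : ∀ N ω, 0 ≤ R N ω := fun N ω => runMax_nonneg _ _ _
  have hRm : ∀ N, Measurable (R N) := fun N =>
    ((stronglyMeasurable_runMax (𝒢 := 𝒢 N) (fun i => hXad _ (hτT N i)) (N + 1)).mono
      ((𝒢 N).le _)).measurable
  have hRb : ∀ N, ∫⁻ ω, ‖R N ω‖ₑ ^ q ∂P ≤ ENNReal.ofReal (4 ^ q) * ∫⁻ ω, ‖X T ω‖ₑ ^ q ∂P := by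
    intro N
    obtain ⟨h1, h2⟩ := hR N
    rw [hτN] at h2
    have h3 : Integrable (fun ω => |X T ω| ^ q) P := by
      have := (hXq T le_rfl).integrable_norm_rpow (by simpa using hq0) ENNReal.ofReal_ne_top
      simpa [ENNReal.toReal_ofReal hq0.le] using this
    simp only [enorm_rpow_eq_ofReal _ hq0.le, abs_of_nonneg (hR0 N _)]
    rw [← ofReal_integral_eq_lintegral_ofReal h1 (Eventually.of_forall fun ω =>
        Real.rpow_nonneg (hR0 N ω) q),
      ← ofReal_integral_eq_lintegral_ofReal h3 (Eventually.of_forall fun ω => by positivity),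
      ← ENNReal.ofReal_mul (by positivity)]
    exact ENNReal.ofReal_le_ofReal h2
  -- The grids are not nested, so the maxima need not increase. The lower limit still dominates the
  -- path at every time by continuity, and Fatou's lemma bounds its moments.
  refine ⟨fun ω => liminf (fun N => ‖R N ω‖ₑ) atTop, .liminf fun N => (hRm N).enorm, ?_, ?_⟩
  · have hc : ∀ᵐ ω ∂P, ∀ k ∈ I, ContinuousOn (fun t => M k t ω) (Set.Icc 0 T) :=
      (Finset.eventually_all I).2 fun k hk => (hM k hk).continuous
    filter_upwards [hc] with ω hω t ht
    have hcX : ContinuousOn (fun t => X t ω) (Set.Icc 0 T) := continuousOn_finsetSum _ hω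
    -- The index of the last grid point that is not after `t`; these points converge to `t`.
    let i : ℕ → ℕ := fun N => ⌊(t / T : ℝ≥0) * (N + 1)⌋₊
    have htT : t / T ≤ 1 := (div_le_one₀ hT).2 ht
    have hi : ∀ N, i N ≤ N + 1 := fun N => by
      refine Nat.floor_le_of_le ?_
      push_cast
      exact mul_le_of_le_one_left zero_le htT
    have e : ∀ N, τ N (i N) = T * ((i N : ℝ≥0) / (N + 1)) := fun N => by
      simp only [τ, min_eq_left (hi N)]; rw [mul_div_assoc]
    have hlim0 : Tendsto (fun N : ℕ => ((i N : ℝ≥0) / ((N : ℝ≥0) + 1))) atTop (𝓝 (t / T)) := by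
      have h1 := (tendsto_nat_floor_mul_div_atTop (R := ℝ) (a := ((t / T : ℝ≥0) : ℝ))
        (NNReal.coe_nonneg _)).comp (tendsto_natCast_atTop_atTop.comp (tendsto_add_atTop_nat 1))
      rw [← NNReal.tendsto_coe]
      refine h1.congr fun N => ?_
      simp only [Function.comp, i, NNReal.coe_div, NNReal.coe_natCast, NNReal.coe_add,
        NNReal.coe_one, Nat.cast_add, Nat.cast_one]
      congr 2
    have hlim : Tendsto (fun N => τ N (i N)) atTop (𝓝 t) := by
      simp only [e]
      have h2 := hlim0.const_mul T
      rwa [mul_div_cancel₀ _ hT.ne'] at h2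
    have hlim2 : Tendsto (fun N => X (τ N (i N)) ω) atTop (𝓝 (X t ω)) := by
      refine (hcX t ⟨zero_le, ht⟩).tendsto.comp (tendsto_nhdsWithin_iff.2 ⟨hlim, ?_⟩)
      exact Eventually.of_forall fun N => ⟨zero_le, hτT N _⟩
    have h3 := ((continuous_enorm.tendsto _).comp hlim2).liminf_eq
    refine h3.symm.le.trans (liminf_le_liminf (Eventually.of_forall fun N => ?_))
    simp only [Function.comp]
    refine enorm_le_iff_norm_le.2 ?_
    rw [Real.norm_eq_abs, Real.norm_of_nonneg (hR0 N ω)]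
    exact abs_le_runMax (fun i => X (τ N i)) (hi N) ω
  · have h1 : ∀ ω, (liminf (fun N => ‖R N ω‖ₑ) atTop) ^ q ≤ liminf (fun N => ‖R N ω‖ₑ ^ q) atTop := by
      intro ω
      have := (ENNReal.orderIsoRpow q hq0).liminf_apply (f := atTop) (u := fun N => ‖R N ω‖ₑ)
      exact this.le
    calc _ ≤ ∫⁻ ω, liminf (fun N => ‖R N ω‖ₑ ^ q) atTop ∂P := lintegral_mono h1
      _ ≤ liminf (fun N => ∫⁻ ω, ‖R N ω‖ₑ ^ q ∂P) atTop :=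
        lintegral_liminf_le fun N => (hRm N).enorm.pow_const q
      _ ≤ liminf (fun _ : ℕ => ENNReal.ofReal (4 ^ q) * ∫⁻ ω, ‖X T ω‖ₑ ^ q ∂P) atTop :=
        liminf_le_liminf (Eventually.of_forall hRb)
      _ = ENNReal.ofReal (4 ^ q) * ∫⁻ ω, ‖X T ω‖ₑ ^ q ∂P := tendsto_const_nhds.liminf_eq
      _ ≤ _ := by
        rw [ENNReal.ofReal_mul (by positivity), mul_assoc]
        exact mul_le_mul_right (lintegral_sum_ito_le hW hT I hM hq hG le_rfl) _

end Ito

/-! ### The stochastic integral with respect to infinitely many Wiener processes -/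

lemma ell2_sum_sq_le (x : ell2) (I : Finset ℕ) : ∑ k ∈ I, x k ^ 2 ≤ ‖x‖ ^ 2 := by
  have h := lp.sum_rpow_le_norm_rpow (p := 2) (by simp) x I
  simpa using h

lemma ell2_hasSum_sq (x : ell2) : HasSum (fun k => x k ^ 2) (‖x‖ ^ 2) := by
  have h := lp.hasSum_norm (p := 2) (by simp) x
  simpa using h

lemma ell2_abs_apply_le (x : ell2) (k : ℕ) : |x k| ≤ ‖x‖ := by
  have := lp.norm_apply_le_norm (p := 2) (by simp) x k
  simpa using this

lemma continuous_ell2_apply (k : ℕ) : Continuous fun x : ell2 => x k := by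
  refine LipschitzWith.continuous (K := 1) (LipschitzWith.of_dist_le_mul fun x y => ?_)
  have := ell2_abs_apply_le (x - y) k
  simpa [Real.dist_eq, dist_eq_norm] using this

section Ito
variable {Ω : Type*} {mΩ : MeasurableSpace Ω} {P : Measure Ω} [IsProbabilityMeasure P]
  {ℱ : Filtration ℝ≥0 mΩ} {w : ℕ → ℝ≥0 → Ω → ℝ} {T : ℝ≥0}

lemma memLp_ell2_apply {α : Type*} {m : MeasurableSpace α} {μ : Measure α} {r : ℝ≥0∞}
    {G : α → ell2} (hG : MemLp G r μ) (k : ℕ) : MemLp (fun z => G z k) r μ :=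
  hG.mono ((continuous_ell2_apply k).comp_aestronglyMeasurable hG.1)
    (Eventually.of_forall fun z => ell2_abs_apply_le (G z) k)

lemma sum_ell2_rpow_le (x : ell2) (I : Finset ℕ) {q : ℝ} (hq : 0 ≤ q) :
    ENNReal.ofReal ((∑ k ∈ I, x k ^ 2) ^ (q / 2)) ≤ ‖x‖ₑ ^ q := by
  rw [← ofReal_norm, ENNReal.ofReal_rpow_of_nonneg (norm_nonneg _) hq]
  refine ENNReal.ofReal_le_ofReal ?_
  calc (∑ k ∈ I, x k ^ 2) ^ (q / 2) ≤ (‖x‖ ^ 2) ^ (q / 2) :=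
        Real.rpow_le_rpow (Finset.sum_nonneg fun _ _ => sq_nonneg _) (ell2_sum_sq_le x I)
          (by positivity)
    _ = ‖x‖ ^ q := by
      rw [← Real.rpow_natCast, ← Real.rpow_mul (norm_nonneg _)]
      congr 1; push_cast; ring

lemma tendsto_lintegral_ell2_tail {α : Type*} {m : MeasurableSpace α} {μ : Measure α} {q : ℝ}
    (hq : 0 < q) {G : α → ell2} (hG : MemLp G (ENNReal.ofReal q) μ) :
    Tendsto (fun K : ℕ => ∫⁻ z, ENNReal.ofReal
      ((‖G z‖ ^ 2 - ∑ k ∈ Finset.range K, G z k ^ 2) ^ (q / 2)) ∂μ) atTop (𝓝 0) := by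
  have hGf : ∫⁻ x, ‖G x‖ₑ ^ q ∂μ ≠ ∞ := by
    have := hG.eLpNorm_lt_top
    rw [eLpNorm_lt_top_iff_lintegral_rpow_enorm_lt_top (by simpa using hq) ENNReal.ofReal_ne_top,
      ENNReal.toReal_ofReal hq.le] at this
    exact this.ne
  have h : Tendsto (fun K : ℕ => ∫⁻ z, ENNReal.ofReal
      ((‖G z‖ ^ 2 - ∑ k ∈ Finset.range K, G z k ^ 2) ^ (q / 2)) ∂μ) atTop (𝓝 (∫⁻ _, 0 ∂μ)) := by
    refine tendsto_lintegral_of_dominated_convergence' (fun x => ‖G x‖ₑ ^ q) (fun n => ?_)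
      (fun n => Eventually.of_forall fun x => ?_) hGf (Eventually.of_forall fun x => ?_)
    · have h1 : AEMeasurable (fun z => ‖G z‖ ^ 2 - ∑ k ∈ Finset.range n, G z k ^ 2) μ :=
        (hG.1.norm.aemeasurable.pow_const 2).sub (Finset.aemeasurable_fun_sum _ fun k _ =>
          ((continuous_ell2_apply k).comp_aestronglyMeasurable hG.1).aemeasurable.pow_const 2)
      exact (h1.pow_const (q / 2)).ennreal_ofReal
    · beta_reduce
      rw [← ofReal_norm, ENNReal.ofReal_rpow_of_nonneg (norm_nonneg _) hq.le]
      refine ENNReal.ofReal_le_ofReal ?_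
      have h0 := ell2_sum_sq_le (G x) (Finset.range n)
      have h1 : 0 ≤ ∑ k ∈ Finset.range n, G x k ^ 2 := Finset.sum_nonneg fun _ _ => sq_nonneg _
      calc _ ≤ (‖G x‖ ^ 2) ^ (q / 2) :=
            Real.rpow_le_rpow (by linarith) (by linarith) (by positivity)
        _ = ‖G x‖ ^ q := by
          rw [← Real.rpow_natCast, ← Real.rpow_mul (norm_nonneg _)]
          congr 1; push_cast; ring
    · have h1 := (ell2_hasSum_sq (G x)).tendsto_sum_nat.const_sub (‖G x‖ ^ 2)
      rw [sub_self] at h1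
      have h2 := h1.rpow_const (p := q / 2) (Or.inr (by positivity))
      rw [Real.zero_rpow (by positivity)] at h2
      simpa using ENNReal.tendsto_ofReal h2
  rwa [lintegral_zero] at h

lemma lintegral_le_of_lintegral_rpow_le {Z : Ω → ℝ≥0∞} (hZ : AEMeasurable Z P) {q : ℝ}
    (hq : 1 ≤ q) {δ : ℝ≥0∞} (h : ∫⁻ ω, Z ω ^ q ∂P ≤ δ ^ q) : ∫⁻ ω, Z ω ∂P ≤ δ := by
  have hq0 : 0 < q := by linarith
  have h1 := eLpNorm_le_eLpNorm_of_exponent_le (μ := P) (f := Z) (p := 1) (q := ENNReal.ofReal q)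
    (by rw [← ENNReal.ofReal_one]; exact ENNReal.ofReal_le_ofReal hq) hZ.aestronglyMeasurable
  rw [eLpNorm_one_eq_lintegral_enorm, eLpNorm_eq_lintegral_rpow_enorm_toReal (by simpa using hq0)
    ENNReal.ofReal_ne_top, ENNReal.toReal_ofReal hq0.le] at h1
  simp only [enorm_eq_self] at h1
  refine h1.trans ((ENNReal.rpow_le_rpow h (by positivity)).trans (le_of_eq ?_))
  rw [← ENNReal.rpow_mul, mul_one_div_cancel hq0.ne', ENNReal.rpow_one]

/-- `X` is the continuous process `∑_k M^k` on `[0, T]` (the limit of the partial sums along `ns`),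
where the `M^k` are the Itô integrals of the coordinates of `G`. -/
structure IsItoSum (P : Measure Ω) (T : ℝ≥0) (q : ℝ) (G : ℝ≥0 × Ω → ell2) (M : ℕ → ℝ≥0 → Ω → ℝ)
    (ns : ℕ → ℕ) (X : ℝ≥0 → Ω → ℝ) : Prop where
  strictMono : StrictMono ns
  aestronglyMeasurable : ∀ t ≤ T, AEStronglyMeasurable (X t) P
  zero : ∀ᵐ ω ∂P, X 0 ω = 0
  continuousOn : ∀ᵐ ω ∂P, ContinuousOn (fun t => X t ω) (Set.Icc 0 T)
  tendsto : ∀ᵐ ω ∂P, TendstoUniformlyOn (fun n t => ∑ k ∈ Finset.range (ns n), M k t ω)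
    (fun t => X t ω) atTop (Set.Icc 0 T)
  exists_sup_le : ∃ Z : Ω → ℝ≥0∞, Measurable Z ∧ (∀ᵐ ω ∂P, ∀ t ≤ T, ‖X t ω‖ₑ ≤ Z ω) ∧
      ∫⁻ ω, Z ω ^ q ∂P ≤ ENNReal.ofReal (4 ^ q * (itoConst q * (T : ℝ) ^ ((q - 2) / 2))) *
        ∫⁻ z, ‖G z‖ₑ ^ q ∂rectMeasure P T
  stepInt_le : ∀ (σ : ℕ → ℝ≥0), Monotone σ → ∀ (c : ℕ → ℝ) (n : ℕ), σ n ≤ T → ∀ A : ℝ, 0 < A →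
      stepInt σ (fun i => c i ^ 2) n (↑) ≤ A →
      ∫⁻ ω, ‖stepInt σ c n (fun t => X t ω)‖ₑ ^ q ∂P ≤
        ENNReal.ofReal (itoConst q * A ^ ((q - 2) / 2)) *
          ∫⁻ z, ENNReal.ofReal (stepFun σ c n z.1 ^ 2) * ‖G z‖ₑ ^ q ∂rectMeasure P T

/-- The tails of the `ℓ₂` norm tend to zero in `L_q`, so partial sums can be grouped into blocks
whose suprema in time have summable means. Almost surely the blocks then converge uniformly on `[0,
T]`, and the limit inherits continuity and, by Fatou's lemma, both moment bounds. -/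
theorem exists_isItoSum (hW : IsWienerBasis P ℱ w) (hT : 0 < T) {q : ℝ} (hq : 2 ≤ q)
    {G : ℝ≥0 × Ω → ell2} (hG : MemLp G (ENNReal.ofReal q) (rectMeasure P T))
    {M : ℕ → ℝ≥0 → Ω → ℝ} (hM : ∀ k, IsItoIntegral ℱ P T (w k) (fun z => G z k) (M k)) :
    ∃ (ns : ℕ → ℕ) (X : ℝ≥0 → Ω → ℝ), IsItoSum P T q G M ns X := by
  have hq0 : 0 < q := by linarith
  have hito := itoConst_pos hq
  let C : ℝ := 4 ^ q * (itoConst q * (T : ℝ) ^ ((q - 2) / 2))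
  have hGk : ∀ k, MemLp (fun z => G z k) (ENNReal.ofReal q) (rectMeasure P T) :=
    fun k => memLp_ell2_apply hG k
  -- the tails
  have htail : ∀ n : ℕ, ∀ᶠ K in atTop, ENNReal.ofReal C * ∫⁻ z, ENNReal.ofReal
      ((‖G z‖ ^ 2 - ∑ k ∈ Finset.range K, G z k ^ 2) ^ (q / 2)) ∂rectMeasure P T <
      (((1 / 2 : ℝ≥0∞)) ^ n) ^ q := by
    intro n
    have h1 := ENNReal.Tendsto.const_mul (a := ENNReal.ofReal C) (tendsto_lintegral_ell2_tail hq0 hG)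
      (Or.inr ENNReal.ofReal_ne_top)
    rw [mul_zero] at h1
    refine h1.eventually_lt_const (ENNReal.rpow_pos (ENNReal.pow_pos (by simp) n) ?_)
    exact ENNReal.pow_ne_top (by simp)
  -- The threshold `(2^{-n})^q` makes the first moment of the supremum of block `n` at most
  -- `2^{-n}`.
  obtain ⟨ns, hns, hnsb⟩ := extraction_forall_of_eventually htail
  let f : ℕ → ℝ≥0 → Ω → ℝ := fun n t ω => ∑ k ∈ Finset.Ico (ns n) (ns (n + 1)), M k t ω
  have hblock : ∀ n, ∃ Z : Ω → ℝ≥0∞, Measurable Z ∧ (∀ᵐ ω ∂P, ∀ t ≤ T, ‖f n t ω‖ₑ ≤ Z ω) ∧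
      ∫⁻ ω, Z ω ∂P ≤ (1 / 2 : ℝ≥0∞) ^ n := by
    intro n
    obtain ⟨Z, hZm, hZ1, hZ2⟩ := exists_sup_sum_ito_le hW hT (Finset.Ico (ns n) (ns (n + 1)))
      (fun k _ => hM k) hq fun k _ => hGk k
    refine ⟨Z, hZm, hZ1, lintegral_le_of_lintegral_rpow_le hZm.aemeasurable (by linarith)
      (hZ2.trans ((mul_le_mul_right (lintegral_mono fun z => ENNReal.ofReal_le_ofReal ?_) _).trans
        (hnsb n).le))⟩
    refine Real.rpow_le_rpow (Finset.sum_nonneg fun _ _ => sq_nonneg _) ?_ (by positivity)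
    have h1 := ell2_sum_sq_le (G z) (Finset.range (ns (n + 1)))
    rw [← Finset.sum_range_add_sum_Ico _ (hns.monotone (Nat.le_succ n))] at h1
    linarith
  choose Z hZm hZ1 hZ2 using hblock
  have hZsum : ∀ᵐ ω ∂P, ∑' n, Z n ω ≠ ∞ := by
    have h1 : ∫⁻ ω, ∑' n, Z n ω ∂P ≠ ∞ := by
      rw [lintegral_tsum fun n => (hZm n).aemeasurable]
      refine ne_top_of_le_ne_top ?_ (ENNReal.tsum_le_tsum hZ2)
      rw [ENNReal.tsum_geometric]
      simp
    exact (ae_lt_top (.tsum hZm) h1).mono fun ω h => h.ne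
  let X : ℝ≥0 → Ω → ℝ := fun t ω => ∑ k ∈ Finset.range (ns 0), M k t ω + ∑' n, f n t ω
  have hZall : ∀ᵐ ω ∂P, ∀ n, ∀ t ≤ T, ‖f n t ω‖ₑ ≤ Z n ω := ae_all_iff.2 hZ1
  have hpart : ∀ N t ω, ∑ k ∈ Finset.range (ns N), M k t ω =
      ∑ k ∈ Finset.range (ns 0), M k t ω + ∑ n ∈ Finset.range N, f n t ω := by
    intro N t ω
    induction N with
    | zero => simp
    | succ N ih =>
      rw [Finset.sum_range_succ, ← add_assoc, ← ih]
      exact (Finset.sum_range_add_sum_Ico _ (hns.monotone (Nat.le_succ N))).symm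
  have hunif : ∀ᵐ ω ∂P, TendstoUniformlyOn (fun n t => ∑ k ∈ Finset.range (ns n), M k t ω)
      (fun t => X t ω) atTop (Set.Icc 0 T) := by
    filter_upwards [hZsum, hZall] with ω h1 h2
    have h3 : Summable fun n => (Z n ω).toReal := ENNReal.summable_toReal h1
    have h4 := tendstoUniformlyOn_tsum_nat (f := fun n t => f n t ω) (s := Set.Icc 0 T) h3
      fun n t ht => by
        have h5 := ENNReal.ne_top_of_tsum_ne_top h1 n
        have h6 := ENNReal.toReal_mono h5 (h2 n t ht.2)
        simpa using h6
    rw [Metric.tendstoUniformlyOn_iff] at h4 ⊢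
    intro ε hε
    filter_upwards [h4 ε hε] with N hN t ht
    rw [hpart N t ω]
    simpa only [X, dist_add_left] using hN t ht
  have hpt : ∀ᵐ ω ∂P, ∀ t ≤ T, Tendsto (fun n => ∑ k ∈ Finset.range (ns n), M k t ω) atTop
      (𝓝 (X t ω)) := hunif.mono fun ω h t ht => h.tendsto_at ⟨zero_le, ht⟩
  have hMc : ∀ᵐ ω ∂P, ∀ k, ContinuousOn (fun t => M k t ω) (Set.Icc 0 T) :=
    ae_all_iff.2 fun k => (hM k).continuous
  have hMm : ∀ k, ∀ t ≤ T, AEStronglyMeasurable (M k t) P := fun k t ht =>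
    ((hM k).aestronglyMeasurable ht).aestronglyMeasurable
  have hSm : ∀ n, ∀ t ≤ T, AEStronglyMeasurable (fun ω => ∑ k ∈ Finset.range (ns n), M k t ω) P :=
    fun n t ht => Finset.aestronglyMeasurable_fun_sum _ fun k _ => hMm k t ht
  refine ⟨ns, X, hns, fun t ht => ?_, ?_, ?_, hunif, ?_, ?_⟩
  · exact aestronglyMeasurable_of_tendsto_ae atTop (fun n => hSm n t ht)
      (hpt.mono fun ω h => h t ht)
  · have h0 : ∀ᵐ ω ∂P, ∀ k, M k 0 ω = 0 := ae_all_iff.2 fun k => (hM k).ae_zero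
    filter_upwards [hpt, h0] with ω h1 h2
    have h3 := h1 0 zero_le
    simp only [h2, Finset.sum_const_zero] at h3
    exact tendsto_nhds_unique h3 tendsto_const_nhds
  · filter_upwards [hunif, hMc] with ω h1 h2
    exact h1.continuousOn (Eventually.of_forall fun n =>
      continuousOn_finsetSum _ fun k _ => h2 k).frequently
  · have hex := fun n => exists_sup_sum_ito_le hW hT (Finset.range (ns n))
      (fun k _ => hM k) hq fun k _ => hGk k
    choose Y hYm hY1 hY2 using hex
    refine ⟨fun ω => liminf (fun n => Y n ω) atTop, .liminf hYm, ?_, ?_⟩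
    · filter_upwards [hpt, ae_all_iff.2 hY1] with ω h1 h2 t ht
      have h3 := ((continuous_enorm.tendsto _).comp (h1 t ht)).liminf_eq
      exact h3.symm.le.trans (liminf_le_liminf (Eventually.of_forall fun n => h2 n t ht))
    · have h1 : ∀ ω, (liminf (fun N => Y N ω) atTop) ^ q ≤ liminf (fun N => Y N ω ^ q) atTop :=
        fun ω => ((ENNReal.orderIsoRpow q hq0).liminf_apply (f := atTop) (u := fun N => Y N ω)).le
      calc _ ≤ ∫⁻ ω, liminf (fun N => Y N ω ^ q) atTop ∂P := lintegral_mono h1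
        _ ≤ liminf (fun N => ∫⁻ ω, Y N ω ^ q ∂P) atTop :=
          lintegral_liminf_le fun N => (hYm N).pow_const q
        _ ≤ liminf (fun _ : ℕ => ENNReal.ofReal C * ∫⁻ z, ‖G z‖ₑ ^ q ∂rectMeasure P T) atTop := by
          refine liminf_le_liminf (Eventually.of_forall fun n => (hY2 n).trans ?_)
          exact mul_le_mul_right (lintegral_mono fun z => sum_ell2_rpow_le _ _ hq0.le) _
        _ = _ := tendsto_const_nhds.liminf_eq
  · intro σ hσ c n hσT A hA hcA
    have hσ' : ∀ i ≤ n, σ i ≤ T := fun i hi => (hσ hi).trans hσT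
    refine lintegral_le_of_tendsto_ae
      (F := fun m ω => ‖∑ k ∈ Finset.range (ns m), stepInt σ c n (fun t => M k t ω)‖ₑ ^ q)
      (fun m => ?_) ?_ (fun m => ?_) tendsto_const_nhds
    · refine AEMeasurable.pow_const (AEStronglyMeasurable.enorm ?_) q
      refine Finset.aestronglyMeasurable_fun_sum _ fun k _ =>
        Finset.aestronglyMeasurable_fun_sum _ fun i hi => ?_
      have hi' := Finset.mem_range.1 hi
      exact ((hMm k _ (hσ' _ hi')).sub (hMm k _ (hσ' _ hi'.le))).const_mul _
    · filter_upwards [hpt] with ω h1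
      refine ((continuous_enorm.tendsto _).comp ?_).ennrpow_const q
      have e : ∀ m, ∑ k ∈ Finset.range (ns m), stepInt σ c n (fun t => M k t ω) =
          stepInt σ c n fun t => ∑ k ∈ Finset.range (ns m), M k t ω := by
        intro m
        simp only [stepInt]
        rw [Finset.sum_comm]
        refine Finset.sum_congr rfl fun i _ => ?_
        rw [← Finset.sum_sub_distrib, Finset.mul_sum]
      simp only [e]
      refine tendsto_finsetSum _ fun i hi => ?_
      have hi' := Finset.mem_range.1 hi
      exact ((h1 _ (hσ' _ hi')).sub (h1 _ (hσ' _ hi'.le))).const_mul _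
    · refine (lintegral_sum_stepInt_ito_le hW hσ c hσT _ (fun k _ => hM k) hq
        (fun k _ => hGk k) hA hcA).trans (mul_le_mul_right (lintegral_mono fun z => ?_) _)
      rw [ENNReal.ofReal_mul (sq_nonneg _)]
      exact mul_le_mul_right (sum_ell2_rpow_le _ _ hq0.le) _

end Ito

/-! ### Riemann–Liouville integrals on the real line -/

/-- The kernel `r ↦ r_+^{a-1} / Γ(a)`. -/
def rlK (a r : ℝ) : ℝ := if 0 < r then r ^ (a - 1) / Real.Gamma a else 0

lemma rlK_of_pos {a r : ℝ} (hr : 0 < r) : rlK a r = r ^ (a - 1) / Real.Gamma a := if_pos hr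

lemma rlK_of_nonpos {a r : ℝ} (hr : r ≤ 0) : rlK a r = 0 := if_neg (not_lt.2 hr)

lemma rlK_nonneg {a : ℝ} (ha : 0 < a) (r : ℝ) : 0 ≤ rlK a r := by
  have := Real.Gamma_pos_of_pos ha
  unfold rlK; split_ifs with h <;> positivity

lemma measurable_rlK (a : ℝ) : Measurable (rlK a) :=
  Measurable.ite measurableSet_Ioi ((measurable_id.pow_const (a - 1)).div_const _) measurable_const

lemma measurable_rlK_sub (a t : ℝ) : Measurable fun s => rlK a (t - s) :=
  (measurable_rlK a).comp (measurable_const.sub measurable_id)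

lemma measurable_rlK_sub_right (a r : ℝ) : Measurable fun s => rlK a (s - r) :=
  (measurable_rlK a).comp (measurable_id.sub measurable_const)

lemma rlK_one {r : ℝ} (hr : 0 < r) : rlK 1 r = 1 := by simp [rlK, hr]

lemma lintegral_comp_mul_left_real {f : ℝ → ℝ≥0∞} (hf : Measurable f) {x : ℝ} (hx : 0 < x) :
    ∫⁻ y, f y = ENNReal.ofReal x * ∫⁻ z, f (x * z) := by
  have h := Real.smul_map_volume_mul_left hx.ne'
  rw [abs_of_pos hx] at h
  conv_lhs => rw [← h]
  rw [lintegral_smul_measure, lintegral_map hf (measurable_const_mul x), smul_eq_mul]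

/-- After the substitution `y = x z` the integrand is a multiple of the density of the Beta
distribution, whose total mass is one. -/
lemma lintegral_rlK_mul_rlK {a b : ℝ} (ha : 0 < a) (hb : 0 < b) (x : ℝ) :
    ∫⁻ y, ENNReal.ofReal (rlK a y) * ENNReal.ofReal (rlK b (x - y)) =
      ENNReal.ofReal (rlK (a + b) x) := by
  have hm : Measurable fun y => ENNReal.ofReal (rlK a y) * ENNReal.ofReal (rlK b (x - y)) :=
    (measurable_rlK a).ennreal_ofReal.mul (measurable_rlK_sub b x).ennreal_ofReal
  rcases le_or_gt x 0 with hx | hx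
  · rw [rlK_of_nonpos hx, ENNReal.ofReal_zero]
    rw [lintegral_eq_zero_iff hm]
    refine Eventually.of_forall fun y => ?_
    rcases le_or_gt y 0 with hy | hy
    · simp [rlK_of_nonpos hy]
    · simp [rlK_of_nonpos (show x - y ≤ 0 by linarith)]
  · rw [lintegral_comp_mul_left_real hm hx]
    have e : ∀ z, ENNReal.ofReal (rlK a (x * z)) * ENNReal.ofReal (rlK b (x - x * z)) =
        ENNReal.ofReal (x ^ (a + b - 2) / Real.Gamma (a + b)) * betaPDF a b z := by
      intro z
      rw [betaPDF_eq, ← ENNReal.ofReal_mul (rlK_nonneg ha _), ← ENNReal.ofReal_mul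
        (by have := Real.Gamma_pos_of_pos (add_pos ha hb); positivity)]
      congr 1
      have hΓa := Real.Gamma_pos_of_pos ha
      have hΓb := Real.Gamma_pos_of_pos hb
      have hΓ := Real.Gamma_pos_of_pos (add_pos ha hb)
      split_ifs with hz
      · have h1 : 0 < x * z := mul_pos hx hz.1
        have h2 : 0 < 1 - z := by linarith [hz.2]
        have h3 : x - x * z = x * (1 - z) := by ring
        rw [h3, rlK_of_pos h1, rlK_of_pos (mul_pos hx h2), Real.mul_rpow hx.le hz.1.le,
          Real.mul_rpow hx.le h2.le, beta, show a + b - 2 = (a - 1) + (b - 1) by ring,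
          Real.rpow_add hx]
        field_simp
      · rw [mul_zero]
        rcases le_or_gt z 0 with h | h
        · rw [rlK_of_nonpos (mul_nonpos_of_nonneg_of_nonpos hx.le h), zero_mul]
        · have h1 : 1 ≤ z := by by_contra h'; exact hz ⟨h, not_le.1 h'⟩
          rw [rlK_of_nonpos (a := b) (by nlinarith), mul_zero]
    simp only [e]
    rw [lintegral_const_mul' _ _ ENNReal.ofReal_ne_top, lintegral_betaPDF_eq_one ha hb, mul_one,
      ← ENNReal.ofReal_mul hx.le, rlK_of_pos hx]
    congr 1
    rw [← mul_div_assoc, mul_comm, ← Real.rpow_add_one hx.ne']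
    congr 2; ring

lemma lintegral_rlK_sub_mul_rlK_sub {a b : ℝ} (ha : 0 < a) (hb : 0 < b) (t r : ℝ) :
    ∫⁻ s, ENNReal.ofReal (rlK a (t - s)) * ENNReal.ofReal (rlK b (s - r)) =
      ENNReal.ofReal (rlK (a + b) (t - r)) := by
  rw [add_comm a b, ← lintegral_rlK_mul_rlK hb ha (t - r),
    ← lintegral_sub_right_eq_self (fun s => ENNReal.ofReal (rlK b s) *
      ENNReal.ofReal (rlK a (t - r - s))) r]
  refine lintegral_congr fun s => ?_
  rw [mul_comm, show t - r - (s - r) = t - s by ring]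

lemma integral_rlK_sub_mul_rlK_sub {a b : ℝ} (ha : 0 < a) (hb : 0 < b) (t r : ℝ) :
    ∫ s, rlK a (t - s) * rlK b (s - r) = rlK (a + b) (t - r) := by
  have hm : Measurable fun s => rlK a (t - s) * rlK b (s - r) :=
    (measurable_rlK_sub a t).mul (measurable_rlK_sub_right b r)
  rw [integral_eq_lintegral_of_nonneg_ae (Eventually.of_forall fun s =>
    mul_nonneg (rlK_nonneg ha _) (rlK_nonneg hb _)) hm.aestronglyMeasurable]
  simp only [ENNReal.ofReal_mul (rlK_nonneg ha _)]
  rw [lintegral_rlK_sub_mul_rlK_sub ha hb, ENNReal.toReal_ofReal (rlK_nonneg (add_pos ha hb) _)]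

/-- The integral of the kernel over `[0, t]`. -/
lemma lintegral_rlK_sub {a : ℝ} (ha : 0 < a) (t : ℝ) :
    ∫⁻ s in Set.Ioi 0, ENNReal.ofReal (rlK a (t - s)) = ENNReal.ofReal (rlK (a + 1) t) := by
  have h := lintegral_rlK_sub_mul_rlK_sub ha one_pos t 0
  rw [sub_zero] at h
  rw [← h, ← lintegral_indicator measurableSet_Ioi]
  refine lintegral_congr fun s => ?_
  by_cases hs : 0 < s
  · rw [Set.indicator_of_mem (Set.mem_Ioi.2 hs), sub_zero, rlK_one hs]; simp
  · rw [Set.indicator_of_notMem (by simpa using hs), sub_zero, rlK_of_nonpos (not_lt.1 hs)]; simp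

/-- The Riemann–Liouville integral of positive order of a function on the real line. -/
def rl (a : ℝ) (F : ℝ → ℝ) (t : ℝ) : ℝ := ∫ s, rlK a (t - s) * F s

lemma rl_congr {a : ℝ} {F G : ℝ → ℝ} {t : ℝ} (h : ∀ᵐ s, s < t → F s = G s) : rl a F t = rl a G t := by
  refine integral_congr_ae ?_
  filter_upwards [h] with s hs
  rcases lt_or_ge s t with h1 | h1
  · rw [hs h1]
  · rw [rlK_of_nonpos (by linarith), zero_mul, zero_mul]

lemma rl_of_nonpos {a : ℝ} {F : ℝ → ℝ} (hF : ∀ s < 0, F s = 0) {t : ℝ} (ht : t ≤ 0) : rl a F t = 0 := by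
  have : ∀ s, rlK a (t - s) * F s = 0 := fun s => by
    rcases lt_or_ge s 0 with h | h
    · rw [hF s h, mul_zero]
    · rw [rlK_of_nonpos (by linarith), zero_mul]
  simp [rl, this]

/-- Absolute convergence of the integral that defines `rl a F t`. -/
def RLIntegrable (a : ℝ) (F : ℝ → ℝ) (t : ℝ) : Prop := Integrable fun s => rlK a (t - s) * F s

lemma rl_add {a : ℝ} {F G : ℝ → ℝ} {t : ℝ} (hF : RLIntegrable a F t) (hG : RLIntegrable a G t) :
    rl a (fun s => F s + G s) t = rl a F t + rl a G t := by
  unfold rl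
  rw [← integral_add hF hG]
  simp only [mul_add]

lemma rl_sub {a : ℝ} {F G : ℝ → ℝ} {t : ℝ} (hF : RLIntegrable a F t) (hG : RLIntegrable a G t) :
    rl a (fun s => F s - G s) t = rl a F t - rl a G t := by
  unfold rl
  rw [← integral_sub hF hG]
  simp only [mul_sub]

lemma RLIntegrable.add {a : ℝ} {F G : ℝ → ℝ} {t : ℝ} (hF : RLIntegrable a F t)
    (hG : RLIntegrable a G t) : RLIntegrable a (fun s => F s + G s) t := by
  have := Integrable.add hF hG
  refine this.congr (Eventually.of_forall fun s => ?_)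
  simp only [Pi.add_apply]; ring

lemma RLIntegrable.sub {a : ℝ} {F G : ℝ → ℝ} {t : ℝ} (hF : RLIntegrable a F t)
    (hG : RLIntegrable a G t) : RLIntegrable a (fun s => F s - G s) t := by
  have := Integrable.sub hF hG
  refine this.congr (Eventually.of_forall fun s => ?_)
  simp only [Pi.sub_apply]; ring

lemma rlIntegrable_iff {a : ℝ} (ha : 0 < a) {F : ℝ → ℝ} (hF : Measurable F) (t : ℝ) :
    RLIntegrable a F t ↔ ∫⁻ s, ENNReal.ofReal (rlK a (t - s)) * ‖F s‖ₑ ≠ ∞ := by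
  have hm : Measurable fun s => rlK a (t - s) * F s := (measurable_rlK_sub a t).mul hF
  have e : ∀ s, ‖rlK a (t - s) * F s‖ₑ = ENNReal.ofReal (rlK a (t - s)) * ‖F s‖ₑ := fun s => by
    rw [enorm_mul, Real.enorm_eq_ofReal (rlK_nonneg ha _)]
  unfold RLIntegrable Integrable HasFiniteIntegral
  simp only [e, hm.aestronglyMeasurable, true_and, lt_top_iff_ne_top]

section Semigroup
variable {a b : ℝ} {F : ℝ → ℝ} {t : ℝ}

/-- Integrating the absolute value first in the outer time produces the kernel of order `a + b`, so
that absolute convergence at that order is all that Fubini's theorem needs. -/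
lemma integrable_prod_rlK (ha : 0 < a) (hb : 0 < b) (hF : Measurable F)
    (h : RLIntegrable (a + b) F t) :
    Integrable (fun z : ℝ × ℝ => rlK a (t - z.1) * (rlK b (z.1 - z.2) * F z.2))
      (volume.prod volume) := by
  have hm : Measurable fun z : ℝ × ℝ => rlK a (t - z.1) * (rlK b (z.1 - z.2) * F z.2) :=
    ((measurable_rlK_sub a t).comp measurable_fst).mul
      (((measurable_rlK b).comp (measurable_fst.sub measurable_snd)).mul (hF.comp measurable_snd))
  refine ⟨hm.aestronglyMeasurable, ?_⟩
  rw [HasFiniteIntegral, lintegral_prod_symm' _ hm.enorm]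
  rw [rlIntegrable_iff (add_pos ha hb) hF] at h
  refine lt_of_le_of_lt (le_of_eq (lintegral_congr fun r => ?_)) h.lt_top
  have hm2 : Measurable fun s => ENNReal.ofReal (rlK a (t - s)) * ENNReal.ofReal (rlK b (s - r)) :=
    (measurable_rlK_sub a t).ennreal_ofReal.mul (measurable_rlK_sub_right b r).ennreal_ofReal
  rw [← lintegral_rlK_sub_mul_rlK_sub ha hb, ← lintegral_mul_const _ hm2]
  refine lintegral_congr fun s => ?_
  rw [enorm_mul, enorm_mul, Real.enorm_eq_ofReal (rlK_nonneg ha _),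
    Real.enorm_eq_ofReal (rlK_nonneg hb _), mul_assoc]

lemma RLIntegrable.rl (ha : 0 < a) (hb : 0 < b) (hF : Measurable F)
    (h : RLIntegrable (a + b) F t) : RLIntegrable a (rl b F) t := by
  have h1 := (integrable_prod_rlK ha hb hF h).integral_prod_left
  refine h1.congr (Eventually.of_forall fun s => ?_)
  simp only
  rw [integral_const_mul]
  rfl

theorem rl_rl (ha : 0 < a) (hb : 0 < b) (hF : Measurable F) (h : RLIntegrable (a + b) F t) :
    rl a (rl b F) t = rl (a + b) F t := by
  have h1 := integral_integral_swap (f := fun s r => rlK a (t - s) * (rlK b (s - r) * F r))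
    (integrable_prod_rlK ha hb hF h)
  calc rl a (rl b F) t = ∫ s, ∫ r, rlK a (t - s) * (rlK b (s - r) * F r) := by
        unfold rl; simp only [integral_const_mul]
    _ = _ := h1
    _ = ∫ r, rlK (a + b) (t - r) * F r := by
      refine integral_congr_ae (Eventually.of_forall fun r => ?_)
      simp only [← mul_assoc]
      rw [integral_mul_const, integral_rlK_sub_mul_rlK_sub ha hb]

end Semigroup

lemma rlK_le {a : ℝ} (ha : 1 ≤ a) {r R : ℝ} (hrR : r ≤ R) : rlK a r ≤ rlK a R := by
  rcases le_or_gt r 0 with h | h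
  · rw [rlK_of_nonpos h]; exact rlK_nonneg (by linarith) _
  · rw [rlK_of_pos h, rlK_of_pos (h.trans_le hrR)]
    have := Real.Gamma_pos_of_pos (by linarith : 0 < a)
    have := Real.rpow_le_rpow h.le hrR (by linarith : 0 ≤ a - 1)
    gcongr

lemma continuousAt_rlK {a r : ℝ} (hr : r ≠ 0) : ContinuousAt (rlK a) r := by
  rcases lt_or_gt_of_ne hr with h | h
  · have : rlK a =ᶠ[𝓝 r] fun _ => 0 := by
      filter_upwards [eventually_lt_nhds h] with x hx using rlK_of_nonpos hx.le
    exact continuousAt_const.congr this.symm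
  · have : rlK a =ᶠ[𝓝 r] fun x => x ^ (a - 1) / Real.Gamma a := by
      filter_upwards [eventually_gt_nhds h] with x hx using rlK_of_pos hx
    exact ((continuousAt_id.rpow_const (Or.inl h.ne')).div_const _).congr this.symm

section Props
variable {a : ℝ} {F : ℝ → ℝ}

lemma RLIntegrable.of_one_le (ha : 1 ≤ a) (hF : Measurable F) (h0 : ∀ s < 0, F s = 0) {t : ℝ}
    (hFi : IntegrableOn F (Set.Icc 0 t)) : RLIntegrable a F t := by
  have h1 : Integrable (fun s => rlK a t * (Set.Icc 0 t).indicator F s) :=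
    ((integrable_indicator_iff measurableSet_Icc).2 hFi).const_mul _
  refine h1.mono ((measurable_rlK_sub a t).mul hF).aestronglyMeasurable
    (Eventually.of_forall fun s => ?_)
  rw [norm_mul, norm_mul, Real.norm_of_nonneg (rlK_nonneg (by linarith) _),
    Real.norm_of_nonneg (rlK_nonneg (by linarith) _)]
  rcases lt_or_ge s 0 with h | h
  · rw [h0 s h, norm_zero, mul_zero]
    have := rlK_nonneg (a := a) (by linarith) t
    positivity
  rcases le_or_gt s t with h' | h'
  · rw [Set.indicator_of_mem (show s ∈ Set.Icc 0 t from ⟨h, h'⟩)]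
    exact mul_le_mul_of_nonneg_right (rlK_le ha (by linarith)) (norm_nonneg _)
  · rw [rlK_of_nonpos (by linarith), zero_mul]
    have := rlK_nonneg (a := a) (by linarith) t
    positivity

lemma enorm_rl_le (ha : 0 < a) (h0 : ∀ s < 0, F s = 0) {t : ℝ} {B : ℝ≥0∞}
    (hB : ∀ s, s < t → ‖F s‖ₑ ≤ B) : ‖rl a F t‖ₑ ≤ ENNReal.ofReal (rlK (a + 1) t) * B := by
  refine (enorm_integral_le_lintegral_enorm _).trans ?_
  have h1 : ∫⁻ s, ‖rlK a (t - s) * F s‖ₑ =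
      ∫⁻ s in Set.Ioi 0, ‖rlK a (t - s) * F s‖ₑ := by
    rw [restrict_Ioi_eq_restrict_Ici, setLIntegral_eq_of_support_subset]
    intro s hs
    by_contra h
    exact hs (by simp [h0 s (not_le.1 h)])
  rw [h1, ← lintegral_rlK_sub ha, ← lintegral_mul_const _ (measurable_rlK_sub a t).ennreal_ofReal]
  refine lintegral_mono fun s => ?_
  simp only
  rw [enorm_mul, Real.enorm_eq_ofReal (rlK_nonneg ha _)]
  rcases lt_or_ge s t with h | h
  · gcongr; exact hB s h
  · rw [rlK_of_nonpos (by linarith), ENNReal.ofReal_zero, zero_mul, zero_mul]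

lemma RLIntegrable.of_bounded (ha : 0 < a) (hF : Measurable F) (h0 : ∀ s < 0, F s = 0) {t B : ℝ}
    (hB : ∀ s, s < t → |F s| ≤ B) : RLIntegrable a F t := by
  rw [rlIntegrable_iff ha hF]
  have h1 : ∫⁻ s, ENNReal.ofReal (rlK a (t - s)) * ‖F s‖ₑ =
      ∫⁻ s in Set.Ioi 0, ENNReal.ofReal (rlK a (t - s)) * ‖F s‖ₑ := by
    rw [restrict_Ioi_eq_restrict_Ici, setLIntegral_eq_of_support_subset]
    intro s hs
    by_contra h
    exact hs (by simp [h0 s (not_le.1 h)])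
  have h2 : ∫⁻ s in Set.Ioi 0, ENNReal.ofReal (rlK a (t - s)) * ‖F s‖ₑ ≤
      ENNReal.ofReal (rlK (a + 1) t) * ENNReal.ofReal B := by
    rw [← lintegral_rlK_sub ha, ← lintegral_mul_const _ (measurable_rlK_sub a t).ennreal_ofReal]
    refine lintegral_mono fun s => ?_
    simp only
    rcases lt_or_ge s t with h | h
    · rw [Real.enorm_eq_ofReal_abs]; gcongr; exact hB s h
    · rw [rlK_of_nonpos (by linarith), ENNReal.ofReal_zero, zero_mul, zero_mul]
  rw [h1]
  exact ne_top_of_le_ne_top (ENNReal.mul_ne_top ENNReal.ofReal_ne_top ENNReal.ofReal_ne_top) h2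

/-- Riemann–Liouville integrals of order at least one are continuous. -/
lemma continuous_rl_of_one_le (ha : 1 ≤ a) (hF : Measurable F) (h0 : ∀ s < 0, F s = 0)
    (hFi : LocallyIntegrable F) : Continuous (rl a F) := by
  rw [continuous_iff_continuousAt]
  intro t
  have hi : IntegrableOn F (Set.Icc 0 (t + 1)) := hFi.integrableOn_isCompact isCompact_Icc
  refine continuousAt_of_dominated
    (bound := fun s => rlK a (t + 1) * ‖(Set.Icc 0 (t + 1)).indicator F s‖)
    (Eventually.of_forall fun t => ((measurable_rlK_sub a t).mul hF).aestronglyMeasurable) ?_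
    (((integrable_indicator_iff measurableSet_Icc).2 hi).norm.const_mul _) ?_
  · filter_upwards [eventually_lt_nhds (lt_add_one t)] with t' ht'
    refine Eventually.of_forall fun s => ?_
    have hp := rlK_nonneg (a := a) (by linarith) (t + 1)
    rw [norm_mul, Real.norm_of_nonneg (rlK_nonneg (by linarith) _)]
    rcases lt_or_ge s 0 with h | h
    · rw [h0 s h, norm_zero, mul_zero]; positivity
    rcases le_or_gt s t' with h' | h'
    · rw [Set.indicator_of_mem (show s ∈ Set.Icc 0 (t + 1) from ⟨h, h'.trans ht'.le⟩)]
      exact mul_le_mul_of_nonneg_right (rlK_le ha (by linarith)) (norm_nonneg _)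
    · rw [rlK_of_nonpos (by linarith), zero_mul]; positivity
  · have : ∀ᵐ s : ℝ, s ≠ t := by simp [ae_iff, measure_singleton]
    filter_upwards [this] with s hs
    have h1 : ContinuousAt (fun t => rlK a (t - s)) t :=
      ContinuousAt.comp (f := fun t => t - s) (continuousAt_rlK (sub_ne_zero.2 hs.symm))
        (continuousAt_id.sub continuousAt_const)
    exact h1.mul continuousAt_const

/-- Riemann–Liouville integrals of bounded functions with at most countably many discontinuities are
continuous. -/
lemma continuous_rl_of_bounded (ha : 0 < a) (hF : Measurable F) (h0 : ∀ s < 0, F s = 0) {B : ℝ}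
    (hB : ∀ s, |F s| ≤ B) {D : Set ℝ} (hD : D.Countable) (hc : ∀ s, s ∉ D → ContinuousAt F s) :
    Continuous (rl a F) := by
  have hB0 : 0 ≤ B := (abs_nonneg _).trans (hB 0)
  have e : rl a F = fun t => ∫ r, rlK a r * F (t - r) := by
    ext t
    unfold rl
    rw [← integral_sub_left_eq_self (fun r => rlK a r * F (t - r)) volume t]
    simp only [sub_sub_cancel]
  rw [e, continuous_iff_continuousAt]
  intro t
  have hi : Integrable ((Set.Iic (t + 1)).indicator (rlK a)) := by
    have h1 := RLIntegrable.of_bounded (F := (Set.Ici 0).indicator fun _ => 1) (t := t + 1) (B := 1)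
      ha (measurable_const.indicator measurableSet_Ici)
      (fun s hs => Set.indicator_of_notMem (by simpa using hs) _) fun s _ => by
        by_cases h : s ∈ Set.Ici (0 : ℝ) <;> simp [h]
    have h2 := h1.comp_sub_left (t + 1)
    refine h2.congr (Eventually.of_forall fun s => ?_)
    simp only [sub_sub_cancel]
    by_cases h : s ≤ t + 1
    · rw [Set.indicator_of_mem (by simpa using h), Set.indicator_of_mem (by simpa using h), mul_one]
    · rw [Set.indicator_of_notMem (by simpa using h), Set.indicator_of_notMem (by simpa using h),
        mul_zero]
  refine continuousAt_of_dominated (bound := fun r => (Set.Iic (t + 1)).indicator (rlK a) r * B)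
    (Eventually.of_forall fun t => ((measurable_rlK a).mul
      (hF.comp (measurable_const.sub measurable_id))).aestronglyMeasurable) ?_
    (hi.mul_const B) ?_
  · filter_upwards [eventually_lt_nhds (lt_add_one t)] with t' ht'
    refine Eventually.of_forall fun r => ?_
    rw [norm_mul, Real.norm_of_nonneg (rlK_nonneg ha _)]
    by_cases h : r ≤ t + 1
    · rw [Set.indicator_of_mem (by exact h)]
      exact mul_le_mul_of_nonneg_left (hB _) (rlK_nonneg ha _)
    · rw [Set.indicator_of_notMem (by exact h), h0 _ (by linarith)]; simp
  · have h1 : ∀ᵐ r : ℝ, t - r ∉ D := by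
      have h2 : volume ((fun r => t - r) ⁻¹' D) = 0 :=
        (hD.preimage (sub_right_injective (b := t))).measure_zero volume
      exact measure_eq_zero_iff_ae_notMem.1 h2
    filter_upwards [h1] with r hr
    have h3 : ContinuousAt (fun t => F (t - r)) t :=
      ContinuousAt.comp (f := fun t => t - r) (hc _ hr) (continuousAt_id.sub continuousAt_const)
    exact continuousAt_const.mul h3

end Props

/-- A bound of `T^a / Γ(a + 1)` that is uniform in `a ≥ 0`. -/
lemma rlK_add_one_le {T a : ℝ} (hT : 0 < T) (ha : 0 ≤ a) :
    rlK (a + 1) T ≤ max 1 T * Real.exp (max 1 T) := by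
  set S := max 1 T
  have hS1 : 1 ≤ S := le_max_left _ _
  have hexp : 1 ≤ Real.exp S := Real.one_le_exp (by linarith)
  rw [rlK_of_pos hT, add_sub_cancel_right]
  have hΓ := Real.Gamma_pos_of_pos (by linarith : 0 < a + 1)
  rw [div_le_iff₀ hΓ]
  have hTa : T ^ a ≤ S ^ a := Real.rpow_le_rpow hT.le (le_max_right _ _) ha
  rcases lt_or_ge a 1 with h | h
  -- From `1 = Γ(2) ≤ Γ(a + 2) = (a + 1) Γ(a + 1)` and `a < 1` one gets `Γ(a + 1) ≥ 1/2`.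
  · have h1 : Real.Gamma 2 ≤ Real.Gamma (a + 1 + 1) :=
      Real.Gamma_strictMonoOn_Ici.monotoneOn (by simp) (Set.mem_Ici.2 (by linarith)) (by linarith)
    rw [Real.Gamma_two, Real.Gamma_add_one (by linarith : a + 1 ≠ 0)] at h1
    have h2 : S ^ a ≤ S ^ (1 : ℝ) := Real.rpow_le_rpow_of_exponent_le hS1 h.le
    rw [Real.rpow_one] at h2
    have h3 : 2 ≤ Real.exp S := by
      have := Real.add_one_le_exp S; linarith
    have h4 : 1 ≤ 2 * Real.Gamma (a + 1) := by nlinarith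
    calc T ^ a ≤ S * 1 := by linarith
      _ ≤ S * (2 * Real.Gamma (a + 1)) := by gcongr
      _ ≤ S * (Real.exp S * Real.Gamma (a + 1)) := by gcongr
      _ = _ := by ring
  -- Here `Γ(a + 1) ≥ n!`, and `S^n / n! ≤ e^S`; the factor `S` pays for the fractional part of `a`.
  · set n := ⌊a⌋₊
    have hn : (n : ℝ) ≤ a := Nat.floor_le ha
    have hn1 : 1 ≤ n := Nat.le_floor (by simpa using h)
    have h1 : Real.Gamma (n + 1) ≤ Real.Gamma (a + 1) := by
      have : (1 : ℝ) ≤ n := by exact_mod_cast hn1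
      exact Real.Gamma_strictMonoOn_Ici.monotoneOn (Set.mem_Ici.2 (by linarith))
        (Set.mem_Ici.2 (by linarith)) (by linarith)
    rw [Real.Gamma_nat_eq_factorial] at h1
    have h2 : S ^ a ≤ S ^ (n + 1) := by
      rw [← Real.rpow_natCast]
      refine Real.rpow_le_rpow_of_exponent_le hS1 ?_
      push_cast; exact (Nat.lt_floor_add_one a).le
    have h3 := Real.pow_div_factorial_le_exp S (by linarith) n
    rw [div_le_iff₀ (by positivity)] at h3
    calc T ^ a ≤ S ^ (n + 1) := hTa.trans h2
      _ = S * S ^ n := by ring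
      _ ≤ S * (Real.exp S * n.factorial) := by gcongr
      _ ≤ S * (Real.exp S * Real.Gamma (a + 1)) := by gcongr
      _ = _ := by ring

lemma rl_one_eq {F : ℝ → ℝ} (h0 : ∀ s < 0, F s = 0) {t : ℝ} (ht : 0 ≤ t) :
    rl 1 F t = ∫ s in (0)..t, F s := by
  rw [intervalIntegral.integral_of_le ht, ← integral_indicator measurableSet_Ioc]
  refine integral_congr_ae ?_
  have h1 : ∀ᵐ s : ℝ, s ≠ t := by simp [ae_iff, measure_singleton]
  have h2 : ∀ᵐ s : ℝ, s ≠ 0 := by simp [ae_iff, measure_singleton]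
  filter_upwards [h1, h2] with s hs hs0
  rcases lt_trichotomy s 0 with h | h | h
  · rw [h0 s h, mul_zero, Set.indicator_of_notMem (by simp [h.le])]
  · exact absurd h hs0
  · rcases lt_or_gt_of_ne hs with h' | h'
    · rw [rlK_one (sub_pos.2 h'), one_mul, Set.indicator_of_mem (Set.mem_Ioc.2 ⟨h, h'.le⟩)]
    · rw [rlK_of_nonpos (by linarith), zero_mul, Set.indicator_of_notMem (by simp [h'])]

/-! ### Injectivity of repeated integration and reduction of the order of the equation. -/

lemma eq_zero_of_rl_one_eq_zero {F : ℝ → ℝ} (hF : Continuous F) (h0 : ∀ s < 0, F s = 0) {T : ℝ}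
    (hT : 0 < T) (h : ∀ t ≤ T, rl 1 F t = 0) : ∀ t ≤ T, F t = 0 := by
  have h1 : ∀ t ∈ Set.Ioo 0 T, F t = 0 := by
    intro t ht
    have hd : HasDerivAt (fun u => ∫ s in (0)..u, F s) (F t) t := hF.integral_hasStrictDerivAt 0 t
      |>.hasDerivAt
    have he : (fun u => ∫ s in (0)..u, F s) =ᶠ[𝓝 t] fun _ => 0 := by
      filter_upwards [Ioo_mem_nhds ht.1 ht.2] with u hu
      rw [← rl_one_eq h0 hu.1.le, h u hu.2.le]
    exact hd.unique ((hasDerivAt_const t (0 : ℝ)).congr_of_eventuallyEq he)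
  have h2 : Set.EqOn F (fun _ => 0) (closure (Set.Ioo 0 T)) :=
    Set.EqOn.closure (fun t ht => h1 t ht) hF continuous_const
  intro t ht
  rcases lt_or_ge t 0 with h' | h'
  · exact h0 t h'
  · rw [closure_Ioo hT.ne] at h2
    exact h2 ⟨h', ht⟩

/-- By the semigroup law one integration can be stripped off at a time; differentiation of the
remaining one is elementary, since the inner integral is continuous. -/
lemma eq_zero_of_rl_nat_eq_zero {T : ℝ} (hT : 0 < T) (m : ℕ) {F : ℝ → ℝ} (hF : Continuous F)
    (h0 : ∀ s < 0, F s = 0) (h : ∀ t ≤ T, rl (m + 1) F t = 0) : ∀ t ≤ T, F t = 0 := by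
  induction m with
  | zero => exact eq_zero_of_rl_one_eq_zero hF h0 hT (by simpa using h)
  | succ m ih =>
    have hm : (0 : ℝ) < m + 1 := by positivity
    have hc : Continuous (rl (m + 1) F) := continuous_rl_of_one_le (by linarith [hm, (Nat.cast_nonneg m : (0:ℝ) ≤ m)])
      hF.measurable h0 hF.locallyIntegrable
    refine ih (eq_zero_of_rl_one_eq_zero hc (fun s hs => rl_of_nonpos h0 hs.le) hT fun t ht => ?_)
    have e : (1 : ℝ) + (m + 1) = (m + 1 : ℕ) + 1 := by push_cast; ring
    rw [rl_rl one_pos hm hF.measurable, e, h t ht]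
    refine RLIntegrable.of_one_le (by linarith) hF.measurable h0 ?_
    exact hF.locallyIntegrable.integrableOn_isCompact isCompact_Icc

/-- `rl a F`, with the convention that it is `F` for `a = 0`. -/
def rlI (a : ℝ) (F : ℝ → ℝ) (t : ℝ) : ℝ := if a = 0 then F t else rl a F t

lemma rl_rlI {a b : ℝ} {F : ℝ → ℝ} {t : ℝ} (ha : 0 < a) (hb : 0 ≤ b) (hF : Measurable F)
    (h : RLIntegrable (a + b) F t) :
    RLIntegrable a (rlI b F) t ∧ rl a (rlI b F) t = rl (a + b) F t := by
  rcases hb.eq_or_lt with rfl | hb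
  · have : rlI 0 F = F := by ext; simp [rlI]
    rw [this, add_zero]
    rw [add_zero] at h
    exact ⟨h, rfl⟩
  · have : rlI b F = rl b F := by ext; simp [rlI, hb.ne']
    rw [this]
    exact ⟨h.rl ha hb hF, rl_rl ha hb hF h⟩

/-- From the equation of order `Λ = m + 1` to the equation of order one. -/
theorem rl_one_eq_of_rlI_eq {T α β : ℝ} {m : ℕ} (hT : 0 < T) (hα : 0 < α)
    (hβ : β < α + 1) (hmα : α ≤ m + 1) (hmβ : β ≤ m + 1) {Y Φ X : ℝ → ℝ}
    (hY : Measurable Y) (hΦ : Measurable Φ) (hX : Measurable X) (hY0 : ∀ s < 0, Y s = 0)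
    (hΦ0 : ∀ s < 0, Φ s = 0) (hX0 : ∀ s < 0, X s = 0) (hYi : Integrable Y) (hΦi : Integrable Φ)
    {B : ℝ} (hB : ∀ s, |X s| ≤ B) {D : Set ℝ} (hD : D.Countable)
    (hc : ∀ s, s ∉ D → ContinuousAt X s)
    (h : ∀ᵐ s, s < T →
      rlI ((m + 1) - α) Y s = rl (m + 1) Φ s + rlI ((m + 1) - β) X s) :
    ∀ t ≤ T, rl 1 Y t = rl (1 + α) Φ t + rl (1 + (α - β)) X t := by
  have hm0 : (0 : ℝ) ≤ m := Nat.cast_nonneg m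
  have iY : ∀ a, 1 ≤ a → ∀ t, RLIntegrable a Y t := fun a ha t =>
    .of_one_le ha hY hY0 hYi.integrableOn
  have iΦ : ∀ a, 1 ≤ a → ∀ t, RLIntegrable a Φ t := fun a ha t =>
    .of_one_le ha hΦ hΦ0 hΦi.integrableOn
  have iX : ∀ a, 0 < a → ∀ t, RLIntegrable a X t := fun a ha t =>
    .of_bounded ha hX hX0 fun s _ => hB s
  -- the equation of order `m + 1`
  have h1 : ∀ t ≤ T, rl (m + 1) Y t =
      rl (m + (1 + α)) Φ t + rl (m + (1 + (α - β))) X t := by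
    intro t ht
    obtain ⟨-, e1⟩ := rl_rlI (b := (m + 1) - α) (F := Y) (t := t) hα (by linarith) hY
      (by rw [add_sub_cancel]; exact iY _ (by linarith) t)
    obtain ⟨i2, e2⟩ := rl_rlI (b := m + 1) (F := Φ) (t := t) hα (by linarith) hΦ
      (iΦ _ (by linarith) t)
    obtain ⟨i3, e3⟩ := rl_rlI (b := (m + 1) - β) (F := X) (t := t) hα (by linarith) hX
      (iX _ (by linarith) t)
    have e4 : rlI (m + 1 : ℝ) Φ = rl (m + 1) Φ := by
      ext s; simp [rlI, (by linarith : (m + 1 : ℝ) ≠ 0)]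
    rw [e4] at i2 e2
    rw [add_sub_cancel] at e1
    rw [← e1, show (m : ℝ) + (1 + α) = α + (m + 1) by ring, ← e2,
      show (m : ℝ) + (1 + (α - β)) = α + ((m + 1) - β) by ring, ← e3, ← rl_add i2 i3]
    refine rl_congr ?_
    filter_upwards [h] with s hs hst
    exact hs (hst.trans_le ht)
  rcases Nat.eq_zero_or_pos m with rfl | hm
  · intro t ht
    have := h1 t ht
    simpa using this
  obtain ⟨n, rfl⟩ := Nat.exists_eq_succ_of_ne_zero hm.ne'
  have hn0 : (0 : ℝ) ≤ n := Nat.cast_nonneg n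
  have hn : (0 : ℝ) < n + 1 := by linarith
  -- The difference of the two sides is continuous and is annihilated by `rl (n + 1)` up to time
  -- `T`. The condition `β < α + 1` makes the order `1 + (α - β)` positive.
  set Z : ℝ → ℝ := fun t => rl 1 Y t - (rl (1 + α) Φ t + rl (1 + (α - β)) X t) with hZ
  have cY : Continuous (rl 1 Y) := continuous_rl_of_one_le le_rfl hY hY0 hYi.locallyIntegrable
  have cΦ : Continuous (rl (1 + α) Φ) :=
    continuous_rl_of_one_le (by linarith) hΦ hΦ0 hΦi.locallyIntegrable
  have cX : Continuous (rl (1 + (α - β)) X) :=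
    continuous_rl_of_bounded (by linarith) hX hX0 hB hD hc
  have hZ0 : ∀ t ≤ T, Z t = 0 := by
    refine eq_zero_of_rl_nat_eq_zero hT n (cY.sub (cΦ.add cX)) (fun s hs => ?_) fun t ht => ?_
    · show rl 1 Y s - (rl (1 + α) Φ s + rl (1 + (α - β)) X s) = 0
      rw [rl_of_nonpos hY0 hs.le, rl_of_nonpos hΦ0 hs.le, rl_of_nonpos hX0 hs.le]; simp
    · have iY' := iY (n + 1 + 1) (by linarith) t
      have iΦ' := iΦ (n + 1 + (1 + α)) (by linarith) t
      have iX' := iX (n + 1 + (1 + (α - β))) (by linarith) t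
      have r1 := iY'.rl hn one_pos hY
      have r2 := iΦ'.rl hn (by linarith : 0 < 1 + α) hΦ
      have r3 := iX'.rl hn (by linarith : 0 < 1 + (α - β)) hX
      have := h1 t ht
      push_cast at this
      rw [rl_sub r1 (r2.add r3), rl_add r2 r3, rl_rl hn one_pos hY iY',
        rl_rl hn (by linarith) hΦ iΦ', rl_rl hn (by linarith) hX iX', this, sub_self]
  intro t ht
  have := hZ0 t ht
  rw [hZ] at this
  linarith

/-! ### Abel summation for Riemann–Liouville integrals of continuous paths -/

/-- For `c ≥ 1` this is the tangent bound; for `c < 1` it amounts to `a^{c-1} b ≤ b^c`, so the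
derivative, unbounded near zero, is never used. -/
lemma rpow_sub_rpow_le_mul {a b c : ℝ} (hb : 0 ≤ b) (hba : b ≤ a) (hc : 0 < c) :
    a ^ c - b ^ c ≤ max 1 c * (a ^ (c - 1) * (a - b)) := by
  rcases le_or_gt 1 c with h | h
  · rw [max_eq_right h]
    have := rpow_sub_rpow_le hb hba h
    linarith
  · rw [max_eq_left h.le, one_mul]
    rcases hb.eq_or_lt with rfl | hb
    · rcases hba.eq_or_lt with rfl | ha
      · simp
      · rw [Real.zero_rpow hc.ne', sub_zero, sub_zero, ← Real.rpow_add_one ha.ne', sub_add_cancel]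
    · have ha := hb.trans_le hba
      have h1 : a ^ (c - 1) ≤ b ^ (c - 1) := Real.rpow_le_rpow_of_nonpos hb hba (by linarith)
      have h2 : a ^ c = a ^ (c - 1) * a := by rw [← Real.rpow_add_one ha.ne', sub_add_cancel]
      have h3 : b ^ c = b ^ (c - 1) * b := by rw [← Real.rpow_add_one hb.ne', sub_add_cancel]
      rw [h2, h3]
      nlinarith

/-- The left-hand side is the lower rectangle of the decreasing function `e r^{e-1}` over `[b, a]`.
It is used to bound Riemann sums of a singular weight by a telescoping sum. -/
lemma mul_rpow_mul_sub_le {a b e : ℝ} (hb : 0 ≤ b) (hba : b ≤ a) (he : 0 < e) (he1 : e ≤ 1) :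
    e * (a ^ (e - 1) * (a - b)) ≤ a ^ e - b ^ e := by
  rcases (hb.trans hba).eq_or_lt with h | ha
  · obtain rfl : b = 0 := by linarith
    simp [← h]
  · have h1 := rpow_one_add_le_one_add_mul_self (s := b / a - 1)
      (by have := div_nonneg hb ha.le; linarith) he.le he1
    rw [add_sub_cancel, Real.div_rpow hb ha.le, div_le_iff₀ (Real.rpow_pos_of_pos ha e)] at h1
    have h2 : a ^ e = a ^ (e - 1) * a := by rw [← Real.rpow_add_one ha.ne', sub_add_cancel]
    have h3 : (1 + e * (b / a - 1)) * a ^ e = a ^ e + e * a ^ (e - 1) * (b - a) := by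
      rw [h2]; field_simp
    rw [h3] at h1
    linarith

/-- The extension by zero to the real line of the restriction of `φ` to `[0, T]`. -/
def cut (T : ℝ≥0) (φ : ℝ≥0 → ℝ) : ℝ → ℝ := (Set.Icc (0 : ℝ) T).indicator fun s => φ s.toNNReal

lemma cut_of_neg {T : ℝ≥0} {φ : ℝ≥0 → ℝ} {s : ℝ} (hs : s < 0) : cut T φ s = 0 :=
  Set.indicator_of_notMem (by simp [hs]) _

lemma cut_coe {T : ℝ≥0} {φ : ℝ≥0 → ℝ} {s : ℝ≥0} (hs : s ≤ T) : cut T φ s = φ s := by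
  rw [cut, Set.indicator_of_mem (by simpa using hs), Real.toNNReal_coe]

/-- The partition points `j t / (N + 1)`, `j ≤ N + 1`, of `[0, t]`. -/
def unifGrid (t : ℝ≥0) (N j : ℕ) : ℝ≥0 := t * (min j (N + 1) : ℕ) / (N + 1)

lemma monotone_unifGrid (t : ℝ≥0) (N : ℕ) : Monotone (unifGrid t N) := fun i j hij => by
  simp only [unifGrid]
  gcongr

lemma unifGrid_zero (t : ℝ≥0) (N : ℕ) : unifGrid t N 0 = 0 := by simp [unifGrid]

lemma unifGrid_last (t : ℝ≥0) (N : ℕ) : unifGrid t N (N + 1) = t := by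
  simp only [unifGrid, min_self, Nat.cast_add, Nat.cast_one]
  rw [mul_div_assoc, div_self (by positivity), mul_one]

lemma unifGrid_succ_sub_le (t : ℝ≥0) (N j : ℕ) :
    unifGrid t N (j + 1) ≤ unifGrid t N j + t / (N + 1) := by
  simp only [unifGrid]
  rw [← add_div]
  gcongr
  have : ((min (j + 1) (N + 1) : ℕ) : ℝ≥0) ≤ (min j (N + 1) : ℕ) + 1 := by
    exact_mod_cast (by omega : min (j + 1) (N + 1) ≤ min j (N + 1) + 1)
  calc t * ((min (j + 1) (N + 1) : ℕ) : ℝ≥0) ≤ t * ((min j (N + 1) : ℕ) + 1) := by gcongr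
    _ = _ := by ring

lemma integrable_rlK_sub_mul_rlK_sub {a b : ℝ} (ha : 0 < a) (hb : 0 < b) (t r : ℝ) :
    Integrable fun s => rlK a (t - s) * rlK b (s - r) := by
  refine ⟨((measurable_rlK_sub a t).mul (measurable_rlK_sub_right b r)).aestronglyMeasurable, ?_⟩
  have e : ∀ s, ‖rlK a (t - s) * rlK b (s - r)‖ₑ =
      ENNReal.ofReal (rlK a (t - s)) * ENNReal.ofReal (rlK b (s - r)) := fun s => by
    rw [enorm_mul, Real.enorm_eq_ofReal (rlK_nonneg ha _), Real.enorm_eq_ofReal (rlK_nonneg hb _)]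
  rw [HasFiniteIntegral]
  simp only [e]
  rw [lintegral_rlK_sub_mul_rlK_sub ha hb]
  exact ENNReal.ofReal_lt_top

lemma indicator_Ioc_eq_rlK (a b s : ℝ) (hab : a ≤ b) (c : ℝ) :
    (Set.Ioc a b).indicator (fun _ => c) s = c * (rlK 1 (s - a) - rlK 1 (s - b)) := by
  rcases le_or_gt s a with h | h
  · rw [Set.indicator_of_notMem (by simp [h]), rlK_of_nonpos (by linarith),
      rlK_of_nonpos (by linarith)]; simp
  · rcases le_or_gt s b with h' | h'
    · rw [Set.indicator_of_mem (Set.mem_Ioc.2 ⟨h, h'⟩), rlK_one (by linarith),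
        rlK_of_nonpos (a := 1) (r := s - b) (by linarith)]; simp
    · rw [Set.indicator_of_notMem (by simp [h']), rlK_one (by linarith), rlK_one (by linarith)]
      simp

/-- The Riemann–Liouville integral of a step function. -/
lemma rl_step {a : ℝ} (ha : 0 < a) {σ : ℕ → ℝ≥0} (hσ : Monotone σ) (x : ℕ → ℝ) (n : ℕ) (t : ℝ) :
    rl a (fun s => ∑ j ∈ Finset.range n,
      (Set.Ioc (σ j : ℝ) (σ (j + 1))).indicator (fun _ => x j) s) t =
    ∑ j ∈ Finset.range n, x j * (rlK (a + 1) (t - σ j) - rlK (a + 1) (t - σ (j + 1))) := by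
  have hi := fun r => integrable_rlK_sub_mul_rlK_sub ha one_pos t r
  have e : ∀ s, rlK a (t - s) * ∑ j ∈ Finset.range n,
      (Set.Ioc (σ j : ℝ) (σ (j + 1))).indicator (fun _ => x j) s =
      ∑ j ∈ Finset.range n, x j * (rlK a (t - s) * rlK 1 (s - σ j) -
        rlK a (t - s) * rlK 1 (s - σ (j + 1))) := fun s => by
    rw [Finset.mul_sum]
    refine Finset.sum_congr rfl fun j _ => ?_
    rw [indicator_Ioc_eq_rlK _ _ _ (NNReal.coe_le_coe.2 (hσ (Nat.le_succ j)))]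
    ring
  have hi2 : ∀ j ∈ Finset.range n, Integrable fun s => x j * (rlK a (t - s) * rlK 1 (s - σ j) -
      rlK a (t - s) * rlK 1 (s - σ (j + 1))) := fun j _ => ((hi _).sub (hi _)).const_mul _
  unfold rl
  simp only [e]
  rw [integral_finsetSum _ hi2]
  refine Finset.sum_congr rfl fun j _ => ?_
  rw [integral_const_mul, integral_sub (hi _) (hi _), integral_rlK_sub_mul_rlK_sub ha one_pos,
    integral_rlK_sub_mul_rlK_sub ha one_pos]

lemma sum_abel (m x : ℕ → ℝ) (n : ℕ) :
    ∑ j ∈ Finset.range n, x (j + 1) * (m j - m (j + 1)) =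
      ∑ j ∈ Finset.range n, m j * (x (j + 1) - x j) + m 0 * x 0 - m n * x n := by
  induction n with
  | zero => simp
  | succ n ih => rw [Finset.sum_range_succ, Finset.sum_range_succ, ih]; ring

lemma exists_bound_of_continuousOn {T : ℝ≥0} {x : ℝ≥0 → ℝ} (hx : ContinuousOn x (Set.Icc 0 T)) :
    ∃ B, ∀ s ≤ T, |x s| ≤ B := by
  obtain ⟨B, hB⟩ := (isCompact_Icc (a := (0 : ℝ≥0)) (b := T)).exists_bound_of_continuousOn hx
  exact ⟨B, fun s hs => hB s ⟨zero_le, hs⟩⟩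

/-- The step functions sample the path at right end points, so they converge to it by continuity,
and the kernel is a dominating function because the path is bounded on `[0, T]`. -/
lemma tendsto_rl_step {T : ℝ≥0} {x : ℝ≥0 → ℝ} (hx : ContinuousOn x (Set.Icc 0 T)) {a : ℝ}
    (ha : 0 < a) {t : ℝ≥0} (ht : t ≤ T) {t' : ℝ} (ht' : t' ≤ t) :
    Tendsto (fun N : ℕ => rl a (fun s => ∑ j ∈ Finset.range (N + 1),
      (Set.Ioc (unifGrid t N j : ℝ) (unifGrid t N (j + 1))).indicator
        (fun _ => x (unifGrid t N (j + 1))) s) t') atTop (𝓝 (rl a (cut T x) t')) := by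
  obtain ⟨B, hB⟩ := exists_bound_of_continuousOn hx
  have hB0 : 0 ≤ B := (abs_nonneg _).trans (hB 0 zero_le)
  have hgT : ∀ N j, unifGrid t N j ≤ T := fun N j => by
    refine le_trans ?_ ht
    simp only [unifGrid]
    rw [div_le_iff₀ (by positivity)]
    gcongr
    exact_mod_cast min_le_right _ _
  -- value of the step functions
  have hval : ∀ N (s : ℝ), 0 < s → s ≤ t → ∃ j < N + 1,
      s ∈ Set.Ioc (unifGrid t N j : ℝ) (unifGrid t N (j + 1)) ∧
      ∑ j ∈ Finset.range (N + 1), (Set.Ioc (unifGrid t N j : ℝ) (unifGrid t N (j + 1))).indicator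
        (fun _ => x (unifGrid t N (j + 1))) s = x (unifGrid t N (j + 1)) := by
    intro N s hs hst
    have hmem : ∀ i, s ∈ Set.Ioc (unifGrid t N i : ℝ) (unifGrid t N (i + 1)) ↔
        s.toNNReal ∈ Set.Ioc (unifGrid t N i) (unifGrid t N (i + 1)) := fun i => by
      rw [Set.mem_Ioc, Set.mem_Ioc, ← NNReal.coe_lt_coe, ← NNReal.coe_le_coe,
        Real.coe_toNNReal _ hs.le]
    have hcast : ∑ j ∈ Finset.range (N + 1),
        (Set.Ioc (unifGrid t N j : ℝ) (unifGrid t N (j + 1))).indicator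
        (fun _ => x (unifGrid t N (j + 1))) s =
        stepFun (unifGrid t N) (fun j => x (unifGrid t N (j + 1))) (N + 1) s.toNNReal := by
      refine Finset.sum_congr rfl fun i _ => ?_
      simp only [Set.indicator, hmem]
    rcases stepFun_eq_or (monotone_unifGrid t N) (N + 1) s.toNNReal with h | ⟨j, hj, hjs, h⟩
    -- The cells cover `(0, t]`: the least `i` whose right end point is not before `s` gives a cell
    -- that contains `s`.
    · exfalso
      have h1 := h fun _ => 1
      have hex : ∃ i, s.toNNReal ≤ unifGrid t N (i + 1) := ⟨N, by
        rw [unifGrid_last]; exact Real.toNNReal_le_iff_le_coe.2 hst⟩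
      classical
      let i := Nat.find hex
      have hi : s.toNNReal ≤ unifGrid t N (i + 1) := Nat.find_spec hex
      have hiN : i ≤ N := Nat.find_min' hex (by
        rw [unifGrid_last]; exact Real.toNNReal_le_iff_le_coe.2 hst)
      have hi2 : unifGrid t N i < s.toNNReal := by
        rcases Nat.eq_zero_or_pos i with h0 | h0
        · rw [h0, unifGrid_zero]; exact Real.toNNReal_pos.2 hs
        · have := Nat.find_min hex (m := i - 1) (by omega)
          rw [show i - 1 + 1 = i by omega] at this
          exact not_le.1 this
      have h2 : (1 : ℝ) ≤ stepFun (unifGrid t N) (fun _ => 1) (N + 1) s.toNNReal := by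
        unfold stepFun
        calc (1 : ℝ) = (Set.Ioc (unifGrid t N i) (unifGrid t N (i + 1))).indicator
              (fun _ => (1 : ℝ)) s.toNNReal := by
                rw [Set.indicator_of_mem (Set.mem_Ioc.2 ⟨hi2, hi⟩)]
          _ ≤ _ := Finset.single_le_sum (f := fun i => (Set.Ioc (unifGrid t N i)
              (unifGrid t N (i + 1))).indicator (fun _ => (1 : ℝ)) s.toNNReal)
              (fun j _ => Set.indicator_nonneg (fun _ _ => zero_le_one) _)
              (Finset.mem_range.2 (by omega))
      linarith
    · exact ⟨j, hj, (hmem j).2 hjs, hcast.trans (h _)⟩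
  have hval0 : ∀ N (s : ℝ), s ≤ 0 →
      ∑ j ∈ Finset.range (N + 1), (Set.Ioc (unifGrid t N j : ℝ) (unifGrid t N (j + 1))).indicator
        (fun _ => x (unifGrid t N (j + 1))) s = 0 := fun N s hs =>
    Finset.sum_eq_zero fun j _ => Set.indicator_of_notMem (fun h =>
      absurd (h.1.trans_le hs) (not_lt.2 (NNReal.coe_nonneg _))) _
  have hi : Integrable fun s => rlK a (t' - s) * (B * rlK 1 (s - 0)) := by
    refine ((integrable_rlK_sub_mul_rlK_sub ha one_pos t' 0).const_mul B).congr
      (Eventually.of_forall fun s => ?_)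
    simp only; ring
  refine tendsto_integral_of_dominated_convergence _ (fun N => ?_) hi (fun N => ?_) ?_
  · exact ((measurable_rlK_sub a t').mul (Finset.measurable_fun_sum _ fun j _ =>
      measurable_const.indicator measurableSet_Ioc)).aestronglyMeasurable
  · refine Eventually.of_forall fun s => ?_
    beta_reduce
    rw [norm_mul, Real.norm_of_nonneg (rlK_nonneg ha _)]
    rcases le_or_gt s 0 with h | h
    · rw [hval0 N s h, norm_zero, mul_zero]
      exact mul_nonneg (rlK_nonneg ha _) (mul_nonneg hB0 (rlK_nonneg one_pos _))
    · rcases lt_or_ge s t' with h' | h'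
      · obtain ⟨j, _, _, hj⟩ := hval N s h (h'.le.trans ht')
        rw [hj, sub_zero, rlK_one h, mul_one]
        exact mul_le_mul_of_nonneg_left (hB _ (hgT N _)) (rlK_nonneg ha _)
      · rw [rlK_of_nonpos (by linarith), zero_mul, zero_mul]
  · have hs0 : ∀ᵐ s : ℝ, s ≠ 0 := by simp [ae_iff, measure_singleton]
    filter_upwards [hs0] with s hs0
    rcases lt_or_ge s t' with h' | h'
    swap
    · simp [rlK_of_nonpos (show t' - s ≤ 0 by linarith)]
    refine Tendsto.const_mul _ ?_
    rcases lt_or_gt_of_ne hs0 with h | h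
    · simp only [hval0 _ s h.le, cut_of_neg h]
      exact tendsto_const_nhds
    · have hst := h'.le.trans ht'
      choose j hj1 hj2 hj3 using fun N => hval N s h hst
      simp only [hj3]
      have hsT : s.toNNReal ≤ T := (Real.toNNReal_le_iff_le_coe.2 hst).trans ht
      have e : cut T x s = x s.toNNReal := by
        rw [← cut_coe (φ := x) hsT, Real.coe_toNNReal _ h.le]
      rw [e]
      refine (hx _ ⟨zero_le, hsT⟩).tendsto.comp (tendsto_nhdsWithin_iff.2
        ⟨?_, Eventually.of_forall fun N => ⟨zero_le, hgT _ _⟩⟩)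
      have hlim : Tendsto (fun N : ℕ => s + (t : ℝ) * (1 / ((N : ℝ) + 1))) atTop (𝓝 s) := by
        have := (tendsto_one_div_add_atTop_nhds_zero_nat (𝕜 := ℝ)).const_mul (t : ℝ)
        rw [mul_zero] at this
        simpa using this.const_add s
      have hlim2 : Tendsto (fun N => (unifGrid t N (j N + 1) : ℝ)) atTop (𝓝 s) := by
        refine tendsto_of_tendsto_of_tendsto_of_le_of_le tendsto_const_nhds hlim
          (fun N => (hj2 N).2) fun N => ?_
        have h1 := NNReal.coe_le_coe.2 (unifGrid_succ_sub_le t N (j N))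
        push_cast at h1
        have h2 := (hj2 N).1
        calc (unifGrid t N (j N + 1) : ℝ) ≤ unifGrid t N (j N) + t / (N + 1) := h1
          _ ≤ s + t * (1 / (N + 1)) := by rw [mul_one_div]; linarith
      rw [← NNReal.tendsto_coe, Real.coe_toNNReal _ h.le]
      exact hlim2

/-- Abel summation for differences of Riemann–Liouville integrals of a continuous path. -/
lemma tendsto_stepInt_rl_sub {T : ℝ≥0} {x : ℝ≥0 → ℝ} (hx : ContinuousOn x (Set.Icc 0 T))
    (hx0 : x 0 = 0) {a : ℝ} (ha : 0 < a) {t : ℝ≥0} (ht : t ≤ T) {h : ℝ}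
    (hh : 0 < h) :
    Tendsto (fun N : ℕ => stepInt (unifGrid t N)
      (fun j => (rlK (a + 1) (t - unifGrid t N j) - rlK (a + 1) (t - h - unifGrid t N j)) / h)
      (N + 1) x) atTop (𝓝 ((rl a (cut T x) t - rl a (cut T x) (t - h)) / h)) := by
  have h1 := tendsto_rl_step hx ha ht (le_refl (t : ℝ))
  have h2 := tendsto_rl_step hx ha ht (show (t : ℝ) - h ≤ t by linarith)
  -- Abel summation moves the differences from the kernels to the path. The boundary terms vanish
  -- because the path starts at zero and both kernels are zero at the last grid point.
  refine ((h1.sub h2).div_const h).congr fun N => ?_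
  rw [rl_step ha (monotone_unifGrid t N) (fun j => x (unifGrid t N (j + 1))),
    rl_step ha (monotone_unifGrid t N) (fun j => x (unifGrid t N (j + 1))),
    sum_abel (fun j => rlK (a + 1) (t - unifGrid t N j)) fun j => x (unifGrid t N j),
    sum_abel (fun j => rlK (a + 1) (t - h - unifGrid t N j)) fun j => x (unifGrid t N j)]
  simp only [unifGrid_zero, unifGrid_last, hx0, mul_zero, add_zero]
  rw [rlK_of_nonpos (show (t : ℝ) - t ≤ 0 by simp), rlK_of_nonpos (show (t : ℝ) - h - t ≤ 0 by linarith),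
    zero_mul, sub_zero, sub_zero, ← Finset.sum_sub_distrib, Finset.sum_div]
  exact Finset.sum_congr rfl fun j _ => by ring

/-! ### From the half line to the real line -/

lemma setLIntegral_timeVol (f : ℝ → ℝ≥0∞) (t : ℝ≥0) :
    ∫⁻ s in Set.Iic t, f s ∂timeVol = ∫⁻ s in Set.Icc (0 : ℝ) t, f s := by
  have h : Set.Iic t = ((↑) : ℝ≥0 → ℝ) ⁻¹' Set.Iic (t : ℝ) := by ext x; simp
  rw [h, measurePreserving_coe_timeVol.setLIntegral_comp_preimage_emb measurableEmbedding_coe_nnreal,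
    Measure.restrict_restrict measurableSet_Iic]
  congr 2
  ext x; simp [and_comm]

lemma rlK_sub_eq_fracKernel {a : ℝ} {t s : ℝ≥0} (h : s < t) :
    rlK a ((t : ℝ) - s) = fracKernel a t s := by
  rw [rlK_of_pos (sub_pos.2 (NNReal.coe_lt_coe.2 h)), fracKernel]

/-- The two kernels can differ only at `s = t`, where `fracKernel` takes the value of `0 ^ (a - 1)`;
this is a null set. -/
lemma fracKernel_ae_eq (a : ℝ) (φ : ℝ≥0 → ℝ) {t T : ℝ≥0} (ht : t ≤ T) :
    (Set.Iic t).indicator (fun s => fracKernel a t s • φ s) =ᵐ[timeVol]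
      fun s => rlK a ((t : ℝ) - s) * cut T φ s := by
  have h1 : ∀ᵐ s ∂timeVol, s ≠ t := by simp [ae_iff, measure_singleton]
  filter_upwards [h1] with s hs
  rcases lt_or_gt_of_ne hs with h | h
  · rw [Set.indicator_of_mem (Set.mem_Iic.2 h.le), rlK_sub_eq_fracKernel h,
      cut_coe (h.le.trans ht), smul_eq_mul]
  · rw [Set.indicator_of_notMem (by simpa using h), rlK_of_nonpos, zero_mul]
    have := NNReal.coe_lt_coe.2 h
    linarith

lemma fracInt_eq_rl {a : ℝ} (ha : a ≠ 0) (φ : ℝ≥0 → ℝ) {t T : ℝ≥0} (ht : t ≤ T) :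
    fracInt a φ t = rl a (cut T φ) t := by
  rw [fracInt, if_neg ha, ← integral_indicator measurableSet_Iic,
    integral_congr_ae (fracKernel_ae_eq a φ ht), rl,
    measurePreserving_coe_timeVol.integral_comp measurableEmbedding_coe_nnreal
      fun s : ℝ => rlK a (t - s) * cut T φ s, ← integral_indicator measurableSet_Ici]
  refine integral_congr_ae (Eventually.of_forall fun s => ?_)
  by_cases h : 0 ≤ s
  · rw [Set.indicator_of_mem (Set.mem_Ici.2 h)]
  · rw [Set.indicator_of_notMem (by simpa using h)]
    beta_reduce
    rw [cut_of_neg (not_le.1 h), mul_zero]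

lemma fracInt_eq_rlI (a : ℝ) (φ : ℝ≥0 → ℝ) {t T : ℝ≥0} (ht : t ≤ T) :
    fracInt a φ t = rlI a (cut T φ) t := by
  by_cases ha : a = 0
  · rw [fracInt, rlI, if_pos ha, if_pos ha, cut_coe ht]
  · rw [fracInt_eq_rl ha φ ht, rlI, if_neg ha]

lemma measurable_cut {T : ℝ≥0} {φ : ℝ≥0 → ℝ} (hφ : Measurable φ) : Measurable (cut T φ) :=
  (hφ.comp measurable_real_toNNReal).indicator measurableSet_Icc

lemma measurable_cut_of_continuousOn {T : ℝ≥0} {φ : ℝ≥0 → ℝ}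
    (hφ : ContinuousOn φ (Set.Icc 0 T)) : Measurable (cut T φ) := by
  have h1 : ContinuousOn (fun s : ℝ => φ s.toNNReal) (Set.Icc 0 T) := by
    refine hφ.comp continuous_real_toNNReal.continuousOn fun s hs => ⟨zero_le, ?_⟩
    exact Real.toNNReal_le_iff_le_coe.2 hs.2
  have h2 := h1.measurable_piecewise (g := fun _ => (0 : ℝ)) continuous_const.continuousOn
    measurableSet_Icc
  have e : cut T φ = (Set.Icc (0 : ℝ) T).piecewise (fun s : ℝ => φ s.toNNReal) fun _ => 0 :=
    (Set.piecewise_eq_indicator).symm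
  rw [e]
  exact h2

lemma continuousAt_cut {T : ℝ≥0} {φ : ℝ≥0 → ℝ} (hφ : ContinuousOn φ (Set.Icc 0 T)) {s : ℝ}
    (hs : s ∉ ({0, (T : ℝ)} : Set ℝ)) : ContinuousAt (cut T φ) s := by
  simp only [Set.mem_insert_iff, Set.mem_singleton_iff, not_or] at hs
  rcases lt_or_gt_of_ne hs.1 with h | h
  · have : cut T φ =ᶠ[𝓝 s] fun _ => 0 := by
      filter_upwards [eventually_lt_nhds h] with x hx using cut_of_neg hx
    exact continuousAt_const.congr this.symm
  rcases lt_or_gt_of_ne hs.2 with h' | h'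
  · have : cut T φ =ᶠ[𝓝 s] fun s => φ s.toNNReal := by
      filter_upwards [Icc_mem_nhds h h'] with x hx using Set.indicator_of_mem hx _
    refine ContinuousAt.congr ?_ this.symm
    have h1 : ContinuousAt φ s.toNNReal := by
      refine hφ.continuousAt (mem_of_superset (Iio_mem_nhds (?_ : s.toNNReal < T)) fun x hx =>
        ⟨zero_le, le_of_lt hx⟩)
      exact (Real.toNNReal_lt_iff_lt_coe h.le).2 h'
    exact ContinuousAt.comp (f := Real.toNNReal) h1 continuous_real_toNNReal.continuousAt
  · have : cut T φ =ᶠ[𝓝 s] fun _ => 0 := by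
      filter_upwards [eventually_gt_nhds h'] with x hx
      exact Set.indicator_of_notMem (fun h => absurd h.2 (not_le.2 hx)) _
    exact continuousAt_const.congr this.symm

lemma abs_cut_le {T : ℝ≥0} {φ : ℝ≥0 → ℝ} {B : ℝ} (hB : ∀ s ≤ T, |φ s| ≤ B) (s : ℝ) :
    |cut T φ s| ≤ B := by
  by_cases h : s ∈ Set.Icc (0 : ℝ) T
  · rw [cut, Set.indicator_of_mem h]
    exact hB _ (Real.toNNReal_le_iff_le_coe.2 h.2)
  · rw [cut, Set.indicator_of_notMem h, abs_zero]
    exact (abs_nonneg _).trans (hB 0 zero_le)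

lemma integrable_cut {T : ℝ≥0} {φ : ℝ≥0 → ℝ} (hφ : IntegrableOn φ (Set.Iic T) timeVol) :
    Integrable (cut T φ) := by
  have h : Set.Iic T = ((↑) : ℝ≥0 → ℝ) ⁻¹' Set.Iic (T : ℝ) := by ext x; simp
  have e : φ = (fun s : ℝ => φ s.toNNReal) ∘ ((↑) : ℝ≥0 → ℝ) := by ext s; simp
  rw [h, e, measurePreserving_coe_timeVol.integrableOn_comp_preimage
    measurableEmbedding_coe_nnreal, IntegrableOn, Measure.restrict_restrict measurableSet_Iic] at hφ
  rw [cut, integrable_indicator_iff measurableSet_Icc]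
  have e2 : Set.Iic (T : ℝ) ∩ Set.Ici 0 = Set.Icc 0 (T : ℝ) := by ext; simp [and_comm]
  rwa [e2] at hφ

/-! ### Difference quotients of Riemann–Liouville integrals of stochastic integrals -/

/-- The bound does not depend on the step `h`. When `h > r` the second kernel vanishes; this is
covered by replacing `r - h` by `max (r - h) 0`, whose distance to `r` is still at most `h`. -/
lemma rlK_quot_bounds {a : ℝ} (ha : 0 < a) {h r : ℝ} (hh : 0 < h) (hr : 0 < r) :
    |(rlK (a + 1) r - rlK (a + 1) (r - h)) / h| ≤ max 1 a / Real.Gamma (a + 1) * r ^ (a - 1) := by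
  have hΓ := Real.Gamma_pos_of_pos (by linarith : 0 < a + 1)
  have hp : (0 : ℝ) < max 1 a := lt_max_of_lt_left one_pos
  have e : ∀ r : ℝ, rlK (a + 1) r = (max r 0) ^ a / Real.Gamma (a + 1) := fun r => by
    rcases le_or_gt r 0 with h | h
    · rw [rlK_of_nonpos h, max_eq_right h, Real.zero_rpow ha.ne', zero_div]
    · rw [rlK_of_pos h, max_eq_left h.le, add_sub_cancel_right]
  rw [e, e, max_eq_left hr.le]
  set b := max (r - h) 0
  have hb0 : 0 ≤ b := le_max_right _ _
  have hbr : b ≤ r := max_le (by linarith) hr.le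
  have hrb : r - b ≤ h := by have := le_max_left (r - h) 0; linarith
  have h1 := rpow_sub_rpow_le_mul hb0 hbr ha
  have h2 : b ^ a ≤ r ^ a := Real.rpow_le_rpow hb0 hbr ha.le
  have h3 : r ^ (a - 1) * (r - b) ≤ r ^ (a - 1) * h := by gcongr
  rw [← sub_div, abs_of_nonneg (div_nonneg (div_nonneg (by linarith) hΓ.le) hh.le), div_div,
    div_mul_eq_mul_div, div_le_div_iff₀ (by positivity) hΓ]
  calc (r ^ a - b ^ a) * Real.Gamma (a + 1) ≤ (max 1 a * (r ^ (a - 1) * h)) * Real.Gamma (a + 1) := by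
        gcongr
        exact h1.trans (by gcongr)
    _ = _ := by ring

/-- The square of the constant of `rlK_quot_bounds`, for the exponent `min (2 (a - 1)) 0`. -/
def quotSqConst (a T : ℝ) : ℝ :=
  (max 1 a / Real.Gamma (a + 1)) ^ 2 * T ^ (2 * (a - 1) - min (2 * (a - 1)) 0)

/-- The exponent is lowered to a nonpositive one at the cost of a power of `T`. The bound is then
nonincreasing in `r`, so its value at the left end of a cell, which is farthest from `t`, is
dominated by its values in the whole cell. -/
lemma rlK_quot_sq_le {a : ℝ} (ha : 0 < a) {h r T : ℝ} (hh : 0 < h) (hr : 0 < r) (hrT : r ≤ T) :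
    ((rlK (a + 1) r - rlK (a + 1) (r - h)) / h) ^ 2 ≤
      quotSqConst a T * r ^ min (2 * (a - 1)) 0 := by
  have h1 := rlK_quot_bounds ha hh hr
  rw [← sq_abs]
  calc |(rlK (a + 1) r - rlK (a + 1) (r - h)) / h| ^ 2 ≤
        (max 1 a / Real.Gamma (a + 1) * r ^ (a - 1)) ^ 2 := by gcongr
    _ = (max 1 a / Real.Gamma (a + 1)) ^ 2 *
        (r ^ (2 * (a - 1) - min (2 * (a - 1)) 0) * r ^ min (2 * (a - 1)) 0) := by
      rw [mul_pow, ← Real.rpow_add hr, ← Real.rpow_natCast (r ^ (a - 1)), ← Real.rpow_mul hr.le]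
      congr 2; push_cast; ring
    _ ≤ (max 1 a / Real.Gamma (a + 1)) ^ 2 *
        (T ^ (2 * (a - 1) - min (2 * (a - 1)) 0) * r ^ min (2 * (a - 1)) 0) := by
      have : r ^ (2 * (a - 1) - min (2 * (a - 1)) 0) ≤ T ^ (2 * (a - 1) - min (2 * (a - 1)) 0) :=
        Real.rpow_le_rpow hr.le hrT (sub_nonneg.2 (min_le_left _ _))
      gcongr
    _ = _ := by rw [quotSqConst]; ring

lemma quotSqConst_pos {a T : ℝ} (ha : 0 < a) (hT : 0 < T) : 0 < quotSqConst a T := by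
  have := Real.Gamma_pos_of_pos (by linarith : 0 < a + 1)
  have : (0 : ℝ) < max 1 a := lt_max_of_lt_left one_pos
  unfold quotSqConst; positivity

/-- The constant of `IsItoSum.lintegral_quot_le`. -/
def quotConst (q a T : ℝ) : ℝ :=
  itoConst q * (quotSqConst a T * T ^ (min (2 * (a - 1)) 0 + 1) /
    (min (2 * (a - 1)) 0 + 1)) ^ ((q - 2) / 2) *
    (quotSqConst a T * Real.Gamma (min (2 * (a - 1)) 0 + 1))

section Ito
variable {Ω : Type*} {mΩ : MeasurableSpace Ω} {P : Measure Ω} [IsProbabilityMeasure P]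
  {ℱ : Filtration ℝ≥0 mΩ} {w : ℕ → ℝ≥0 → Ω → ℝ} {T : ℝ≥0}

lemma ae_rectMeasure_fst_ne (t : ℝ≥0) : ∀ᵐ z ∂rectMeasure P T, z.1 ≠ t := by
  have h : ∀ᵐ s ∂timeVol.restrict (Set.Iic T), s ≠ t := by
    refine ae_restrict_of_ae ?_
    simp [ae_iff, measure_singleton]
  exact Measure.quasiMeasurePreserving_fst.ae h

/-- The quotient is the limit of weighted sums of increments of `X`, to which `stepInt_le` applies.
The condition `a > 1/2` makes the squared weight integrable, with a bound uniform in the grid and in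
`h`. -/
lemma IsItoSum.lintegral_quot_le {q : ℝ} (hq : 2 ≤ q) (hT : 0 < T) {G : ℝ≥0 × Ω → ell2}
    {M : ℕ → ℝ≥0 → Ω → ℝ} {ns : ℕ → ℕ} {X : ℝ≥0 → Ω → ℝ} (hX : IsItoSum P T q G M ns X) {a : ℝ}
    (ha : 1 / 2 < a) {t : ℝ≥0} (ht : t ≤ T) {h : ℝ} (hh : 0 < h) :
    ∫⁻ ω, ‖(rl a (cut T fun s => X s ω) t - rl a (cut T fun s => X s ω) (t - h)) / h‖ₑ ^ q ∂P ≤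
      ENNReal.ofReal (quotConst q a T) *
        ∫⁻ z, ENNReal.ofReal (rlK (min (2 * (a - 1)) 0 + 1) (t - z.1)) * ‖G z‖ₑ ^ q
          ∂rectMeasure P T := by
  have ha0 : 0 < a := by linarith
  have hq0 : 0 < q := by linarith
  have hT' : (0 : ℝ) < T := hT
  set ρ := min (2 * (a - 1)) 0 with hρ
  have hρ1 : 0 < ρ + 1 := by
    have : -1 < ρ := lt_min (by linarith) (by norm_num)
    linarith
  have hρ0 : ρ ≤ 0 := min_le_right _ _
  have hC2 := quotSqConst_pos ha0 hT'
  have hΓρ := Real.Gamma_pos_of_pos hρ1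
  have hito := itoConst_pos hq
  -- The constant of the weight times `∫_0^T r^ρ dr`.
  let A : ℝ := quotSqConst a T * (T : ℝ) ^ (ρ + 1) / (ρ + 1)
  have hA : 0 < A := by positivity
  let c : ℕ → ℕ → ℝ := fun N j =>
    (rlK (a + 1) (t - unifGrid t N j) - rlK (a + 1) (t - h - unifGrid t N j)) / h
  have hgt : ∀ N j, unifGrid t N j ≤ t := fun N j => by
    simp only [unifGrid]
    rw [div_le_iff₀ (by positivity)]
    gcongr
    exact_mod_cast min_le_right _ _
  have hgT : ∀ N, unifGrid t N (N + 1) ≤ T := fun N => (hgt N _).trans ht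
  have hc : ∀ N j, unifGrid t N j < t →
      c N j ^ 2 ≤ quotSqConst a T * ((t : ℝ) - unifGrid t N j) ^ ρ := fun N j hj => by
    have h1 : (0 : ℝ) < t - unifGrid t N j := sub_pos.2 (NNReal.coe_lt_coe.2 hj)
    have h2 : (t : ℝ) - unifGrid t N j ≤ T := by
      have := NNReal.coe_le_coe.2 ht
      have := NNReal.coe_nonneg (unifGrid t N j)
      linarith
    have := rlK_quot_sq_le ha0 hh h1 h2
    rwa [show (t : ℝ) - unifGrid t N j - h = t - h - unifGrid t N j by ring] at this
  have hcA : ∀ N, stepInt (unifGrid t N) (fun i => c N i ^ 2) (N + 1) (↑) ≤ A := by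
    intro N
    -- Since `ρ ≤ 0`, each term is at most a lower rectangle of the weight, hence at most a
    -- difference of values of the primitive.
    have h1 : ∀ j, c N j ^ 2 * ((unifGrid t N (j + 1) : ℝ) - unifGrid t N j) ≤
        quotSqConst a T / (ρ + 1) * (((t : ℝ) - unifGrid t N j) ^ (ρ + 1) -
          ((t : ℝ) - unifGrid t N (j + 1)) ^ (ρ + 1)) := by
      intro j
      have hm := NNReal.coe_le_coe.2 (monotone_unifGrid t N (Nat.le_succ j))
      have ht1 := NNReal.coe_le_coe.2 (hgt N (j + 1))
      rcases (hgt N j).eq_or_lt with h2 | h2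
      · have h3 : (unifGrid t N (j + 1) : ℝ) = unifGrid t N j := by
          rw [h2] at hm ⊢; exact le_antisymm ht1 hm
        rw [h3]; simp
      · have h4 := mul_rpow_mul_sub_le (a := (t : ℝ) - unifGrid t N j)
          (b := (t : ℝ) - unifGrid t N (j + 1)) (e := ρ + 1) (by linarith) (by linarith) hρ1
          (by linarith)
        rw [add_sub_cancel_right] at h4
        calc c N j ^ 2 * ((unifGrid t N (j + 1) : ℝ) - unifGrid t N j) ≤
              quotSqConst a T * ((t : ℝ) - unifGrid t N j) ^ ρ *
                ((unifGrid t N (j + 1) : ℝ) - unifGrid t N j) :=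
              mul_le_mul_of_nonneg_right (hc N j h2) (by linarith)
          _ = quotSqConst a T / (ρ + 1) * ((ρ + 1) * (((t : ℝ) - unifGrid t N j) ^ ρ *
                ((t : ℝ) - unifGrid t N j - ((t : ℝ) - unifGrid t N (j + 1))))) := by
            field_simp; ring
          _ ≤ _ := by gcongr
    calc stepInt (unifGrid t N) (fun i => c N i ^ 2) (N + 1) (↑) ≤
          ∑ j ∈ Finset.range (N + 1), quotSqConst a T / (ρ + 1) *
            (((t : ℝ) - unifGrid t N j) ^ (ρ + 1) - ((t : ℝ) - unifGrid t N (j + 1)) ^ (ρ + 1)) :=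
          Finset.sum_le_sum fun j _ => h1 j
      _ = quotSqConst a T / (ρ + 1) * ((t : ℝ) ^ (ρ + 1)) := by
          rw [← Finset.mul_sum, Finset.sum_range_sub' fun j => ((t : ℝ) - unifGrid t N j) ^ (ρ + 1),
            unifGrid_zero, unifGrid_last, sub_self, Real.zero_rpow hρ1.ne', sub_zero]
          simp
      _ ≤ quotSqConst a T / (ρ + 1) * ((T : ℝ) ^ (ρ + 1)) := by
          have := NNReal.coe_le_coe.2 ht
          gcongr
      _ = A := by simp only [A]; ring
  set R := ∫⁻ z, ENNReal.ofReal (rlK (ρ + 1) (t - z.1)) * ‖G z‖ₑ ^ q ∂rectMeasure P T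
  have hbound : ∀ N, ∫⁻ ω, ‖stepInt (unifGrid t N) (c N) (N + 1) fun s => X s ω‖ₑ ^ q ∂P ≤
      ENNReal.ofReal (quotConst q a T) * R := by
    intro N
    refine (hX.stepInt_le _ (monotone_unifGrid t N) (c N) (N + 1) (hgT N) A hA (hcA N)).trans ?_
    have h1 : ∫⁻ z, ENNReal.ofReal (stepFun (unifGrid t N) (c N) (N + 1) z.1 ^ 2) * ‖G z‖ₑ ^ q
        ∂rectMeasure P T ≤ ENNReal.ofReal (quotSqConst a T * Real.Gamma (ρ + 1)) * R := by
      rw [← lintegral_const_mul' _ _ ENNReal.ofReal_ne_top]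
      refine lintegral_mono_ae ?_
      filter_upwards [ae_rectMeasure_fst_ne t] with z hz
      rw [← mul_assoc, ← ENNReal.ofReal_mul (mul_nonneg hC2.le hΓρ.le)]
      refine mul_le_mul_left (ENNReal.ofReal_le_ofReal ?_) _
      rcases stepFun_eq_or (monotone_unifGrid t N) (N + 1) z.1 with h | ⟨j, hj, hjs, h⟩
      · rw [h]
        have := rlK_nonneg hρ1 ((t : ℝ) - z.1)
        rw [zero_pow two_ne_zero]
        exact mul_nonneg (mul_nonneg hC2.le hΓρ.le) this
      · rw [h]
        have h2 : z.1 < t := lt_of_le_of_ne (hjs.2.trans (hgt N _)) hz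
        have h3 : (0 : ℝ) < t - z.1 := sub_pos.2 (NNReal.coe_lt_coe.2 h2)
        have h4 := NNReal.coe_lt_coe.2 hjs.1
        refine (hc N j (hjs.1.trans h2)).trans ?_
        rw [rlK_of_pos h3, add_sub_cancel_right, mul_assoc, mul_div_cancel₀ _ hΓρ.ne']
        exact mul_le_mul_of_nonneg_left (Real.rpow_le_rpow_of_nonpos h3 (by linarith) hρ0) hC2.le
    refine (mul_le_mul_right h1 _).trans (le_of_eq ?_)
    have hnn := itoConst_pos hq
    rw [← mul_assoc, ← ENNReal.ofReal_mul (mul_nonneg hnn.le (Real.rpow_nonneg hA.le _))]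
    rfl
  have hσT : ∀ N j, unifGrid t N j ≤ T := fun N j => (hgt N j).trans ht
  refine lintegral_le_of_tendsto_ae
    (F := fun N ω => ‖stepInt (unifGrid t N) (c N) (N + 1) fun s => X s ω‖ₑ ^ q) (fun N => ?_) ?_
    hbound tendsto_const_nhds
  · refine AEMeasurable.pow_const (AEStronglyMeasurable.enorm ?_) q
    exact Finset.aestronglyMeasurable_fun_sum _ fun i hi =>
      ((hX.aestronglyMeasurable _ (hσT _ _)).sub (hX.aestronglyMeasurable _ (hσT _ _))).const_mul _
  · filter_upwards [hX.continuousOn, hX.zero] with ω h1 h2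
    exact ((continuous_enorm.tendsto _).comp
      (tendsto_stepInt_rl_sub h1 h2 ha0 ht hh)).ennrpow_const q

end Ito

/-! ### The Volterra bound for scalar equations -/

lemma lintegral_rpow_le_measure_univ {X : Type*} {mX : MeasurableSpace X} (μ : Measure X) {f : X → ℝ≥0∞}
    (hf : AEMeasurable f μ) {q : ℝ} (hq : 1 ≤ q) :
    (∫⁻ x, f x ∂μ) ^ q ≤ μ Set.univ ^ (q - 1) * ∫⁻ x, f x ^ q ∂μ := by
  have hq0 : 0 < q := by linarith
  have h1 := eLpNorm_le_eLpNorm_mul_rpow_measure_univ (μ := μ) (f := f) (p := 1)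
    (q := ENNReal.ofReal q) (by rw [← ENNReal.ofReal_one]; exact ENNReal.ofReal_le_ofReal hq)
    hf.aestronglyMeasurable
  rw [eLpNorm_one_eq_lintegral_enorm, eLpNorm_eq_lintegral_rpow_enorm_toReal (by simpa using hq0)
    ENNReal.ofReal_ne_top, ENNReal.toReal_ofReal hq0.le] at h1
  simp only [enorm_eq_self] at h1
  refine (ENNReal.rpow_le_rpow h1 hq0.le).trans (le_of_eq ?_)
  rw [ENNReal.mul_rpow_of_nonneg _ _ hq0.le, ← ENNReal.rpow_mul, ← ENNReal.rpow_mul,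
    one_div_mul_cancel hq0.ne', ENNReal.rpow_one, mul_comm]
  congr 2
  simp only [ENNReal.toReal_one]
  field_simp

lemma rlK_le_rpow {θ a r T : ℝ} (hθa : θ ≤ a) (ha : 0 < a) (hr : 0 < r) (hrT : r ≤ T) :
    rlK a r ≤ T ^ (a - θ) / Real.Gamma a * r ^ (θ - 1) := by
  have hΓ := Real.Gamma_pos_of_pos ha
  rw [rlK_of_pos hr, show a - 1 = (a - θ) + (θ - 1) by ring, Real.rpow_add hr, div_mul_eq_mul_div]
  gcongr

lemma ae_of_ae_timeVol {T : ℝ≥0} {p : ℝ≥0 → Prop} (h : ∀ᵐ t ∂timeVol.restrict (Set.Iic T), p t) :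
    ∀ᵐ s : ℝ, 0 ≤ s → s ≤ T → p s.toNNReal := by
  have h1 := (ae_restrict_iff' measurableSet_Iic).1 h
  rw [timeVol] at h1
  have h2 := (ae_restrict_iff' measurableSet_Ici).1 (ae_of_ae_map measurable_real_toNNReal.aemeasurable h1)
  filter_upwards [h2] with s hs h0 hT
  exact hs h0 (Real.toNNReal_le_iff_le_coe.2 hT)

lemma ae_timeVol_of_ae {p : ℝ → Prop} (h : ∀ᵐ s : ℝ, p s) : ∀ᵐ t : ℝ≥0 ∂timeVol, p t :=
  measurePreserving_coe_timeVol.quasiMeasurePreserving.ae (ae_restrict_of_ae h)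

lemma locallyIntegrable_of_rlIntegrable_one {V : ℝ → ℝ} (hV : ∀ t, RLIntegrable 1 V t) :
    LocallyIntegrable V := by
  intro x
  refine ⟨Set.Iio (x + 1), Iio_mem_nhds (by linarith), ?_⟩
  refine ((hV (x + 1)).integrableOn (s := Set.Iio (x + 1))).congr_fun (fun s hs => ?_) measurableSet_Iio
  beta_reduce
  rw [rlK_one (sub_pos.2 hs), one_mul]

/-- The Lebesgue differentiation theorem, along the countable sequence of backward steps `1 / (n +
1)`, which is what Fatou's lemma needs. -/
lemma ae_tendsto_slope_rl_one {V : ℝ → ℝ} (h0 : ∀ s < 0, V s = 0) (hV : ∀ t, RLIntegrable 1 V t) :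
    ∀ᵐ t, Tendsto (fun n : ℕ => (rl 1 V t - rl 1 V (t - 1 / ((n : ℝ) + 1))) / (1 / ((n : ℝ) + 1)))
      atTop (𝓝 (V t)) := by
  have h1 : ∀ t, rl 1 V t = ∫ s in (0)..t, V s := by
    intro t
    rcases le_total 0 t with ht | ht
    · exact rl_one_eq h0 ht
    · rw [rl_of_nonpos h0 ht, intervalIntegral.integral_symm, intervalIntegral.integral_of_le ht,
        integral_Ioc_eq_integral_Ioo, setIntegral_eq_zero_of_forall_eq_zero fun s hs => h0 s hs.2,
        neg_zero]
  filter_upwards [_root_.LocallyIntegrable.ae_hasDerivAt_integral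
    (locallyIntegrable_of_rlIntegrable_one hV)] with t ht
  have h2 := (ht 0).tendsto_slope_zero
  have h3 : Tendsto (fun n : ℕ => -(1 / ((n : ℝ) + 1))) atTop (𝓝[≠] 0) := by
    refine tendsto_nhdsWithin_iff.2 ⟨?_, ?_⟩
    · have := (tendsto_one_div_add_atTop_nhds_zero_nat (𝕜 := ℝ)).neg
      rwa [neg_zero] at this
    filter_upwards with n
    have : (0 : ℝ) < 1 / ((n : ℝ) + 1) := by positivity
    simpa using by linarith
  refine (h2.comp h3).congr fun n => ?_
  have : (0 : ℝ) < 1 / ((n : ℝ) + 1) := by positivity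
  simp only [Function.comp_apply, smul_eq_mul, h1, ← sub_eq_add_neg]
  field_simp
  ring

lemma measurable_rl_prod {X : Type*} {mX : MeasurableSpace X} {F : X → ℝ → ℝ}
    (hF : Measurable (Function.uncurry F)) (a : ℝ) : Measurable fun z : ℝ × X => rl a (F z.2) z.1 := by
  have h : Measurable fun y : (ℝ × X) × ℝ => rlK a (y.1.1 - y.2) * F y.1.2 y.2 :=
    ((measurable_rlK a).comp (measurable_fst.fst.sub measurable_snd)).mul
      (hF.comp (measurable_fst.snd.prodMk measurable_snd))
  exact (h.stronglyMeasurable.integral_prod_right (ν := volume)).measurable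

lemma measurable_cut_prod {X : Type*} {mX : MeasurableSpace X} (T : ℝ≥0) {y : ℝ≥0 × X → ℝ}
    (hy : Measurable y) : Measurable (Function.uncurry fun (x : X) (s : ℝ) => cut T (fun r => y (r, x)) s) := by
  have h : Measurable fun z : X × ℝ => y (z.2.toNNReal, z.1) :=
    hy.comp ((measurable_real_toNNReal.comp measurable_snd).prodMk measurable_fst)
  exact h.indicator (measurable_snd measurableSet_Icc)

lemma lintegral_mul_enorm_cut_rpow (k : ℝ → ℝ≥0∞) (T : ℝ≥0) (φ : ℝ≥0 → ℝ) {q : ℝ} (hq : 0 < q) :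
    ∫⁻ s, k s * ‖cut T φ s‖ₑ ^ q = ∫⁻ s in Set.Iic T, k s * ‖φ s‖ₑ ^ q ∂timeVol := by
  have h1 : ∫⁻ s in Set.Iic T, k s * ‖φ s‖ₑ ^ q ∂timeVol =
      ∫⁻ s in Set.Iic T, (fun s : ℝ => k s * ‖φ s.toNNReal‖ₑ ^ q) s ∂timeVol := by
    simp
  rw [h1, setLIntegral_timeVol (fun s : ℝ => k s * ‖φ s.toNNReal‖ₑ ^ q),
    ← lintegral_indicator measurableSet_Icc]
  refine lintegral_congr fun s => ?_
  rw [cut]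
  by_cases hs : s ∈ Set.Icc (0 : ℝ) T
  · rw [Set.indicator_of_mem hs, Set.indicator_of_mem hs]
  · rw [Set.indicator_of_notMem hs, Set.indicator_of_notMem hs, enorm_zero, ENNReal.zero_rpow_of_pos hq,
      mul_zero]

/-- Jensen's inequality for the finite measure on `(0, ∞)` whose density is the kernel and whose
total mass is `rlK (a + 1) t`. -/
lemma enorm_rl_rpow_le {a : ℝ} (ha : 0 < a) {F : ℝ → ℝ} (hF : Measurable F) (h0 : ∀ s < 0, F s = 0)
    {q : ℝ} (hq : 1 ≤ q) (t : ℝ) :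
    ‖rl a F t‖ₑ ^ q ≤ ENNReal.ofReal (rlK (a + 1) t) ^ (q - 1) *
      ∫⁻ s, ENNReal.ofReal (rlK a (t - s)) * ‖F s‖ₑ ^ q := by
  have hq0 : 0 < q := by linarith
  have hk : Measurable fun s => ENNReal.ofReal (rlK a (t - s)) := (measurable_rlK_sub a t).ennreal_ofReal
  let μ : Measure ℝ := (volume.restrict (Set.Ioi 0)).withDensity fun s => ENNReal.ofReal (rlK a (t - s))
  have h1 : μ Set.univ = ENNReal.ofReal (rlK (a + 1) t) := by
    rw [withDensity_apply _ MeasurableSet.univ, Measure.restrict_univ, lintegral_rlK_sub ha]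
  have hne : ∀ᵐ s : ℝ, s ≠ 0 := Measure.ae_ne volume 0
  have h3 : ∀ G : ℝ → ℝ≥0∞, (∀ s < 0, G s = 0) → ∫⁻ s, ENNReal.ofReal (rlK a (t - s)) * G s =
      ∫⁻ s in Set.Ioi 0, ENNReal.ofReal (rlK a (t - s)) * G s := by
    intro G hG
    rw [← lintegral_indicator measurableSet_Ioi]
    refine lintegral_congr_ae ?_
    filter_upwards [hne] with s hs
    rcases lt_or_gt_of_ne hs with h | h
    · rw [Set.indicator_of_notMem (by simpa using h.le), hG s h, mul_zero]
    · rw [Set.indicator_of_mem (Set.mem_Ioi.2 h)]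
  have h2 : ‖rl a F t‖ₑ ≤ ∫⁻ s, ‖F s‖ₑ ∂μ := by
    rw [lintegral_withDensity_eq_lintegral_mul _ hk hF.enorm]
    refine (enorm_integral_le_lintegral_enorm _).trans (le_of_eq ?_)
    simp only [Pi.mul_apply]
    rw [← h3 (fun s => ‖F s‖ₑ) fun s hs => by rw [h0 s hs, enorm_zero]]
    refine lintegral_congr fun s => ?_
    rw [enorm_mul, Real.enorm_eq_ofReal (rlK_nonneg ha _)]
  refine (ENNReal.rpow_le_rpow h2 hq0.le).trans
    ((lintegral_rpow_le_measure_univ μ hF.enorm.aemeasurable hq).trans (le_of_eq ?_))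
  rw [h1, lintegral_withDensity_eq_lintegral_mul _ hk (hF.enorm.pow_const q)]
  simp only [Pi.mul_apply]
  rw [← h3 (fun s => ‖F s‖ₑ ^ q) fun s hs => by rw [h0 s hs, enorm_zero, ENNReal.zero_rpow_of_pos hq0]]

/-! ### Tonelli bounds for singular kernels. -/

section Scalar

variable {Ω : Type*} {mΩ : MeasurableSpace Ω} {P : Measure Ω} [IsProbabilityMeasure P] {T : ℝ≥0}

lemma lintegral_rectMeasure_eq_indicator {s : ℝ≥0} (hs : s ≤ T) {H : ℝ≥0 × Ω → ℝ≥0∞} :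
    ∫⁻ z, H z ∂rectMeasure P s = ∫⁻ z, {z : ℝ≥0 × Ω | z.1 ≤ s}.indicator H z ∂rectMeasure P T := by
  have h : MeasurableSet {z : ℝ≥0 × Ω | z.1 ≤ s} := measurable_fst measurableSet_Iic
  have h1 : {z : ℝ≥0 × Ω | z.1 ≤ s} = Set.Iic s ×ˢ Set.univ := by ext; simp
  rw [lintegral_indicator h, rectMeasure, rectMeasure, h1, ← Measure.prod_restrict,
    Measure.restrict_restrict measurableSet_Iic, Measure.restrict_univ,
    Set.inter_eq_left.2 (Set.Iic_subset_Iic.2 hs)]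

/-- The reflection `t ↦ t₀ + r - t` of `[r, t₀]` exchanges `t - r` and `t₀ - t`. Thereby a kernel
started at `r` becomes one that looks back from `t₀`, the form of the asserted estimate. -/
lemma lintegral_rlK_sub_le {θ a : ℝ} (ha : 0 < a) (hθa : θ ≤ a) {t₀ : ℝ≥0}
    (ht : t₀ ≤ T) (r : ℝ≥0) :
    ∫⁻ t in Set.Iic t₀, ENNReal.ofReal (rlK a ((t : ℝ) - r)) ∂timeVol ≤
      ENNReal.ofReal ((T : ℝ) ^ (a - θ) / Real.Gamma a) *
        ∫⁻ s in Set.Iic t₀, (Set.Ici r).indicator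
          (fun s : ℝ≥0 => ENNReal.ofReal (((t₀ : ℝ) - s) ^ (θ - 1))) s ∂timeVol := by
  have hT : (t₀ : ℝ) ≤ T := ht
  have hr := NNReal.coe_nonneg r
  have h1 : ∫⁻ s in Set.Iic t₀, (Set.Ici r).indicator
      (fun s : ℝ≥0 => ENNReal.ofReal (((t₀ : ℝ) - s) ^ (θ - 1))) s ∂timeVol =
      ∫⁻ s in Set.Iic t₀, (fun x : ℝ => (Set.Ici (r : ℝ)).indicator
      (fun x : ℝ => ENNReal.ofReal (((t₀ : ℝ) - x) ^ (θ - 1))) x) s ∂timeVol := by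
    refine lintegral_congr fun s => ?_
    beta_reduce
    by_cases h : r ≤ s
    · rw [Set.indicator_of_mem (Set.mem_Ici.2 h), Set.indicator_of_mem (Set.mem_Ici.2 (NNReal.coe_le_coe.2 h))]
    · rw [Set.indicator_of_notMem (by simpa using h), Set.indicator_of_notMem (by simpa using h)]
  rw [h1, setLIntegral_timeVol (fun x : ℝ => (Set.Ici (r : ℝ)).indicator
      (fun x : ℝ => ENNReal.ofReal (((t₀ : ℝ) - x) ^ (θ - 1))) x),
    setLIntegral_timeVol (fun t => ENNReal.ofReal (rlK a (t - r))),
    ← lintegral_const_mul' _ _ ENNReal.ofReal_ne_top, ← lintegral_indicator measurableSet_Icc,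
    ← lintegral_indicator measurableSet_Icc,
    ← lintegral_sub_left_eq_self (fun x => (Set.Icc (0 : ℝ) t₀).indicator
      (fun t => ENNReal.ofReal (rlK a (t - r))) x) ((t₀ : ℝ) + r)]
  refine lintegral_mono fun x => ?_
  by_cases hx : (t₀ : ℝ) + r - x ∈ Set.Icc (0 : ℝ) t₀
  swap
  · beta_reduce; rw [Set.indicator_of_notMem hx]; exact zero_le
  beta_reduce
  rw [Set.indicator_of_mem hx, show (t₀ : ℝ) + r - x - r = t₀ - x by ring]
  rcases le_or_gt ((t₀ : ℝ) - x) 0 with h | h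
  · rw [rlK_of_nonpos h]; simp
  have hrx : (r : ℝ) ≤ x := by linarith [hx.2]
  rw [Set.indicator_of_mem (show x ∈ Set.Icc (0 : ℝ) t₀ from ⟨hr.trans hrx, by linarith⟩),
    Set.indicator_of_mem (Set.mem_Ici.2 hrx), ← ENNReal.ofReal_mul
      (div_nonneg (Real.rpow_nonneg (NNReal.coe_nonneg T) _) (Real.Gamma_pos_of_pos ha).le)]
  exact ENNReal.ofReal_le_ofReal (rlK_le_rpow hθa ha h (by linarith))

/-- By Tonelli's theorem both sides become integrals of `H z` against a function of `z.1`, and these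
functions are compared by `lintegral_rlK_sub_le`. -/
lemma lintegral_volterra_le {θ a : ℝ} (ha : 0 < a) (hθa : θ ≤ a) {t₀ : ℝ≥0}
    (ht : t₀ ≤ T) {H : ℝ≥0 × Ω → ℝ≥0∞} (hH : AEMeasurable H (rectMeasure P T)) :
    ∫⁻ t in Set.Iic t₀, ∫⁻ z, ENNReal.ofReal (rlK a ((t : ℝ) - z.1)) * H z ∂rectMeasure P T ∂timeVol ≤
      ENNReal.ofReal ((T : ℝ) ^ (a - θ) / Real.Gamma a) *
        ∫⁻ s in Set.Iic t₀, ENNReal.ofReal (((t₀ : ℝ) - s) ^ (θ - 1)) *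
          ∫⁻ z, H z ∂rectMeasure P s ∂timeVol := by
  have hS : MeasurableSet {y : ℝ≥0 × (ℝ≥0 × Ω) | y.2.1 ≤ y.1} :=
    measurableSet_le measurable_snd.fst measurable_fst
  have hW : Measurable fun s : ℝ≥0 => ENNReal.ofReal (((t₀ : ℝ) - s) ^ (θ - 1)) := by fun_prop
  have hH2 : AEMeasurable (fun y : ℝ≥0 × (ℝ≥0 × Ω) => H y.2)
      ((timeVol.restrict (Set.Iic t₀)).prod (rectMeasure P T)) :=
    hH.comp_quasiMeasurePreserving Measure.quasiMeasurePreserving_snd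
  -- The moving horizon `s` becomes an indicator, so that one fixed product measure remains.
  have e1 : ∫⁻ s in Set.Iic t₀, ENNReal.ofReal (((t₀ : ℝ) - s) ^ (θ - 1)) *
      ∫⁻ z, H z ∂rectMeasure P s ∂timeVol = ∫⁻ s in Set.Iic t₀, ∫⁻ z,
        {y : ℝ≥0 × (ℝ≥0 × Ω) | y.2.1 ≤ y.1}.indicator
          (fun y => ENNReal.ofReal (((t₀ : ℝ) - y.1) ^ (θ - 1)) * H y.2) (s, z)
            ∂rectMeasure P T ∂timeVol := by
    refine setLIntegral_congr_fun measurableSet_Iic fun s hs => ?_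
    rw [lintegral_rectMeasure_eq_indicator (le_trans hs ht), ← lintegral_const_mul' _ _ ENNReal.ofReal_ne_top]
    refine lintegral_congr fun z => ?_
    by_cases h : z.1 ≤ s
    · rw [Set.indicator_of_mem (by exact h), Set.indicator_of_mem (by exact h)]
    · rw [Set.indicator_of_notMem (by exact h), Set.indicator_of_notMem (by exact h), mul_zero]
  have hk : Measurable fun y : ℝ≥0 × (ℝ≥0 × Ω) => ENNReal.ofReal (rlK a ((y.1 : ℝ) - y.2.1)) :=
    ((measurable_rlK a).comp (measurable_fst.coe_nnreal_real.sub
      measurable_snd.fst.coe_nnreal_real)).ennreal_ofReal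
  have hsf : SFinite (rectMeasure P T) := by unfold rectMeasure; infer_instance
  rw [e1, lintegral_lintegral_swap (hk.aemeasurable.mul hH2), lintegral_lintegral_swap
    (f := fun s z => {y : ℝ≥0 × (ℝ≥0 × Ω) | y.2.1 ≤ y.1}.indicator
      (fun y => ENNReal.ofReal (((t₀ : ℝ) - y.1) ^ (θ - 1)) * H y.2) (s, z))
    (((hW.comp measurable_fst).aemeasurable.mul hH2).indicator hS),
    ← lintegral_const_mul' _ _ ENNReal.ofReal_ne_top]
  refine lintegral_mono fun z => ?_
  have e2 : ∫⁻ s in Set.Iic t₀, {y : ℝ≥0 × (ℝ≥0 × Ω) | y.2.1 ≤ y.1}.indicator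
      (fun y => ENNReal.ofReal (((t₀ : ℝ) - y.1) ^ (θ - 1)) * H y.2) (s, z) ∂timeVol =
      (∫⁻ s in Set.Iic t₀, (Set.Ici z.1).indicator
          (fun s : ℝ≥0 => ENNReal.ofReal (((t₀ : ℝ) - s) ^ (θ - 1))) s ∂timeVol) * H z := by
    rw [← lintegral_mul_const _ (hW.indicator measurableSet_Ici)]
    refine lintegral_congr fun s => ?_
    by_cases h : z.1 ≤ s
    · rw [Set.indicator_of_mem (by exact h), Set.indicator_of_mem (by exact h)]
    · rw [Set.indicator_of_notMem (by exact h), Set.indicator_of_notMem (by exact h), zero_mul]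
  beta_reduce
  have hkz : Measurable fun t : ℝ≥0 => ENNReal.ofReal (rlK a ((t : ℝ) - z.1)) :=
    hk.comp (measurable_id.prodMk measurable_const)
  rw [e2, lintegral_mul_const _ hkz, ← mul_assoc]
  exact mul_le_mul_left (lintegral_rlK_sub_le ha hθa ht z.1) _

end Scalar

/-! ### The Volterra estimate for a scalar process. -/

section ScalarVolterra

variable {Ω : Type*} {mΩ : MeasurableSpace Ω} {P : Measure Ω} [IsProbabilityMeasure P] {T : ℝ≥0}

lemma ae_integrableOn_section {q : ℝ} (hq : 1 ≤ q) {y : ℝ≥0 × Ω → ℝ} (hy : Measurable y)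
    (hyq : ∫⁻ z, ‖y z‖ₑ ^ q ∂rectMeasure P T ≠ ∞) :
    ∀ᵐ ω ∂P, IntegrableOn (fun t => y (t, ω)) (Set.Iic T) timeVol := by
  have hq0 : 0 < q := by linarith
  have h1 : MemLp y (ENNReal.ofReal q) (rectMeasure P T) := by
    refine ⟨hy.aestronglyMeasurable, ?_⟩
    rw [eLpNorm_eq_lintegral_rpow_enorm_toReal (by simpa using hq0) ENNReal.ofReal_ne_top,
      ENNReal.toReal_ofReal hq0.le]
    exact ENNReal.rpow_lt_top_of_nonneg (by positivity) hyq
  have h2 : Integrable y (rectMeasure P T) :=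
    h1.integrable (by rw [← ENNReal.ofReal_one]; exact ENNReal.ofReal_le_ofReal hq)
  exact h2.prod_left_ae

/-- The constant in `lintegral_le_of_fracInt_eq`. -/
def volterraConst (q α β θ T : ℝ) : ℝ≥0∞ :=
  2 ^ (q - 1) * (ENNReal.ofReal (quotConst q (1 + (α - β)) T) *
    ENNReal.ofReal (T ^ (min (2 * (α - β)) 0 + 1 - θ) / Real.Gamma (min (2 * (α - β)) 0 + 1)) +
      ENNReal.ofReal (rlK (α + 1) T) ^ (q - 1) * ENNReal.ofReal (T ^ (α - θ) / Real.Gamma α))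

lemma volterraConst_ne_top {q : ℝ} (hq : 1 ≤ q) (α β θ T : ℝ) : volterraConst q α β θ T ≠ ∞ := by
  have h0 : 0 ≤ q - 1 := by linarith
  unfold volterraConst
  refine ENNReal.mul_ne_top (ENNReal.rpow_ne_top_of_nonneg h0 (by norm_num)) (ENNReal.add_ne_top.2
    ⟨ENNReal.mul_ne_top ENNReal.ofReal_ne_top ENNReal.ofReal_ne_top,
      ENNReal.mul_ne_top (ENNReal.rpow_ne_top_of_nonneg h0 ENNReal.ofReal_ne_top)
        ENNReal.ofReal_ne_top⟩)

lemma lintegral_rl_cut_rpow_le {q a : ℝ} (hq : 1 ≤ q) (ha : 0 < a) {f : ℝ≥0 × Ω → ℝ}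
    (hf : Measurable f) {t₀ : ℝ≥0} (ht : t₀ ≤ T) :
    ∫⁻ z : ℝ≥0 × Ω, ‖rl a (cut T fun s => f (s, z.2)) z.1‖ₑ ^ q ∂rectMeasure P t₀ ≤
      ENNReal.ofReal (rlK (a + 1) T) ^ (q - 1) * ∫⁻ t in Set.Iic t₀,
        ∫⁻ z, ENNReal.ofReal (rlK a ((t : ℝ) - z.1)) * ‖f z‖ₑ ^ q ∂rectMeasure P T ∂timeVol := by
  have hq0 : 0 < q := by linarith
  have hq1 : 0 ≤ q - 1 := by linarith
  have hm : Measurable fun z : ℝ≥0 × Ω => ‖rl a (cut T fun s => f (s, z.2)) z.1‖ₑ ^ q :=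
    ((measurable_rl_prod (measurable_cut_prod T hf) a).comp
      (measurable_fst.coe_nnreal_real.prodMk measurable_snd)).enorm.pow_const q
  rw [rectMeasure, lintegral_prod _ hm.aemeasurable,
    ← lintegral_const_mul' _ _ (ENNReal.rpow_ne_top_of_nonneg hq1 ENNReal.ofReal_ne_top)]
  refine setLIntegral_mono_ae' measurableSet_Iic (Eventually.of_forall fun t htt => ?_)
  have hk : Measurable fun z : ℝ≥0 × Ω => ENNReal.ofReal (rlK a ((t : ℝ) - z.1)) * ‖f z‖ₑ ^ q :=
    ((measurable_rlK_sub a t).comp measurable_fst.coe_nnreal_real).ennreal_ofReal.mul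
      (hf.enorm.pow_const q)
  rw [rectMeasure, lintegral_prod_symm _ hk.aemeasurable,
    ← lintegral_const_mul' _ _ (ENNReal.rpow_ne_top_of_nonneg hq1 ENNReal.ofReal_ne_top)]
  refine lintegral_mono fun ω => ?_
  refine (enorm_rl_rpow_le ha (measurable_cut (hf.comp measurable_prodMk_right))
    (fun s hs => cut_of_neg hs) hq t).trans ?_
  rw [lintegral_mul_enorm_cut_rpow (fun s => ENNReal.ofReal (rlK a (t - s))) T _ hq0]
  refine mul_le_mul_left (ENNReal.rpow_le_rpow (ENNReal.ofReal_le_ofReal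
    (rlK_le (by linarith) (NNReal.coe_le_coe.2 (le_trans htt ht)))) hq1) _

/-- The path of `V = y - I^α f`, for a solution `y` of the equation in integrated form, is recovered
from the difference quotients of `I^{1+α-β} X`. -/
lemma ae_tendsto_quot_of_fracInt_eq {α β : ℝ} {m : ℕ} (hT : 0 < T) (hα : 0 < α) (hβ : β < α + 1)
    (hmα : α ≤ m + 1) (hmβ : β ≤ m + 1) {y f x : ℝ≥0 → ℝ} (hy : Measurable y) (hf : Measurable f)
    (hx : ContinuousOn x (Set.Icc 0 T)) (hyi : IntegrableOn y (Set.Iic T) timeVol)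
    (hfi : IntegrableOn f (Set.Iic T) timeVol)
    (h : ∀ᵐ t ∂timeVol.restrict (Set.Iic T),
      fracInt (m + 1 - α) y t = fracInt (m + 1) f t + fracInt (m + 1 - β) x t) :
    let V : ℝ → ℝ := fun s => cut T y s - rl α (cut T f) s
    (∀ t ≤ (T : ℝ), rl 1 V t = rl (1 + (α - β)) (cut T x) t) ∧
    ∀ᵐ t : ℝ, Tendsto (fun n : ℕ =>
      (rl 1 V t - rl 1 V (t - 1 / ((n : ℝ) + 1))) / (1 / ((n : ℝ) + 1))) atTop (𝓝 (V t)) := by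
  intro V
  obtain ⟨B, hB⟩ := exists_bound_of_continuousOn hx
  have cy := measurable_cut (T := T) hy
  have cf := measurable_cut (T := T) hf
  have z0 : ∀ φ : ℝ≥0 → ℝ, ∀ s < 0, cut T φ s = 0 := fun φ s hs => cut_of_neg hs
  have hmain := rl_one_eq_of_rlI_eq (T := T) hT hα hβ hmα hmβ cy cf
    (measurable_cut_of_continuousOn hx) (z0 _) (z0 _) (z0 _) (integrable_cut hyi)
    (integrable_cut hfi) (abs_cut_le hB) (Set.countable_insert.2 (Set.countable_singleton _))
    (fun s hs => continuousAt_cut hx hs) (by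
      filter_upwards [ae_of_ae_timeVol h] with s hs hsT
      rcases lt_or_ge s 0 with h0 | h0
      · have e : ∀ (a : ℝ) (φ : ℝ≥0 → ℝ), rlI a (cut T φ) s = 0 := fun a φ => by
          rw [rlI, z0 φ s h0, rl_of_nonpos (z0 φ) h0.le, ite_self]
        rw [e, e, rl_of_nonpos (z0 f) h0.le, add_zero]
      · have h1 := hs h0 hsT.le
        have hle : s.toNNReal ≤ T := Real.toNNReal_le_iff_le_coe.2 hsT.le
        have hm1 : (m + 1 : ℝ) ≠ 0 := by positivity
        rw [fracInt_eq_rlI _ _ hle, fracInt_eq_rl hm1 _ hle, fracInt_eq_rlI _ _ hle,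
          Real.coe_toNNReal s h0] at h1
        exact h1)
  have iy : ∀ t, RLIntegrable 1 (cut T y) t := fun t =>
    .of_one_le le_rfl cy (z0 _) (integrable_cut hyi).integrableOn
  have if1 : ∀ t, RLIntegrable (1 + α) (cut T f) t := fun t =>
    .of_one_le (by linarith) cf (z0 _) (integrable_cut hfi).integrableOn
  have iV : ∀ t, RLIntegrable 1 V t := fun t => (iy t).sub ((if1 t).rl one_pos hα cf)
  refine ⟨fun t ht => ?_, ae_tendsto_slope_rl_one (fun s hs => ?_) iV⟩
  · rw [rl_sub (iy t) ((if1 t).rl one_pos hα cf), rl_rl one_pos hα cf (if1 t), hmain t ht]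
    ring
  · simp only [V]
    rw [z0 y s hs, rl_of_nonpos (z0 f) hs.le, sub_zero]

/-- The process is split as `y = V + I^α f`. The first part is a limit of difference quotients of
`I^{1+α-β} X` and is bounded by Fatou's lemma and `lintegral_quot_le`; the second is bounded by
Jensen's inequality. Both produce singular kernels, which `lintegral_volterra_le` converts to the
exponent `θ - 1`. -/
theorem lintegral_le_of_fracInt_eq {q α β θ : ℝ} {m : ℕ} (hq : 2 ≤ q) (hT : 0 < T) (hα : 0 < α)
    (hβ : β < α + 1 / 2) (hmα : α ≤ m + 1) (hmβ : β ≤ m + 1) (hθ1 : θ ≤ α)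
    (hθ2 : θ ≤ min (2 * (α - β)) 0 + 1) {y f : ℝ≥0 × Ω → ℝ} (hy : Measurable y)
    (hf : Measurable f) (hyq : ∫⁻ z, ‖y z‖ₑ ^ q ∂rectMeasure P T ≠ ∞)
    (hfq : ∫⁻ z, ‖f z‖ₑ ^ q ∂rectMeasure P T ≠ ∞) {G : ℝ≥0 × Ω → ell2}
    (hG : AEStronglyMeasurable G (rectMeasure P T))
    {M : ℕ → ℝ≥0 → Ω → ℝ} {ns : ℕ → ℕ} {X : ℝ≥0 → Ω → ℝ} (hX : IsItoSum P T q G M ns X)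
    (h : ∀ᵐ ω ∂P, ∀ᵐ t ∂timeVol.restrict (Set.Iic T), fracInt (m + 1 - α) (fun s => y (s, ω)) t =
      fracInt (m + 1) (fun s => f (s, ω)) t + fracInt (m + 1 - β) (fun s => X s ω) t)
    {t₀ : ℝ≥0} (ht : t₀ ≤ T) :
    ∫⁻ z, ‖y z‖ₑ ^ q ∂rectMeasure P t₀ ≤ volterraConst q α β θ T *
      ∫⁻ s in Set.Iic t₀, ENNReal.ofReal (((t₀ : ℝ) - s) ^ (θ - 1)) *
        (∫⁻ z, ‖f z‖ₑ ^ q ∂rectMeasure P s + ∫⁻ z, ‖G z‖ₑ ^ q ∂rectMeasure P s) ∂timeVol := by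
  have hq0 : 0 < q := by linarith
  have hq1 : 1 ≤ q := by linarith
  set κ := α - β with hκ
  have hρ : 0 < min (2 * κ) 0 + 1 := by
    have : -1 < min (2 * κ) 0 := lt_min (by linarith) (by norm_num)
    linarith
  let R : ℝ × Ω → ℝ := fun z => rl α (cut T fun s => f (s, z.2)) z.1
  let V : Ω → ℝ → ℝ := fun ω s => cut T (fun r => y (r, ω)) s - R (s, ω)
  have hR : Measurable R := measurable_rl_prod (measurable_cut_prod T hf) α
  have hV : Measurable (Function.uncurry V) :=
    (measurable_cut_prod T hy).sub (hR.comp measurable_swap)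
  let D : ℕ → ℝ × Ω → ℝ := fun n z =>
    (rl 1 (V z.2) z.1 - rl 1 (V z.2) (z.1 - 1 / ((n : ℝ) + 1))) / (1 / ((n : ℝ) + 1))
  have hrl := measurable_rl_prod hV 1
  have hD : ∀ n, Measurable (D n) := fun n =>
    (hrl.sub (hrl.comp ((measurable_fst.sub_const _).prodMk measurable_snd))).div_const _
  let ι : ℝ≥0 × Ω → ℝ × Ω := fun z => ((z.1 : ℝ), z.2)
  have hι : Measurable ι := measurable_fst.coe_nnreal_real.prodMk measurable_snd
  have hDι : ∀ n, Measurable fun z => ‖D n (ι z)‖ₑ ^ q := fun n =>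
    ((hD n).comp hι).enorm.pow_const q
  have hpath : ∀ᵐ ω ∂P, (∀ t ≤ (T : ℝ), rl 1 (V ω) t = rl (1 + κ) (cut T fun s => X s ω) t) ∧
      ∀ᵐ t : ℝ, Tendsto (fun n : ℕ => D n (t, ω)) atTop (𝓝 (V ω t)) := by
    filter_upwards [h, ae_integrableOn_section hq1 hy hyq, ae_integrableOn_section hq1 hf hfq,
      hX.continuousOn] with ω h1 h2 h3 h4
    exact ae_tendsto_quot_of_fracInt_eq hT hα (by linarith) hmα hmβ (hy.comp measurable_prodMk_right)
      (hf.comp measurable_prodMk_right) h4 h2 h3 h1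
  have hlim : ∀ᵐ z ∂rectMeasure P t₀, Tendsto (fun n => ‖D n (ι z)‖ₑ ^ q) atTop
      (𝓝 (‖V z.2 z.1‖ₑ ^ q)) := by
    have hset : MeasurableSet {z : ℝ≥0 × Ω | Tendsto (fun n => D n (ι z)) atTop (𝓝 (V z.2 z.1))} :=
      measurableSet_tendsto_fun (fun n => (hD n).comp hι)
        (hV.comp (measurable_snd.prodMk measurable_fst.coe_nnreal_real))
    have h1 : ∀ᵐ z ∂rectMeasure P t₀, Tendsto (fun n => D n (ι z)) atTop (𝓝 (V z.2 z.1)) := by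
      -- Convergence is known for almost every time on almost every path. Measurability of the
      -- convergence set permits the exchange of the order.
      rw [rectMeasure, Measure.ae_prod_iff_ae_ae hset, Measure.ae_ae_comm hset]
      filter_upwards [hpath] with ω hω
      exact ae_restrict_of_ae (ae_timeVol_of_ae hω.2)
    filter_upwards [h1] with z hz
    exact ((continuous_enorm.tendsto _).comp hz).ennrpow_const q
  have hVle : ∫⁻ z, ‖V z.2 z.1‖ₑ ^ q ∂rectMeasure P t₀ ≤
      ENNReal.ofReal (quotConst q (1 + κ) T) * ∫⁻ t in Set.Iic t₀,
        ∫⁻ z, ENNReal.ofReal (rlK (min (2 * κ) 0 + 1) ((t : ℝ) - z.1)) * ‖G z‖ₑ ^ q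
          ∂rectMeasure P T ∂timeVol := by
    refine lintegral_le_of_tendsto_ae (F := fun n z => ‖D n (ι z)‖ₑ ^ q)
      (fun n => (hDι n).aemeasurable) hlim (fun n => ?_)
      tendsto_const_nhds
    rw [rectMeasure, lintegral_prod _ (hDι n).aemeasurable,
      ← lintegral_const_mul' _ _ ENNReal.ofReal_ne_top]
    refine setLIntegral_mono_ae' measurableSet_Iic (Eventually.of_forall fun t htt => ?_)
    have htT : t ≤ T := le_trans htt ht
    -- The hypothesis on `β` is exactly `1 + κ > 1/2`, and the bound is the same for all `n`.
    have h1 := hX.lintegral_quot_le hq hT (a := 1 + κ) (by linarith) htT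
      (h := 1 / ((n : ℝ) + 1)) (by positivity)
    rw [add_sub_cancel_left] at h1
    refine le_trans (le_of_eq (lintegral_congr_ae ?_)) h1
    filter_upwards [hpath] with ω hω
    have h2 : (0 : ℝ) < 1 / ((n : ℝ) + 1) := by positivity
    have h3 : (t : ℝ) ≤ T := htT
    simp only [D, ι]
    rw [hω.1 t h3, hω.1 _ (by linarith)]
  have hgq : AEMeasurable (fun z => ‖G z‖ₑ ^ q) (rectMeasure P T) := hG.enorm.pow_const q
  let I : ℝ≥0∞ := ∫⁻ s in Set.Iic t₀, ENNReal.ofReal (((t₀ : ℝ) - s) ^ (θ - 1)) *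
        (∫⁻ z, ‖f z‖ₑ ^ q ∂rectMeasure P s + ∫⁻ z, ‖G z‖ₑ ^ q ∂rectMeasure P s) ∂timeVol
  have hVI := hVle.trans (mul_le_mul_right ((lintegral_volterra_le hρ hθ2 ht hgq).trans
    (mul_le_mul_right (lintegral_mono fun s => mul_le_mul_right le_add_self _ :
      _ ≤ I) _)) _)
  have hRI := (lintegral_rl_cut_rpow_le (P := P) hq1 hα hf ht).trans
    (mul_le_mul_right ((lintegral_volterra_le hα hθ1 ht (hf.enorm.pow_const q).aemeasurable).trans
    (mul_le_mul_right (lintegral_mono fun s => mul_le_mul_right le_self_add _ :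
      _ ≤ I) _)) _)
  have hsum : ∫⁻ z, ‖y z‖ₑ ^ q ∂rectMeasure P t₀ ≤ 2 ^ (q - 1) *
      (∫⁻ z, ‖V z.2 z.1‖ₑ ^ q ∂rectMeasure P t₀ + ∫⁻ z, ‖R (ι z)‖ₑ ^ q ∂rectMeasure P t₀) := by
    have hRι : Measurable fun z => ‖R (ι z)‖ₑ ^ q := (hR.comp hι).enorm.pow_const q
    rw [← lintegral_add_right _ hRι, ← lintegral_const_mul' _ _
      (ENNReal.rpow_ne_top_of_nonneg (by linarith) (by norm_num))]
    refine lintegral_mono_ae ?_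
    have h1 : ∀ᵐ z ∂rectMeasure P t₀, z.1 ≤ t₀ := by
      have : ∀ᵐ t ∂timeVol.restrict (Set.Iic t₀), t ≤ t₀ := ae_restrict_mem measurableSet_Iic
      exact Measure.quasiMeasurePreserving_fst.ae this
    filter_upwards [h1] with z hz
    have e : y z = V z.2 z.1 + R (ι z) := by
      simp only [V, ι]
      rw [cut_coe (hz.trans ht)]
      ring
    rw [e]
    exact (ENNReal.rpow_le_rpow (enorm_add_le _ _) hq0.le).trans
      (ENNReal.rpow_add_le_mul_rpow_add_rpow _ _ hq1)
  refine hsum.trans ((mul_le_mul_right (add_le_add hVI hRI) _).trans (le_of_eq ?_))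
  rw [volterraConst, ← mul_assoc, ← mul_assoc, ← add_mul, ← mul_assoc]

end ScalarVolterra

/-! ### The bound of the supremum for scalar equations -/

/-- A bound of the kernels of all Riemann–Liouville integrals on `[0, T]`. -/
def rlConst (T : ℝ) : ℝ := max 1 T * Real.exp (max 1 T)

lemma one_le_rlConst (T : ℝ) : 1 ≤ rlConst T := by
  have h1 : 1 ≤ max 1 T := le_max_left _ _
  have h2 : 1 ≤ Real.exp (max 1 T) := Real.one_le_exp (by linarith)
  unfold rlConst; nlinarith

/-- Order zero is included because `rlConst` is at least one. -/
lemma enorm_rlI_le {a T : ℝ} (hT : 0 < T) (ha : 0 ≤ a) {F : ℝ → ℝ} (h0 : ∀ s < 0, F s = 0) {B : ℝ≥0∞}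
    (hB : ∀ s ≤ T, ‖F s‖ₑ ≤ B) {t : ℝ} (ht : t ≤ T) :
    ‖rlI a F t‖ₑ ≤ ENNReal.ofReal (rlConst T) * B := by
  rcases ha.eq_or_lt with rfl | ha'
  · rw [rlI, if_pos rfl]
    calc ‖F t‖ₑ ≤ 1 * B := by rw [one_mul]; exact hB t ht
      _ ≤ _ := mul_le_mul_left (by
        rw [← ENNReal.ofReal_one]; exact ENNReal.ofReal_le_ofReal (one_le_rlConst T)) _
  · rw [rlI, if_neg ha'.ne']
    refine (enorm_rl_le ha' h0 fun s hs => hB s (hs.le.trans ht)).trans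
      (mul_le_mul_left (ENNReal.ofReal_le_ofReal ?_) _)
    exact (rlK_le (by linarith) ht).trans (rlK_add_one_le hT ha)

section Cut
variable {T : ℝ≥0}

lemma enorm_cut_le {φ : ℝ≥0 → ℝ} {B : ℝ≥0∞} (hB : ∀ s ≤ T, ‖φ s‖ₑ ≤ B) (s : ℝ) : ‖cut T φ s‖ₑ ≤ B := by
  rw [cut]
  by_cases hs : s ∈ Set.Icc (0 : ℝ) T
  · rw [Set.indicator_of_mem hs]
    exact hB _ (Real.toNNReal_le_iff_le_coe.2 hs.2)
  · rw [Set.indicator_of_notMem hs, enorm_zero]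
    exact zero_le

lemma enorm_fracInt_le (hT : 0 < T) {a : ℝ} (ha : 0 ≤ a) {φ : ℝ≥0 → ℝ} {B : ℝ≥0∞}
    (hB : ∀ s ≤ T, ‖φ s‖ₑ ≤ B) {t : ℝ≥0} (ht : t ≤ T) :
    ‖fracInt a φ t‖ₑ ≤ ENNReal.ofReal (rlConst T) * B := by
  rw [fracInt_eq_rlI a φ ht]
  exact enorm_rlI_le hT ha (fun s hs => cut_of_neg hs) (fun s _ => enorm_cut_le hB s) ht

/-- From order one on the kernel is bounded, so mere integrability of `φ` suffices. -/
lemma enorm_fracInt_add_one_le (hT : 0 < T) {a : ℝ} (ha : 0 ≤ a) (φ : ℝ≥0 → ℝ) {t : ℝ≥0}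
    (ht : t ≤ T) :
    ‖fracInt (a + 1) φ t‖ₑ ≤
      ENNReal.ofReal (rlConst T) * ∫⁻ s in Set.Iic T, ‖φ s‖ₑ ∂timeVol := by
  have hT' : (0 : ℝ) < T := hT
  rw [fracInt_eq_rl (by linarith) φ ht]
  have h1 := lintegral_mul_enorm_cut_rpow (fun _ => ENNReal.ofReal (rlConst T)) T φ one_pos
  simp only [ENNReal.rpow_one] at h1
  rw [← lintegral_const_mul' _ _ ENNReal.ofReal_ne_top, ← h1]
  refine (enorm_integral_le_lintegral_enorm _).trans (lintegral_mono_ae ?_)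
  filter_upwards [Measure.ae_ne volume (0 : ℝ)] with s hs
  rcases lt_or_gt_of_ne hs with h | h
  · rw [cut_of_neg h, mul_zero, enorm_zero]; exact zero_le
  · rw [enorm_mul, Real.enorm_eq_ofReal (rlK_nonneg (by linarith) _)]
    refine mul_le_mul_left (ENNReal.ofReal_le_ofReal ?_) _
    have := NNReal.coe_le_coe.2 ht
    exact (rlK_le (by linarith) (by linarith)).trans (rlK_add_one_le hT' ha)

lemma fracInt_add_of_continuousOn {a : ℝ} (ha : 0 ≤ a) {φ ψ : ℝ≥0 → ℝ}
    (hφ : ContinuousOn φ (Set.Icc 0 T)) (hψ : ContinuousOn ψ (Set.Icc 0 T)) {t : ℝ≥0} (ht : t ≤ T) :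
    fracInt a (fun s => φ s + ψ s) t = fracInt a φ t + fracInt a ψ t := by
  have hi : ∀ χ : ℝ≥0 → ℝ, ContinuousOn χ (Set.Icc 0 T) → 0 < a → RLIntegrable a (cut T χ) t := by
    intro χ hχ ha'
    obtain ⟨B, hB⟩ := exists_bound_of_continuousOn hχ
    exact .of_bounded ha' (measurable_cut_of_continuousOn hχ) (fun s hs => cut_of_neg hs)
      fun s _ => abs_cut_le hB s
  have hc : cut T (fun s => φ s + ψ s) = fun s => cut T φ s + cut T ψ s := by
    ext s
    simp only [cut, Set.indicator_apply]
    split_ifs <;> simp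
  rw [fracInt_eq_rlI _ _ ht, fracInt_eq_rlI _ _ ht, fracInt_eq_rlI _ _ ht, hc]
  rcases ha.eq_or_lt with rfl | ha'
  · simp [rlI]
  · simp only [rlI, if_neg ha'.ne']
    exact rl_add (hi φ hφ ha') (hi ψ hψ ha')

lemma fracInt_zero_fun (a : ℝ) (t : ℝ≥0) : fracInt a (fun _ : ℝ≥0 => (0 : ℝ)) t = 0 :=
  (fracInt_zero (E := ℝ) a t).2

lemma fracInt_sum_of_continuousOn {a : ℝ} (ha : 0 ≤ a) {φ : ℕ → ℝ≥0 → ℝ}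
    (hφ : ∀ k, ContinuousOn (φ k) (Set.Icc 0 T)) {t : ℝ≥0} (ht : t ≤ T) (K : ℕ) :
    fracInt a (fun s => ∑ k ∈ Finset.range K, φ k s) t =
      ∑ k ∈ Finset.range K, fracInt a (φ k) t := by
  induction K with
  | zero => simp [fracInt_zero_fun]
  | succ K ih =>
    simp only [Finset.sum_range_succ]
    rw [fracInt_add_of_continuousOn ha (continuousOn_finsetSum _ fun k _ => hφ k) (hφ K) ht, ih]

lemma tendsto_fracInt_of_tendstoUniformlyOn (hT : 0 < T) {a : ℝ} (ha : 0 ≤ a) {φ : ℕ → ℝ≥0 → ℝ}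
    {x : ℝ≥0 → ℝ} (hφ : ∀ n, ContinuousOn (φ n) (Set.Icc 0 T)) (hx : ContinuousOn x (Set.Icc 0 T))
    (h : TendstoUniformlyOn φ x atTop (Set.Icc 0 T)) {t : ℝ≥0} (ht : t ≤ T) :
    Tendsto (fun n => fracInt a (φ n) t) atTop (𝓝 (fracInt a x t)) := by
  have hC := one_le_rlConst T
  rw [Metric.tendsto_atTop]
  intro ε hε
  have h1 := Metric.tendstoUniformlyOn_iff.1 h (ε / (2 * rlConst T)) (by positivity)
  obtain ⟨n₀, hn₀⟩ := eventually_atTop.1 h1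
  refine ⟨n₀, fun n hn => ?_⟩
  have h2 : fracInt a x t = fracInt a (φ n) t + fracInt a (fun s => x s - φ n s) t := by
    have := fracInt_add_of_continuousOn ha (hφ n) (hx.sub (hφ n)) ht
    simp only [Pi.sub_apply, add_sub_cancel] at this
    exact this
  have h3 : ‖fracInt a (fun s => x s - φ n s) t‖ₑ ≤
      ENNReal.ofReal (rlConst T) * ENNReal.ofReal (ε / (2 * rlConst T)) := by
    refine enorm_fracInt_le hT ha (fun s hs => ?_) ht
    rw [← ofReal_norm, ← dist_eq_norm]
    exact ENNReal.ofReal_le_ofReal (hn₀ n hn s ⟨zero_le, hs⟩).le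
  rw [← ENNReal.ofReal_mul (by linarith), ← ofReal_norm, ENNReal.ofReal_le_ofReal_iff (by positivity)] at h3
  rw [dist_comm, dist_eq_norm, h2, add_sub_cancel_left]
  have h4 : rlConst T * (ε / (2 * rlConst T)) = ε / 2 := by field_simp
  rw [h4] at h3
  linarith

lemma continuous_fracInt_of_continuousOn {a : ℝ} (ha : 0 ≤ a) {x : ℝ≥0 → ℝ}
    (hx : ContinuousOn x (Set.Icc 0 T)) :
    Continuous fun t : Set.Icc (0 : ℝ≥0) T => fracInt a x t := by
  rcases ha.eq_or_lt with rfl | ha'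
  · simp only [fracInt, if_pos]
    exact continuousOn_iff_continuous_domRestrict.1 hx
  · obtain ⟨B, hB⟩ := exists_bound_of_continuousOn hx
    have h1 := continuous_rl_of_bounded ha' (measurable_cut_of_continuousOn hx)
      (fun s hs => cut_of_neg hs) (abs_cut_le hB)
      (Set.countable_insert.2 (Set.countable_singleton _)) fun s hs => continuousAt_cut hx hs
    refine (h1.comp (NNReal.continuous_coe.comp continuous_subtype_val)).congr fun t => ?_
    exact (fracInt_eq_rl ha'.ne' x t.2.2).symm

lemma continuous_fracInt_add_one {a : ℝ} (ha : 0 ≤ a) {f : ℝ≥0 → ℝ} (hf : Measurable f)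
    (hfi : IntegrableOn f (Set.Iic T) timeVol) :
    Continuous fun t : Set.Icc (0 : ℝ≥0) T => fracInt (a + 1) f t := by
  have h1 := continuous_rl_of_one_le (a := a + 1) (by linarith) (measurable_cut hf)
    (fun s hs => cut_of_neg hs) (integrable_cut hfi).locallyIntegrable
  refine (h1.comp (NNReal.continuous_coe.comp continuous_subtype_val)).congr fun t => ?_
  exact (fracInt_eq_rl (by linarith) f t.2.2).symm

end Cut

/-! ### Identification of the stochastic series and the supremum estimate. -/

section ScalarSup

variable {Ω : Type*} {mΩ : MeasurableSpace Ω} {P : Measure Ω} [IsProbabilityMeasure P] {T : ℝ≥0}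
  {q : ℝ} {G : ℝ≥0 × Ω → ell2} {M : ℕ → ℝ≥0 → Ω → ℝ} {ns : ℕ → ℕ} {X : ℝ≥0 → Ω → ℝ}

/-- The series converges only in probability. A further subsequence of `ns` makes it converge almost
surely, and along `ns` the partial sums of the paths converge uniformly, so that the fractional
integral may be taken term by term. -/
lemma IsItoSum.ae_eq_fracInt (hX : IsItoSum P T q G M ns X) (hT : 0 < T)
    (hM : ∀ k, ∀ᵐ ω ∂P, ContinuousOn (fun t => M k t ω) (Set.Icc 0 T)) {a : ℝ} (ha : 0 ≤ a)
    {t : ℝ≥0} (ht : t ≤ T) {S : Ω → ℝ}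
    (hS : TendstoInMeasure P (fun (K : ℕ) ω => ∑ k ∈ Finset.range K,
      fracInt a (fun s => M k s ω) t) atTop S) :
    ∀ᵐ ω ∂P, S ω = fracInt a (fun s => X s ω) t := by
  obtain ⟨js, hjs, h1⟩ := (hS.comp hX.strictMono.tendsto_atTop).exists_seq_tendsto_ae
  filter_upwards [h1, ae_all_iff.2 hM, hX.continuousOn, hX.tendsto] with ω h1 h2 h3 h4
  refine tendsto_nhds_unique h1 ?_
  have h5 := (tendsto_fracInt_of_tendstoUniformlyOn hT ha
    (fun n => continuousOn_finsetSum _ fun k _ => h2 k) h3 h4 ht).comp hjs.tendsto_atTop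
  refine h5.congr fun n => ?_
  exact fracInt_sum_of_continuousOn ha h2 ht _

/-- The integrated equation, with the limit of the stochastic integrals in place of the series. -/
lemma IsItoSum.ae_forall_eq (hX : IsItoSum P T q G M ns X) (hT : 0 < T)
    (hM : ∀ k, ∀ᵐ ω ∂P, ContinuousOn (fun t => M k t ω) (Set.Icc 0 T)) {a b : ℝ} (ha : 0 ≤ a)
    (hb : 0 ≤ b) {f : ℝ≥0 × Ω → ℝ} (hf : Measurable f)
    (hfi : ∀ᵐ ω ∂P, IntegrableOn (fun t => f (t, ω)) (Set.Iic T) timeVol) {S : ℝ≥0 → Ω → ℝ}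
    (hS : ∀ t ≤ T, TendstoInMeasure P (fun (K : ℕ) ω => ∑ k ∈ Finset.range K,
      fracInt a (fun s => M k s ω) t) atTop (S t))
    {A : Set.Icc (0 : ℝ≥0) T → Ω → ℝ} (hA : ∀ᵐ ω ∂P, Continuous fun t => A t ω)
    (h : ∀ᵐ ω ∂P, ∀ t : Set.Icc (0 : ℝ≥0) T,
      A t ω = fracInt (b + 1) (fun s => f (s, ω)) t + S t ω) :
    ∀ᵐ ω ∂P, ∀ t : Set.Icc (0 : ℝ≥0) T,
      A t ω = fracInt (b + 1) (fun s => f (s, ω)) t + fracInt a (fun s => X s ω) t := by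
  have : Nonempty (Set.Icc (0 : ℝ≥0) T) := ⟨⟨0, le_rfl, hT.le⟩⟩
  have h1 := ae_all_iff.2 fun n : ℕ => hX.ae_eq_fracInt hT hM ha
    (TopologicalSpace.denseSeq (Set.Icc (0 : ℝ≥0) T) n).2.2 (hS _
      (TopologicalSpace.denseSeq (Set.Icc (0 : ℝ≥0) T) n).2.2)
  filter_upwards [h, h1, hfi, hX.continuousOn, hA] with ω h2 h3 h4 h5 h6
  have h7 := (continuous_fracInt_add_one hb (hf.comp measurable_prodMk_right) h4).add
    (continuous_fracInt_of_continuousOn ha h5)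
  -- For each fixed time the value of `S` is identified only up to a null set. Countably many times
  -- suffice because all remaining terms are continuous.
  have h8 := h6.ext_on (TopologicalSpace.denseRange_denseSeq _) h7 (by
    rintro _ ⟨n, rfl⟩
    have := h2 (TopologicalSpace.denseSeq (Set.Icc (0 : ℝ≥0) T) n)
    rw [h3 n] at this
    exact this)
  exact fun t => congrFun h8 t

/-- The constant in `IsItoSum.lintegral_iSup_le`. -/
def supConst (q : ℝ) (T : ℝ≥0) : ℝ≥0∞ :=
  ENNReal.ofReal (rlConst T) ^ q * (4 ^ (q - 1) * (1 + T ^ q + T ^ (q - 1) +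
    ENNReal.ofReal (4 ^ q * (itoConst q * (T : ℝ) ^ ((q - 2) / 2)))))

lemma supConst_ne_top (hq : 2 ≤ q) : supConst q T ≠ ∞ := by
  have h0 : 0 ≤ q - 1 := by linarith
  have h1 : 0 ≤ q := by linarith
  unfold supConst
  refine ENNReal.mul_ne_top (ENNReal.rpow_ne_top_of_nonneg h1 ENNReal.ofReal_ne_top)
    (ENNReal.mul_ne_top (ENNReal.rpow_ne_top_of_nonneg h0 (by norm_num)) ?_)
  simp [ENNReal.add_eq_top, ENNReal.rpow_eq_top_iff, h0.not_gt, h1.not_gt]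

lemma ENNReal_add_four_rpow_le (hq : 1 ≤ q) (a b c e : ℝ≥0∞) :
    (a + b + (c + e)) ^ q ≤ 4 ^ (q - 1) * (a ^ q + b ^ q + (c ^ q + e ^ q)) := by
  have h0 : 0 ≤ q - 1 := by linarith
  refine (ENNReal.rpow_add_le_mul_rpow_add_rpow _ _ hq).trans ?_
  rw [show (4 : ℝ≥0∞) = 2 * 2 by norm_num, ENNReal.mul_rpow_of_nonneg _ _ h0, mul_assoc, mul_add (2 ^ (q - 1))]
  rw [← mul_add, mul_add (2 ^ (q - 1)) (a ^ q + b ^ q)]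
  exact mul_le_mul_right (add_le_add (ENNReal.rpow_add_le_mul_rpow_add_rpow _ _ hq)
    (ENNReal.rpow_add_le_mul_rpow_add_rpow _ _ hq)) _

/-- A countable family of times keeps the exceptional sets null and the supremum measurable. Each of
the four terms of the equation is bounded independently of the time, with the common factor `rlConst
T`. -/
theorem IsItoSum.lintegral_iSup_le (hX : IsItoSum P T q G M ns X) (hq : 2 ≤ q) (hT : 0 < T)
    (hM : ∀ k, ∀ᵐ ω ∂P, ContinuousOn (fun t => M k t ω) (Set.Icc 0 T)) {a b c : ℝ} (ha : 0 ≤ a)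
    (hb : 0 ≤ b) (hc : 0 ≤ c) {f : ℝ≥0 × Ω → ℝ} (hf : Measurable f) {S : ℝ≥0 → Ω → ℝ}
    (hS : ∀ t ≤ T, TendstoInMeasure P (fun (K : ℕ) ω => ∑ k ∈ Finset.range K,
      fracInt a (fun s => M k s ω) t) atTop (S t)) {x₀ y₀ : Ω → ℝ} (hx₀ : Measurable x₀)
    (hy₀ : Measurable y₀) (e : Prop) [Decidable e] {A : Set.Icc (0 : ℝ≥0) T → Ω → ℝ}
    (h : ∀ᵐ ω ∂P, ∀ t : Set.Icc (0 : ℝ≥0) T,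
      A t ω - fracInt c (fun s => x₀ ω + if e then (s : ℝ) * y₀ ω else 0) t =
        fracInt (b + 1) (fun s => f (s, ω)) t + S t ω) (τ : ℕ → Set.Icc (0 : ℝ≥0) T) :
    ∫⁻ ω, (⨆ n, ‖A (τ n) ω‖ₑ) ^ q ∂P ≤ supConst q T *
      (∫⁻ ω, ‖x₀ ω‖ₑ ^ q ∂P + (if e then ∫⁻ ω, ‖y₀ ω‖ₑ ^ q ∂P else 0) +
        ∫⁻ z, ‖f z‖ₑ ^ q ∂rectMeasure P T + ∫⁻ z, ‖G z‖ₑ ^ q ∂rectMeasure P T) := by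
  have hq1 : 1 ≤ q := by linarith
  have hq0 : 0 < q := by linarith
  obtain ⟨Z, hZm, hZ1, hZ2⟩ := hX.exists_sup_le
  let C := ENNReal.ofReal (rlConst T)
  let y₁ : Ω → ℝ≥0∞ := fun ω => T * if e then ‖y₀ ω‖ₑ else 0
  let F : Ω → ℝ≥0∞ := fun ω => ∫⁻ s in Set.Iic T, ‖f (s, ω)‖ₑ ∂timeVol
  have hFm : Measurable F := hf.enorm.lintegral_prod_left'
  have hy₁ : Measurable y₁ := by
    by_cases he : e <;> simp only [y₁, he, if_true, if_false] <;> fun_prop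
  have h1 : ∀ᵐ ω ∂P, ∀ n, ‖A (τ n) ω‖ₑ ≤ C * (‖x₀ ω‖ₑ + y₁ ω + (F ω + Z ω)) := by
    filter_upwards [h, ae_all_iff.2 fun n => hX.ae_eq_fracInt hT hM ha (τ n).2.2 (hS _ (τ n).2.2), hZ1]
      with ω h2 h3 h4 n
    have htn : (τ n : ℝ≥0) ≤ T := (τ n).2.2
    have h5 := h2 (τ n)
    rw [h3 n, sub_eq_iff_eq_add] at h5
    rw [h5, mul_add, mul_add C (F ω), add_comm]
    refine (enorm_add_le _ _).trans (add_le_add ?_ ((enorm_add_le _ _).trans (add_le_add ?_ ?_)))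
    · refine enorm_fracInt_le hT hc (fun s hs => ?_) htn
      refine (enorm_add_le _ _).trans (add_le_add le_rfl ?_)
      by_cases he : e
      · simp only [y₁, he, if_true, enorm_mul]
        refine mul_le_mul_left ?_ _
        rw [Real.enorm_eq_ofReal (NNReal.coe_nonneg s), ENNReal.ofReal_coe_nnreal]
        exact ENNReal.coe_le_coe.2 hs
      · simp [y₁, he]
    · exact enorm_fracInt_add_one_le hT hb _ htn
    · exact enorm_fracInt_le hT ha h4 htn
  have h2 : ∫⁻ ω, (⨆ n, ‖A (τ n) ω‖ₑ) ^ q ∂P ≤ ∫⁻ ω, C ^ q * (4 ^ (q - 1) *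
      (‖x₀ ω‖ₑ ^ q + y₁ ω ^ q + (F ω ^ q + Z ω ^ q))) ∂P := by
    refine lintegral_mono_ae ?_
    filter_upwards [h1] with ω h1
    refine (ENNReal.rpow_le_rpow (iSup_le h1) hq0.le).trans ?_
    rw [ENNReal.mul_rpow_of_nonneg _ _ hq0.le]
    exact mul_le_mul_right (ENNReal_add_four_rpow_le hq1 _ _ _ _) _
  have hFq : ∫⁻ ω, F ω ^ q ∂P ≤ (T : ℝ≥0∞) ^ (q - 1) * ∫⁻ z, ‖f z‖ₑ ^ q ∂rectMeasure P T := by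
    rw [rectMeasure, lintegral_prod_symm _ (hf.enorm.pow_const q).aemeasurable,
      ← lintegral_const_mul' _ _ (ENNReal.rpow_ne_top_of_nonneg (by linarith) ENNReal.coe_ne_top)]
    refine lintegral_mono fun ω => ?_
    have := lintegral_rpow_le_measure_univ (timeVol.restrict (Set.Iic T))
      (hf.comp measurable_prodMk_right).enorm.aemeasurable (f := fun s => ‖f (s, ω)‖ₑ) hq1
    rwa [Measure.restrict_apply_univ, timeVol_Iic] at this
  have hyq : ∫⁻ ω, y₁ ω ^ q ∂P = (T : ℝ≥0∞) ^ q * if e then ∫⁻ ω, ‖y₀ ω‖ₑ ^ q ∂P else 0 := by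
    by_cases he : e
    · simp only [y₁, he, if_true]
      rw [← lintegral_const_mul' _ _ (ENNReal.rpow_ne_top_of_nonneg hq0.le ENNReal.coe_ne_top)]
      simp only [ENNReal.mul_rpow_of_nonneg _ _ hq0.le]
    · simp [y₁, he, hq0]
  refine h2.trans ?_
  have n1 : C ^ q ≠ ∞ := ENNReal.rpow_ne_top_of_nonneg hq0.le ENNReal.ofReal_ne_top
  have n2 : (4 : ℝ≥0∞) ^ (q - 1) ≠ ∞ := ENNReal.rpow_ne_top_of_nonneg (by linarith) (by norm_num)
  have hm : Measurable fun ω => ‖x₀ ω‖ₑ ^ q + y₁ ω ^ q :=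
    (hx₀.enorm.pow_const q).add (hy₁.pow_const q)
  rw [lintegral_const_mul' _ _ n1, lintegral_const_mul' _ _ n2, lintegral_add_left hm,
    lintegral_add_left (hx₀.enorm.pow_const q), lintegral_add_left (hFm.pow_const q), supConst,
    mul_assoc, mul_assoc]
  refine mul_le_mul_right (mul_le_mul_right ?_ _) _
  rw [hyq]
  refine (add_le_add le_rfl (add_le_add hFq hZ2)).trans ?_
  generalize ∫⁻ ω, ‖x₀ ω‖ₑ ^ q ∂P = i₁
  generalize (if e then ∫⁻ ω, ‖y₀ ω‖ₑ ^ q ∂P else 0) = i₂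
  generalize ∫⁻ z, ‖f z‖ₑ ^ q ∂rectMeasure P T = i₃
  generalize ∫⁻ z, ‖G z‖ₑ ^ q ∂rectMeasure P T = i₄
  generalize ENNReal.ofReal (4 ^ q * (itoConst q * (T : ℝ) ^ ((q - 2) / 2))) = k₄
  generalize (T : ℝ≥0∞) ^ q = k₂
  generalize (T : ℝ≥0∞) ^ (q - 1) = k₃
  have l1 : i₁ ≤ (1 + k₂ + k₃ + k₄) * i₁ := by
    nth_rw 1 [← one_mul i₁]
    exact mul_le_mul_left (le_self_add.trans (le_self_add.trans le_self_add)) _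
  have l2 : k₂ ≤ 1 + k₂ + k₃ + k₄ := le_add_self.trans (le_self_add.trans le_self_add)
  have l3 : k₃ ≤ 1 + k₂ + k₃ + k₄ := le_add_self.trans le_self_add
  have l4 : k₄ ≤ 1 + k₂ + k₃ + k₄ := le_add_self
  rw [mul_add, mul_add, mul_add, add_assoc _ (_ * i₃)]
  exact add_le_add (add_le_add l1 (mul_le_mul_left l2 _))
    (add_le_add (mul_le_mul_left l3 _) (mul_le_mul_left l4 _))

end ScalarSup

/-! ### Test functions -/

lemma fourier_comp_sub {d : ℕ} (φ : Space d → ℂ) (x ξ : Space d) :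
    𝓕 (fun y => φ (y - x)) ξ = Real.fourierChar (-inner ℝ x ξ) • 𝓕 φ ξ := by
  rw [Real.fourier_eq, Real.fourier_eq, ← integral_add_right_eq_self _ x, Circle.smul_def,
    ← integral_smul]
  refine integral_congr_ae (Eventually.of_forall fun v => ?_)
  beta_reduce
  rw [← Circle.smul_def, add_sub_cancel_right, smul_smul, ← AddChar.map_add_eq_mul, inner_add_left, neg_add_rev]

/-- A Fourier multiplier commutes with translations, which are multiplications by characters on the
Fourier side. -/
lemma schwartzBessel_shift (d : ℕ) (s : ℝ) (x : Space d) (φ : 𝓢(Space d, ℝ)) :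
    schwartzBessel d s (φ.compSubConstCLM ℝ x) = (schwartzBessel d s φ).compSubConstCLM ℝ x := by
  ext y
  change (schwartzBesselC d s (SchwartzMap.postcompCLM Complex.ofRealCLM (φ.compSubConstCLM ℝ x)) y).re =
    (schwartzBesselC d s (SchwartzMap.postcompCLM Complex.ofRealCLM φ) (y - x)).re
  rw [schwartzBesselC_apply, schwartzBesselC_apply, Real.fourierInv_eq, Real.fourierInv_eq]
  congr 2
  ext ξ
  have h : (SchwartzMap.postcompCLM Complex.ofRealCLM (φ.compSubConstCLM ℝ x) : Space d → ℂ) =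
      fun y => (SchwartzMap.postcompCLM Complex.ofRealCLM φ) (y - x) := rfl
  rw [h, fourier_comp_sub, smul_comm (besselSymbol d s ξ), smul_smul, ← AddChar.map_add_eq_mul,
    inner_sub_right, real_inner_comm x ξ, sub_eq_add_neg]

section Pairing

variable {d : ℕ} {F : Type*} [NormedAddCommGroup F] [NormedSpace ℝ F] [CompleteSpace F]
  {p : ℝ≥0∞} [hp : Fact (1 ≤ p)] {γ : ℝ}

/-- Moving `(1 - Δ)^{-γ/2}` to the test function expresses the pairing through the `L_p` density
alone; this is what makes it continuous for the norm of the space. -/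
lemma HSpace.toDist_apply (u : HSpace d F p γ) (φ : 𝓢(Space d, ℝ)) :
    u.toDist φ = ∫ x, schwartzBessel d (-γ) φ x • u.density x := by
  rw [← u.density_spec]
  simp only [bessel, ContinuousLinearMap.comp_apply, schwartzBessel_comp, add_neg_cancel,
    schwartzBessel_zero]

variable (F p γ) in
/-- The pairing `u ↦ (u, φ)` on `H_p^γ`. -/
def HSpace.toDistL (φ : 𝓢(Space d, ℝ)) : HSpace d F p γ →L[ℝ] F where
  toFun u := u.toDist φ
  map_add' _ _ := rfl
  map_smul' _ _ := rfl
  cont := by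
    have h1 := ENNReal.HolderConjugate.inv_one_sub_inv' hp.out
    have h2 : Fact (1 ≤ (1 - p⁻¹)⁻¹) := by simp [fact_iff]
    have h3 : Isometry (HSpace.densityL d F p γ) :=
      AddMonoidHomClass.isometry_of_norm _ fun _ => rfl
    let ψ := schwartzBessel d (-γ) φ
    have h4 : (fun u : HSpace d F p γ => u.toDist φ) = fun u =>
        (ContinuousLinearMap.lsmul ℝ ℝ (E := F)).flip.lpPairing volume p (1 - p⁻¹)⁻¹
          (HSpace.densityL d F p γ u) (ψ.toLp (1 - p⁻¹)⁻¹ volume) := by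
      ext u
      rw [HSpace.toDist_apply, ContinuousLinearMap.lpPairing_eq_integral]
      refine integral_congr_ae ?_
      filter_upwards [ψ.coeFn_toLp (1 - p⁻¹)⁻¹ volume] with x hx
      rw [hx]
      rfl
    change Continuous fun u : HSpace d F p γ => u.toDist φ
    rw [h4]
    exact (ContinuousLinearMap.continuous _ |>.comp h3.continuous).clm_apply continuous_const

lemma HSpace.toDistL_apply (φ : 𝓢(Space d, ℝ)) (u : HSpace d F p γ) :
    HSpace.toDistL F p γ φ u = u.toDist φ := rfl

/-- Dominated convergence. Locally uniformly in the shift, the Schwartz function is dominated by a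
multiple of the integrable weight `(1 + ‖y‖)^{-(d+1)}`. -/
lemma continuous_integral_shift_smul (hp' : p ≠ ∞) (h : 𝓢(Space d, ℝ))
    (f : Lp F p (volume : Measure (Space d))) :
    Continuous fun x : Space d => ∫ y, h (y - x) • f y := by
  have hp0 : p ≠ 0 := (zero_lt_one.trans_le hp.out).ne'
  have hq : 1 ≤ p.toReal := by
    rw [← ENNReal.toReal_one]; exact ENNReal.toReal_mono hp' hp.out
  let k := d + 1
  let C : ℝ := 2 ^ k * ((Finset.Iic (k, 0)).sup fun m => SchwartzMap.seminorm ℝ m.1 m.2) h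
  have hC : 0 ≤ C := by positivity
  have hh : ∀ y, ‖h y‖ ≤ C * (1 + ‖y‖) ^ (-(k : ℝ)) := by
    intro y
    have := SchwartzMap.one_add_le_sup_seminorm_apply (𝕜 := ℝ) (m := (k, 0)) le_rfl le_rfl h y
    rw [norm_iteratedFDeriv_zero] at this
    rw [Real.rpow_neg (by positivity), Real.rpow_natCast, ← div_eq_mul_inv, le_div_iff₀ (by positivity),
      mul_comm]
    exact this
  rw [continuous_iff_continuousAt]
  intro x₀
  have hint : Integrable fun y : Space d => C * (2 + ‖x₀‖) ^ (k : ℝ) *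
      ((1 + ‖y‖) ^ (-(k : ℝ)) + ‖f y‖ ^ p.toReal) := by
    refine Integrable.const_mul (Integrable.add (integrable_one_add_norm ?_) ?_) _
    · simp [k]
    · exact (Lp.memLp f).integrable_norm_rpow hp0 hp'
  refine continuousAt_of_dominated (Eventually.of_forall fun x => ?_) ?_ hint
    (Eventually.of_forall fun y => ?_)
  · exact (h.continuous.comp (continuous_id.sub continuous_const)).aestronglyMeasurable.smul
      (Lp.aestronglyMeasurable f)
  · filter_upwards [Metric.ball_mem_nhds x₀ one_pos] with x hx
    refine Eventually.of_forall fun y => ?_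
    rw [norm_smul]
    have h1 : ‖x‖ ≤ 1 + ‖x₀‖ := by
      have h2 : ‖x - x₀‖ < 1 := by simpa [dist_eq_norm] using hx
      have h3 := norm_add_le (x - x₀) x₀
      rw [sub_add_cancel] at h3
      linarith
    -- Peetre's inequality transfers the decay in `y - x` to decay in `y`.
    have h2 : 1 + ‖y‖ ≤ (2 + ‖x₀‖) * (1 + ‖y - x‖) := by
      have h3 := norm_add_le (y - x) x
      rw [sub_add_cancel] at h3
      nlinarith [norm_nonneg (y - x), norm_nonneg x₀]
    have h3 : (1 + ‖y - x‖) ^ (-(k : ℝ)) ≤ (2 + ‖x₀‖) ^ (k : ℝ) * (1 + ‖y‖) ^ (-(k : ℝ)) := by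
      rw [Real.rpow_neg (by positivity), Real.rpow_neg (by positivity), ← div_eq_mul_inv,
        inv_le_comm₀ (by positivity) (by positivity), inv_div, div_le_iff₀ (by positivity),
        ← Real.mul_rpow (by positivity) (by positivity), mul_comm]
      exact Real.rpow_le_rpow (by positivity) h2 (by positivity)
    have h4 : (1 + ‖y‖) ^ (-(k : ℝ)) ≤ 1 :=
      Real.rpow_le_one_of_one_le_of_nonpos (by linarith [norm_nonneg y]) (by simp)
    have h5 : 0 ≤ (1 + ‖y‖) ^ (-(k : ℝ)) := by positivity
    -- Where `‖f y‖ ≤ 1` the weight dominates; elsewhere `‖f y‖ ≤ ‖f y‖^p` and the weight is at most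
    -- one.
    have h6 : (1 + ‖y‖) ^ (-(k : ℝ)) * ‖f y‖ ≤ (1 + ‖y‖) ^ (-(k : ℝ)) + ‖f y‖ ^ p.toReal := by
      rcases le_total ‖f y‖ 1 with h | h
      · have := Real.rpow_nonneg (norm_nonneg (f y)) p.toReal
        nlinarith
      · have := Real.rpow_le_rpow_of_exponent_le h hq
        rw [Real.rpow_one] at this
        nlinarith [norm_nonneg (f y)]
    calc ‖h (y - x)‖ * ‖f y‖ ≤ C * ((2 + ‖x₀‖) ^ (k : ℝ) * (1 + ‖y‖) ^ (-(k : ℝ))) * ‖f y‖ := by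
          refine mul_le_mul_of_nonneg_right ((hh _).trans ?_) (norm_nonneg _)
          exact mul_le_mul_of_nonneg_left h3 hC
      _ = C * (2 + ‖x₀‖) ^ (k : ℝ) * ((1 + ‖y‖) ^ (-(k : ℝ)) * ‖f y‖) := by ring
      _ ≤ _ := mul_le_mul_of_nonneg_left h6 (by positivity)
  · exact ((h.continuous.comp (continuous_const.sub continuous_id)).smul continuous_const).continuousAt

/-- `φ(y - x)` as a function of `y`, followed by `(1 - Δ)^{γ/2}`. -/
def besselShift (γ : ℝ) (φ : 𝓢(Space d, ℝ)) (x : Space d) : 𝓢(Space d, ℝ) :=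
  schwartzBessel d γ (φ.compSubConstCLM ℝ x)

lemma continuous_toDist_besselShift (hp' : p ≠ ∞) (γ' : ℝ) (φ : 𝓢(Space d, ℝ)) (u : HSpace d F p γ) :
    Continuous fun x : Space d => u.toDist (besselShift γ' φ x) := by
  refine (continuous_integral_shift_smul hp' (schwartzBessel d (-γ + γ') φ) u.density).congr fun x => ?_
  rw [HSpace.toDist_apply, besselShift, schwartzBessel_comp, schwartzBessel_shift]
  rfl

/-- Continuity in the shift and measurability in the parameter give joint measurability, which the
exchanges of integrals over `x` require. -/
lemma stronglyMeasurable_toDist_besselShift {X : Type*} {mX : MeasurableSpace X} (hp' : p ≠ ∞)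
    (γ' : ℝ) (φ : 𝓢(Space d, ℝ)) {u : X → HSpace d F p γ} (hu : StronglyMeasurable u) :
    StronglyMeasurable fun z : Space d × X => (u z.2).toDist (besselShift γ' φ z.1) :=
  stronglyMeasurable_uncurry_of_continuous_of_stronglyMeasurable
    (u := fun (x : Space d) (z : X) => (u z).toDist (besselShift γ' φ x))
    (fun z => continuous_toDist_besselShift hp' γ' φ (u z))
    fun x => (HSpace.toDistL F p γ (besselShift γ' φ x)).continuous.comp_stronglyMeasurable hu

end Pairing

/-! ### Mollification -/

lemma enorm_integral_smul_rpow_le {X F : Type*} {mX : MeasurableSpace X} [NormedAddCommGroup F]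
    [NormedSpace ℝ F] {μ : Measure X} {k : X → ℝ} (hk : Measurable k) (hk0 : ∀ x, 0 ≤ k x)
    (hk1 : ∫⁻ x, ENNReal.ofReal (k x) ∂μ = 1) {f : X → F} (hf : AEStronglyMeasurable f μ) {q : ℝ}
    (hq : 1 ≤ q) :
    ‖∫ x, k x • f x ∂μ‖ₑ ^ q ≤ ∫⁻ x, ENNReal.ofReal (k x) * ‖f x‖ₑ ^ q ∂μ := by
  have hq0 : 0 < q := by linarith
  have hkm := hk.ennreal_ofReal
  let ν : Measure X := μ.withDensity fun x => ENNReal.ofReal (k x)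
  have h1 : ν Set.univ = 1 := by
    rw [withDensity_apply _ MeasurableSet.univ, Measure.restrict_univ, hk1]
  have h2 : ‖∫ x, k x • f x ∂μ‖ₑ ≤ ∫⁻ x, ‖f x‖ₑ ∂ν := by
    rw [lintegral_withDensity_eq_lintegral_mul₀ hkm.aemeasurable hf.enorm]
    refine (enorm_integral_le_lintegral_enorm _).trans (le_of_eq (lintegral_congr fun x => ?_))
    rw [enorm_smul, Real.enorm_eq_ofReal (hk0 x), Pi.mul_apply]
  have h3 : AEMeasurable (fun x => ‖f x‖ₑ) ν := hf.enorm.mono_ac (withDensity_absolutelyContinuous _ _)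
  refine (ENNReal.rpow_le_rpow h2 hq0.le).trans
    ((lintegral_rpow_le_measure_univ ν h3 hq).trans (le_of_eq ?_))
  rw [h1, ENNReal.one_rpow, one_mul, lintegral_withDensity_eq_lintegral_mul₀ hkm.aemeasurable
    (hf.enorm.pow_const q)]
  rfl

/-- Smooth bumps that concentrate at the origin. -/
def bump (d n : ℕ) : ContDiffBump (0 : Space d) where
  rIn := 1 / ((n : ℝ) + 1)
  rOut := 2 * (1 / ((n : ℝ) + 1))
  rIn_pos := by positivity
  rIn_lt_rOut := by
    have : (0 : ℝ) < 1 / ((n : ℝ) + 1) := by positivity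
    linarith

/-- An approximate identity of Schwartz functions. -/
def mollifier (d n : ℕ) : 𝓢(Space d, ℝ) :=
  ((bump d n).hasCompactSupport_normed (μ := volume)).toSchwartzMap (bump d n).contDiff_normed

lemma mollifier_apply (d n : ℕ) (x : Space d) : mollifier d n x = (bump d n).normed volume x := rfl

lemma mollifier_nonneg (d n : ℕ) (x : Space d) : 0 ≤ mollifier d n x := (bump d n).nonneg_normed x

lemma mollifier_sub_comm (d n : ℕ) (x y : Space d) : mollifier d n (x - y) = mollifier d n (y - x) := by
  rw [mollifier_apply, mollifier_apply, ← neg_sub, ContDiffBump.normed_neg]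

lemma lintegral_mollifier (d n : ℕ) : ∫⁻ x, ENNReal.ofReal (mollifier d n x) = 1 := by
  have h1 : Integrable (fun x => mollifier d n x) := (bump d n).integrable_normed
  rw [← ofReal_integral_eq_lintegral_ofReal h1 (Eventually.of_forall (mollifier_nonneg d n)),
    ← ENNReal.ofReal_one]
  congr 1
  exact (bump d n).integral_normed

section Mollify

variable {d : ℕ} {F : Type*} [NormedAddCommGroup F] [NormedSpace ℝ F] [CompleteSpace F]
  {p : ℝ≥0∞} [hp : Fact (1 ≤ p)] {γ : ℝ}

/-- The link between scalar and norm estimates: the pairing is the mollification at `x` of the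
density `(1 - Δ)^{γ/2} v`. The mollifier is even, so no reflection appears. -/
lemma Represents.apply_besselShift {f : Lp F p (volume : Measure (Space d))} {v : TDist d F}
    (hf : Represents f (bessel γ v)) (n : ℕ) (x : Space d) :
    v (besselShift γ (mollifier d n) x) = ∫ y, mollifier d n (x - y) • f y := by
  have h := hf ((mollifier d n).compSubConstCLM ℝ x)
  simp only [SchwartzMap.compSubConstCLM_apply] at h
  simp only [mollifier_sub_comm d n x]
  exact h

lemma enorm_Lp_rpow (hp' : p ≠ ∞) (f : Lp F p (volume : Measure (Space d))) :
    ‖f‖ₑ ^ p.toReal = ∫⁻ x, ‖f x‖ₑ ^ p.toReal := by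
  have hp0 : p ≠ 0 := (zero_lt_one.trans_le hp.out).ne'
  rw [Lp.enorm_def, eLpNorm_eq_lintegral_rpow_enorm_toReal hp0 hp', ← ENNReal.rpow_mul,
    one_div_mul_cancel (ENNReal.toReal_pos hp0 hp').ne', ENNReal.rpow_one]

/-- Young's inequality for convolution with a probability density. There is nothing to prove outside
`H_p^γ`, where `hNorm` is infinite, so the data may lie in spaces of any smoothness. -/
lemma lintegral_besselShift_le (hp' : p ≠ ∞) (v : TDist d F) (n : ℕ) :
    ∫⁻ x, ‖v (besselShift γ (mollifier d n) x)‖ₑ ^ p.toReal ≤ hNorm p γ v ^ p.toReal := by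
  have hp0 : p ≠ 0 := (zero_lt_one.trans_le hp.out).ne'
  have hq0 : 0 < p.toReal := ENNReal.toReal_pos hp0 hp'
  have hq : 1 ≤ p.toReal := by
    rw [← ENNReal.toReal_one]; exact ENNReal.toReal_mono hp' hp.out
  rw [← ENNReal.rpow_inv_le_iff hq0]
  refine le_iInf₂ fun f hf => ?_
  rw [ENNReal.rpow_inv_le_iff hq0, enorm_Lp_rpow hp']
  simp only [hf.apply_besselShift]
  have hm : Measurable (mollifier d n) := (mollifier d n).continuous.measurable
  have hfe : AEMeasurable (fun y => ‖f y‖ₑ ^ p.toReal) volume :=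
    (Lp.aestronglyMeasurable f).enorm.pow_const _
  calc ∫⁻ x, ‖∫ y, mollifier d n (x - y) • f y‖ₑ ^ p.toReal ≤
        ∫⁻ x, ∫⁻ y, ENNReal.ofReal (mollifier d n (x - y)) * ‖f y‖ₑ ^ p.toReal := by
        refine lintegral_mono fun x => ?_
        refine enorm_integral_smul_rpow_le (k := fun y => mollifier d n (x - y))
          (hm.comp (measurable_const.sub measurable_id)) (fun y => mollifier_nonneg d n _) ?_ (Lp.aestronglyMeasurable f) hq
        rw [lintegral_sub_left_eq_self (fun y => ENNReal.ofReal (mollifier d n y)) x,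
          lintegral_mollifier]
    _ = ∫⁻ y, ∫⁻ x, ENNReal.ofReal (mollifier d n (x - y)) * ‖f y‖ₑ ^ p.toReal := by
        refine lintegral_lintegral_swap ?_
        exact (hm.comp (measurable_fst.sub measurable_snd)).ennreal_ofReal.aemeasurable.mul
          (hfe.comp_quasiMeasurePreserving Measure.quasiMeasurePreserving_snd)
    _ = ∫⁻ y, ‖f y‖ₑ ^ p.toReal := by
        refine lintegral_congr fun y => ?_
        have hmy : Measurable fun x => ENNReal.ofReal (mollifier d n (x - y)) :=
          (hm.comp (measurable_id.sub measurable_const)).ennreal_ofReal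
        rw [lintegral_mul_const _ hmy,
          lintegral_sub_right_eq_self (fun y => ENNReal.ofReal (mollifier d n y)) y,
          lintegral_mollifier, one_mul]

/-- Mollifications converge at almost every point, and Fatou's lemma does the rest. Representability
has to be assumed here: it is what excludes an infinite left-hand side. -/
lemma Represents.hNorm_rpow_le_liminf (hp' : p ≠ ∞) {f : Lp F p (volume : Measure (Space d))}
    {v : TDist d F} (hf : Represents f (bessel γ v)) :
    hNorm p γ v ^ p.toReal ≤ liminf (fun n =>
      ∫⁻ x, ‖v (besselShift γ (mollifier d n) x)‖ₑ ^ p.toReal) atTop := by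
  have h1 : hNorm p γ v ^ p.toReal ≤ ∫⁻ x, ‖f x‖ₑ ^ p.toReal := by
    rw [← enorm_Lp_rpow hp']
    exact ENNReal.rpow_le_rpow (iInf₂_le f hf) ENNReal.toReal_nonneg
  have hφ : Tendsto (fun n => (bump d n).rOut) atTop (𝓝 0) := by
    have := (tendsto_one_div_add_atTop_nhds_zero_nat (𝕜 := ℝ)).const_mul 2
    rwa [mul_zero] at this
  have h2 := ContDiffBump.ae_convolution_tendsto_right_of_locallyIntegrable (μ := volume) (K := 2) hφ
    (Eventually.of_forall fun n => le_rfl) ((Lp.memLp f).locallyIntegrable hp.out)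
  have h3 : ∀ n x, v (besselShift γ (mollifier d n) x) =
      MeasureTheory.convolution ((bump d n).normed volume) f (ContinuousLinearMap.lsmul ℝ ℝ) volume x := by
    intro n x
    rw [hf.apply_besselShift, convolution_eq_swap]
    rfl
  have h4 : ∀ n, Measurable fun x => ‖v (besselShift γ (mollifier d n) x)‖ₑ ^ p.toReal := fun n => by
    have := continuous_integral_shift_smul hp' (mollifier d n) f
    simp only [mollifier_sub_comm d n _] at this
    simp only [hf.apply_besselShift]
    exact this.enorm.measurable.pow_const _
  refine h1.trans ((lintegral_mono_ae ?_).trans (lintegral_liminf_le h4))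
  filter_upwards [h2] with x hx
  refine le_of_eq (Tendsto.liminf_eq ?_).symm
  simp only [h3]
  exact ((continuous_enorm.tendsto _).comp hx).ennrpow_const _

end Mollify

/-! ### The embedding of `H_p^{γ+2}` into `H_p^γ` -/

/-- The standard exponential distribution. -/
def expLaw : Measure ℝ :=
  (volume.restrict (Set.Ioi 0)).withDensity fun t => ENNReal.ofReal (Real.exp (-t))

lemma integrableOn_exp_neg : IntegrableOn (fun t : ℝ => Real.exp (-t)) (Set.Ioi 0) := by
  simpa using integrableOn_exp_mul_Ioi (a := -1) (by norm_num) 0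

instance : IsProbabilityMeasure expLaw := by
  constructor
  rw [expLaw, withDensity_apply _ MeasurableSet.univ, Measure.restrict_univ,
    ← ofReal_integral_eq_lintegral_ofReal integrableOn_exp_neg
      (Eventually.of_forall fun t => (Real.exp_pos _).le), integral_exp_neg_Ioi_zero,
    ENNReal.ofReal_one]

lemma integral_exp_neg_mul_expLaw {a : ℝ} (ha : 0 ≤ a) :
    ∫ t, Real.exp (-(a * t)) ∂expLaw = (1 + a)⁻¹ := by
  have hm : Measurable fun t : ℝ => ENNReal.ofReal (Real.exp (-t)) := by fun_prop
  rw [expLaw, integral_withDensity_eq_integral_toReal_smul hm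
    (Eventually.of_forall fun t => ENNReal.ofReal_lt_top)]
  have h : ∀ t : ℝ, (ENNReal.ofReal (Real.exp (-t))).toReal • Real.exp (-(a * t)) =
      Real.exp (-(1 + a) * t) := fun t => by
    rw [ENNReal.toReal_ofReal (Real.exp_pos _).le, smul_eq_mul, ← Real.exp_add]
    congr 1; ring
  simp only [h]
  rw [integral_exp_mul_Ioi (by linarith), mul_zero, Real.exp_zero, neg_div_neg_eq, one_div]

/-- The law of `√(2τ) Z` for independent standard exponential `τ` and standard Gaussian `Z`; its density is
the kernel of `(1 - Δ)⁻¹`. -/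
def besselLaw (d : ℕ) : Measure (Space d) :=
  (expLaw.prod (stdGaussian (Space d))).map fun z => Real.sqrt (2 * z.1) • z.2

lemma measurable_besselVar (d : ℕ) :
    Measurable fun z : ℝ × Space d => Real.sqrt (2 * z.1) • z.2 := by fun_prop

instance (d : ℕ) : IsProbabilityMeasure (besselLaw d) :=
  Measure.isProbabilityMeasure_map (measurable_besselVar d).aemeasurable

lemma ae_expLaw_nonneg : ∀ᵐ t ∂expLaw, 0 ≤ t := by
  refine (withDensity_absolutelyContinuous _ _).ae_le ?_
  filter_upwards [ae_restrict_mem measurableSet_Ioi] with t ht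
  exact le_of_lt ht

/-- Given `τ` the variable is Gaussian with characteristic function `exp(-τ ‖t‖²)`; averaging over
the exponential law gives `1 / (1 + ‖t‖²)`. -/
lemma charFun_besselLaw (d : ℕ) (t : Space d) :
    charFun (besselLaw d) t = ((1 + ‖t‖ ^ 2)⁻¹ : ℝ) := by
  have hc : Continuous fun y : Space d => Complex.exp ((inner ℝ y t : ℝ) * Complex.I) := by fun_prop
  have hi : Integrable (fun z : ℝ × Space d =>
      Complex.exp ((inner ℝ (Real.sqrt (2 * z.1) • z.2) t : ℝ) * Complex.I))
      (expLaw.prod (stdGaussian (Space d))) := by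
    refine Integrable.of_bound
      (hc.measurable.comp (measurable_besselVar d)).aestronglyMeasurable 1
      (Eventually.of_forall fun z => ?_)
    rw [Complex.norm_exp_ofReal_mul_I]
  rw [charFun_apply, besselLaw, integral_map (measurable_besselVar d).aemeasurable
    hc.aestronglyMeasurable, integral_prod _ hi,
    ← integral_exp_neg_mul_expLaw (sq_nonneg ‖t‖), ← integral_complex_ofReal]
  refine integral_congr_ae ?_
  filter_upwards [ae_expLaw_nonneg] with τ hτ
  have h1 := charFun_stdGaussian (Real.sqrt (2 * τ) • t)
  rw [charFun_apply] at h1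
  simp only [real_inner_smul_left]
  simp only [real_inner_smul_right] at h1
  have e : (Real.sqrt (2 * τ) * ‖t‖) ^ 2 = 2 * τ * ‖t‖ ^ 2 := by
    rw [mul_pow, Real.sq_sqrt (by linarith)]
  rw [h1, norm_smul, Real.norm_of_nonneg (Real.sqrt_nonneg _), ← Complex.ofReal_pow, e]
  push_cast
  congr 1
  ring

lemma integral_fourierChar_besselLaw (d : ℕ) (ξ : Space d) :
    ∫ y, (Real.fourierChar (-inner ℝ y ξ) : ℂ) ∂besselLaw d = besselSymbol d (-2) ξ := by
  have h := charFun_besselLaw d (-((2 * Real.pi) • ξ))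
  rw [charFun_apply, norm_neg] at h
  rw [besselSymbol, show (-2 : ℝ) / 2 = -1 by norm_num, Real.rpow_neg_one, ← h]
  refine integral_congr_ae (Eventually.of_forall fun y => ?_)
  beta_reduce
  rw [Real.fourierChar_apply, inner_neg_right, real_inner_smul_right]
  congr 3
  ring

/-- In the Fourier inversion formula the symbol is written as the characteristic function of
`besselLaw`. Fubini's theorem then leaves an average of translates. -/
lemma schwartzBessel_neg_two_apply (d : ℕ) (φ : 𝓢(Space d, ℝ)) (x : Space d) :
    schwartzBessel d (-2) φ x = ∫ y, φ (x - y) ∂besselLaw d := by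
  let Φ : 𝓢(Space d, ℂ) := SchwartzMap.postcompCLM Complex.ofRealCLM φ
  have hint : Integrable (𝓕 (Φ : Space d → ℂ)) := by
    rw [← SchwartzMap.fourier_coe]
    exact (𝓕 Φ).integrable
  have hinv : ∀ z, 𝓕⁻ (𝓕 (Φ : Space d → ℂ)) z = Φ z := fun z => by
    rw [← SchwartzMap.fourier_coe, ← SchwartzMap.fourierInv_coe, FourierTransform.fourierInv_fourier_eq]
  have hI : Integrable (Function.uncurry fun (ξ y : Space d) =>
      (Real.fourierChar (inner ℝ ξ (x - y)) : ℂ) * 𝓕 (Φ : Space d → ℂ) ξ)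
      (volume.prod (besselLaw d)) := by
    have h1 : Integrable (fun z : Space d × Space d => 𝓕 (Φ : Space d → ℂ) z.1)
      (volume.prod (besselLaw d)) := hint.comp_fst _
    refine h1.bdd_mul (c := 1) ?_ (Eventually.of_forall fun z => (Circle.norm_coe _).le)
    exact Continuous.aestronglyMeasurable (by fun_prop)
  have hC : schwartzBesselC d (-2) Φ x = ∫ y, Φ (x - y) ∂besselLaw d := by
    calc schwartzBesselC d (-2) Φ x =
        ∫ ξ, ∫ y, (Real.fourierChar (inner ℝ ξ (x - y)) : ℂ) * 𝓕 (Φ : Space d → ℂ) ξ ∂besselLaw d := by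
          rw [schwartzBesselC_apply, Real.fourierInv_eq]
          refine integral_congr_ae (Eventually.of_forall fun ξ => ?_)
          beta_reduce
          rw [integral_mul_const, Circle.smul_def, Complex.real_smul,
            ← integral_fourierChar_besselLaw, smul_eq_mul, ← mul_assoc, ← integral_const_mul]
          congr 1
          refine integral_congr_ae (Eventually.of_forall fun y => ?_)
          beta_reduce
          rw [inner_sub_right, sub_eq_add_neg, AddChar.map_add_eq_mul, Circle.coe_mul,
            real_inner_comm ξ y]
      _ = ∫ y, (∫ ξ, (Real.fourierChar (inner ℝ ξ (x - y)) : ℂ) * 𝓕 (Φ : Space d → ℂ) ξ) ∂besselLaw d :=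
          integral_integral_swap hI
      _ = _ := by
          refine integral_congr_ae (Eventually.of_forall fun y => ?_)
          beta_reduce
          rw [← hinv, Real.fourierInv_eq]
          rfl
  change (schwartzBesselC d (-2) Φ x).re = _
  rw [hC, show (fun y => Φ (x - y)) = fun y => ((φ (x - y) : ℝ) : ℂ) from rfl,
    integral_complex_ofReal]
  exact Complex.ofReal_re _

section Embedding

variable {d : ℕ} {F : Type*} [NormedAddCommGroup F] [NormedSpace ℝ F] [CompleteSpace F]
  {p : ℝ≥0∞} [hp : Fact (1 ≤ p)] {γ : ℝ}

/-- An average of translates over a probability measure does not increase the `L_p` norm, by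
Jensen's inequality. The shear `(y, x) ↦ (y, y + x)` preserves the product measure and carries the
translation from the test function to `f`. -/
lemma exists_represents_bessel_neg_two (hp' : p ≠ ∞) {f : Lp F p (volume : Measure (Space d))}
    {v : TDist d F} (hf : Represents f v) :
    ∃ g : Lp F p (volume : Measure (Space d)), Represents g (bessel (-2) v) := by
  have hp0 : p ≠ 0 := (zero_lt_one.trans_le hp.out).ne'
  have hq : 1 ≤ p.toReal := by
    rw [← ENNReal.toReal_one]; exact ENNReal.toReal_mono hp' hp.out
  let μ := besselLaw d
  have hS := measurePreserving_prod_add μ (volume : Measure (Space d))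
  have hSe : MeasurableEmbedding fun z : Space d × Space d => (z.1, z.1 + z.2) :=
    (MeasurableEquiv.shearAddRight (Space d)).measurableEmbedding
  have hfm := Lp.stronglyMeasurable f
  have hfS : StronglyMeasurable fun z : Space d × Space d => f (z.1 + z.2) :=
    hfm.comp_measurable (measurable_fst.add measurable_snd)
  -- Since the operator acts on test functions by `φ (x - y)`, its adjoint translates by `+y`.
  let g : Space d → F := fun x => ∫ y, f (y + x) ∂μ
  have hgm : AEStronglyMeasurable g volume :=
    (hfm.comp_measurable (measurable_snd.add measurable_fst) :
      StronglyMeasurable fun z : Space d × Space d => f (z.2 + z.1)).integral_prod_right'.aestronglyMeasurable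
  have hfq : ∫⁻ z : Space d × Space d, ‖f (z.1 + z.2)‖ₑ ^ p.toReal ∂μ.prod volume =
      ∫⁻ x, ‖f x‖ₑ ^ p.toReal := by
    have hm : Measurable fun z : Space d × Space d => ‖f z.2‖ₑ ^ p.toReal :=
      (hfm.enorm.pow_const _).comp measurable_snd
    rw [hS.lintegral_comp_emb hSe fun z => ‖f z.2‖ₑ ^ p.toReal, lintegral_prod _ hm.aemeasurable]
    simp
  have hlt : ∫⁻ x, ‖f x‖ₑ ^ p.toReal < ∞ := by
    rw [← enorm_Lp_rpow hp']
    exact ENNReal.rpow_lt_top_of_nonneg ENNReal.toReal_nonneg enorm_ne_top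
  have hg : MemLp g p volume := by
    refine ⟨hgm, ?_⟩
    rw [eLpNorm_lt_top_iff_lintegral_rpow_enorm_lt_top hp0 hp']
    refine lt_of_le_of_lt ?_ hlt
    rw [← hfq, lintegral_prod_symm _ (hfS.enorm.pow_const _).aemeasurable]
    refine lintegral_mono fun x => ?_
    have := enorm_integral_smul_rpow_le (μ := μ) (k := fun _ => 1) measurable_const
      (fun _ => zero_le_one) (by simp) (f := fun y => f (y + x))
      (hfm.comp_measurable (measurable_id.add_const x)).aestronglyMeasurable hq
    simpa using this
  refine ⟨hg.toLp g, fun φ => ?_⟩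
  obtain ⟨C, hC⟩ : ∃ C, ∀ x, ‖φ x‖ ≤ C := ⟨_, fun x => φ.norm_le_seminorm ℝ x⟩
  have hJ : Integrable (fun z : Space d × Space d => φ z.2 • f (z.1 + z.2)) (μ.prod volume) := by
    have h1 : Integrable (fun z : Space d × Space d => ‖φ z.2‖) (μ.prod volume) :=
      (φ.integrable.norm).comp_snd _
    have h2 : Integrable (fun z : Space d × Space d => ‖f (z.1 + z.2)‖ ^ p.toReal) (μ.prod volume) := by
      have h3 : Integrable (fun z : Space d × Space d => ‖f z.2‖ ^ p.toReal) (μ.prod volume) :=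
        ((Lp.memLp f).integrable_norm_rpow hp0 hp').comp_snd _
      exact (hS.integrable_comp_emb hSe).2 h3
    refine (h1.add (h2.const_mul C)).mono'
      (((φ.continuous.comp continuous_snd).aestronglyMeasurable).smul hfS.aestronglyMeasurable)
      (Eventually.of_forall fun z => ?_)
    rw [norm_smul, Pi.add_apply]
    have hz := norm_nonneg (φ z.2)
    have hz2 := Real.rpow_nonneg (norm_nonneg (f (z.1 + z.2))) p.toReal
    have hz3 := hC z.2
    rcases le_total ‖f (z.1 + z.2)‖ 1 with h | h
    · nlinarith [mul_nonneg (hz.trans hz3) hz2]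
    · have := Real.rpow_le_rpow_of_exponent_le h hq
      rw [Real.rpow_one] at this
      nlinarith
  have hK : Integrable (fun z : Space d × Space d => φ (z.2 - z.1) • f z.2) (μ.prod volume) := by
    rw [← hS.integrable_comp_emb hSe]
    simpa [Function.comp_def] using hJ
  have e1 : bessel (-2) v φ = ∫ z, φ (z.2 - z.1) • f z.2 ∂μ.prod volume := by
    change v (schwartzBessel d (-2) φ) = _
    rw [hf, integral_prod_symm _ hK]
    refine integral_congr_ae (Eventually.of_forall fun x => ?_)
    beta_reduce
    rw [schwartzBessel_neg_two_apply]
    exact (integral_smul_const _ _).symm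
  rw [e1, ← hS.integral_comp hSe]
  simp only [add_sub_cancel_left]
  rw [integral_prod_symm _ hJ]
  refine integral_congr_ae ?_
  filter_upwards [hg.coeFn_toLp] with x hx
  rw [hx, ← integral_smul]

lemma exists_represents_bessel_of_add_two (hp' : p ≠ ∞) (u : HSpace d F p (γ + 2)) :
    ∃ f : Lp F p (volume : Measure (Space d)), Represents f (bessel γ u.toDist) := by
  have := exists_represents_bessel_neg_two hp' u.density_spec
  rwa [bessel_bessel, show -2 + (γ + 2) = γ by ring] at this

end Embedding

/-! ### Estimates for the equation -/

lemma fracInt_toDist {d : ℕ} {F : Type*} [NormedAddCommGroup F] [NormedSpace ℝ F] [CompleteSpace F]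
    {p : ℝ≥0∞} [Fact (1 ≤ p)] {γ a : ℝ} {u : ℝ≥0 → HSpace d F p γ} {t : ℝ≥0} (h : FracIntegrable a u t)
    (φ : 𝓢(Space d, ℝ)) : (fracInt a u t).toDist φ = fracInt a (fun s => (u s).toDist φ) t := by
  by_cases ha : a = 0
  · simp [fracInt, ha]
  · simp only [fracInt, ha, if_false]
    exact ((HSpace.toDistL F p γ φ).integral_comp_comm (h.resolve_left ha)).symm

/-- Positivity of `α` forces `⌈α⌉ ≥ 1`, so the order of the equation is a natural number that is at
least one. -/
lemma exists_bigLambda_eq {α : ℝ} (hα : 0 < α) (β : ℝ) :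
    ∃ m : ℕ, bigLambda α β = m + 1 ∧ α ≤ m + 1 ∧ β ≤ m + 1 := by
  have h1 : 0 < ⌈α⌉ := Int.ceil_pos.2 hα
  obtain ⟨m, hm⟩ := Int.eq_ofNat_of_zero_le (show 0 ≤ max ⌈α⌉ ⌈β⌉ - 1 by
    have := le_max_left ⌈α⌉ ⌈β⌉
    omega)
  have h2 : bigLambda α β = m + 1 := by
    rw [bigLambda, show max ⌈α⌉ ⌈β⌉ = m + 1 by omega]
    push_cast; rfl
  refine ⟨m, h2, ?_, ?_⟩ <;> rw [← h2, bigLambda]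
  · exact (Int.le_ceil α).trans (Int.cast_le.2 (le_max_left _ _))
  · exact (Int.le_ceil β).trans (Int.cast_le.2 (le_max_right _ _))

section Norms

variable {d : ℕ} {F : Type*} [NormedAddCommGroup F] [NormedSpace ℝ F] [CompleteSpace F]
  {p : ℝ≥0∞} [hp : Fact (1 ≤ p)] {γ : ℝ}

lemma lintegral_lintegral_besselShift_le {X : Type*} {mX : MeasurableSpace X} {μ : Measure X} [SFinite μ]
    (hp' : p ≠ ∞) {γ' : ℝ} {u : X → HSpace d F p γ'} (hu : StronglyMeasurable u) (n : ℕ) :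
    ∫⁻ x, ∫⁻ z, ‖(u z).toDist (besselShift γ (mollifier d n) x)‖ₑ ^ p.toReal ∂μ ≤
      ∫⁻ z, hNorm p γ (u z).toDist ^ p.toReal ∂μ := by
  rw [lintegral_lintegral_swap
    ((stronglyMeasurable_toDist_besselShift hp' γ (mollifier d n) hu).enorm.pow_const _).aemeasurable]
  exact lintegral_mono fun z => lintegral_besselShift_le hp' _ n

lemma enorm_le_iSup_of_denseRange {K E : Type*} [TopologicalSpace K] [CompactSpace K]
    [NormedAddCommGroup E] (U : C(K, E)) {τ : ℕ → K} (hτ : DenseRange τ) :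
    ‖U‖ₑ ≤ ⨆ n, ‖U (τ n)‖ₑ := by
  set B := ⨆ n, ‖U (τ n)‖ₑ
  have h1 : ∀ t, ‖U t‖ₑ ≤ B := fun t => hτ.induction_on t
    (isClosed_le (continuous_enorm.comp U.continuous) continuous_const)
    fun n => le_iSup (fun n => ‖U (τ n)‖ₑ) n
  by_cases hB : B = ∞
  · rw [hB]; exact le_top
  rw [← ENNReal.ofReal_toReal hB, ← ofReal_norm]
  refine ENNReal.ofReal_le_ofReal ((ContinuousMap.norm_le _ ENNReal.toReal_nonneg).2 fun t => ?_)
  have := ENNReal.toReal_mono hB (h1 t)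
  rwa [toReal_enorm] at this

end Norms

/-! ### Passage from tested equations to norms in Bessel potential spaces. -/

section Solution

variable {d : ℕ} {p : ℝ≥0∞} [hp : Fact (1 ≤ p)] {Ω : Type*} {mΩ : MeasurableSpace Ω} {P : Measure Ω}
  {ℱ : Filtration ℝ≥0 mΩ} {w : ℕ → ℝ≥0 → Ω → ℝ} {T : ℝ≥0}
  {F : Type*} [NormedAddCommGroup F] [NormedSpace ℝ F] [CompleteSpace F]

lemma StochH.stronglyMeasurable {γ : ℝ} (u : StochH d F p γ ℱ P T) :
    StronglyMeasurable fun z : ℝ≥0 × Ω => u z :=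
  (Lp.stronglyMeasurable u).mono (predictable_le ℱ)

lemma StochH.stronglyMeasurable_toDist {γ : ℝ} (u : StochH d F p γ ℱ P T) (φ : 𝓢(Space d, ℝ)) :
    StronglyMeasurable fun z : ℝ≥0 × Ω => (u z).toDist φ :=
  (HSpace.toDistL F p γ φ).continuous.comp_stronglyMeasurable (StochH.stronglyMeasurable u)

lemma StochH.memLp_toDist {γ : ℝ} (u : StochH d F p γ ℱ P T) (φ : 𝓢(Space d, ℝ)) :
    MemLp (fun z : ℝ≥0 × Ω => (u z).toDist φ) p (rectMeasure P T) :=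
  (HSpace.toDistL F p γ φ).comp_memLp' (memLp_of_memLp_trim (predictable_le ℱ) (Lp.memLp u))

lemma StochH.lintegral_toDist_ne_top (hp' : p ≠ ∞) {γ : ℝ} (u : StochH d F p γ ℱ P T)
    (φ : 𝓢(Space d, ℝ)) : ∫⁻ z, ‖(u z).toDist φ‖ₑ ^ p.toReal ∂rectMeasure P T ≠ ∞ :=
  (lintegral_rpow_enorm_lt_top_of_eLpNorm_lt_top (zero_lt_one.trans_le hp.out).ne' hp'
    (StochH.memLp_toDist u φ).2).ne

variable [IsProbabilityMeasure P] {α β γ₁ γ₂ γ₃ γ₄ : ℝ}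
  {u : SolSpace d p α β γ₁ ℱ P T} {f : StochH d ℝ p γ₂ ℱ P T} {g : StochH d ell2 p γ₃ ℱ P T}
  {u₀ : InitSpace d p α γ₄ ℱ P} {v₀ : InitSpace d p (α - 1) γ₄ ℱ P}

lemma exists_isItoSum_toDist (hW : IsWienerBasis P ℱ w) (hp2 : 2 ≤ p) (hp' : p ≠ ∞) (hT : 0 < T)
    (g : StochH d ell2 p γ₃ ℱ P T) (φ : 𝓢(Space d, ℝ)) {M : ℕ → ℝ≥0 → Ω → ℝ}
    (hM : ∀ k, IsItoIntegral ℱ P T (w k) (fun z => (g z).toDist φ k) (M k)) :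
    ∃ (ns : ℕ → ℕ) (X : ℝ≥0 → Ω → ℝ), IsItoSum P T p.toReal (fun z => (g z).toDist φ) M ns X := by
  refine exists_isItoSum hW hT ?_ ?_ hM
  · rw [← ENNReal.toReal_ofNat]; exact ENNReal.toReal_mono hp' hp2
  · rw [ENNReal.ofReal_toReal hp']
    exact StochH.memLp_toDist g φ

/-- The bound of the supremum after testing with one Schwartz function. -/
lemma IsSolution.lintegral_iSup_toDist_le (h : IsSolution w u f g u₀ v₀) (hW : IsWienerBasis P ℱ w)
    (hp2 : 2 ≤ p) (hp' : p ≠ ∞) (hT : 0 < T) (hα : 0 < α) (φ : 𝓢(Space d, ℝ))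
    (τ : ℕ → Set.Icc (0 : ℝ≥0) T) :
    ∫⁻ ω, (⨆ n, ‖(u.1.snd ω (τ n)).toDist φ‖ₑ) ^ p.toReal ∂P ≤ supConst p.toReal T *
      (∫⁻ ω, ‖(u₀ ω).toDist φ‖ₑ ^ p.toReal ∂P +
        (if 1 < α then ∫⁻ ω, ‖(v₀ ω).toDist φ‖ₑ ^ p.toReal ∂P else 0) +
        ∫⁻ z, ‖(f z).toDist φ‖ₑ ^ p.toReal ∂rectMeasure P T +
        ∫⁻ z, ‖(g z).toDist φ‖ₑ ^ p.toReal ∂rectMeasure P T) := by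
  have hq2 : 2 ≤ p.toReal := by
    rw [← ENNReal.toReal_ofNat]; exact ENNReal.toReal_mono hp' hp2
  obtain ⟨m, hm, hmα, hmβ⟩ := exists_bigLambda_eq hα β
  obtain ⟨M, S, hM, hS, hE⟩ := h φ
  obtain ⟨ns, X, hX⟩ := exists_isItoSum_toDist hW hp2 hp' hT g φ hM
  rw [hm] at hE
  rw [hm] at hS
  refine hX.lintegral_iSup_le hq2 hT (fun k => (hM k).continuous) (a := m + 1 - β) (b := m)
    (c := m + 1 - α) (by linarith) (Nat.cast_nonneg m) (by linarith)
    (StochH.stronglyMeasurable_toDist f φ).measurable hS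
    ((HSpace.toDistL ℝ p _ φ).continuous.comp_stronglyMeasurable
      ((Lp.stronglyMeasurable u₀).mono (ℱ.le 0))).measurable
    ((HSpace.toDistL ℝ p _ φ).continuous.comp_stronglyMeasurable
      ((Lp.stronglyMeasurable v₀).mono (ℱ.le 0))).measurable
    (1 < α) (A := fun t ω => (u.1.snd ω t).toDist φ) ?_ τ
  filter_upwards [hE] with ω h1 t
  exact h1 t t.2

/-- The Volterra bound after testing with one Schwartz function. -/
lemma IsSolution.lintegral_toDist_le
    (h : IsSolution w u f g (0 : InitSpace d p α γ₄ ℱ P) (0 : InitSpace d p (α - 1) γ₄ ℱ P))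
    (hW : IsWienerBasis P ℱ w) (hp2 : 2 ≤ p) (hp' : p ≠ ∞) (hT : 0 < T) (hα : 0 < α)
    (hβ : β < α + 1 / 2) (φ : 𝓢(Space d, ℝ)) {t : ℝ≥0} (ht : t ≤ T) :
    let θ := min 1 (min α (2 * (α - β) + 1))
    ∫⁻ z, ‖(u.1.fst z).toDist φ‖ₑ ^ p.toReal ∂rectMeasure P t ≤ volterraConst p.toReal α β θ T *
      ∫⁻ s in Set.Iic t, ENNReal.ofReal (((t : ℝ) - s) ^ (θ - 1)) *
        (∫⁻ z, ‖(f z).toDist φ‖ₑ ^ p.toReal ∂rectMeasure P s +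
          ∫⁻ z, ‖(g z).toDist φ‖ₑ ^ p.toReal ∂rectMeasure P s) ∂timeVol := by
  intro θ
  have hq2 : 2 ≤ p.toReal := by
    rw [← ENNReal.toReal_ofNat]; exact ENNReal.toReal_mono hp' hp2
  obtain ⟨m, hm, hmα, hmβ⟩ := exists_bigLambda_eq hα β
  obtain ⟨M, S, hM, hS, hE⟩ := h φ
  obtain ⟨ns, X, hX⟩ := exists_isItoSum_toDist hW hp2 hp' hT g φ hM
  have hV : IsVersion α β u.1.fst u.1.snd := u.2
  rw [IsVersion, hm] at hV
  rw [hm] at hE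
  rw [hm] at hS
  have hy := (StochH.stronglyMeasurable_toDist u.1.fst φ).measurable
  have hf := (StochH.stronglyMeasurable_toDist f φ).measurable
  have hyq := StochH.lintegral_toDist_ne_top hp' u.1.fst φ
  have hfq := StochH.lintegral_toDist_ne_top hp' f φ
  refine lintegral_le_of_fracInt_eq hq2 hT hα hβ hmα hmβ ((min_le_right _ _).trans (min_le_left _ _))
    ?_ hy hf hyq hfq (StochH.stronglyMeasurable_toDist g φ).aestronglyMeasurable hX ?_ ht
  -- `θ` is at most both `2 (α - β) + 1` and `1`.
  · rw [← min_add_add_right, zero_add]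
    exact le_min ((min_le_right _ _).trans (min_le_right _ _)) (min_le_left _ _)
  have h0 : ∀ᵐ ω ∂P, (0 : InitSpace d p α γ₄ ℱ P) ω = 0 :=
    ae_of_ae_trim (ℱ.le 0) (Lp.coeFn_zero _ _ _)
  have h0' : ∀ᵐ ω ∂P, (0 : InitSpace d p (α - 1) γ₄ ℱ P) ω = 0 :=
    ae_of_ae_trim (ℱ.le 0) (Lp.coeFn_zero _ _ _)
  have h1 := hX.ae_forall_eq hT (fun k => (hM k).continuous) (a := m + 1 - β) (b := m)
    (by linarith) (Nat.cast_nonneg m) hf (ae_integrableOn_section (by linarith) hf hfq) hS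
    (A := fun t ω => (u.1.snd ω t).toDist φ) (Eventually.of_forall fun ω =>
      (HSpace.toDistL ℝ p _ φ).continuous.comp (u.1.snd ω).continuous) (by
      filter_upwards [hE, h0, h0'] with ω h1 h2 h3 t
      have h4 := h1 t t.2
      rw [h2, h3, HSpace.toDist_zero, HSpace.toDist_zero] at h4
      simp only [zero_apply, mul_zero, ite_self, add_zero, fracInt_zero_fun, sub_zero] at h4
      exact h4)
  filter_upwards [h1, hV] with ω h2 h3
  filter_upwards [h3, ae_restrict_mem measurableSet_Iic] with t h4 htT
  have h5 := h2 ⟨t, zero_le, htT⟩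
  beta_reduce at h5
  rw [h4.2 ⟨zero_le, htT⟩, fracInt_toDist h4.1] at h5
  exact h5

/-- The tested bound is integrated over the shifts `x` with the supremum in time inside the
integral. The integral of the supremum dominates the supremum of the integrals, so nothing is lost
in the wrong direction. -/
theorem IsSolution.lintegral_enorm_rpow_le (h : IsSolution w u f g u₀ v₀) (hW : IsWienerBasis P ℱ w)
    (hp2 : 2 ≤ p) (hp' : p ≠ ∞) (hT : 0 < T) (hα : 0 < α) :
    ∫⁻ ω, ‖u.1.snd ω‖ₑ ^ p.toReal ∂P ≤ supConst p.toReal T *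
      (initNormPow γ₁ P u₀ + (if 1 < α then initNormPow γ₁ P v₀ else 0) +
        stochNormPow γ₁ f T + stochNormPow γ₁ g T) := by
  have hq0 : 0 < p.toReal := ENNReal.toReal_pos (zero_lt_one.trans_le hp.out).ne' hp'
  have hq2 : 2 ≤ p.toReal := by
    rw [← ENNReal.toReal_ofNat]; exact ENNReal.toReal_mono hp' hp2
  have : Nonempty (Set.Icc (0 : ℝ≥0) T) := ⟨⟨0, le_rfl, hT.le⟩⟩
  let τ := TopologicalSpace.denseSeq (Set.Icc (0 : ℝ≥0) T)
  let s : ℕ → Space d → Ω → ℝ≥0∞ := fun n x ω =>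
    (⨆ j, ‖(u.1.snd ω (τ j)).toDist (besselShift γ₁ (mollifier d n) x)‖ₑ) ^ p.toReal
  have hU : ∀ j, StronglyMeasurable fun ω => u.1.snd ω (τ j) := fun j =>
    (continuous_eval_const (τ j)).comp_stronglyMeasurable (Lp.stronglyMeasurable u.1.snd)
  have hs : ∀ n, Measurable (Function.uncurry (s n)) := fun n =>
    (Measurable.iSup fun j =>
      (stronglyMeasurable_toDist_besselShift hp' γ₁ (mollifier d n) (hU j)).enorm).pow_const _
  have hu₀ : StronglyMeasurable u₀ := (Lp.stronglyMeasurable u₀).mono (ℱ.le 0)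
  have hv₀ : StronglyMeasurable v₀ := (Lp.stronglyMeasurable v₀).mono (ℱ.le 0)
  have hf := StochH.stronglyMeasurable f
  have hg := StochH.stronglyMeasurable g
  have hbound : ∀ n, ∫⁻ ω, (∫⁻ x, s n x ω) ∂P ≤ supConst p.toReal T *
      (initNormPow γ₁ P u₀ + (if 1 < α then initNormPow γ₁ P v₀ else 0) +
        stochNormPow γ₁ f T + stochNormPow γ₁ g T) := by
    intro n
    have hm₀ : Measurable fun x => ∫⁻ ω, ‖(u₀ ω).toDist (besselShift γ₁ (mollifier d n) x)‖ₑ ^ p.toReal ∂P :=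
      ((stronglyMeasurable_toDist_besselShift hp' γ₁ (mollifier d n) hu₀).enorm.pow_const
        _).lintegral_prod_right'
    have hm₁ : Measurable fun x => if 1 < α then
        ∫⁻ ω, ‖(v₀ ω).toDist (besselShift γ₁ (mollifier d n) x)‖ₑ ^ p.toReal ∂P else 0 := by
      split_ifs
      · exact ((stronglyMeasurable_toDist_besselShift hp' γ₁ (mollifier d n) hv₀).enorm.pow_const
          _).lintegral_prod_right'
      · exact measurable_const
    have hm₂ : Measurable fun x => ∫⁻ z, ‖(f z).toDist (besselShift γ₁ (mollifier d n) x)‖ₑ ^ p.toReal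
        ∂rectMeasure P T :=
      ((stronglyMeasurable_toDist_besselShift hp' γ₁ (mollifier d n) hf).enorm.pow_const
        _).lintegral_prod_right'
    rw [lintegral_lintegral_swap (f := fun ω x => s n x ω) ((hs n).comp measurable_swap).aemeasurable]
    refine (lintegral_mono fun x => h.lintegral_iSup_toDist_le hW hp2 hp' hT hα _ τ).trans ?_
    have hm₀₁ := hm₀.add hm₁
    have hm₀₂ := hm₀₁.add hm₂
    rw [lintegral_const_mul' _ _ (supConst_ne_top hq2)]
    refine mul_le_mul_right ?_ _
    refine (lintegral_add_left hm₀₂ _).le.trans (add_le_add ?_ (lintegral_lintegral_besselShift_le hp' hg n))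
    refine (lintegral_add_left hm₀₁ _).le.trans (add_le_add ?_ (lintegral_lintegral_besselShift_le hp' hf n))
    refine (lintegral_add_left hm₀ _).le.trans (add_le_add (lintegral_lintegral_besselShift_le hp' hu₀ n) ?_)
    split_ifs
    · exact lintegral_lintegral_besselShift_le hp' hv₀ n
    · simp
  have hlow : ∀ ω, ‖u.1.snd ω‖ₑ ^ p.toReal ≤ liminf (fun n => ∫⁻ x, s n x ω) atTop := by
    intro ω
    -- Paths are continuous, so the supremum over a dense sequence is the norm of the path; each
    -- time is then treated by `hNorm_rpow_le_liminf`.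
    refine (ENNReal.rpow_le_rpow (enorm_le_iSup_of_denseRange _
      (TopologicalSpace.denseRange_denseSeq _)) hq0.le).trans ?_
    rw [← ENNReal.le_rpow_inv_iff hq0]
    refine iSup_le fun j => ?_
    rw [ENNReal.le_rpow_inv_iff hq0, ← hNorm_toDist]
    refine ((HSpace.density_spec _).hNorm_rpow_le_liminf hp').trans
      (liminf_le_liminf (Eventually.of_forall fun n => lintegral_mono fun x => ?_))
    exact ENNReal.rpow_le_rpow (le_iSup (fun j =>
      ‖(u.1.snd ω (τ j)).toDist (besselShift γ₁ (mollifier d n) x)‖ₑ) j) hq0.le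
  refine (lintegral_mono hlow).trans ((lintegral_liminf_le fun n => (hs n).lintegral_prod_left').trans ?_)
  exact (liminf_le_liminf (Eventually.of_forall hbound)).trans (liminf_const _).le

/-- Tonelli's theorem followed by Young's inequality at each horizon `s`. The horizon is again
written as an indicator, to have joint measurability in `x` and `s`. -/
lemma lintegral_lintegral_volterra_le (hp' : p ≠ ∞) {γ : ℝ} (W : ℝ≥0 → ℝ≥0∞) (hW : Measurable W)
    (f : StochH d ℝ p γ₂ ℱ P T) (g : StochH d ell2 p γ₃ ℱ P T) {t : ℝ≥0} (ht : t ≤ T) (n : ℕ) :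
    ∫⁻ x, (∫⁻ s in Set.Iic t, W s *
      (∫⁻ z, ‖(f z).toDist (besselShift γ (mollifier d n) x)‖ₑ ^ p.toReal ∂rectMeasure P s +
        ∫⁻ z, ‖(g z).toDist (besselShift γ (mollifier d n) x)‖ₑ ^ p.toReal ∂rectMeasure P s) ∂timeVol) ≤
    ∫⁻ s in Set.Iic t, W s * (stochNormPow γ f s + stochNormPow γ g s) ∂timeVol := by
  have hf := StochH.stronglyMeasurable f
  have hg := StochH.stronglyMeasurable g
  have key : ∀ H : Space d × (ℝ≥0 × Ω) → ℝ≥0∞, Measurable H →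
      Measurable fun y : Space d × ℝ≥0 =>
        ∫⁻ z, {z : ℝ≥0 × Ω | z.1 ≤ y.2}.indicator (fun z => H (y.1, z)) z ∂rectMeasure P T := by
    intro H hH
    have h1 : MeasurableSet {y : (Space d × ℝ≥0) × (ℝ≥0 × Ω) | y.2.1 ≤ y.1.2} :=
      measurableSet_le measurable_snd.fst measurable_fst.snd
    have h2 : Measurable fun y : (Space d × ℝ≥0) × (ℝ≥0 × Ω) => H (y.1.1, y.2) :=
      hH.comp (measurable_fst.fst.prodMk measurable_snd)
    exact (h2.indicator h1).lintegral_prod_right'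
  have kf := key _ ((stronglyMeasurable_toDist_besselShift hp' γ (mollifier d n) hf).enorm.pow_const
    p.toReal)
  have kg := key _ ((stronglyMeasurable_toDist_besselShift hp' γ (mollifier d n) hg).enorm.pow_const
    p.toReal)
  have e1 : ∀ x, ∫⁻ s in Set.Iic t, W s *
      (∫⁻ z, ‖(f z).toDist (besselShift γ (mollifier d n) x)‖ₑ ^ p.toReal ∂rectMeasure P s +
        ∫⁻ z, ‖(g z).toDist (besselShift γ (mollifier d n) x)‖ₑ ^ p.toReal ∂rectMeasure P s) ∂timeVol =
      ∫⁻ s in Set.Iic t, W s *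
      (∫⁻ z, {z : ℝ≥0 × Ω | z.1 ≤ s}.indicator (fun z =>
        ‖(f z).toDist (besselShift γ (mollifier d n) x)‖ₑ ^ p.toReal) z ∂rectMeasure P T +
        ∫⁻ z, {z : ℝ≥0 × Ω | z.1 ≤ s}.indicator (fun z =>
          ‖(g z).toDist (besselShift γ (mollifier d n) x)‖ₑ ^ p.toReal) z ∂rectMeasure P T) ∂timeVol := by
    intro x
    refine setLIntegral_congr_fun measurableSet_Iic fun s hs => ?_
    rw [lintegral_rectMeasure_eq_indicator (le_trans hs ht),
      lintegral_rectMeasure_eq_indicator (le_trans hs ht)]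
  simp only [e1]
  rw [lintegral_lintegral_swap ((hW.comp measurable_snd).mul (kf.add kg)).aemeasurable]
  refine setLIntegral_mono_ae' measurableSet_Iic (Eventually.of_forall fun s hs => ?_)
  have kfs := kf.comp (measurable_id.prodMk (measurable_const (a := s)))
  have kgs := kg.comp (measurable_id.prodMk (measurable_const (a := s)))
  refine (lintegral_const_mul _ (kfs.add kgs)).le.trans (mul_le_mul_right ?_ _)
  refine (lintegral_add_left kfs _).le.trans (add_le_add ?_ ?_)
  · refine le_trans (le_of_eq (lintegral_congr fun x => ?_)) (lintegral_lintegral_besselShift_le hp' hf n)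
    exact (lintegral_rectMeasure_eq_indicator (le_trans hs ht)).symm
  · refine le_trans (le_of_eq (lintegral_congr fun x => ?_)) (lintegral_lintegral_besselShift_le hp' hg n)
    exact (lintegral_rectMeasure_eq_indicator (le_trans hs ht)).symm

/-- The values of the solution have smoothness `γ₁ + 2` while the estimate is in `H_p^{γ₁}`; the
embedding supplies the representative that `hNorm_rpow_le_liminf` requires. -/
theorem IsSolution.stochNormPow_le
    (h : IsSolution w u f g (0 : InitSpace d p α γ₄ ℱ P) (0 : InitSpace d p (α - 1) γ₄ ℱ P))
    (hW : IsWienerBasis P ℱ w) (hp2 : 2 ≤ p) (hp' : p ≠ ∞) (hT : 0 < T) (hα : 0 < α)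
    (hβ : β < α + 1 / 2) {t : ℝ≥0} (ht : t ≤ T) :
    let θ := min 1 (min α (2 * (α - β) + 1))
    stochNormPow γ₁ u.1.fst t ≤ volterraConst p.toReal α β θ T *
      ∫⁻ s in Set.Iic t, ENNReal.ofReal (((t : ℝ) - s) ^ (θ - 1)) *
        (stochNormPow γ₁ f s + stochNormPow γ₁ g s) ∂timeVol := by
  intro θ
  have hq1 : 1 ≤ p.toReal := by
    rw [← ENNReal.toReal_one]; exact ENNReal.toReal_mono hp' hp.out
  have hm : ∀ n, Measurable fun y : Space d × (ℝ≥0 × Ω) =>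
      ‖(u.1.fst y.2).toDist (besselShift γ₁ (mollifier d n) y.1)‖ₑ ^ p.toReal := fun n =>
    (stronglyMeasurable_toDist_besselShift hp' γ₁ (mollifier d n)
      (StochH.stronglyMeasurable u.1.fst)).enorm.pow_const _
  have hW' : Measurable fun s : ℝ≥0 => ENNReal.ofReal (((t : ℝ) - s) ^ (θ - 1)) := by fun_prop
  have hbound : ∀ n, ∫⁻ z, (∫⁻ x, ‖(u.1.fst z).toDist (besselShift γ₁ (mollifier d n) x)‖ₑ ^ p.toReal)
      ∂rectMeasure P t ≤ volterraConst p.toReal α β θ T *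
        ∫⁻ s in Set.Iic t, ENNReal.ofReal (((t : ℝ) - s) ^ (θ - 1)) *
          (stochNormPow γ₁ f s + stochNormPow γ₁ g s) ∂timeVol := by
    intro n
    rw [lintegral_lintegral_swap (f := fun z x =>
      ‖(u.1.fst z).toDist (besselShift γ₁ (mollifier d n) x)‖ₑ ^ p.toReal)
      ((hm n).comp measurable_swap).aemeasurable]
    refine (lintegral_mono fun x => h.lintegral_toDist_le hW hp2 hp' hT hα hβ _ ht).trans ?_
    rw [lintegral_const_mul' _ _ (volterraConst_ne_top hq1 _ _ _ _)]
    exact mul_le_mul_right (lintegral_lintegral_volterra_le hp' _ hW' f g ht n) _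
  have hlow : ∀ z, hNorm p γ₁ (u.1.fst z).toDist ^ p.toReal ≤ liminf (fun n =>
      ∫⁻ x, ‖(u.1.fst z).toDist (besselShift γ₁ (mollifier d n) x)‖ₑ ^ p.toReal) atTop := by
    intro z
    obtain ⟨g, hg⟩ := exists_represents_bessel_of_add_two hp' (u.1.fst z)
    exact hg.hNorm_rpow_le_liminf hp'
  refine (lintegral_mono hlow).trans ((lintegral_liminf_le fun n =>
    (hm n).lintegral_prod_left').trans ?_)
  exact (liminf_le_liminf (Eventually.of_forall hbound)).trans (liminf_const _).le

end Solution

/-! ### The isometry `(1 - Δ)^{ν/2}` -/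

section Isometries

variable {d : ℕ} {F : Type*} [NormedAddCommGroup F] [NormedSpace ℝ F] [CompleteSpace F]
  {p : ℝ≥0∞} [hp : Fact (1 ≤ p)]

/-- `(1 - Δ)^{ν/2}` as an isometry of `H_p^{γ'+ν}` onto `H_p^{γ'}`. -/
def HSpace.besselIso (F : Type*) [NormedAddCommGroup F] [NormedSpace ℝ F] [CompleteSpace F]
    (ν : ℝ) {γ γ' : ℝ} (h : γ' + ν = γ) :
    HSpace d F p γ ≃ₗᵢ[ℝ] HSpace d F p γ' where
  toFun u := ⟨bessel ν u.toDist, u.density, by rw [bessel_bessel, h]; exact u.density_spec⟩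
  invFun u := ⟨bessel (-ν) u.toDist, u.density, by
    rw [bessel_bessel, show γ + -ν = γ' by linarith]; exact u.density_spec⟩
  map_add' _ _ := rfl
  map_smul' _ _ := rfl
  left_inv u := Subtype.ext <| by
    change bessel (-ν) (bessel ν u.toDist) = u.toDist
    rw [bessel_bessel, neg_add_cancel, bessel_zero]
  right_inv u := Subtype.ext <| by
    change bessel ν (bessel (-ν) u.toDist) = u.toDist
    rw [bessel_bessel, add_neg_cancel, bessel_zero]
  norm_map' u := by
    rw [HSpace.norm_def, HSpace.norm_def]
    congr 1
    refine (HSpace.density_spec _).unique ?_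
    change Represents u.density (bessel γ' (bessel ν u.toDist))
    rw [bessel_bessel, h]
    exact u.density_spec

variable {E E' : Type*} [NormedAddCommGroup E] [NormedSpace ℝ E] [NormedAddCommGroup E'] [NormedSpace ℝ E']

/-- A linear isometry of the values induces one of the `L_p` spaces. -/
def lpCongr {X : Type*} {mX : MeasurableSpace X} (p : ℝ≥0∞) [Fact (1 ≤ p)] (μ : Measure X)
    (e : E ≃ₗᵢ[ℝ] E') : Lp E p μ ≃ₗᵢ[ℝ] Lp E' p μ where
  toFun := (e : E →L[ℝ] E').compLpL p μ
  invFun := (e.symm : E' →L[ℝ] E).compLpL p μ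
  map_add' := map_add _
  map_smul' := map_smul _
  left_inv f := Lp.ext <| by
    filter_upwards [(e : E →L[ℝ] E').coeFn_compLpL f,
      (e.symm : E' →L[ℝ] E).coeFn_compLpL ((e : E →L[ℝ] E').compLpL p μ f)] with x h1 h2
    rw [h2, h1]
    exact e.symm_apply_apply _
  right_inv f := Lp.ext <| by
    filter_upwards [(e.symm : E' →L[ℝ] E).coeFn_compLpL f,
      (e : E →L[ℝ] E').coeFn_compLpL ((e.symm : E' →L[ℝ] E).compLpL p μ f)] with x h1 h2
    rw [h2, h1]
    exact e.apply_symm_apply _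
  norm_map' f := by
    change ‖(e : E →L[ℝ] E').compLpL p μ f‖ = ‖f‖
    rw [Lp.norm_def, Lp.norm_def]
    congr 1
    refine eLpNorm_congr_norm_ae ?_
    filter_upwards [(e : E →L[ℝ] E').coeFn_compLpL f] with x h1
    rw [h1]
    exact e.norm_map _

lemma coeFn_lpCongr {X : Type*} {mX : MeasurableSpace X} {p : ℝ≥0∞} [Fact (1 ≤ p)] {μ : Measure X}
    (e : E ≃ₗᵢ[ℝ] E') (f : Lp E p μ) : ∀ᵐ x ∂μ, lpCongr p μ e f x = e (f x) :=
  (e : E →L[ℝ] E').coeFn_compLpL f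

/-- A linear isometry of the values induces one of the spaces of continuous functions. -/
def continuousMapCongr (K : Type*) [TopologicalSpace K] [CompactSpace K] (e : E ≃ₗᵢ[ℝ] E') :
    C(K, E) ≃ₗᵢ[ℝ] C(K, E') where
  toFun U := ⟨fun t => e (U t), e.continuous.comp U.continuous⟩
  invFun U := ⟨fun t => e.symm (U t), e.symm.continuous.comp U.continuous⟩
  map_add' U V := by ext t; exact map_add e _ _
  map_smul' c U := by ext t; exact map_smul e _ _
  left_inv U := by ext t; exact e.symm_apply_apply _
  right_inv U := by ext t; exact e.apply_symm_apply _
  norm_map' U := by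
    rw [ContinuousMap.norm_eq_iSup_norm, ContinuousMap.norm_eq_iSup_norm]
    exact iSup_congr fun t => e.norm_map _

lemma fracInt_clm [CompleteSpace E] [CompleteSpace E'] (L : E →L[ℝ] E') {a : ℝ} {φ : ℝ≥0 → E} {t : ℝ≥0}
    (h : FracIntegrable a φ t) : FracIntegrable a (fun s => L (φ s)) t ∧
      fracInt a (fun s => L (φ s)) t = L (fracInt a φ t) := by
  by_cases ha : a = 0
  · simp [FracIntegrable, fracInt, ha]
  · have h1 := h.resolve_left ha
    have e1 : (fun s => fracKernel a t s • L (φ s)) = fun s => L (fracKernel a t s • φ s) := by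
      ext s; rw [map_smul]
    simp only [FracIntegrable, fracInt, ha, if_false, e1]
    exact ⟨Or.inr (L.integrable_comp h1), L.integral_comp_comm h1⟩

end Isometries

/-! ### The isometry on the solution space. -/

section SolIso

variable {d : ℕ} {p : ℝ≥0∞} [hp : Fact (1 ≤ p)] {Ω : Type*} {mΩ : MeasurableSpace Ω} {P : Measure Ω}
  {ℱ : Filtration ℝ≥0 mΩ} {T : ℝ≥0} {α β γ γ' : ℝ}

/-- A process and its version take values in different spaces and are compared as distributions.
Hence the two isometries have to agree on the underlying distributions, as `he` demands. -/
lemma IsVersion.congr [IsProbabilityMeasure P] {u : StochH d ℝ p (γ + 2) ℱ P T} {U : PathH d p γ P T}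
    (h : IsVersion α β u U) (e : HSpace d ℝ p (γ + 2) ≃ₗᵢ[ℝ] HSpace d ℝ p (γ' + 2))
    (e' : HSpace d ℝ p γ ≃ₗᵢ[ℝ] HSpace d ℝ p γ')
    (he : ∀ v w, v.toDist = w.toDist → (e' v).toDist = (e w).toDist) :
    IsVersion α β (lpCongr p (predMeasure ℱ P T) e u)
      (lpCongr p P (continuousMapCongr (Set.Icc (0 : ℝ≥0) T) e') U) := by
  have h1 := ae_ae_of_ae_predMeasure ℱ P T (coeFn_lpCongr e u)
  have h2 := coeFn_lpCongr (continuousMapCongr (Set.Icc (0 : ℝ≥0) T) e') U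
  filter_upwards [h, h1, h2] with ω h h1 h2
  filter_upwards [h, h1, ae_restrict_mem measurableSet_Iic] with t h h3 htT
  obtain ⟨e1, e2⟩ := fracInt_congr (a := bigLambda α β - α) htT h3 h1
  obtain ⟨e3, e4⟩ := fracInt_clm (e : HSpace d ℝ p (γ + 2) →L[ℝ] HSpace d ℝ p (γ' + 2)) h.1
  refine ⟨e1.2 e3, fun ht => ?_⟩
  rw [e2, h2]
  exact (he _ _ (h.2 ht)).trans (congrArg HSpace.toDist e4.symm)

/-- `(1 - Δ)^{ν/2}` as an isometry of `𝓗_p^{γ+2}(T)` onto `𝓗_p^{γ-ν+2}(T)`. -/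
def SolSpace.besselIso (d : ℕ) (p : ℝ≥0∞) [Fact (1 ≤ p)] (α β γ ν : ℝ) (ℱ : Filtration ℝ≥0 mΩ)
    (P : Measure Ω) [IsProbabilityMeasure P] (T : ℝ≥0) :
    SolSpace d p α β γ ℱ P T ≃ₗᵢ[ℝ] SolSpace d p α β (γ - ν) ℱ P T :=
  let e : HSpace d ℝ p (γ + 2) ≃ₗᵢ[ℝ] HSpace d ℝ p (γ - ν + 2) := HSpace.besselIso ℝ ν (by ring)
  let e' : HSpace d ℝ p γ ≃ₗᵢ[ℝ] HSpace d ℝ p (γ - ν) := HSpace.besselIso ℝ ν (by ring)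
  let A := LinearIsometryEquiv.withLpProdCongr 1 (lpCongr p (predMeasure ℱ P T) e)
    (lpCongr p P (continuousMapCongr (Set.Icc (0 : ℝ≥0) T) e'))
  { toFun := fun u => ⟨A u.1, IsVersion.congr u.2 e e' fun v w h => congrArg (bessel ν) h⟩
    invFun := fun u => ⟨A.symm u.1,
      IsVersion.congr u.2 e.symm e'.symm fun v w h => congrArg (bessel (-ν)) h⟩
    map_add' := fun u v => Subtype.ext (map_add A u.1 v.1)
    map_smul' := fun c u => Subtype.ext (map_smul A c u.1)
    left_inv := fun u => Subtype.ext (A.symm_apply_apply u.1)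
    right_inv := fun u => Subtype.ext (A.apply_symm_apply u.1)
    norm_map' := fun u => A.norm_map u.1 }

lemma SolSpace.toDist_besselIso [IsProbabilityMeasure P] (ν : ℝ) (u : SolSpace d p α β γ ℱ P T) :
    ∀ᵐ z ∂rectMeasure P T, ((SolSpace.besselIso d p α β γ ν ℱ P T u).1.fst z).toDist =
      bessel ν (u.1.fst z).toDist := by
  have h := ae_of_ae_trim (predictable_le ℱ) (coeFn_lpCongr
    (HSpace.besselIso ℝ ν (by ring) : HSpace d ℝ p (γ + 2) ≃ₗᵢ[ℝ] HSpace d ℝ p (γ - ν + 2)) u.1.fst)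
  filter_upwards [h] with z hz
  exact congrArg HSpace.toDist hz

end SolIso

/-! ### Completeness -/

section Paths

variable {E : Type*} [NormedAddCommGroup E] [NormedSpace ℝ E] {T : ℝ≥0} {a : ℝ}

/-- Integration over `[0, T]` is convolution with the kernel of order one, which raises the order
from `a` to `1 + a`. -/
lemma lintegral_rlK_sub_le_rlConst (hT : 0 < T) (ha : 0 < a) (r : ℝ≥0) :
    ∫⁻ t in Set.Iic T, ENNReal.ofReal (rlK a ((t : ℝ) - r)) ∂timeVol ≤ ENNReal.ofReal (rlConst T) := by
  have h := lintegral_rlK_sub_mul_rlK_sub one_pos ha T r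
  rw [setLIntegral_timeVol (fun t => ENNReal.ofReal (rlK a (t - r))), ← restrict_Ico_eq_restrict_Icc]
  calc ∫⁻ t in Set.Ico (0 : ℝ) T, ENNReal.ofReal (rlK a (t - r))
      = ∫⁻ t in Set.Ico (0 : ℝ) T, ENNReal.ofReal (rlK 1 (T - t)) * ENNReal.ofReal (rlK a (t - r)) := by
        refine setLIntegral_congr_fun measurableSet_Ico fun t ht => ?_
        rw [rlK_one (sub_pos.2 ht.2), ENNReal.ofReal_one, one_mul]
    _ ≤ ENNReal.ofReal (rlK (1 + a) (T - r)) := (setLIntegral_le_lintegral _ _).trans h.le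
    _ ≤ _ := ENNReal.ofReal_le_ofReal <| by
        rw [add_comm]
        exact (rlK_le (by linarith) (sub_le_self _ r.2)).trans (rlK_add_one_le (by exact_mod_cast hT) ha.le)

/-- A bound of `‖I^a_t v‖` for `t ≤ T`. -/
def fracBound (a : ℝ) (T : ℝ≥0) (v : ℝ≥0 → E) (t : ℝ≥0) : ℝ≥0∞ :=
  if a = 0 then ‖v t‖ₑ else ∫⁻ s in Set.Iic T, ENNReal.ofReal (rlK a ((t : ℝ) - s)) * ‖v s‖ₑ ∂timeVol

lemma lintegral_enorm_fracKernel_le (ha : 0 < a) (v : ℝ≥0 → E) {t : ℝ≥0} (ht : t ≤ T) :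
    ∫⁻ s in Set.Iic t, ‖fracKernel a t s • v s‖ₑ ∂timeVol ≤
      ∫⁻ s in Set.Iic T, ENNReal.ofReal (rlK a ((t : ℝ) - s)) * ‖v s‖ₑ ∂timeVol := by
  refine le_trans (lintegral_mono_ae ?_) (lintegral_mono_set (Set.Iic_subset_Iic.2 ht))
  have h1 : ∀ᵐ s ∂timeVol.restrict (Set.Iic t), s ≠ t :=
    ae_restrict_of_ae (by simp [ae_iff, measure_singleton])
  filter_upwards [h1, ae_restrict_mem measurableSet_Iic] with s hs hst
  rw [enorm_smul, rlK_sub_eq_fracKernel (lt_of_le_of_ne hst hs), Real.enorm_eq_ofReal]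
  rw [← rlK_sub_eq_fracKernel (lt_of_le_of_ne hst hs)]
  exact rlK_nonneg ha _

lemma fracIntegrable_of_fracBound_lt_top (ha : 0 ≤ a) {v : ℝ≥0 → E} (hv : StronglyMeasurable v) {t : ℝ≥0}
    (ht : t ≤ T) (h : fracBound a T v t < ∞) : FracIntegrable a v t := by
  rcases ha.eq_or_lt with rfl | ha'
  · exact Or.inl rfl
  · rw [fracBound, if_neg ha'.ne'] at h
    have hk : Measurable fun s : ℝ≥0 => fracKernel a t s := by
      unfold fracKernel; fun_prop
    exact Or.inr ⟨hk.stronglyMeasurable.aestronglyMeasurable.smul hv.aestronglyMeasurable,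
      (lintegral_enorm_fracKernel_le ha' v ht).trans_lt h⟩

lemma enorm_fracInt_le_fracBound (ha : 0 ≤ a) (v : ℝ≥0 → E) {t : ℝ≥0} (ht : t ≤ T) :
    ‖fracInt a v t‖ₑ ≤ fracBound a T v t := by
  rcases ha.eq_or_lt with rfl | ha'
  · simp [fracInt, fracBound]
  · rw [fracInt, fracBound, if_neg ha'.ne', if_neg ha'.ne']
    exact (enorm_integral_le_lintegral_enorm _).trans (lintegral_enorm_fracKernel_le ha' v ht)

lemma measurable_rlK_sub_mul_enorm (a : ℝ) {v : ℝ≥0 → E} (hv : StronglyMeasurable v) :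
    Measurable fun y : ℝ≥0 × ℝ≥0 => ENNReal.ofReal (rlK a ((y.1 : ℝ) - y.2)) * ‖v y.2‖ₑ :=
  ((measurable_rlK a).comp (measurable_fst.coe_nnreal_real.sub
    measurable_snd.coe_nnreal_real)).ennreal_ofReal.mul (hv.enorm.comp measurable_snd)

lemma measurable_fracBound (a : ℝ) (T : ℝ≥0) {v : ℝ≥0 → E} (hv : StronglyMeasurable v) :
    Measurable (fracBound a T v) := by
  unfold fracBound
  split_ifs
  · exact hv.enorm
  · exact (measurable_rlK_sub_mul_enorm a hv).lintegral_prod_right'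

lemma lintegral_fracBound_le (hT : 0 < T) (ha : 0 ≤ a) {v : ℝ≥0 → E} (hv : StronglyMeasurable v) :
    ∫⁻ t in Set.Iic T, fracBound a T v t ∂timeVol ≤
      ENNReal.ofReal (rlConst T) * ∫⁻ t in Set.Iic T, ‖v t‖ₑ ∂timeVol := by
  rcases ha.eq_or_lt with rfl | ha'
  · simp only [fracBound, if_true]
    calc _ ≤ 1 * ∫⁻ t in Set.Iic T, ‖v t‖ₑ ∂timeVol := (one_mul _).ge
      _ ≤ _ := mul_le_mul_left (by
        rw [← ENNReal.ofReal_one]; exact ENNReal.ofReal_le_ofReal (one_le_rlConst T)) _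
  · simp only [fracBound, ha'.ne', if_false]
    rw [lintegral_lintegral_swap (measurable_rlK_sub_mul_enorm a hv).aemeasurable,
      ← lintegral_const_mul' _ _ ENNReal.ofReal_ne_top]
    refine lintegral_mono fun s => ?_
    have hm : Measurable fun t : ℝ≥0 => ENNReal.ofReal (rlK a ((t : ℝ) - s)) :=
      ((measurable_rlK_sub_right a s).comp measurable_coe_nnreal_real).ennreal_ofReal
    exact (lintegral_mul_const _ hm).le.trans (mul_le_mul_left (lintegral_rlK_sub_le_rlConst hT ha' s) _)

/-- Convergence in `L_1` alone would give no pointwise information, but summability of the norms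
makes the series of the bounds `fracBound` finite at almost every time. Its terms then tend to zero.
-/
lemma ae_fracIntegrable_tendsto_fracInt (hT : 0 < T) (ha : 0 ≤ a) {v : ℕ → ℝ≥0 → E}
    (hv : ∀ k, StronglyMeasurable (v k))
    (hsum : ∑' k, ∫⁻ s in Set.Iic T, ‖v k s‖ₑ ∂timeVol ≠ ∞) :
    ∀ᵐ t ∂timeVol.restrict (Set.Iic T), (∀ k, FracIntegrable a (v k) t) ∧
      Tendsto (fun k => fracInt a (v k) t) atTop (𝓝 0) := by
  have hm := fun k => measurable_fracBound a T (hv k)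
  have h1 : ∫⁻ t in Set.Iic T, ∑' k, fracBound a T (v k) t ∂timeVol ≠ ∞ := by
    rw [lintegral_tsum fun k => (hm k).aemeasurable]
    refine ne_top_of_le_ne_top ?_ (ENNReal.tsum_le_tsum fun k => lintegral_fracBound_le hT ha (hv k))
    rw [ENNReal.tsum_mul_left]
    exact ENNReal.mul_ne_top ENNReal.ofReal_ne_top hsum
  filter_upwards [ae_lt_top (Measurable.tsum hm) h1, ae_restrict_mem measurableSet_Iic] with t ht htT
  refine ⟨fun k => fracIntegrable_of_fracBound_lt_top ha (hv k) htT ((ENNReal.le_tsum k).trans_lt ht), ?_⟩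
  rw [tendsto_zero_iff_enorm_tendsto_zero]
  exact tendsto_of_tendsto_of_tendsto_of_le_of_le tendsto_const_nhds
    (ENNReal.tendsto_atTop_zero_of_tsum_ne_top ht.ne) (fun _ => zero_le)
    fun k => enorm_fracInt_le_fracBound ha (v k) htT

lemma tsum_lintegral_enorm_ne_top {X : Type*} {mX : MeasurableSpace X} {μ : Measure X} [IsFiniteMeasure μ]
    {p : ℝ≥0∞} [hp : Fact (1 ≤ p)] {f : ℕ → Lp E p μ} (hf : ∑' k, ‖f k‖ₑ ≠ ∞) :
    ∑' k, ∫⁻ x, ‖f k x‖ₑ ∂μ ≠ ∞ := by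
  have h (k : ℕ) : ∫⁻ x, ‖f k x‖ₑ ∂μ ≤ ‖f k‖ₑ * μ Set.univ ^ (1 / (1 : ℝ≥0∞).toReal - 1 / p.toReal) := by
    rw [← eLpNorm_one_eq_lintegral_enorm, Lp.enorm_def]
    exact eLpNorm_le_eLpNorm_mul_rpow_measure_univ hp.out (Lp.aestronglyMeasurable _)
  refine ne_top_of_le_ne_top ?_ (ENNReal.tsum_le_tsum h)
  rw [ENNReal.tsum_mul_right]
  refine ENNReal.mul_ne_top hf (ENNReal.rpow_ne_top_of_nonneg ?_ (measure_ne_top _ _))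
  rw [ENNReal.toReal_one, div_one, sub_nonneg]
  by_cases hp' : p = ∞
  · simp [hp']
  · rw [one_div]
    refine inv_le_one_of_one_le₀ ?_
    rw [← ENNReal.toReal_one]
    exact ENNReal.toReal_mono hp' hp.out

end Paths

/-! ### Closedness of the solution space. -/

section Complete

variable {d : ℕ} {p : ℝ≥0∞} [hp : Fact (1 ≤ p)] {Ω : Type*} {mΩ : MeasurableSpace Ω} {P : Measure Ω}
  [IsProbabilityMeasure P] {ℱ : Filtration ℝ≥0 mΩ} {T : ℝ≥0} {α β γ : ℝ}

instance : IsFiniteMeasure (rectMeasure P T) := by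
  have : IsFiniteMeasure (timeVol.restrict (Set.Iic T)) :=
    ⟨by rw [Measure.restrict_apply_univ, timeVol_Iic]; exact ENNReal.coe_lt_top⟩
  unfold rectMeasure; infer_instance

instance : IsFiniteMeasure (predMeasure ℱ P T) := isFiniteMeasure_trim _

lemma StochH.ae_tsum_lintegral_ne_top {v : ℕ → StochH d ℝ p γ ℱ P T} (hv : ∑' k, ‖v k‖ₑ ≠ ∞) :
    ∀ᵐ ω ∂P, ∑' k, ∫⁻ s in Set.Iic T, ‖v k (s, ω)‖ₑ ∂timeVol ≠ ∞ := by
  have hm (k : ℕ) : Measurable fun z : ℝ≥0 × Ω => ‖v k z‖ₑ := (StochH.stronglyMeasurable (v k)).enorm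
  have h1 := tsum_lintegral_enorm_ne_top hv
  have h2 (k : ℕ) : ∫⁻ z, ‖v k z‖ₑ ∂predMeasure ℱ P T =
      ∫⁻ ω, (∫⁻ s in Set.Iic T, ‖v k (s, ω)‖ₑ ∂timeVol) ∂P := by
    exact (lintegral_trim (predictable_le ℱ) (Lp.stronglyMeasurable (v k)).enorm).trans
      (lintegral_prod_symm _ (hm k).aemeasurable)
  have hm2 (k : ℕ) : Measurable fun ω => ∫⁻ s in Set.Iic T, ‖v k (s, ω)‖ₑ ∂timeVol :=
    (hm k).lintegral_prod_left'
  simp only [h2] at h1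
  rw [← lintegral_tsum fun k => (hm2 k).aemeasurable] at h1
  filter_upwards [ae_lt_top (Measurable.tsum hm2) h1] with ω hω using hω.ne

lemma ae_tendsto_zero_of_tsum_enorm_ne_top {X E : Type*} {mX : MeasurableSpace X} {μ : Measure X}
    [IsFiniteMeasure μ] [NormedAddCommGroup E] [NormedSpace ℝ E] {f : ℕ → Lp E p μ}
    (hf : ∑' k, ‖f k‖ₑ ≠ ∞) : ∀ᵐ x ∂μ, Tendsto (fun k => f k x) atTop (𝓝 0) := by
  have h1 := tsum_lintegral_enorm_ne_top hf
  have hm (k : ℕ) : AEMeasurable (fun x => ‖f k x‖ₑ) μ := (Lp.aestronglyMeasurable (f k)).enorm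
  rw [← lintegral_tsum hm] at h1
  filter_upwards [ae_lt_top' (AEMeasurable.tsum hm) h1] with x hx
  rw [tendsto_zero_iff_enorm_tendsto_zero]
  exact ENNReal.tendsto_atTop_zero_of_tsum_ne_top hx.ne

/-- Summable distances give, on almost every path, fractional integrals of `y k - u` that vanish in
the limit for almost every time and versions that converge uniformly. The identity for `y k` then
passes to the limit. -/
lemma IsVersion.of_tsum_ne_top (hT : 0 < T) (hα : 0 < α) {u : StochH d ℝ p (γ + 2) ℱ P T}
    {U : PathH d p γ P T} {y : ℕ → StochH d ℝ p (γ + 2) ℱ P T} {Y : ℕ → PathH d p γ P T}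
    (hy : ∀ k, IsVersion α β (y k) (Y k)) (hu : ∑' k, ‖y k - u‖ₑ ≠ ∞) (hU : ∑' k, ‖Y k - U‖ₑ ≠ ∞) :
    IsVersion α β u U := by
  have ha : 0 ≤ bigLambda α β - α := by
    obtain ⟨m, h1, h2, -⟩ := exists_bigLambda_eq hα β
    linarith
  have e1 : ∀ᵐ ω ∂P, ∀ k, ∀ᵐ t ∂timeVol.restrict (Set.Iic T), (y k - u) (t, ω) = y k (t, ω) - u (t, ω) :=
    ae_all_iff.2 fun k => ae_ae_of_ae_predMeasure ℱ P T (Lp.coeFn_sub (y k) u)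
  have e2 : ∀ᵐ ω ∂P, ∀ k, (Y k - U) ω = Y k ω - U ω := ae_all_iff.2 fun k => Lp.coeFn_sub (Y k) U
  filter_upwards [ae_all_iff.2 hy, e1, e2, StochH.ae_tsum_lintegral_ne_top hu,
    ae_tendsto_zero_of_tsum_enorm_ne_top hU] with ω hy e1 e2 hv hV
  have hmeas (k : ℕ) : StronglyMeasurable fun s => (y k - u) (s, ω) :=
    (StochH.stronglyMeasurable (y k - u)).comp_measurable measurable_prodMk_right
  have e1' := ae_all_iff.2 e1
  filter_upwards [ae_all_iff.2 hy, e1', ae_fracIntegrable_tendsto_fracInt hT ha hmeas hv,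
    ae_restrict_mem measurableSet_Iic] with t hy e3 hlim htT
  -- Writing `u = y k - (y k - u)` also yields absolute convergence of the fractional integral of
  -- `u`.
  have key (k : ℕ) : FracIntegrable (bigLambda α β - α) (fun s => u (s, ω)) t ∧
      fracInt (bigLambda α β - α) (fun s => u (s, ω)) t =
        fracInt (bigLambda α β - α) (fun s => y k (s, ω)) t -
          fracInt (bigLambda α β - α) (fun s => (y k - u) (s, ω)) t := by
    obtain ⟨i1, i2⟩ := fracInt_smul (-1) (hlim.1 k)
    obtain ⟨i3, i4⟩ := fracInt_add (hy k).1 i1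
    obtain ⟨i5, i6⟩ := fracInt_congr (a := bigLambda α β - α) (φ := fun s => u (s, ω))
      (ψ := (fun s => y k (s, ω)) + (-1 : ℝ) • fun s => (y k - u) (s, ω)) htT
      (by
        rw [Pi.add_apply, Pi.smul_apply, e3 k, neg_one_smul]; abel) (by
        filter_upwards [e1 k] with s hs
        rw [Pi.add_apply, Pi.smul_apply, hs, neg_one_smul]; abel)
    refine ⟨i5.2 i3, ?_⟩
    rw [i6, i4, i2, neg_one_smul, ← sub_eq_add_neg (fracInt _ (fun s => y k (s, ω)) t)]
  refine ⟨(key 0).1, fun ht => ?_⟩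
  -- The two limits are taken in `H_p^γ` and in `H_p^{γ+2}`, so they are compared after pairing with
  -- test functions.
  refine ContinuousLinearMap.ext fun φ => ?_
  have l1 : Tendsto (fun k => HSpace.toDistL ℝ p γ φ (Y k ω ⟨t, ht⟩)) atTop
      (𝓝 (HSpace.toDistL ℝ p γ φ (U ω ⟨t, ht⟩))) := by
    refine ((HSpace.toDistL ℝ p γ φ).continuous.tendsto _).comp ?_
    have h0 := ((continuous_eval_const (F := C(Set.Icc (0 : ℝ≥0) T, HSpace d ℝ p γ))
      (⟨t, ht⟩ : Set.Icc (0 : ℝ≥0) T)).tendsto _).comp hV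
    have h1 := h0.add_const (U ω ⟨t, ht⟩)
    simp only [ContinuousMap.zero_apply, zero_add] at h1
    refine h1.congr fun k => ?_
    rw [Function.comp_apply, e2 k, ContinuousMap.sub_apply, sub_add_cancel]
  have l2 : Tendsto (fun k => HSpace.toDistL ℝ p γ φ (Y k ω ⟨t, ht⟩)) atTop
      (𝓝 (HSpace.toDistL ℝ p (γ + 2) φ (fracInt (bigLambda α β - α) (fun s => u (s, ω)) t))) := by
    have h1 := ((HSpace.toDistL ℝ p (γ + 2) φ).continuous.tendsto _).comp
      (hlim.2.const_add (fracInt (bigLambda α β - α) (fun s => u (s, ω)) t))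
    rw [add_zero] at h1
    refine h1.congr fun k => ?_
    rw [Function.comp_apply, (key k).2, sub_add_cancel, HSpace.toDistL_apply, HSpace.toDistL_apply,
      (hy k).2 ht]
  exact tendsto_nhds_unique l1 l2

/-- A point of the closure is approximated at the geometric rate `2^{-k}`, which makes both sums of
distances finite. -/
theorem SolSpace.isClosed (hT : 0 < T) (hα : 0 < α) :
    IsClosed (SolSpace d p α β γ ℱ P T : Set (WithLp 1 (StochH d ℝ p (γ + 2) ℱ P T × PathH d p γ P T))) := by
  refine isClosed_of_closure_subset fun x hx => ?_
  have h (k : ℕ) : ∃ y ∈ SolSpace d p α β γ ℱ P T, dist x y < (1 / 2 : ℝ) ^ k :=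
    Metric.mem_closure_iff.1 hx _ (by positivity)
  choose y hyS hy using h
  have hb (k : ℕ) : ‖(y k).fst - x.fst‖ + ‖(y k).snd - x.snd‖ ≤ (1 / 2 : ℝ) ^ k := by
    have := (hy k).le
    rwa [dist_comm, dist_eq_norm, WithLp.prod_norm_eq_of_L1] at this
  have hs : ∑' k : ℕ, ENNReal.ofReal ((1 / 2 : ℝ) ^ k) ≠ ∞ :=
    summable_geometric_two.tsum_ofReal_ne_top
  refine IsVersion.of_tsum_ne_top hT hα (y := fun k => (y k).fst) (Y := fun k => (y k).snd) hyS
    (ne_top_of_le_ne_top hs (ENNReal.tsum_le_tsum fun k => ?_))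
    (ne_top_of_le_ne_top hs (ENNReal.tsum_le_tsum fun k => ?_))
  · rw [← ofReal_norm]
    exact ENNReal.ofReal_le_ofReal ((le_add_of_nonneg_right (norm_nonneg _)).trans (hb k))
  · rw [← ofReal_norm]
    exact ENNReal.ofReal_le_ofReal ((le_add_of_nonneg_left (norm_nonneg _)).trans (hb k))

end Complete

end
end FracSPDE

/-! ### The four assertions. -/

theorem theorem2p6 (d : ℕ) (hd : 0 < d) (p : ℝ≥0∞) [Fact (1 ≤ p)] (hp : 2 ≤ p) (hp' : p ≠ ∞)
    (T : ℝ≥0) (hT : 0 < T) :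
    -- (i): `(1 - Δ)^{ν/2}` is an isometry of `𝓗_p^{γ+2}(T)` onto `𝓗_p^{γ-ν+2}(T)`
    (∀ (α β : ℝ), 0 < α → α < 2 → β < α + 1 / 2 →
      ∀ (Ω : Type*) (mΩ : MeasurableSpace Ω) (P : Measure Ω) [IsProbabilityMeasure P]
        (ℱ : Filtration ℝ≥0 mΩ) (w : ℕ → ℝ≥0 → Ω → ℝ), IsWienerBasis P ℱ w →
      ∀ γ ν : ℝ, ∃ Φ : SolSpace d p α β γ ℱ P T ≃ₗᵢ[ℝ] SolSpace d p α β (γ - ν) ℱ P T,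
        ∀ u, ∀ᵐ z ∂rectMeasure P T, ((Φ u).1.fst z).toDist = bessel ν (u.1.fst z).toDist) ∧
    -- (ii): the bound of the supremum in time, with a constant that depends only on `d, p, T`
    (∃ N : ℝ≥0, ∀ (α β : ℝ), 0 < α → α < 2 → β < α + 1 / 2 →
      ∀ (Ω : Type*) (mΩ : MeasurableSpace Ω) (P : Measure Ω) [IsProbabilityMeasure P]
        (ℱ : Filtration ℝ≥0 mΩ) (w : ℕ → ℝ≥0 → Ω → ℝ), IsWienerBasis P ℱ w →
      ∀ (γ γ₂ γ₃ γ₄ : ℝ) (u : SolSpace d p α β γ ℱ P T) (f : StochH d ℝ p γ₂ ℱ P T)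
        (g : StochH d ell2 p γ₃ ℱ P T) (u₀ : InitSpace d p α γ₄ ℱ P)
        (v₀ : InitSpace d p (α - 1) γ₄ ℱ P), IsSolution w u f g u₀ v₀ →
        ∫⁻ ω, ‖u.1.snd ω‖ₑ ^ p.toReal ∂P ≤
          N * (initNormPow γ P u₀ + (if 1 < α then initNormPow γ P v₀ else 0) +
            stochNormPow γ f T + stochNormPow γ g T)) ∧
    -- (iii): `𝓗_p^{γ+2}(T)` is a Banach space
    (∀ (α β : ℝ), 0 < α → α < 2 → β < α + 1 / 2 →
      ∀ (Ω : Type*) (mΩ : MeasurableSpace Ω) (P : Measure Ω) [IsProbabilityMeasure P]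
        (ℱ : Filtration ℝ≥0 mΩ) (w : ℕ → ℝ≥0 → Ω → ℝ), IsWienerBasis P ℱ w →
      ∀ γ : ℝ, CompleteSpace (SolSpace d p α β γ ℱ P T)) ∧
    -- (iv): the Volterra-type bound, with a constant that depends only on `d, α, β, p, T`
    (∀ (α β : ℝ), 0 < α → α < 2 → β < α + 1 / 2 → ∃ N : ℝ≥0,
      ∀ (Ω : Type*) (mΩ : MeasurableSpace Ω) (P : Measure Ω) [IsProbabilityMeasure P]
        (ℱ : Filtration ℝ≥0 mΩ) (w : ℕ → ℝ≥0 → Ω → ℝ), IsWienerBasis P ℱ w →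
      ∀ (γ γ₂ γ₃ γ₄ : ℝ) (u : SolSpace d p α β γ ℱ P T) (f : StochH d ℝ p γ₂ ℱ P T)
        (g : StochH d ell2 p γ₃ ℱ P T),
        IsSolution w u f g (0 : InitSpace d p α γ₄ ℱ P) (0 : InitSpace d p (α - 1) γ₄ ℱ P) →
        ∀ t ≤ T, stochNormPow γ u.1.fst t ≤
          N * ∫⁻ s in Set.Iic t,
            ENNReal.ofReal (((t : ℝ) - s) ^ (min 1 (min α (2 * (α - β) + 1)) - 1)) *
              (stochNormPow γ f s + stochNormPow γ g s) ∂timeVol) := by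
  have hq2 : 2 ≤ p.toReal := by
    rw [← ENNReal.toReal_ofNat]; exact ENNReal.toReal_mono hp' hp
  refine ⟨?_, ?_, ?_, ?_⟩
  · intro α β _ _ _ Ω mΩ P _ ℱ w _ γ ν
    exact ⟨SolSpace.besselIso d p α β γ ν ℱ P T, SolSpace.toDist_besselIso ν⟩
  -- The constant is finite and involves only `p` and `T`, because `rlConst T` serves all orders of
  -- integration at once.
  · refine ⟨(supConst p.toReal T).toNNReal, ?_⟩
    intro α β hα _ _ Ω mΩ P _ ℱ w hW γ γ₂ γ₃ γ₄ u f g u₀ v₀ h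
    rw [ENNReal.coe_toNNReal (supConst_ne_top hq2)]
    exact h.lintegral_enorm_rpow_le hW hp hp' hT hα
  · intro α β hα _ _ Ω mΩ P _ ℱ w _ γ
    exact (SolSpace.isClosed hT hα).completeSpace_coe
  · intro α β hα _ hβ
    refine ⟨(volterraConst p.toReal α β (min 1 (min α (2 * (α - β) + 1))) T).toNNReal, ?_⟩
    intro Ω mΩ P _ ℱ w hW γ γ₂ γ₃ γ₄ u f g h t ht
    rw [ENNReal.coe_toNNReal (volterraConst_ne_top (by linarith) _ _ _ _)]
    exact h.stochNormPow_le hW hp hp' hT hα hβ ht
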